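/- **Proposition 4.5 (support and closedness of correspondences).** Let $\mathcal X,\mathcal Y$ be compact (Hausdorff) complex manifolds, oriented by their complex structures, and fix product de Rham data on $\mathcal X\times\mathcal Y$: finite families of open sets $B_i\subset U_i$ covering $\mathcal X$ (the $B_i$ already cover) and $B'_j\subset U'_j$ covering $\mathcal Y$ likewise, diffeomorphisms $h_i:U_i\to\mathbb R^{\dim_{\mathbb R}\mathcal X}$ with $h_i(B_i)$ the open unit ball, diffeomorphisms $\kappa_i$ of that ball with $\mathbb R^{\dim_{\mathbb R}\mathcal X}$ such that the translations $x\mapsto x+y$, transported by $\kappa_i\circ h_i$ to $B_i$ and extended by the identity, form a family of maps $s^i_y:\mathcal X\to\mathcal X$ that is $C^\infty$ in $(y,x)$; even $C^\infty$ bump functions $f_i\ge 0$ with support in the unit ball and integral $1$; the same data $h'_j,\kappa'_j,s'^j_{y'},f'_j$ on $\mathcal Y$; and an ordering of the pairs $(i,j)$. With $f^\epsilon(y)=\epsilon^{-m}f(y/\epsilon)$ ($m$ the dimension of the space on which $f$ lives), the smoothing operator $R_\epsilon$ on currents of $\mathcal X\times\mathcal Y$ is the composition, in the given order (the first pair acting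 last), of the operators $$T\mapsto\Big(\phi\mapsto\int\!\!\int f_i^\epsilon(y)\,f'^{\,\epsilon}_j(y')\,T\big((s^i_y\times s'^j_{y'})^*\phi\big)\,dy\,dy'\Big).$$ When $R_\epsilon T$ is given by a smooth form, it is identified with that form. A (real) current is a continuous linear functional on the space of smooth forms with its $C^\infty$ topology; $bT(\phi)=T(d\phi)$; $T$ is closed if $bT=0$ and homologous to zero if $T=bS$ for some current $S$. A current $T$ homogeneous of dimension $k$ on an $m$-dimensional manifold is Lebesgue if for every point $q$, all local coordinates on a neighbourhood $U$ of $q$, and every projection $\pi:U\to\mathbb R^k$ to a $k$-dimensional coordinate plane there is a neighbourhood $B\subset U$ of $q$ such that for every smooth function $\xi$ with compact support in $B$ one has $\pi_*(\xi T)(g)=\int gL\,d\mu$ for all test functions $g$, where $\mu$ is Lebesgue measure and $L$ is a bounded, compactly supported, Riemann integrable function for which there is a bounded function $\psi_a(x)$ of $(a,x)$, Riemann integrable on boxes, with $\lim_{\lambda\to0^+}L(\lambda x+a)=\psi_a(x)$ for every $a$ and almost every $x$. Sums of homogeneous Lebesgue currents are called Lebesgue. For currents $T_1,T_2$ on $\mathcal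 X\times\mathcal Y$ put $[T_1\wedge T_2](\phi)=\lim_{\epsilon\to0^+}T_1(R_\epsilon T_2\wedge\phi)$; it is well defined if these limits exist for all smooth forms $\phi$ and define a current. For a current $F$ on $\mathcal X\times\mathcal Y$, put $$F_*(T)=(P_{\mathcal Y})_*[F\wedge(T\times[\mathcal Y])],\qquad F^*(T)=(P_{\mathcal X})_*[F\wedge([\mathcal X]\times T)]$$ for Lebesgue currents $T$ on $\mathcal X$, respectively on $\mathcal Y$, for which the intersection current on the right is well defined. Here $P_{\mathcal X},P_{\mathcal Y}$ are the projections. Let $F$ be a homogeneous closed Lebesgue current on $\mathcal X\times\mathcal Y$. (a) If $T$ is a Lebesgue current on $\mathcal X$ and $F_*(T)$ is well defined, then $$\operatorname{supp}F_*(T)\subset P_{\mathcal Y}\big(\operatorname{supp}F\cap(\operatorname{supp}T\times\mathcal Y)\big).$$ If $T$ is a Lebesgue current on $\mathcal Y$ and $F^*(T)$ is well defined, then $$\operatorname{supp}F^*(T)\subset P_{\mathcal X}\big(\operatorname{supp}F\cap(\mathcal X\times\operatorname{supp}T)\big).$$ (b) If $T_1$ is a Lebesgue current on $\mathcal X$ that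 is closed (respectively homologous to zero) and $F_*(T_1)$ is well defined, then $F_*(T_1)$ is closed (respectively homologous to zero). If $T_2$ is a Lebesgue current on $\mathcal Y$ that is closed (respectively homologous to zero) and $F^*(T_2)$ is well defined, then $F^*(T_2)$ is closed (respectively homologous to zero). -/

import Mathlib

open Set Filter Topology MeasureTheory
open scoped Manifold ContDiff

set_option linter.unusedSectionVars false

noncomputable section

namespace LebesgueCurrents

/-! ### Alternating forms -/

section Alg
variable {V W : Type*} [NormedAddCommGroup V] [NormedSpace ℝ V] [NormedAddCommGroup W] [NormedSpace ℝ W]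

/-- The exterior product of alternating forms, as a sum over shuffles (no normalising factor). -/
def wedgeAlt {p q r : ℕ} (h : p + q = r) (α : V [⋀^Fin p]→L[ℝ] ℝ) (β : V [⋀^Fin q]→L[ℝ] ℝ) :
    V [⋀^Fin r]→ₗ[ℝ] ℝ :=
  ((LinearMap.mul' ℝ ℝ).compAlternatingMap
    (α.toAlternatingMap.domCoprod β.toAlternatingMap)).domDomCongr
      (finSumFinEquiv.trans (finCongr h))

theorem wedgeAlt_apply {p q r : ℕ} (h : p + q = r) (α : V [⋀^Fin p]→L[ℝ] ℝ)
    (β : V [⋀^Fin q]→L[ℝ] ℝ) (v : Fin r → V) :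
    wedgeAlt h α β v = ∑ σ : Equiv.Perm.ModSumCongr (Fin p) (Fin q),
      ((Equiv.Perm.sign (Quotient.out σ) : ℤ) : ℝ) *
        (α (fun i => v (finCongr h (finSumFinEquiv (Quotient.out σ (Sum.inl i))))) *
         β (fun j => v (finCongr h (finSumFinEquiv (Quotient.out σ (Sum.inr j)))))) := by
  simp only [wedgeAlt, AlternatingMap.domDomCongr_apply, LinearMap.compAlternatingMap_apply,
    AlternatingMap.domCoprod_apply, sum_apply, map_sum]
  refine Finset.sum_congr rfl fun σ _ => ?_
  conv_lhs => rw [← Quotient.out_eq σ]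
  erw [AlternatingMap.domCoprod.summand_mk'']
  rcases Int.units_eq_one_or (Equiv.Perm.sign (Quotient.out σ)) with hs | hs <;>
    simp [hs, MultilinearMap.domDomCongr_apply, MultilinearMap.domCoprod_apply]

/-- The exterior product of continuous alternating forms. -/
def wedgeCAM {p q r : ℕ} (h : p + q = r) (α : V [⋀^Fin p]→L[ℝ] ℝ) (β : V [⋀^Fin q]→L[ℝ] ℝ) :
    V [⋀^Fin r]→L[ℝ] ℝ :=
  { wedgeAlt h α β with
    cont := by
      change Continuous fun v => wedgeAlt h α β v
      simp only [wedgeAlt_apply]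
      refine continuous_finsetSum _ fun σ _ => continuous_const.mul (Continuous.mul ?_ ?_)
      · exact α.cont.comp (continuous_pi fun i => continuous_apply _)
      · exact β.cont.comp (continuous_pi fun i => continuous_apply _) }

theorem wedgeCAM_apply {p q r : ℕ} (h : p + q = r) (α : V [⋀^Fin p]→L[ℝ] ℝ)
    (β : V [⋀^Fin q]→L[ℝ] ℝ) (v : Fin r → V) :
    wedgeCAM h α β v = ∑ σ : Equiv.Perm.ModSumCongr (Fin p) (Fin q),
      ((Equiv.Perm.sign (Quotient.out σ) : ℤ) : ℝ) *
        (α (fun i => v (finCongr h (finSumFinEquiv (Quotient.out σ (Sum.inl i))))) *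
         β (fun j => v (finCongr h (finSumFinEquiv (Quotient.out σ (Sum.inr j)))))) :=
  wedgeAlt_apply h α β v

theorem finiteDimensional_cam [FiniteDimensional ℝ V] (k : ℕ) :
    FiniteDimensional ℝ (V [⋀^Fin k]→L[ℝ] ℝ) := by
  let f : (V [⋀^Fin k]→L[ℝ] ℝ) →ₗ[ℝ] MultilinearMap ℝ (fun _ : Fin k => V) ℝ :=
    { toFun := fun α => α.toMultilinearMap
      map_add' := fun _ _ => rfl
      map_smul' := fun _ _ => rfl }
  refine FiniteDimensional.of_injective f fun α β h => ?_
  ext v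
  exact congrArg (fun g : MultilinearMap ℝ (fun _ : Fin k => V) ℝ => g v) h

theorem contDiffOn_cam [FiniteDimensional ℝ V] {k : ℕ} {s : Set W}
    {g : W → V [⋀^Fin k]→L[ℝ] ℝ} (hg : ∀ v, ContDiffOn ℝ ∞ (fun y => g y v) s) :
    ContDiffOn ℝ ∞ g s := by
  have := finiteDimensional_cam (V := V) k
  let b := Module.finBasis ℝ V
  let ev : (V [⋀^Fin k]→L[ℝ] ℝ) →ₗ[ℝ] ((Fin k → Fin (Module.finrank ℝ V)) → ℝ) :=
    { toFun := fun α f => α fun i => b (f i)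
      map_add' := fun _ _ => rfl
      map_smul' := fun _ _ => rfl }
  have hinj : Function.Injective ev := by
    intro α β h
    have : α.toAlternatingMap = β.toAlternatingMap :=
      Module.Basis.ext_alternating b fun f _ => congrFun h f
    ext v
    exact congrArg (fun g : V [⋀^Fin k]→ₗ[ℝ] ℝ => g v) this
  obtain ⟨inv, hinv⟩ := ev.exists_leftInverse_of_injective (LinearMap.ker_eq_bot.2 hinj)
  have h2 : ContDiffOn ℝ ∞ (fun y => ev (g y)) s :=
    contDiffOn_pi.2 fun f => hg fun i => b (f i)
  have h3 := (LinearMap.toContinuousLinearMap inv).contDiff.comp_contDiffOn h2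
  refine h3.congr fun y _ => ?_
  exact (congrArg (fun l => l (g y)) hinv).symm

theorem contDiffOn_cam_apply {k : ℕ} {s : Set W}
    {g : W → V [⋀^Fin k]→L[ℝ] ℝ} (hg : ContDiffOn ℝ ∞ g s) {u : Fin k → W → V}
    (hu : ∀ i, ContDiffOn ℝ ∞ (u i) s) :
    ContDiffOn ℝ ∞ (fun y => g y fun i => u i y) s := by
  let L : (V [⋀^Fin k]→L[ℝ] ℝ) →L[ℝ] ContinuousMultilinearMap ℝ (fun _ : Fin k => V) ℝ :=
    (ContinuousAlternatingMap.toContinuousMultilinearMapLI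
      (𝕜 := ℝ) (E := V) (F := ℝ) (ι := Fin k)).toContinuousLinearMap
  have h : ContDiffOn ℝ ∞ (fun p : (V [⋀^Fin k]→L[ℝ] ℝ) × (Fin k → V) => L p.1 p.2) univ :=
    (ContinuousLinearMap.cpolynomialOn_uncurry_of_multilinear L (s := univ)).contDiffOn
  exact h.comp (hg.prodMk (contDiffOn_pi.2 hu)) (fun _ _ => mem_univ _)
end Alg

section Forms

variable {E : Type*} [NormedAddCommGroup E] [NormedSpace ℝ E]
  {H : Type*} [TopologicalSpace H] (I : ModelWithCorners ℝ E H)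
  {M : Type*} [TopologicalSpace M] [ChartedSpace H M]
  {E' : Type*} [NormedAddCommGroup E'] [NormedSpace ℝ E']
  {H' : Type*} [TopologicalSpace H'] (J : ModelWithCorners ℝ E' H')
  {N : Type*} [TopologicalSpace N] [ChartedSpace H' N]
  {E'' : Type*} [NormedAddCommGroup E''] [NormedSpace ℝ E'']
  {H'' : Type*} [TopologicalSpace H''] (K : ModelWithCorners ℝ E'' H'')
  {P : Type*} [TopologicalSpace P] [ChartedSpace H'' P]

/-- The differential of `f` at `x`; Mathlib identifies the tangent space at every point with the
model vector space, through the preferred chart at that point. -/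
def diffAt (f : M → N) (x : M) : E →L[ℝ] E' := mfderiv I J f x

theorem diffAt_comp {f : M → N} {g : N → P} (x : M) (hg : MDifferentiableAt J K g (f x))
    (hf : MDifferentiableAt I J f x) :
    diffAt I K (g ∘ f) x = (diffAt J K g (f x)).comp (diffAt I J f x) :=
  mfderiv_comp x hg hf

theorem diffAt_congr {f g : M → N} {x : M} (h : f =ᶠ[𝓝 x] g) :
    diffAt I J f x = diffAt I J g x := h.mfderiv_eq

theorem diffAt_eq_fderiv (f : E → E') (x : E) :
    diffAt 𝓘(ℝ, E) 𝓘(ℝ, E') f x = fderiv ℝ f x := mfderiv_eq_fderiv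

/-- The expression of a field of alternating forms in the preferred chart at `p`. -/
def chartRep {k : ℕ} (p : M) (θ : M → E [⋀^Fin k]→L[ℝ] ℝ) (y : E) : E [⋀^Fin k]→L[ℝ] ℝ :=
  (θ ((extChartAt I p).symm y)).compContinuousLinearMap
    (diffAt 𝓘(ℝ, E) I (extChartAt I p).symm y)

variable (M) in
/-- Smooth real differential `k`-forms on `M`: fields of alternating forms whose expressions in
the charts are smooth. -/
def smoothForms (k : ℕ) : Submodule ℝ (M → E [⋀^Fin k]→L[ℝ] ℝ) where
  carrier := {θ | ∀ p : M, ContDiffOn ℝ ∞ (chartRep I p θ) (extChartAt I p).target}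
  add_mem' := fun ha hb p => ((ha p).add (hb p)).congr fun _ _ => rfl
  zero_mem' := fun _ => (contDiffOn_const (c := 0)).congr fun _ _ => rfl
  smul_mem' := fun c _ ha p => ((ha p).const_smul c).congr fun _ _ => rfl

variable (M) in
/-- The space of smooth real differential `k`-forms on `M`. -/
def KForm (k : ℕ) : Type _ := smoothForms I M k

instance (k : ℕ) : AddCommGroup (KForm I M k) := inferInstanceAs (AddCommGroup (smoothForms I M k))

instance (k : ℕ) : Module ℝ (KForm I M k) := inferInstanceAs (Module ℝ (smoothForms I M k))

/-- The `C^∞` topology: uniform convergence, on compact subsets of the charts, of the coordinate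
expression and of each of its derivatives. -/
instance (k : ℕ) : TopologicalSpace (KForm I M k) :=
  ⨅ (p : M) (j : ℕ), TopologicalSpace.induced
    (fun θ : KForm I M k => UniformOnFun.ofFun {C : Set E | IsCompact C ∧ C ⊆ (extChartAt I p).target}
      (fun y => iteratedFDeriv ℝ j (chartRep I p θ.1) y)) inferInstance

variable (M) in
/-- Smooth differential forms, not necessarily homogeneous: the component of index `k` is the part
of degree `k` (it vanishes automatically for `k > dim M`). -/
abbrev Form : Type _ := ∀ k : ℕ, KForm I M k

variable (M) in
/-- Real currents on a compact manifold: the topological dual of the space of smooth forms. -/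
abbrev Current : Type _ := Form I M →L[ℝ] ℝ

/-- Exterior product of homogeneous smooth forms. -/
def wedgeK {p q r : ℕ} [FiniteDimensional ℝ E] (h : p + q = r) (α : KForm I M p) (β : KForm I M q) : KForm I M r :=
  ⟨fun x => wedgeCAM h (α.1 x) (β.1 x), fun p => by
    refine contDiffOn_cam fun v => ?_
    have h1 : ∀ y, chartRep I p (fun x => wedgeCAM h (α.1 x) (β.1 x)) y v
      = wedgeCAM h (chartRep I p α.1 y) (chartRep I p β.1 y) v := by
      intro y
      simp only [chartRep, wedgeCAM_apply, ContinuousAlternatingMap.compContinuousLinearMap_apply]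
      rfl
    simp only [h1, wedgeCAM_apply]
    refine ContDiffOn.sum fun σ _ => contDiffOn_const.mul (ContDiffOn.mul ?_ ?_)
    · exact contDiffOn_cam_apply (α.2 p) fun i => contDiffOn_const
    · exact contDiffOn_cam_apply (β.2 p) fun i => contDiffOn_const⟩

/-- Exterior product of smooth forms. -/
def wedge [FiniteDimensional ℝ E] (α β : Form I M) : Form I M := fun r =>
  ∑ p : Fin (r + 1), wedgeK I (Nat.add_sub_of_le (Nat.lt_succ_iff.1 p.2)) (α p) (β (r - p))

variable [I.Boundaryless] [J.Boundaryless] [IsManifold I ∞ M] [IsManifold J ∞ N]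

theorem mdiff_symm (p : M) {y : E} (hy : y ∈ (extChartAt I p).target) :
    MDifferentiableAt 𝓘(ℝ, E) I (extChartAt I p).symm y :=
  ((contMDiffOn_extChartAt_symm (n := ∞) p).contMDiffAt
    ((isOpen_extChartAt_target p).mem_nhds hy)).mdifferentiableAt (by simp)


theorem isOpen_chartDomain {f : M → N} (hf : Continuous f) (p : M) (q : N) :
    IsOpen ((extChartAt I p).target ∩
      (fun z => f ((extChartAt I p).symm z)) ⁻¹' (extChartAt J q).source) := by
  have h : ContinuousOn (fun z => f ((extChartAt I p).symm z)) (extChartAt I p).target :=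
    hf.comp_continuousOn (continuousOn_extChartAt_symm p)
  exact h.isOpen_inter_preimage (isOpen_extChartAt_target p) (isOpen_extChartAt_source q)

theorem contDiffOn_chartExpr {f : M → N} (hf : ContMDiff I J ∞ f) (p : M) (q : N) :
    ContDiffOn ℝ ∞ (fun z => extChartAt J q (f ((extChartAt I p).symm z)))
      ((extChartAt I p).target ∩
        (fun z => f ((extChartAt I p).symm z)) ⁻¹' (extChartAt J q).source) := by
  rw [← contMDiffOn_iff_contDiffOn]
  have h1 : ContMDiffOn 𝓘(ℝ, E) J ∞ (fun z => f ((extChartAt I p).symm z))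
      (extChartAt I p).target := hf.comp_contMDiffOn (contMDiffOn_extChartAt_symm p)
  exact (contMDiffOn_extChartAt (x := q)).comp (h1.mono inter_subset_left)
    (fun z hz => by simpa using hz.2)

theorem chartRep_pullback {f : M → N} (hf : ContMDiff I J ∞ f) {k : ℕ}
    (θ : N → E' [⋀^Fin k]→L[ℝ] ℝ) (p : M) (q : N) {y : E} (hy : y ∈ (extChartAt I p).target)
    (hq : f ((extChartAt I p).symm y) ∈ (extChartAt J q).source) :
    chartRep I p (fun x => (θ (f x)).compContinuousLinearMap (diffAt I J f x)) y =
      (chartRep J q θ (extChartAt J q (f ((extChartAt I p).symm y)))).compContinuousLinearMap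
        (fderiv ℝ (fun z => extChartAt J q (f ((extChartAt I p).symm z))) y) := by
  set g : E → E' := fun z => extChartAt J q (f ((extChartAt I p).symm z)) with hg
  have hO := isOpen_chartDomain I J hf.continuous p q
  have hgd : MDifferentiableAt 𝓘(ℝ, E) 𝓘(ℝ, E') g y :=
    (((contDiffOn_chartExpr I J hf p q).contDiffAt (hO.mem_nhds ⟨hy, hq⟩)).differentiableAt
      (by simp)).mdifferentiableAt
  have hgy : g y ∈ (extChartAt J q).target := (extChartAt J q).map_source hq
  have hs : (extChartAt J q).symm (g y) = f ((extChartAt I p).symm y) :=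
    (extChartAt J q).left_inv hq
  have h1 : diffAt 𝓘(ℝ, E) J (f ∘ (extChartAt I p).symm) y =
      (diffAt I J f ((extChartAt I p).symm y)).comp
        (diffAt 𝓘(ℝ, E) I (extChartAt I p).symm y) :=
    diffAt_comp _ _ _ _ (hf.mdifferentiableAt (by simp)) (mdiff_symm I p hy)
  have h2 : diffAt 𝓘(ℝ, E) J ((extChartAt J q).symm ∘ g) y =
      (diffAt 𝓘(ℝ, E') J (extChartAt J q).symm (g y)).comp (diffAt 𝓘(ℝ, E) 𝓘(ℝ, E') g y) :=
    diffAt_comp _ _ _ _ (mdiff_symm J q hgy) hgd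
  have h3 : diffAt 𝓘(ℝ, E) J ((extChartAt J q).symm ∘ g) y =
      diffAt 𝓘(ℝ, E) J (f ∘ (extChartAt I p).symm) y := by
    refine diffAt_congr _ _ ?_
    filter_upwards [hO.mem_nhds ⟨hy, hq⟩] with z hz
    exact (extChartAt J q).left_inv hz.2
  have h4 : (diffAt I J f ((extChartAt I p).symm y)).comp
        (diffAt 𝓘(ℝ, E) I (extChartAt I p).symm y) =
      (diffAt 𝓘(ℝ, E') J (extChartAt J q).symm (g y)).comp (fderiv ℝ g y) := by
    rw [← h1, ← h3, h2, diffAt_eq_fderiv]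
  ext v
  simp only [chartRep, ContinuousAlternatingMap.compContinuousLinearMap_apply]
  rw [hs]
  congr 1
  funext i
  exact congrArg (fun l : E →L[ℝ] E' => l (v i)) h4

/-- Pull-back of a homogeneous smooth form by a smooth map. -/
def pullbackK [FiniteDimensional ℝ E] (f : M → N) (hf : ContMDiff I J ∞ f) {k : ℕ}
    (θ : KForm J N k) : KForm I M k :=
  ⟨fun x => (θ.1 (f x)).compContinuousLinearMap (diffAt I J f x), fun p => by
    intro y hy
    set q := f ((extChartAt I p).symm y) with hq
    have hO := isOpen_chartDomain I J hf.continuous p q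
    have hyO : y ∈ (extChartAt I p).target ∩
        (fun z => f ((extChartAt I p).symm z)) ⁻¹' (extChartAt J q).source :=
      ⟨hy, mem_extChartAt_source q⟩
    have hg := contDiffOn_chartExpr I J hf p q
    have h : ContDiffOn ℝ ∞
        (chartRep I p (fun x => (θ.1 (f x)).compContinuousLinearMap (diffAt I J f x)))
        ((extChartAt I p).target ∩
          (fun z => f ((extChartAt I p).symm z)) ⁻¹' (extChartAt J q).source) := by
      refine ContDiffOn.congr (f := fun y =>
        (chartRep J q θ.1 (extChartAt J q (f ((extChartAt I p).symm y)))).compContinuousLinearMap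
        (fderiv ℝ (fun z => extChartAt J q (f ((extChartAt I p).symm z))) y)) ?_
        (fun z hz => chartRep_pullback I J hf θ.1 p q hz.1 hz.2)
      refine contDiffOn_cam fun v => ?_
      refine contDiffOn_cam_apply (g := fun y =>
        chartRep J q θ.1 (extChartAt J q (f ((extChartAt I p).symm y))))
        ((θ.2 q).comp hg fun z hz => (extChartAt J q).map_source hz.2) fun i => ?_
      exact (hg.fderiv_of_isOpen hO (by simp)).clm_apply contDiffOn_const
    exact (h.contDiffAt (hO.mem_nhds hyO)).contDiffWithinAt⟩

/-- Pull-back of a smooth form by a smooth map. -/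
def pullback [FiniteDimensional ℝ E] (f : M → N) (hf : ContMDiff I J ∞ f)
    (φ : Form J N) : Form I M := fun k => pullbackK I J f hf (φ k)

/-- The exterior derivative, computed at `x` in the preferred chart at `x`. By the lemma
`chartRep_extDerivAt` below every chart gives the same result. -/
def extDerivAt {k : ℕ} (θ : M → E [⋀^Fin k]→L[ℝ] ℝ) (x : M) : E [⋀^Fin (k + 1)]→L[ℝ] ℝ :=
  (extDeriv (chartRep I x θ) (extChartAt I x x)).compContinuousLinearMap
    (diffAt I 𝓘(ℝ, E) (extChartAt I x) x)

theorem chartRep_change {k : ℕ} (θ : M → E [⋀^Fin k]→L[ℝ] ℝ) (p q : M) {y : E}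
    (hy : y ∈ (extChartAt I p).target) (hq : (extChartAt I p).symm y ∈ (extChartAt I q).source) :
    chartRep I p θ y =
      (chartRep I q θ (extChartAt I q ((extChartAt I p).symm y))).compContinuousLinearMap
        (fderiv ℝ (fun z => extChartAt I q ((extChartAt I p).symm z)) y) := by
  have h := chartRep_pullback I I (contMDiff_id (I := I) (M := M)) θ p q hy hq
  have h2 : (fun x => (θ (id x)).compContinuousLinearMap (diffAt I I (id : M → M) x)) = θ := by
    funext x
    have : diffAt I I (id : M → M) x = ContinuousLinearMap.id ℝ E := mfderiv_id
    rw [this]; rfl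
  rw [h2] at h
  exact h

theorem chartRep_extDerivAt {k : ℕ} (θ : KForm I M k) (p : M) {y : E}
    (hy : y ∈ (extChartAt I p).target) :
    chartRep I p (extDerivAt I θ.1) y = extDeriv (chartRep I p θ.1) y := by
  set x := (extChartAt I p).symm y with hx
  have hxs : x ∈ (extChartAt I x).source := mem_extChartAt_source x
  have hO := isOpen_chartDomain I I (continuous_id (X := M)) p x
  have hyO : y ∈ (extChartAt I p).target ∩
      (fun z => (id ((extChartAt I p).symm z) : M)) ⁻¹' (extChartAt I x).source := ⟨hy, hxs⟩
  have hg : ContDiffAt ℝ ∞ (fun z => extChartAt I x ((extChartAt I p).symm z)) y :=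
    (contDiffOn_chartExpr I I (contMDiff_id (I := I) (M := M)) p x).contDiffAt (hO.mem_nhds hyO)
  have h1 : chartRep I p θ.1 =ᶠ[𝓝 y] fun z =>
      (chartRep I x θ.1 (extChartAt I x ((extChartAt I p).symm z))).compContinuousLinearMap
        (fderiv ℝ (fun z => extChartAt I x ((extChartAt I p).symm z)) z) := by
    filter_upwards [hO.mem_nhds hyO] with z hz
    exact chartRep_change I θ.1 p x hz.1 hz.2
  rw [h1.extDeriv_eq, extDeriv_pullback (r := ∞) _ hg (by simpa using (ENat.LEInfty.out : (2 : WithTop ℕ∞) ≤ ∞))]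
  · have h2 : diffAt 𝓘(ℝ, E) 𝓘(ℝ, E) (extChartAt I x ∘ (extChartAt I p).symm) y =
        (diffAt I 𝓘(ℝ, E) (extChartAt I x) x).comp (diffAt 𝓘(ℝ, E) I (extChartAt I p).symm y) :=
      diffAt_comp _ _ _ _ (mdifferentiableAt_extChartAt (mem_chart_source H x)) (mdiff_symm I p hy)
    rw [diffAt_eq_fderiv] at h2
    change ((extDeriv (chartRep I x θ.1) (extChartAt I x x)).compContinuousLinearMap
      (diffAt I 𝓘(ℝ, E) (extChartAt I x) x)).compContinuousLinearMap
        (diffAt 𝓘(ℝ, E) I (extChartAt I p).symm y) = _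
    ext v
    simp only [ContinuousAlternatingMap.compContinuousLinearMap_apply]
    congr 1
    funext i
    exact (congrArg (fun l : E →L[ℝ] E => l (v i)) h2).symm
  · exact ((θ.2 x).contDiffAt ((isOpen_extChartAt_target x).mem_nhds
      ((extChartAt I x).map_source hxs))).differentiableAt (by simp)

/-- The exterior derivative of a homogeneous smooth form. -/
def dK [FiniteDimensional ℝ E] {k : ℕ} (θ : KForm I M k) : KForm I M (k + 1) :=
  ⟨extDerivAt I θ.1, fun p => by
    refine ContDiffOn.congr (f := extDeriv (chartRep I p θ.1)) ?_
      fun y hy => chartRep_extDerivAt I θ p hy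
    exact (ContinuousAlternatingMap.alternatizeUncurryFinCLM ℝ E ℝ).contDiff.comp_contDiffOn
      ((θ.2 p).fderiv_of_isOpen (m := ∞) (isOpen_extChartAt_target p) (by simp))⟩

/-- The exterior derivative of a smooth form. -/
def dForm [FiniteDimensional ℝ E] (φ : Form I M) : Form I M
  | 0 => 0
  | k + 1 => dK I (φ k)



theorem append_update_left {V : Type*} {k l : ℕ} [DecidableEq (Fin k)]
    (a : Fin k → V) (b : Fin l → V) (i : Fin k) (x : V) :
    Fin.append (Function.update a i x) b =
      Function.update (Fin.append a b) (Fin.castAdd l i) x := by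
  funext j
  refine Fin.addCases (fun j => ?_) (fun j => ?_) j
  · by_cases h : j = i
    · subst h; simp
    · have : Fin.castAdd l j ≠ Fin.castAdd l i := fun h' => h (Fin.castAdd_injective _ _ h')
      simp [h, this]
  · have : Fin.natAdd k j ≠ Fin.castAdd l i := by
      intro h'
      have := congrArg Fin.val h'
      simp at this
      omega
    simp [this]

/-- Contract the last `l` arguments of `α` with vectors `w` of the second factor and restrict the
remaining ones to the first factor. -/
def sliceAlt {k l : ℕ} (α : (E × E') [⋀^Fin (k + l)]→L[ℝ] ℝ) (w : Fin l → E') :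
    E [⋀^Fin k]→L[ℝ] ℝ where
  toFun v := α (Fin.append (fun i => ((v i, 0) : E × E')) fun j => (0, w j))
  map_update_add' v i x y := by
    have h : ∀ z : E, (fun j => ((Function.update v i z j, 0) : E × E')) =
        Function.update (fun j => (v j, 0)) i (z, 0) := fun z => by
      funext j
      by_cases hj : j = i
      · subst hj; simp
      · simp [hj]
    have h2 : ((x + y, 0) : E × E') = (x, 0) + (y, 0) := by simp
    rw [h, h, h, append_update_left, append_update_left, append_update_left, h2]
    exact α.map_update_add _ _ _ _
  map_update_smul' v i c x := by
    have h : ∀ z : E, (fun j => ((Function.update v i z j, 0) : E × E')) =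
        Function.update (fun j => (v j, 0)) i (z, 0) := fun z => by
      funext j
      by_cases hj : j = i
      · subst hj; simp
      · simp [hj]
    have h2 : ((c • x, 0) : E × E') = c • (x, 0) := by simp
    rw [h, h, append_update_left, append_update_left, h2]
    exact α.map_update_smul _ _ _ _
  map_eq_zero_of_eq' v i j hv hij := by
    refine α.map_eq_zero_of_eq _ (i := Fin.castAdd l i) (j := Fin.castAdd l j) ?_ ?_
    · simp [hv]
    · exact fun h => hij (Fin.castAdd_injective _ _ h)
  cont := by
    refine α.cont.comp (continuous_pi fun j => ?_)
    refine Fin.addCases (fun j => ?_) (fun j => ?_) j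
    · simp only [Fin.append_left]; fun_prop
    · simp only [Fin.append_right]; fun_prop

theorem sliceAlt_apply {k l : ℕ} (α : (E × E') [⋀^Fin (k + l)]→L[ℝ] ℝ) (w : Fin l → E')
    (v : Fin k → E) :
    sliceAlt α w v = α (Fin.append (fun i => ((v i, 0) : E × E')) fun j => (0, w j)) := rfl

theorem chartRep_slice {k l : ℕ} (θ : M × N → (E × E') [⋀^Fin (k + l)]→L[ℝ] ℝ) (y : N)
    (w : Fin l → E') (p : M) {u : E} (hu : u ∈ (extChartAt I p).target) (v : Fin k → E) :
    chartRep I p (fun x => sliceAlt (θ (x, y)) w) u v =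
      chartRep (I.prod J) (p, y) θ (u, extChartAt J y y)
        (Fin.append (fun i => ((v i, 0) : E × E'))
          fun j => (0, diffAt J 𝓘(ℝ, E') (extChartAt J y) y (w j))) := by
  set t := extChartAt J y y with ht
  have htt : t ∈ (extChartAt J y).target := mem_extChartAt_target y
  have hE : extChartAt (I.prod J) (p, y) = (extChartAt I p).prod (extChartAt J y) :=
    extChartAt_prod (p, y)
  have hprod : (u, t) ∈ (extChartAt (I.prod J) (p, y)).target := by
    rw [hE]
    exact ⟨hu, htt⟩
  have hsymm : ∀ (a : E) (b : E'), (extChartAt (I.prod J) (p, y)).symm (a, b) =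
      ((extChartAt I p).symm a, (extChartAt J y).symm b) := fun a b => by
    rw [hE]
    rfl
  have hty : (extChartAt J y).symm t = y := extChartAt_to_inv y
  have hd := mdiff_symm (I.prod J) (p, y) hprod
  set D := diffAt 𝓘(ℝ, E × E') (I.prod J) (extChartAt (I.prod J) (p, y)).symm (u, t) with hD
  -- the first partial derivative
  have h1 : ∀ a : E, D (a, 0) = (diffAt 𝓘(ℝ, E) I (extChartAt I p).symm u a, 0) := by
    intro a
    have e1 : diffAt 𝓘(ℝ, E) (I.prod J)
        ((extChartAt (I.prod J) (p, y)).symm ∘ fun z : E => (z, t)) u =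
        D.comp (diffAt 𝓘(ℝ, E) 𝓘(ℝ, E × E') (fun z : E => (z, t)) u) :=
      diffAt_comp _ _ _ _ hd (by
        exact ((differentiableAt_id).prodMk (differentiableAt_const t)).mdifferentiableAt)
    have e2 : diffAt 𝓘(ℝ, E) (I.prod J)
        ((fun x : M => (x, y)) ∘ (extChartAt I p).symm) u =
        (diffAt I (I.prod J) (fun x : M => (x, y)) ((extChartAt I p).symm u)).comp
          (diffAt 𝓘(ℝ, E) I (extChartAt I p).symm u) :=
      diffAt_comp _ _ _ _ (mdifferentiableAt_id.prodMk mdifferentiableAt_const) (mdiff_symm I p hu)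
    have e3 : ((extChartAt (I.prod J) (p, y)).symm ∘ fun z : E => (z, t)) =
        (fun x : M => (x, y)) ∘ (extChartAt I p).symm := by
      funext z
      change (extChartAt (I.prod J) (p, y)).symm (z, t) = ((extChartAt I p).symm z, y)
      rw [hsymm, hty]
    have e4 : diffAt 𝓘(ℝ, E) 𝓘(ℝ, E × E') (fun z : E => (z, t)) u =
        ContinuousLinearMap.inl ℝ E E' := by
      rw [diffAt_eq_fderiv]
      exact ((hasFDerivAt_id u).prodMk (hasFDerivAt_const t u)).fderiv
    have e5 : diffAt I (I.prod J) (fun x : M => (x, y)) ((extChartAt I p).symm u) =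
        ContinuousLinearMap.inl ℝ E E' := mfderiv_prod_left
    rw [e3, e2, e4, e5] at e1
    exact (congrArg (fun l : E →L[ℝ] E × E' => l a) e1).symm
  have h2 : ∀ b : E', D (0, b) = (0, diffAt 𝓘(ℝ, E') J (extChartAt J y).symm t b) := by
    intro b
    have e1 : diffAt 𝓘(ℝ, E') (I.prod J)
        ((extChartAt (I.prod J) (p, y)).symm ∘ fun z : E' => (u, z)) t =
        D.comp (diffAt 𝓘(ℝ, E') 𝓘(ℝ, E × E') (fun z : E' => (u, z)) t) :=
      diffAt_comp _ _ _ _ hd (by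
        exact ((differentiableAt_const u).prodMk (differentiableAt_id)).mdifferentiableAt)
    have e2 : diffAt 𝓘(ℝ, E') (I.prod J)
        ((fun z : N => ((extChartAt I p).symm u, z)) ∘ (extChartAt J y).symm) t =
        (diffAt J (I.prod J) (fun z : N => ((extChartAt I p).symm u, z))
          ((extChartAt J y).symm t)).comp (diffAt 𝓘(ℝ, E') J (extChartAt J y).symm t) :=
      diffAt_comp _ _ _ _ (mdifferentiableAt_const.prodMk mdifferentiableAt_id)
        (mdiff_symm J y htt)
    have e3 : ((extChartAt (I.prod J) (p, y)).symm ∘ fun z : E' => (u, z)) =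
        (fun z : N => ((extChartAt I p).symm u, z)) ∘ (extChartAt J y).symm := by
      funext z
      exact hsymm u z
    have e4 : diffAt 𝓘(ℝ, E') 𝓘(ℝ, E × E') (fun z : E' => (u, z)) t =
        ContinuousLinearMap.inr ℝ E E' := by
      rw [diffAt_eq_fderiv]
      exact ((hasFDerivAt_const u t).prodMk (hasFDerivAt_id t)).fderiv
    have e5 : diffAt J (I.prod J) (fun z : N => ((extChartAt I p).symm u, z))
        ((extChartAt J y).symm t) = ContinuousLinearMap.inr ℝ E E' := mfderiv_prod_right
    rw [e3, e2, e4, e5] at e1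
    exact (congrArg (fun l : E' →L[ℝ] E × E' => l b) e1).symm
  have h3 : ∀ b : E', diffAt 𝓘(ℝ, E') J (extChartAt J y).symm t
      (diffAt J 𝓘(ℝ, E') (extChartAt J y) y b) = b := by
    intro b
    have e1 : diffAt J J ((extChartAt J y).symm ∘ extChartAt J y) y =
        (diffAt 𝓘(ℝ, E') J (extChartAt J y).symm t).comp
          (diffAt J 𝓘(ℝ, E') (extChartAt J y) y) :=
      diffAt_comp _ _ _ _ (mdiff_symm J y htt)
        (mdifferentiableAt_extChartAt (mem_chart_source H' y))
    have e2 : diffAt J J ((extChartAt J y).symm ∘ extChartAt J y) y = diffAt J J id y := by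
      refine diffAt_congr _ _ ?_
      filter_upwards [(isOpen_extChartAt_source (I := J) y).mem_nhds (mem_extChartAt_source y)]
        with z hz
      exact (extChartAt J y).left_inv hz
    have e3 : diffAt J J (id : N → N) y = ContinuousLinearMap.id ℝ E' := mfderiv_id
    rw [e2, e3] at e1
    exact (congrArg (fun l : E' →L[ℝ] E' => l b) e1).symm
  simp only [chartRep, ContinuousAlternatingMap.compContinuousLinearMap_apply, sliceAlt_apply]
  rw [hsymm, hty, ← hD]
  congr 1
  funext j
  refine Fin.addCases (fun j => ?_) (fun j => ?_) j
  · simp only [Function.comp_apply, Fin.append_left]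
    exact (h1 _).symm
  · simp only [Function.comp_apply, Fin.append_right]
    exact ((h2 _).trans (congrArg _ (h3 _))).symm

/-- For `y ∈ N` and tangent vectors `w` at `y`: contract the last `l` arguments of a form on
`M × N` with `w` and restrict the result to `M × {y}`. -/
def sliceK [FiniteDimensional ℝ E] {k l : ℕ} (θ : KForm (I.prod J) (M × N) (k + l)) (y : N)
    (w : Fin l → E') : KForm I M k :=
  ⟨fun x => sliceAlt (θ.1 (x, y)) w, fun p => by
    refine contDiffOn_cam fun v => ?_
    refine ContDiffOn.congr ?_ fun u hu => chartRep_slice I J θ.1 y w p hu v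
    refine contDiffOn_cam_apply (g := fun u =>
      chartRep (I.prod J) (p, y) θ.1 (u, extChartAt J y y)) ?_ fun i => contDiffOn_const
    refine (θ.2 (p, y)).comp (contDiff_id.prodMk contDiff_const).contDiffOn fun u hu => ?_
    simp only [extChartAt_prod, PartialEquiv.prod_target]
    exact ⟨hu, mem_extChartAt_target y⟩⟩



end Forms

/-! ### Integration, currents on complex manifolds

`M` is modelled on a complex vector space `E` and is oriented by the complex structure of `E`. -/

/-- The real dimension of a complex vector space. -/
abbrev realDim (E : Type*) [NormedAddCommGroup E] [NormedSpace ℂ E] : ℕ := Module.finrank ℂ E * 2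

section ComplexOrientation

variable {E : Type*} [NormedAddCommGroup E] [NormedSpace ℝ E] [NormedSpace ℂ E]
  [IsScalarTower ℝ ℂ E] [FiniteDimensional ℝ E] [FiniteDimensional ℂ E]
  {H : Type*} [TopologicalSpace H] (I : ModelWithCorners ℝ E H) [I.Boundaryless]
  {M : Type*} [TopologicalSpace M] [ChartedSpace H M] [IsManifold I ∞ M]
  [T2Space M] [CompactSpace M]
  {E' : Type*} [NormedAddCommGroup E'] [NormedSpace ℝ E'] [NormedSpace ℂ E']
  [IsScalarTower ℝ ℂ E'] [FiniteDimensional ℝ E'] [FiniteDimensional ℂ E']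
  {H' : Type*} [TopologicalSpace H'] (J : ModelWithCorners ℝ E' H') [J.Boundaryless]
  {N : Type*} [TopologicalSpace N] [ChartedSpace H' N] [IsManifold J ∞ N]
  [T2Space N] [CompactSpace N]

/-- The positively oriented real basis `c₁, i c₁, c₂, i c₂, …` built from a complex basis `c`. -/
def realFrame (E : Type*) [NormedAddCommGroup E] [NormedSpace ℝ E] [NormedSpace ℂ E]
    [IsScalarTower ℝ ℂ E] [FiniteDimensional ℂ E] : Module.Basis (Fin (realDim E)) ℝ E :=
  (Complex.basisOneI.smulTower (Module.finBasis ℂ E)).reindex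
    ((Equiv.prodComm _ _).trans finProdFinEquiv)

variable (M) in
/-- A smooth partition of unity subordinate to the charts. -/
def chartPartition : SmoothPartitionOfUnity M I M univ :=
  (SmoothPartitionOfUnity.exists_isSubordinate_chartAt_source I M).choose

/-- The integral over `M` of a field `θ` of alternating forms of top degree: decompose `θ` with a
partition of unity and integrate its coefficient in positively oriented charts. -/
def integralTop (θ : M → (Fin (realDim E) → E) → ℝ) : ℝ :=
  ∑ᶠ p : M, ∫ u in {u | (realFrame E).equivFun.symm u ∈ (extChartAt I p).target},
    chartPartition I M p ((extChartAt I p).symm ((realFrame E).equivFun.symm u)) *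
      θ ((extChartAt I p).symm ((realFrame E).equivFun.symm u))
        fun j => diffAt 𝓘(ℝ, E) I (extChartAt I p).symm ((realFrame E).equivFun.symm u)
          (realFrame E j)

/-- The integral over `M` of a smooth form, i.e. of its component of top degree. -/
def integral (φ : Form I M) : ℝ := integralTop I fun x v => (φ (realDim E)).1 x v

/-- The support of a current. -/
def supp (T : Current I M) : Set M :=
  {x | ∀ U : Set M, IsOpen U → x ∈ U →
    ∃ φ : Form I M, (∀ k, closure {z | (φ k).1 z ≠ 0} ⊆ U) ∧ T φ ≠ 0}

/-- `bT = 0`, where `(bT)(φ) = T(dφ)`. -/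
def IsClosedCurrent (T : Current I M) : Prop := ∀ φ : Form I M, T (dForm I φ) = 0

/-- `T = bS` for some current `S`. -/
def IsNullHomologous (T : Current I M) : Prop :=
  ∃ S : Current I M, ∀ φ : Form I M, T φ = S (dForm I φ)

/-- `T` is homogeneous: for some `k` it only sees the component of degree `k` of a form. -/
def IsHomogeneous (T : Current I M) : Prop :=
  ∃ k : ℕ, ∀ φ : Form I M, φ k = 0 → T φ = 0

/-! ### Lebesgue currents -/

/-- Riemann integrability on every box. -/
def RiemannIntegrable {ι : Type} [Fintype ι] (f : (ι → ℝ) → ℝ) : Prop :=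
  ∀ B : BoxIntegral.Box ι, BoxIntegral.Integrable B BoxIntegral.IntegrationParams.Riemann f
    BoxIntegral.BoxAdditiveMap.volume

/-- Compactly supported, bounded, Riemann integrable functions on `ℝ^k`. -/
structure IsLebesgueDistribution {k : ℕ} (L : (Fin k → ℝ) → ℝ) : Prop where
  hasCompactSupport : HasCompactSupport L
  bounded : ∃ C : ℝ, ∀ t, |L t| ≤ C
  riemannIntegrable : RiemannIntegrable L

/-- `L` has a polar function: at each `a` the limit `ψ_a(x)` of `L(λx + a)` as `λ → 0⁺` exists for
almost every `x`, and `ψ_a(x)` is, as a function of `(a, x)`, bounded and Riemann integrable. -/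
def HasPolarFunction {k : ℕ} (L : (Fin k → ℝ) → ℝ) : Prop :=
  ∃ ψ : (Fin k ⊕ Fin k → ℝ) → ℝ, (∃ C : ℝ, ∀ z, |ψ z| ≤ C) ∧ RiemannIntegrable ψ ∧
    ∀ a : Fin k → ℝ, ∀ᵐ x : Fin k → ℝ,
      Tendsto (fun c : ℝ => L (c • x + a)) (𝓝[>] 0) (𝓝 (ψ (Sum.elim a x)))

/-- The form `dt₁ ∧ ⋯ ∧ dt_k` on `ℝ^k`. -/
def stdVolume (k : ℕ) : (Fin k → ℝ) [⋀^Fin k]→L[ℝ] ℝ :=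
  { (Matrix.detRowAlternating : (Fin k → ℝ) [⋀^Fin k]→ₗ[ℝ] ℝ) with
    cont := by
      change Continuous fun v : Matrix (Fin k) (Fin k) ℝ => v.det
      exact continuous_id.matrix_det }

/-- The projection of the coordinate neighbourhood of the chart `e` to the coordinate plane
selected by `σ`. -/
def coordProj {k : ℕ} (e : OpenPartialHomeomorph M H) (σ : Fin k ↪o Fin (realDim E)) (x : M) :
    Fin k → ℝ := fun j => (realFrame E).equivFun (e.extend I x) (σ j)

/-- `η` is the form `ξ · π^*(g dt₁ ∧ ⋯ ∧ dt_k)`, extended by zero outside the chart `e`, where `π`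
is the projection to the coordinate plane selected by `σ`. -/
def IsCutoffPullback {k : ℕ} (e : OpenPartialHomeomorph M H) (σ : Fin k ↪o Fin (realDim E))
    (ξ : M → ℝ) (g : (Fin k → ℝ) → ℝ) (η : KForm I M k) : Prop :=
  (∀ x ∈ e.source, η.1 x = (ξ x * g (coordProj I e σ x)) •
    (stdVolume k).compContinuousLinearMap (diffAt I 𝓘(ℝ, Fin k → ℝ) (coordProj I e σ) x)) ∧
  ∀ x ∉ e.source, η.1 x = 0

/-- `q` is a point of Lebesgue type for the component of dimension `k` of `T`: for all local
coordinates around `q` and all projections `π` to a coordinate plane of dimension `k` there is a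
neighbourhood `B` of `q` such that, for all cut-off functions `ξ` supported in `B`, the current
`π_*(ξT)` is given by a Lebesgue distribution that has a polar function. -/
def IsLebesguePoint (k : ℕ) (T : Current I M) (q : M) : Prop :=
  ∀ e ∈ IsManifold.maximalAtlas I ∞ M, q ∈ e.source → ∀ σ : Fin k ↪o Fin (realDim E),
    ∃ B : Set M, IsOpen B ∧ q ∈ B ∧ B ⊆ e.source ∧
      ∀ ξ : M → ℝ, ContMDiff I 𝓘(ℝ) ∞ ξ → tsupport ξ ⊆ B →
        ∃ L : (Fin k → ℝ) → ℝ, IsLebesgueDistribution L ∧ HasPolarFunction L ∧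
          ∀ g : (Fin k → ℝ) → ℝ, ContDiff ℝ ∞ g → HasCompactSupport g →
            ∀ η : KForm I M k, IsCutoffPullback I e σ ξ g η →
              T (Pi.single k η) = ∫ t, g t * L t

/-- Lebesgue currents: sums of homogeneous currents all of whose points are of Lebesgue type. -/
def IsLebesgue (T : Current I M) : Prop := ∀ (k : ℕ) (q : M), IsLebesguePoint I k T q

/-! ### De Rham's smoothing operators -/

/-- The coordinates used by the smoothing operators: `ℝ^m` with its Euclidean norm. -/
abbrev Coord (E : Type*) [NormedAddCommGroup E] [NormedSpace ℂ E] : Type :=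
  EuclideanSpace ℝ (Fin (realDim E))

open scoped Classical in
/-- Let `h` be a diffeomorphism of an open set of `M` with `ℝ^m` and `κ` a diffeomorphism of the
unit ball with `ℝ^m`. The translation by `y ∈ ℝ^m`, transported by `κ ∘ h` to the set that `h` maps
to the unit ball and extended by the identity to `M`. -/
def ballShift (h : OpenPartialHomeomorph M (Coord E))
    (κ : OpenPartialHomeomorph (Coord E) (Coord E)) (y : Coord E) (x : M) : M :=
  if x ∈ h.source ∧ h x ∈ Metric.ball (0 : Coord E) 1 then h.symm (κ.symm (κ (h x) + y)) else x

variable (M) in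
/-- One local piece `B ⊆ U` of de Rham data: the diffeomorphism `h` of `U` with `ℝ^m` that maps `B`
to the unit ball, the diffeomorphism `κ` of the unit ball with `ℝ^m`, and the bump function. As in
de Rham's construction, `κ` is such that the translations of `ℝ^m`, transported to `B`, extend
smoothly by the identity. -/
structure DeRhamPatch where
  h : OpenPartialHomeomorph M (Coord E)
  h_target : h.target = univ
  h_smooth : ContMDiffOn I 𝓘(ℝ, Coord E) ∞ h h.source
  h_symm_smooth : ContMDiff 𝓘(ℝ, Coord E) I ∞ h.symm
  κ : OpenPartialHomeomorph (Coord E) (Coord E)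
  κ_source : κ.source = Metric.ball 0 1
  κ_target : κ.target = univ
  κ_smooth : ContDiffOn ℝ ∞ κ (Metric.ball 0 1)
  κ_symm_smooth : ContDiff ℝ ∞ κ.symm
  shift_smooth : ContMDiff (𝓘(ℝ, Coord E).prod I) I ∞
    fun z : Coord E × M => ballShift h κ z.1 z.2
  bump : Coord E → ℝ
  bump_smooth : ContDiff ℝ ∞ bump
  bump_nonneg : ∀ y, 0 ≤ bump y
  bump_support : Function.support bump ⊆ Metric.ball 0 1
  bump_integral : ∫ y, bump y = 1
  bump_even : ∀ y, bump (-y) = bump y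

namespace DeRhamPatch

variable {I J}

/-- The open set `B`. -/
def ball (P : DeRhamPatch I M) : Set M := {x | x ∈ P.h.source ∧ P.h x ∈ Metric.ball 0 1}

/-- The diffeomorphisms `s_y` of `M`. -/
def shift (P : DeRhamPatch I M) (y : Coord E) : M → M := ballShift P.h P.κ y

theorem contMDiff_shift (P : DeRhamPatch I M) (y : Coord E) : ContMDiff I I ∞ (P.shift y) :=
  P.shift_smooth.comp (contMDiff_const.prodMk contMDiff_id)

/-- `f^ε(y) = ε^{-m} f(ε⁻¹ y)`. -/
def scaledBump (P : DeRhamPatch I M) (ε : ℝ) (y : Coord E) : ℝ :=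
  (ε ^ realDim E)⁻¹ * P.bump (ε⁻¹ • y)

/-- The smoothing operator of the product of a piece `B ⊆ U` on `M` and a piece `B' ⊆ U'` on `N`,
with the product translations and the product bump function:
`T ↦ (φ ↦ ∫ f^ε(y) f'^ε(y') T((s_y × s_y')^* φ) dy dy')`. The cut-off functions that are `1` near
the closure of `B` do not appear: `s_y` is already globally defined, and it is the identity
outside `B`. -/
def prodSmoothing (P : DeRhamPatch I M) (Q : DeRhamPatch J N) (ε : ℝ)
    (T : Form (I.prod J) (M × N) → ℝ) (φ : Form (I.prod J) (M × N)) : ℝ :=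
  ∫ y : Coord E × Coord E', P.scaledBump ε y.1 * Q.scaledBump ε y.2 *
    T (pullback (I.prod J) (I.prod J) (Prod.map (P.shift y.1) (Q.shift y.2))
      ((P.contMDiff_shift y.1).prodMap (Q.contMDiff_shift y.2)) φ)

end DeRhamPatch

variable (M) in
/-- De Rham data: an ordered family of local pieces whose sets `B` cover the manifold. A locally
finite family of nonempty sets of a compact space is finite. -/
structure DeRhamData where
  card : ℕ
  patch : Fin card → DeRhamPatch I M
  cover : ⋃ i, (patch i).ball = univ

variable (M N) in
/-- Product de Rham data: de Rham data on both factors and an ordering of the pairs of pieces. -/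
structure ProductDeRhamData where
  left : DeRhamData I M
  right : DeRhamData J N
  order : Fin (left.card * right.card) ≃ Fin left.card × Fin right.card

variable {I J} in
/-- The smoothing operator `R_ε = R^1_ε ∘ R^2_ε ∘ ⋯ ∘ R^h_ε` of product de Rham data. -/
def ProductDeRhamData.smoothing (D : ProductDeRhamData I M J N) (ε : ℝ)
    (T : Form (I.prod J) (M × N) → ℝ) : Form (I.prod J) (M × N) → ℝ :=
  (List.ofFn fun a => D.order a).foldr
    (fun ij S => (D.left.patch ij.1).prodSmoothing (D.right.patch ij.2) ε S) T

open scoped Classical in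
/-- The smooth form `η` that represents the functional `T`, i.e. `T(φ) = ∫ η ∧ φ`; it is unique
if it exists. -/
def smoothForm (T : Form I M → ℝ) : Form I M :=
  if h : ∃ η : Form I M, ∀ φ : Form I M, T φ = integral I (wedge I η φ) then h.choose else 0

/-! ### Intersection and correspondences -/

variable {I J} in
/-- `S = [T₁ ∧ T₂]`, that is `S(φ) = lim_{ε → 0} T₁(R_ε T₂ ∧ φ)` for every test form `φ`; in
particular all these limits exist. -/
def IsIntersection (D : ProductDeRhamData I M J N) (T₁ : Current (I.prod J) (M × N))
    (T₂ : Form (I.prod J) (M × N) → ℝ) (S : Current (I.prod J) (M × N)) : Prop :=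
  ∀ φ : Form (I.prod J) (M × N),
    Tendsto (fun ε : ℝ => T₁ (wedge (I.prod J) (smoothForm (I.prod J) (D.smoothing ε T₂)) φ))
      (𝓝[>] 0) (𝓝 (S φ))

/-- The product current `T × [N]`, `φ ↦ ∫_{y ∈ N} T(φ(·, y))`. -/
def crossTop (T : Current I M) (φ : Form (I.prod J) (M × N)) : ℝ :=
  integralTop J fun (y : N) (w : Fin (realDim E') → E') =>
    T fun k => sliceK I J (φ (k + realDim E')) y w

/-- The product current `[M] × T`: the image of `T × [M]` under the exchange of the factors, which
preserves the orientation because the real dimensions are even. -/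
def topCross (T : Current J N) (φ : Form (I.prod J) (M × N)) : ℝ :=
  crossTop J I T (pullback (J.prod I) (I.prod J) (Prod.swap : N × M → M × N)
    (contMDiff_snd.prodMk contMDiff_fst) φ)

variable {I J} in
/-- `F_*(T)` is well defined and equal to `G`: `G = (P_N)_* [F ∧ (T × [N])]`. -/
def IsPushforward (D : ProductDeRhamData I M J N) (F : Current (I.prod J) (M × N))
    (T : Current I M) (G : Current J N) : Prop :=
  ∃ S : Current (I.prod J) (M × N), IsIntersection D F (crossTop I J T) S ∧
    ∀ φ : Form J N, G φ = S (pullback (I.prod J) J (Prod.snd : M × N → N) contMDiff_snd φ)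

variable {I J} in
/-- `F^*(T)` is well defined and equal to `G`: `G = (P_M)_* [F ∧ ([M] × T)]`. -/
def IsPullback (D : ProductDeRhamData I M J N) (F : Current (I.prod J) (M × N))
    (T : Current J N) (G : Current I M) : Prop :=
  ∃ S : Current (I.prod J) (M × N), IsIntersection D F (topCross I J T) S ∧
    ∀ φ : Form I M, G φ = S (pullback (I.prod J) I (Prod.fst : M × N → M) contMDiff_fst φ)

end ComplexOrientation

/-- The real manifold underlying a complex manifold. -/
instance isManifold_real {E : Type*} [NormedAddCommGroup E] [NormedSpace ℂ E]
    {X : Type*} [TopologicalSpace X] [ChartedSpace E X] [IsManifold 𝓘(ℂ, E) ω X] :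
    IsManifold 𝓘(ℝ, E) ∞ X := by
  refine isManifold_of_contDiffOn _ _ _ fun e e' he he' => ?_
  have h := ((contDiffGroupoid ω 𝓘(ℂ, E)).compatible he he')
  rw [contDiffGroupoid, mem_groupoid_of_pregroupoid] at h
  exact (ContDiffOn.restrict_scalars ℝ h.1).of_le le_top

end LebesgueCurrents

end

open LebesgueCurrents

set_option linter.unusedSectionVars false

noncomputable section

namespace LebesgueCurrents

/-! ### The algebra of the exterior product -/

section WedgeAlgebra
variable {V W : Type*} [NormedAddCommGroup V] [NormedSpace ℝ V]
  [NormedAddCommGroup W] [NormedSpace ℝ W]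

/-- The inclusion of the first block of indices. -/
def leftIdx {p q r : ℕ} (h : p + q = r) (i : Fin p) : Fin r :=
  finCongr h (finSumFinEquiv (Sum.inl i))

/-- The inclusion of the second block of indices. -/
def rightIdx {p q r : ℕ} (h : p + q = r) (j : Fin q) : Fin r :=
  finCongr h (finSumFinEquiv (Sum.inr j))

theorem wedgeCAM_eq_sum_perm {p q r : ℕ} (h : p + q = r) (α : V [⋀^Fin p]→L[ℝ] ℝ)
    (β : V [⋀^Fin q]→L[ℝ] ℝ) (v : Fin r → V) :
    ((p.factorial * q.factorial : ℕ) : ℝ) * wedgeCAM h α β v = ∑ σ : Equiv.Perm (Fin r),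
      ((Equiv.Perm.sign σ : ℤ) : ℝ) *
        (α (fun i => v (σ (leftIdx h i))) * β (fun j => v (σ (rightIdx h j)))) := by
  set e : Fin p ⊕ Fin q ≃ Fin r := finSumFinEquiv.trans (finCongr h) with he
  have h1 := congrArg (fun A => LinearMap.mul' ℝ ℝ (A (fun x => v (e x))))
    (MultilinearMap.domCoprod_alternization_eq α.toAlternatingMap β.toAlternatingMap)
  have h2 : wedgeCAM h α β v = LinearMap.mul' ℝ ℝ
      ((α.toAlternatingMap.domCoprod β.toAlternatingMap) (fun x => v (e x))) := rfl
  simp only [Fintype.card_fin, AlternatingMap.smul_apply, map_nsmul] at h1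
  rw [← h2, nsmul_eq_mul] at h1
  rw [← h1, MultilinearMap.alternatization_apply, map_sum]
  refine Fintype.sum_equiv (Equiv.permCongr e) _ _ fun σ => ?_
  have hs : Equiv.Perm.sign (Equiv.permCongr e σ) = Equiv.Perm.sign σ :=
    Equiv.Perm.sign_permCongr e σ
  have hl : ∀ i, Equiv.permCongr e σ (leftIdx h i) = e (σ (Sum.inl i)) := fun i => by
    simp only [Equiv.permCongr_apply]
    congr 2
    exact e.symm_apply_apply (Sum.inl i)
  have hr : ∀ i, Equiv.permCongr e σ (rightIdx h i) = e (σ (Sum.inr i)) := fun i => by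
    simp only [Equiv.permCongr_apply]
    congr 2
    exact e.symm_apply_apply (Sum.inr i)
  rw [hs]
  simp only [hl, hr]
  rcases Int.units_eq_one_or (Equiv.Perm.sign σ) with hσ | hσ <;>
    simp [hσ, MultilinearMap.domDomCongr_apply, MultilinearMap.domCoprod_apply]

theorem alternatizeUncurryFin_eq_sum_perm {n : ℕ} (g : V →L[ℝ] V [⋀^Fin n]→L[ℝ] ℝ)
    (v : Fin (n + 1) → V) :
    (n.factorial : ℝ) * ContinuousAlternatingMap.alternatizeUncurryFin g v =
      ∑ σ : Equiv.Perm (Fin (n + 1)), ((Equiv.Perm.sign σ : ℤ) : ℝ) *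
        g (v (σ 0)) (fun i => v (σ i.succ)) := by
  set a := ContinuousAlternatingMap.alternatizeUncurryFin g
  have h1 : (((n + 1).factorial : ℕ) : ℝ) * a v = ∑ σ : Equiv.Perm (Fin (n + 1)),
      ((Equiv.Perm.sign σ : ℤ) : ℝ) * a (fun i => v (σ i)) := by
    have h2 : ∀ σ : Equiv.Perm (Fin (n + 1)),
        ((Equiv.Perm.sign σ : ℤ) : ℝ) * a (fun i => v (σ i)) = a v := by
      intro σ
      have h3 : a (fun i => v (σ i)) = Equiv.Perm.sign σ • a v := a.toAlternatingMap.map_perm v σ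
      rw [h3]
      rcases Int.units_eq_one_or (Equiv.Perm.sign σ) with hσ | hσ <;> simp [hσ]
    simp only [h2, Finset.sum_const, Finset.card_univ, Fintype.card_perm, Fintype.card_fin,
      nsmul_eq_mul]
  have h4 : ∀ i : Fin (n + 1), ∑ σ : Equiv.Perm (Fin (n + 1)), ((Equiv.Perm.sign σ : ℤ) : ℝ) *
        ((-1) ^ (i : ℕ) * g (v (σ i)) (fun j => v (σ (i.succAbove j)))) =
      ∑ σ : Equiv.Perm (Fin (n + 1)), ((Equiv.Perm.sign σ : ℤ) : ℝ) *
        g (v (σ 0)) (fun i => v (σ i.succ)) := by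
    intro i
    refine Fintype.sum_equiv (Equiv.mulRight (i.cycleRange)⁻¹) _ _ fun σ => ?_
    have e1 : ∀ j, (σ * (i.cycleRange)⁻¹) j = σ (i.cycleRange.symm j) := fun j => rfl
    simp only [Equiv.coe_mulRight, e1, Fin.cycleRange_symm_zero, Fin.cycleRange_symm_succ,
      Equiv.Perm.sign_mul, Equiv.Perm.sign_inv, Fin.sign_cycleRange]
    push_cast
    ring
  have h5 : ∑ σ : Equiv.Perm (Fin (n + 1)), ((Equiv.Perm.sign σ : ℤ) : ℝ) * a (fun i => v (σ i)) =
      (n + 1 : ℝ) * ∑ σ : Equiv.Perm (Fin (n + 1)), ((Equiv.Perm.sign σ : ℤ) : ℝ) *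
        g (v (σ 0)) (fun i => v (σ i.succ)) := by
    have : ∀ σ : Equiv.Perm (Fin (n + 1)), ((Equiv.Perm.sign σ : ℤ) : ℝ) * a (fun i => v (σ i)) =
        ∑ i : Fin (n + 1), ((Equiv.Perm.sign σ : ℤ) : ℝ) *
          ((-1) ^ (i : ℕ) * g (v (σ i)) (fun j => v (σ (i.succAbove j)))) := by
      intro σ
      rw [ContinuousAlternatingMap.alternatizeUncurryFin_apply, Finset.mul_sum]
      refine Finset.sum_congr rfl fun i _ => ?_
      simp only [zsmul_eq_mul]
      push_cast
      rfl
    simp only [this]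
    rw [Finset.sum_comm]
    simp only [h4, Finset.sum_const, Finset.card_univ, Fintype.card_fin, nsmul_eq_mul]
    push_cast; ring
  have h6 := h1.trans h5
  rw [Nat.factorial_succ] at h6
  push_cast at h6
  have : (n + 1 : ℝ) ≠ 0 := by positivity
  rw [mul_assoc] at h6
  exact mul_left_cancel₀ this h6

/-- The exterior product is graded commutative. -/
theorem exists_wedgeCAM_comm {p q r : ℕ} (h : p + q = r) (h' : q + p = r) :
    ∃ s : ℝ, s * s = 1 ∧ ∀ (α : V [⋀^Fin p]→L[ℝ] ℝ) (β : V [⋀^Fin q]→L[ℝ] ℝ),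
      wedgeCAM h' β α = s • wedgeCAM h α β := by
  set e : Fin p ⊕ Fin q ≃ Fin r := finSumFinEquiv.trans (finCongr h) with he
  set e' : Fin q ⊕ Fin p ≃ Fin r := finSumFinEquiv.trans (finCongr h') with he'
  set κ : Equiv.Perm (Fin r) := (e.symm.trans (Equiv.sumComm _ _)).trans e' with hκ
  have hl : ∀ i, κ (leftIdx h i) = rightIdx h' i := fun i => by
    have : e.symm (leftIdx h i) = Sum.inl i := e.symm_apply_apply _
    simp only [hκ, Equiv.trans_apply, this]; rfl
  have hr : ∀ i, κ (rightIdx h i) = leftIdx h' i := fun i => by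
    have : e.symm (rightIdx h i) = Sum.inr i := e.symm_apply_apply _
    simp only [hκ, Equiv.trans_apply, this]; rfl
  refine ⟨((Equiv.Perm.sign κ : ℤ) : ℝ), ?_, fun α β => ?_⟩
  · rcases Int.units_eq_one_or (Equiv.Perm.sign κ) with hσ | hσ <;> simp [hσ]
  ext v
  have h1 := wedgeCAM_eq_sum_perm h α β v
  have h2 := wedgeCAM_eq_sum_perm h' β α v
  have hne : ((p.factorial * q.factorial : ℕ) : ℝ) ≠ 0 := by positivity
  refine mul_left_cancel₀ hne ?_
  rw [ContinuousAlternatingMap.smul_apply, smul_eq_mul, mul_left_comm, h1,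
    Nat.mul_comm p.factorial, h2, Finset.mul_sum]
  refine (Fintype.sum_equiv (Equiv.mulRight κ) _ _ fun σ => ?_)
  simp only [Equiv.coe_mulRight, Equiv.Perm.mul_apply, hl, hr, Equiv.Perm.sign_mul]
  rcases Int.units_eq_one_or (Equiv.Perm.sign κ) with hσ | hσ <;> simp [hσ] <;> ring

theorem wedgeCAM_add_left {p q r : ℕ} (h : p + q = r) (α α' : V [⋀^Fin p]→L[ℝ] ℝ)
    (β : V [⋀^Fin q]→L[ℝ] ℝ) :
    wedgeCAM h (α + α') β = wedgeCAM h α β + wedgeCAM h α' β := by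
  ext v
  simp only [wedgeCAM_apply, ContinuousAlternatingMap.add_apply, ← Finset.sum_add_distrib]
  exact Finset.sum_congr rfl fun _ _ => by ring

theorem wedgeCAM_smul_left {p q r : ℕ} (h : p + q = r) (c : ℝ) (α : V [⋀^Fin p]→L[ℝ] ℝ)
    (β : V [⋀^Fin q]→L[ℝ] ℝ) : wedgeCAM h (c • α) β = c • wedgeCAM h α β := by
  ext v
  simp only [wedgeCAM_apply, ContinuousAlternatingMap.smul_apply, smul_eq_mul, Finset.mul_sum]
  exact Finset.sum_congr rfl fun _ _ => by ring

theorem wedgeCAM_add_right {p q r : ℕ} (h : p + q = r) (α : V [⋀^Fin p]→L[ℝ] ℝ)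
    (β β' : V [⋀^Fin q]→L[ℝ] ℝ) :
    wedgeCAM h α (β + β') = wedgeCAM h α β + wedgeCAM h α β' := by
  ext v
  simp only [wedgeCAM_apply, ContinuousAlternatingMap.add_apply, ← Finset.sum_add_distrib]
  exact Finset.sum_congr rfl fun _ _ => by ring

theorem wedgeCAM_smul_right {p q r : ℕ} (h : p + q = r) (c : ℝ) (α : V [⋀^Fin p]→L[ℝ] ℝ)
    (β : V [⋀^Fin q]→L[ℝ] ℝ) : wedgeCAM h α (c • β) = c • wedgeCAM h α β := by
  ext v
  simp only [wedgeCAM_apply, ContinuousAlternatingMap.smul_apply, smul_eq_mul, Finset.mul_sum]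
  exact Finset.sum_congr rfl fun _ _ => by ring

theorem wedgeCAM_compContinuousLinearMap {p q r : ℕ} (h : p + q = r) (α : V [⋀^Fin p]→L[ℝ] ℝ)
    (β : V [⋀^Fin q]→L[ℝ] ℝ) (L : W →L[ℝ] V) :
    wedgeCAM h (α.compContinuousLinearMap L) (β.compContinuousLinearMap L) =
      (wedgeCAM h α β).compContinuousLinearMap L := by
  ext v
  simp only [wedgeCAM_apply, ContinuousAlternatingMap.compContinuousLinearMap_apply]
  rfl

variable [FiniteDimensional ℝ V]

/-- The exterior product as a continuous bilinear map. -/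
def wedgeBilin {p q r : ℕ} (h : p + q = r) :
    (V [⋀^Fin p]→L[ℝ] ℝ) →L[ℝ] (V [⋀^Fin q]→L[ℝ] ℝ) →L[ℝ] (V [⋀^Fin r]→L[ℝ] ℝ) :=
  haveI := finiteDimensional_cam (V := V) p
  haveI := finiteDimensional_cam (V := V) q
  LinearMap.toContinuousLinearMap
    { toFun := fun α => LinearMap.toContinuousLinearMap
        { toFun := fun β => wedgeCAM h α β
          map_add' := wedgeCAM_add_right h α
          map_smul' := fun c β => wedgeCAM_smul_right h c α β }
      map_add' := fun α α' => by
        ext β : 1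
        exact wedgeCAM_add_left h α α' β
      map_smul' := fun c α => by
        ext β : 1
        exact wedgeCAM_smul_left h c α β }

theorem leftIdx_zero {p q r : ℕ} (h' : (p + 1) + q = r + 1) :
    leftIdx h' 0 = 0 := by
  apply Fin.ext; simp [leftIdx]

theorem leftIdx_succ {p q r : ℕ} (h : p + q = r) (h' : (p + 1) + q = r + 1) (i : Fin p) :
    leftIdx h' i.succ = (leftIdx h i).succ := by
  apply Fin.ext; simp [leftIdx]

theorem rightIdx_succ {p q r : ℕ} (h : p + q = r) (h' : (p + 1) + q = r + 1) (i : Fin q) :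
    rightIdx h' i = (rightIdx h i).succ := by
  apply Fin.ext; simp [rightIdx]; omega

theorem alternatizeUncurryFin_wedge_left {p q r : ℕ} (h : p + q = r) (h' : (p + 1) + q = r + 1)
    (a : V →L[ℝ] V [⋀^Fin p]→L[ℝ] ℝ) (β : V [⋀^Fin q]→L[ℝ] ℝ) :
    ContinuousAlternatingMap.alternatizeUncurryFin (((wedgeBilin h).flip β).comp a) =
      wedgeCAM h' (ContinuousAlternatingMap.alternatizeUncurryFin a) β := by
  ext v
  set X := ∑ σ : Equiv.Perm (Fin (r + 1)), ((Equiv.Perm.sign σ : ℤ) : ℝ) *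
      (a (v (σ 0)) (fun i => v (σ (leftIdx h i).succ)) * β (fun j => v (σ (rightIdx h j).succ)))
    with hX
  have hL : (r.factorial : ℝ) * (((p.factorial * q.factorial : ℕ) : ℝ) *
      ContinuousAlternatingMap.alternatizeUncurryFin (((wedgeBilin h).flip β).comp a) v) =
      r.factorial * X := by
    rw [mul_left_comm, alternatizeUncurryFin_eq_sum_perm, Finset.mul_sum]
    have h1 : ∀ σ : Equiv.Perm (Fin (r + 1)), ((p.factorial * q.factorial : ℕ) : ℝ) *
        (((Equiv.Perm.sign σ : ℤ) : ℝ) *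
          (((wedgeBilin h).flip β).comp a) (v (σ 0)) (fun i => v (σ i.succ))) =
        ∑ τ : Equiv.Perm (Fin r), ((Equiv.Perm.sign σ : ℤ) : ℝ) * (((Equiv.Perm.sign τ : ℤ) : ℝ) *
        (a (v (σ 0)) (fun i => v (σ (τ (leftIdx h i)).succ)) *
          β (fun j => v (σ (τ (rightIdx h j)).succ)))) := by
      intro σ
      rw [mul_left_comm, ← Finset.mul_sum]
      congr 1
      exact wedgeCAM_eq_sum_perm h (a (v (σ 0))) β (fun i => v (σ i.succ))
    simp only [h1]
    rw [Finset.sum_comm]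
    have h2 : ∀ τ : Equiv.Perm (Fin r), ∑ σ : Equiv.Perm (Fin (r + 1)),
        ((Equiv.Perm.sign σ : ℤ) : ℝ) * (((Equiv.Perm.sign τ : ℤ) : ℝ) *
        (a (v (σ 0)) (fun i => v (σ (τ (leftIdx h i)).succ)) *
          β (fun j => v (σ (τ (rightIdx h j)).succ)))) = X := by
      intro τ
      refine Fintype.sum_equiv (Equiv.mulRight (Equiv.Perm.decomposeFin.symm (0, τ))) _ _
        fun σ => ?_
      have hz : Equiv.Perm.decomposeFin.symm (0, τ) 0 = 0 :=
        Equiv.Perm.decomposeFin_symm_apply_zero _ _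
      have hsc : ∀ i, Equiv.Perm.decomposeFin.symm (0, τ) (Fin.succ i) = (τ i).succ := fun i => by
        rw [Equiv.Perm.decomposeFin_symm_apply_succ]; simp
      simp only [Equiv.coe_mulRight, Equiv.Perm.mul_apply, hz, hsc, Equiv.Perm.sign_mul,
        Equiv.Perm.decomposeFin.symm_sign, if_true, one_mul]
      push_cast; ring
    simp only [h2, Finset.sum_const, Finset.card_univ, Fintype.card_perm, Fintype.card_fin,
      nsmul_eq_mul]
  have hR : (((p + 1).factorial : ℕ) : ℝ) * (((p.factorial * q.factorial : ℕ) : ℝ) *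
      wedgeCAM h' (ContinuousAlternatingMap.alternatizeUncurryFin a) β v) =
      ((p + 1).factorial : ℕ) * X := by
    have h0 : (((p + 1).factorial : ℕ) : ℝ) * (((p.factorial * q.factorial : ℕ) : ℝ) *
      wedgeCAM h' (ContinuousAlternatingMap.alternatizeUncurryFin a) β v) = p.factorial *
        ((((p + 1).factorial * q.factorial : ℕ) : ℝ) *
      wedgeCAM h' (ContinuousAlternatingMap.alternatizeUncurryFin a) β v) := by
      push_cast; ring
    rw [h0, wedgeCAM_eq_sum_perm, Finset.mul_sum]
    set e : Fin (p + 1) ⊕ Fin q ≃ Fin (r + 1) := finSumFinEquiv.trans (finCongr h') with he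
    have h1 : ∀ σ : Equiv.Perm (Fin (r + 1)), (p.factorial : ℝ) *
        (((Equiv.Perm.sign σ : ℤ) : ℝ) *
          (ContinuousAlternatingMap.alternatizeUncurryFin a (fun i => v (σ (leftIdx h' i))) *
            β (fun j => v (σ (rightIdx h' j))))) =
        ∑ τ : Equiv.Perm (Fin (p + 1)), ((Equiv.Perm.sign σ : ℤ) : ℝ) *
          (((Equiv.Perm.sign τ : ℤ) : ℝ) *
        (a (v (σ (leftIdx h' (τ 0)))) (fun i => v (σ (leftIdx h' (τ i.succ)))) *
          β (fun j => v (σ (rightIdx h' j))))) := by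
      intro σ
      have := alternatizeUncurryFin_eq_sum_perm a (fun i => v (σ (leftIdx h' i)))
      rw [mul_left_comm, ← Finset.mul_sum, ← mul_assoc (p.factorial : ℝ), this, Finset.sum_mul]
      congr 1
      exact Finset.sum_congr rfl fun τ _ => by ring
    simp only [h1]
    rw [Finset.sum_comm]
    have h2 : ∀ τ : Equiv.Perm (Fin (p + 1)), ∑ σ : Equiv.Perm (Fin (r + 1)),
        ((Equiv.Perm.sign σ : ℤ) : ℝ) * (((Equiv.Perm.sign τ : ℤ) : ℝ) *
        (a (v (σ (leftIdx h' (τ 0)))) (fun i => v (σ (leftIdx h' (τ i.succ)))) *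
          β (fun j => v (σ (rightIdx h' j))))) = X := by
      intro τ
      refine Fintype.sum_equiv (Equiv.mulRight
        (e.permCongr (Equiv.Perm.sumCongr τ 1))) _ _ fun σ => ?_
      have hl : ∀ i, e.permCongr (Equiv.Perm.sumCongr τ 1) (leftIdx h' i) = leftIdx h' (τ i) :=
        fun i => by
          have : e.symm (leftIdx h' i) = Sum.inl i := e.symm_apply_apply _
          simp only [Equiv.permCongr_apply, this]; rfl
      have hr : ∀ i, e.permCongr (Equiv.Perm.sumCongr τ 1) (rightIdx h' i) = rightIdx h' i :=
        fun i => by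
          have : e.symm (rightIdx h' i) = Sum.inr i := e.symm_apply_apply _
          simp only [Equiv.permCongr_apply, this]; rfl
      simp only [Equiv.coe_mulRight, ← leftIdx_succ h h', ← rightIdx_succ h h',
        ← leftIdx_zero h', Equiv.Perm.mul_apply, hl, hr, Equiv.Perm.sign_mul,
        Equiv.Perm.sign_permCongr, Equiv.Perm.sign_sumCongr, Equiv.Perm.sign_one, mul_one]
      push_cast; ring
    simp only [h2, Finset.sum_const, Finset.card_univ, Fintype.card_perm, Fintype.card_fin,
      nsmul_eq_mul]
  have e1 := mul_left_cancel₀ (by positivity) hL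
  have e2 := mul_left_cancel₀ (by positivity) hR
  exact mul_left_cancel₀ (by positivity) (e1.trans e2.symm)

theorem exists_alternatizeUncurryFin_wedge_right {p q r : ℕ} (h : p + q = r)
    (h' : p + (q + 1) = r + 1) :
    ∃ s : ℝ, s * s = 1 ∧ ∀ (α : V [⋀^Fin p]→L[ℝ] ℝ) (b : V →L[ℝ] V [⋀^Fin q]→L[ℝ] ℝ),
    ContinuousAlternatingMap.alternatizeUncurryFin ((wedgeBilin h α).comp b) =
      s • wedgeCAM h' α (ContinuousAlternatingMap.alternatizeUncurryFin b) := by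
  obtain ⟨s, hs, hc⟩ := exists_wedgeCAM_comm (V := V) (p := q) (q := p) (r := r) (by omega) h
  obtain ⟨s', hs', hc'⟩ := exists_wedgeCAM_comm (V := V) (p := q + 1) (q := p) (r := r + 1)
    (by omega) h'
  refine ⟨s * s', by linear_combination (s' * s') * hs + hs', fun α b => ?_⟩
  have h1 : (wedgeBilin h α).comp b = s • (((wedgeBilin (by omega : q + p = r)).flip α).comp b) := by
    ext v : 1
    exact hc (b v) α
  rw [h1, ContinuousAlternatingMap.alternatizeUncurryFin_smul,
    alternatizeUncurryFin_wedge_left _ (by omega), hc', smul_smul]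
  rw [mul_assoc, hs', mul_one]

theorem cam_eq_zero_of_finrank_lt {k : ℕ} (hk : Module.finrank ℝ V < k) (α : V [⋀^Fin k]→L[ℝ] ℝ) :
    α = 0 := by
  ext v
  refine α.toAlternatingMap.map_linearDependent v fun hv => ?_
  have := hv.fintype_card_le_finrank
  simp at this
  omega

/-- The exterior product is a nondegenerate pairing in complementary degrees. -/
theorem eq_zero_of_wedgeCAM_eq_zero {p q n : ℕ} (hn : Module.finrank ℝ V = n) (h : p + q = n)
    (α : V [⋀^Fin p]→L[ℝ] ℝ) (hα : ∀ β : V [⋀^Fin q]→L[ℝ] ℝ, wedgeCAM h α β = 0) : α = 0 := by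
  induction q generalizing p with
  | zero =>
    set one : V [⋀^Fin 0]→L[ℝ] ℝ := ContinuousAlternatingMap.constOfIsEmpty ℝ V (Fin 0) 1
    have h0 := hα one
    ext v
    subst h
    have h1 := wedgeCAM_eq_sum_perm rfl α one v
    rw [h0] at h1
    have h2 : ∀ σ : Equiv.Perm (Fin (p + 0)), ((Equiv.Perm.sign σ : ℤ) : ℝ) *
        (α (fun i => v (σ (leftIdx rfl i))) * one (fun j => v (σ (rightIdx rfl j)))) = α v := by
      intro σ
      have h3 : α (fun i => v (σ i)) = Equiv.Perm.sign σ • α v := α.toAlternatingMap.map_perm v σ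
      have h4 : one (fun j => v (σ (rightIdx rfl j))) = 1 := rfl
      rw [h4, mul_one]
      change _ * α (fun i => v (σ i)) = _
      rw [h3]
      rcases Int.units_eq_one_or (Equiv.Perm.sign σ) with hσ | hσ <;> simp [hσ]
    rw [Finset.sum_congr rfl fun σ _ => h2 σ] at h1
    simp only [Finset.sum_const, Finset.card_univ, Fintype.card_perm, Fintype.card_fin,
      nsmul_eq_mul] at h1
    rcases mul_eq_zero.1 (h1.symm.trans (mul_zero _)) with h5 | h5
    · exact absurd h5 (by positivity)
    · exact h5
  | succ q ih =>
    have key : ∀ l : V →L[ℝ] ℝ,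
        ContinuousAlternatingMap.alternatizeUncurryFin (l.smulRight α) = 0 := by
      intro l
      refine ih (p := p + 1) (by omega) _ fun β => ?_
      subst h
      obtain ⟨s, -, hs⟩ := exists_alternatizeUncurryFin_wedge_right (V := V) (p := p) (q := q)
        (r := p + q) rfl rfl
      have h1 := alternatizeUncurryFin_wedge_left (p := p) (q := q) (r := p + q) rfl
        (by omega) (l.smulRight α) β
      have h2 : ((wedgeBilin (rfl : p + q = p + q)).flip β).comp (l.smulRight α) =
          (wedgeBilin rfl α).comp (l.smulRight β) := by
        ext v : 1
        simp
      rw [h2, hs] at h1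
      exact h1.symm.trans ((congrArg (s • ·) (hα _)).trans (smul_zero s))
    ext v
    set S := Submodule.span ℝ (range v)
    have hS : S < ⊤ := by
      refine Submodule.lt_top_of_finrank_lt_finrank ?_
      have := finrank_range_le_card (R := ℝ) v
      simp only [Fintype.card_fin] at this
      exact lt_of_le_of_lt this (by omega)
    obtain ⟨f, hf, hSf⟩ := Submodule.exists_le_ker_of_lt_top S hS
    obtain ⟨v₀, hv₀⟩ : ∃ v₀, f v₀ ≠ 0 := by
      by_contra! hc
      exact hf (LinearMap.ext hc)
    have h1 := congrArg (fun A => A (Fin.cons v₀ v : Fin (p + 1) → V))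
      (key (LinearMap.toContinuousLinearMap f))
    simp only [ContinuousAlternatingMap.alternatizeUncurryFin_apply] at h1
    rw [Fin.sum_univ_succ, Finset.sum_eq_zero] at h1
    · have h2 : Fin.removeNth 0 (Fin.cons v₀ v : Fin (p + 1) → V) = v := by
        funext i; simp [Fin.removeNth]
      rw [h2] at h1
      have h3 : f v₀ * α v = 0 := by simpa using h1
      exact (mul_eq_zero.1 h3).resolve_left hv₀
    · intro i _
      have : f (v i) = 0 := hSf (Submodule.subset_span ⟨i, rfl⟩)
      simp [this]

end WedgeAlgebra

/-! ### Calculus of smooth forms -/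

section FormCalculus

variable {E : Type*} [NormedAddCommGroup E] [NormedSpace ℝ E] [FiniteDimensional ℝ E]
  {H : Type*} [TopologicalSpace H] (I : ModelWithCorners ℝ E H) [I.Boundaryless]
  {M : Type*} [TopologicalSpace M] [ChartedSpace H M] [IsManifold I ∞ M]
  {E' : Type*} [NormedAddCommGroup E'] [NormedSpace ℝ E'] [FiniteDimensional ℝ E']
  {H' : Type*} [TopologicalSpace H'] (J : ModelWithCorners ℝ E' H') [J.Boundaryless]
  {N : Type*} [TopologicalSpace N] [ChartedSpace H' N] [IsManifold J ∞ N]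
  {E'' : Type*} [NormedAddCommGroup E''] [NormedSpace ℝ E''] [FiniteDimensional ℝ E'']
  {H'' : Type*} [TopologicalSpace H''] (K : ModelWithCorners ℝ E'' H'') [K.Boundaryless]
  {P : Type*} [TopologicalSpace P] [ChartedSpace H'' P] [IsManifold K ∞ P]

@[ext] theorem KForm.ext {I : ModelWithCorners ℝ E H} {k : ℕ} {θ θ' : KForm I M k}
    (h : ∀ x, θ.1 x = θ'.1 x) : θ = θ' := Subtype.ext (funext h)

@[simp] theorem KForm.add_val {k : ℕ} (θ θ' : KForm I M k) (x : M) :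
    (θ + θ').1 x = θ.1 x + θ'.1 x := rfl

@[simp] theorem KForm.smul_val {k : ℕ} (c : ℝ) (θ : KForm I M k) (x : M) :
    (c • θ).1 x = c • θ.1 x := rfl

@[simp] theorem KForm.zero_val {k : ℕ} (x : M) : (0 : KForm I M k).1 x = 0 := rfl

theorem diffAt_symm_comp_diffAt (p : M) {x : M} (hx : x ∈ (extChartAt I p).source) :
    (diffAt 𝓘(ℝ, E) I (extChartAt I p).symm (extChartAt I p x)).comp
      (diffAt I 𝓘(ℝ, E) (extChartAt I p) x) = ContinuousLinearMap.id ℝ E := by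
  have hy := (extChartAt I p).map_source hx
  have e1 : diffAt I I ((extChartAt I p).symm ∘ extChartAt I p) x =
      (diffAt 𝓘(ℝ, E) I (extChartAt I p).symm (extChartAt I p x)).comp
        (diffAt I 𝓘(ℝ, E) (extChartAt I p) x) :=
    diffAt_comp _ _ _ _ (mdiff_symm I p hy)
      (mdifferentiableAt_extChartAt (by simpa using hx))
  have e2 : diffAt I I ((extChartAt I p).symm ∘ extChartAt I p) x = diffAt I I id x := by
    refine diffAt_congr _ _ ?_
    filter_upwards [(isOpen_extChartAt_source (I := I) p).mem_nhds hx] with z hz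
    exact (extChartAt I p).left_inv hz
  have e3 : diffAt I I (id : M → M) x = ContinuousLinearMap.id ℝ E := mfderiv_id
  rw [← e1, e2, e3]

theorem diffAt_comp_diffAt_symm (p : M) {y : E} (hy : y ∈ (extChartAt I p).target) :
    (diffAt I 𝓘(ℝ, E) (extChartAt I p) ((extChartAt I p).symm y)).comp
      (diffAt 𝓘(ℝ, E) I (extChartAt I p).symm y) = ContinuousLinearMap.id ℝ E := by
  have hx := (extChartAt I p).map_target hy
  have e1 : diffAt 𝓘(ℝ, E) 𝓘(ℝ, E) (extChartAt I p ∘ (extChartAt I p).symm) y =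
      (diffAt I 𝓘(ℝ, E) (extChartAt I p) ((extChartAt I p).symm y)).comp
        (diffAt 𝓘(ℝ, E) I (extChartAt I p).symm y) :=
    diffAt_comp _ _ _ _ (mdifferentiableAt_extChartAt (by simpa using hx)) (mdiff_symm I p hy)
  have e2 : diffAt 𝓘(ℝ, E) 𝓘(ℝ, E) (extChartAt I p ∘ (extChartAt I p).symm) y =
      diffAt 𝓘(ℝ, E) 𝓘(ℝ, E) id y := by
    refine diffAt_congr _ _ ?_
    filter_upwards [(isOpen_extChartAt_target (I := I) p).mem_nhds hy] with z hz
    exact (extChartAt I p).right_inv hz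
  have e3 : diffAt 𝓘(ℝ, E) 𝓘(ℝ, E) (id : E → E) y = ContinuousLinearMap.id ℝ E := mfderiv_id
  rw [← e1, e2, e3]

/-- A form is recovered from its expression in any chart. -/
theorem eq_chartRep_comp {k : ℕ} (θ : M → E [⋀^Fin k]→L[ℝ] ℝ) (p : M) {x : M}
    (hx : x ∈ (extChartAt I p).source) :
    θ x = (chartRep I p θ (extChartAt I p x)).compContinuousLinearMap
      (diffAt I 𝓘(ℝ, E) (extChartAt I p) x) := by
  ext v
  simp only [chartRep, ContinuousAlternatingMap.compContinuousLinearMap_apply,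
    (extChartAt I p).left_inv hx]
  congr 1
  funext i
  exact (congrArg (fun l : E →L[ℝ] E => l (v i)) (diffAt_symm_comp_diffAt I p hx)).symm

theorem eq_of_chartRep_eq {k : ℕ} {θ θ' : M → E [⋀^Fin k]→L[ℝ] ℝ} (p : M) {x : M}
    (hx : x ∈ (extChartAt I p).source)
    (h : chartRep I p θ (extChartAt I p x) = chartRep I p θ' (extChartAt I p x)) :
    θ x = θ' x := by
  rw [eq_chartRep_comp I θ p hx, eq_chartRep_comp I θ' p hx, h]

theorem KForm.ext_chartRep {k : ℕ} {θ θ' : KForm I M k}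
    (h : ∀ (p : M), ∀ y ∈ (extChartAt I p).target, chartRep I p θ.1 y = chartRep I p θ'.1 y) :
    θ = θ' :=
  KForm.ext fun x => eq_of_chartRep_eq I x (mem_extChartAt_source x)
    (h x _ (mem_extChartAt_target x))

theorem KForm.contDiffAt {k : ℕ} (θ : KForm I M k) (p : M) {y : E}
    (hy : y ∈ (extChartAt I p).target) : ContDiffAt ℝ ∞ (chartRep I p θ.1) y :=
  (θ.2 p).contDiffAt ((isOpen_extChartAt_target p).mem_nhds hy)

theorem KForm.differentiableAt {k : ℕ} (θ : KForm I M k) (p : M) {y : E}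
    (hy : y ∈ (extChartAt I p).target) : DifferentiableAt ℝ (chartRep I p θ.1) y :=
  (θ.contDiffAt I p hy).differentiableAt (by simp)

/-! #### Multiplication by functions -/

variable {I} in
/-- The product of a smooth function and a smooth form. -/
def smulK {χ : M → ℝ} (hχ : ContMDiff I 𝓘(ℝ) ∞ χ) {k : ℕ} (θ : KForm I M k) : KForm I M k :=
  ⟨fun x => χ x • θ.1 x, fun p => by
    have h : ContDiffOn ℝ ∞ (fun y => χ ((extChartAt I p).symm y)) (extChartAt I p).target := by
      rw [← contMDiffOn_iff_contDiffOn]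
      exact hχ.comp_contMDiffOn (contMDiffOn_extChartAt_symm p)
    exact h.smul (θ.2 p)⟩

variable {I} in
@[simp] theorem smulK_val {χ : M → ℝ} (hχ : ContMDiff I 𝓘(ℝ) ∞ χ) {k : ℕ} (θ : KForm I M k)
    (x : M) : (smulK hχ θ).1 x = χ x • θ.1 x := rfl

variable {I} in
/-- The product of a smooth function and a smooth form. -/
def smulForm {χ : M → ℝ} (hχ : ContMDiff I 𝓘(ℝ) ∞ χ) (φ : Form I M) : Form I M :=
  fun k => smulK hχ (φ k)

/-! #### The exterior derivative -/

theorem dK_val {k : ℕ} (θ : KForm I M k) (x : M) : (dK I θ).1 x =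
    (extDeriv (chartRep I x θ.1) (extChartAt I x x)).compContinuousLinearMap
      (diffAt I 𝓘(ℝ, E) (extChartAt I x) x) := rfl

theorem chartRep_dK {k : ℕ} (θ : KForm I M k) (p : M) {y : E} (hy : y ∈ (extChartAt I p).target) :
    chartRep I p (dK I θ).1 y = extDeriv (chartRep I p θ.1) y := chartRep_extDerivAt I θ p hy

theorem dK_add {k : ℕ} (θ θ' : KForm I M k) : dK I (θ + θ') = dK I θ + dK I θ' := by
  refine KForm.ext_chartRep I fun p y hy => ?_
  rw [chartRep_dK I _ p hy]
  change extDeriv (chartRep I p θ.1 + chartRep I p θ'.1) y =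
    chartRep I p (dK I θ).1 y + chartRep I p (dK I θ').1 y
  rw [chartRep_dK I _ p hy, chartRep_dK I _ p hy,
    extDeriv_add (θ.differentiableAt I p hy) (θ'.differentiableAt I p hy)]

theorem dK_smul {k : ℕ} (c : ℝ) (θ : KForm I M k) : dK I (c • θ) = c • dK I θ := by
  refine KForm.ext_chartRep I fun p y hy => ?_
  rw [chartRep_dK I _ p hy]
  change extDeriv (c • chartRep I p θ.1) y = c • chartRep I p (dK I θ).1 y
  rw [chartRep_dK I _ p hy, extDeriv_smul]

theorem dK_zero {k : ℕ} : dK I (0 : KForm I M k) = 0 := by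
  have := dK_smul I (0 : ℝ) (0 : KForm I M k)
  simpa using this

theorem dK_dK {k : ℕ} (θ : KForm I M k) : dK I (dK I θ) = 0 := by
  refine KForm.ext_chartRep I fun p y hy => ?_
  rw [chartRep_dK I _ p hy]
  have h : chartRep I p (dK I θ).1 =ᶠ[𝓝 y] extDeriv (chartRep I p θ.1) := by
    filter_upwards [(isOpen_extChartAt_target (I := I) p).mem_nhds hy] with z hz
    exact chartRep_dK I _ p hz
  rw [h.extDeriv_eq, extDeriv_extDeriv_apply (θ.contDiffAt I p hy)]
  · rfl
  · simpa using (ENat.LEInfty.out : (2 : WithTop ℕ∞) ≤ ∞)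

theorem dForm_succ (φ : Form I M) (k : ℕ) : dForm I φ (k + 1) = dK I (φ k) := rfl

theorem dForm_zero_comp (φ : Form I M) : dForm I φ 0 = 0 := rfl

theorem dForm_add (φ ψ : Form I M) : dForm I (φ + ψ) = dForm I φ + dForm I ψ := by
  funext k
  cases k with
  | zero => exact (add_zero 0).symm
  | succ k => exact dK_add I _ _

theorem dForm_smul (c : ℝ) (φ : Form I M) : dForm I (c • φ) = c • dForm I φ := by
  funext k
  cases k with
  | zero => exact (smul_zero c).symm
  | succ k => exact dK_smul I _ _

theorem dForm_dForm (φ : Form I M) : dForm I (dForm I φ) = 0 := by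
  funext k
  match k with
  | 0 => rfl
  | 1 => exact dK_zero I
  | k + 2 => exact dK_dK I _

theorem dForm_single {k : ℕ} (θ : KForm I M k) :
    dForm I (Pi.single k θ) = Pi.single (k + 1) (dK I θ) := by
  funext j
  cases j with
  | zero => simp [dForm]
  | succ j =>
    rw [dForm_succ]
    by_cases h : j = k
    · subst h; simp
    · rw [Pi.single_eq_of_ne h, Pi.single_eq_of_ne (by omega), dK_zero]

theorem exists_dK_wedgeK {p q r : ℕ} (h : p + q = r) (h1 : (p + 1) + q = r + 1)
    (h2 : p + (q + 1) = r + 1) : ∃ s : ℝ, s * s = 1 ∧ ∀ (α : KForm I M p) (β : KForm I M q),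
      dK I (wedgeK I h α β) = wedgeK I h1 (dK I α) β + s • wedgeK I h2 α (dK I β) := by
  obtain ⟨s, hs, hw⟩ := exists_alternatizeUncurryFin_wedge_right (V := E) h h2
  refine ⟨s, hs, fun α β => ?_⟩
  refine KForm.ext_chartRep I fun x y hy => ?_
  rw [chartRep_dK I _ x hy]
  have e1 : ∀ {a b c : ℕ} (h : a + b = c) (α : KForm I M a) (β : KForm I M b),
      chartRep I x (wedgeK I h α β).1 =
      fun z => wedgeBilin h (chartRep I x α.1 z) (chartRep I x β.1 z) := by
    intro a b c h α β
    funext z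
    exact (wedgeCAM_compContinuousLinearMap h _ _ _).symm
  have e2 : chartRep I x (wedgeK I h1 (dK I α) β + s • wedgeK I h2 α (dK I β)).1 y =
      chartRep I x (wedgeK I h1 (dK I α) β).1 y + s • chartRep I x (wedgeK I h2 α (dK I β)).1 y :=
    rfl
  rw [e2, e1, e1, e1]
  simp only [chartRep_dK I _ x hy]
  have hd := (wedgeBilin (V := E) h).hasFDerivAt_of_bilinear
    (α.differentiableAt I x hy).hasFDerivAt (β.differentiableAt I x hy).hasFDerivAt
  rw [extDeriv, hd.fderiv, ContinuousAlternatingMap.alternatizeUncurryFin_add]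
  have e3 : ContinuousLinearMap.precompR E (wedgeBilin h) (chartRep I x α.1 y)
      (fderiv ℝ (chartRep I x β.1) y) =
      (wedgeBilin h (chartRep I x α.1 y)).comp (fderiv ℝ (chartRep I x β.1) y) := rfl
  have e4 : ContinuousLinearMap.precompL E (wedgeBilin h) (fderiv ℝ (chartRep I x α.1) y)
      (chartRep I x β.1 y) =
      ((wedgeBilin h).flip (chartRep I x β.1 y)).comp (fderiv ℝ (chartRep I x α.1) y) := rfl
  rw [e3, e4, hw, alternatizeUncurryFin_wedge_left h h1]
  exact add_comm _ _

/-! #### Pull-back -/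

theorem pullbackK_val (f : M → N) (hf : ContMDiff I J ∞ f) {k : ℕ} (θ : KForm J N k) (x : M) :
    (pullbackK I J f hf θ).1 x = (θ.1 (f x)).compContinuousLinearMap (diffAt I J f x) := rfl

theorem dK_pullbackK (f : M → N) (hf : ContMDiff I J ∞ f) {k : ℕ} (θ : KForm J N k) :
    dK I (pullbackK I J f hf θ) = pullbackK I J f hf (dK J θ) := by
  ext1 x
  set y := extChartAt I x x with hy
  set q := f x with hq
  have hxs : x ∈ (extChartAt I x).source := mem_extChartAt_source x
  have hyt : y ∈ (extChartAt I x).target := mem_extChartAt_target x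
  have hsx : (extChartAt I x).symm y = x := extChartAt_to_inv x
  have hO := isOpen_chartDomain I J hf.continuous x q
  have hyO : y ∈ (extChartAt I x).target ∩
      (fun z => f ((extChartAt I x).symm z)) ⁻¹' (extChartAt J q).source :=
    ⟨hyt, by simp only [mem_preimage, hsx]; exact mem_extChartAt_source q⟩
  have hg := (contDiffOn_chartExpr I J hf x q).contDiffAt (hO.mem_nhds hyO)
  have h1 : chartRep I x (pullbackK I J f hf θ).1 =ᶠ[𝓝 y] fun z =>
      (chartRep J q θ.1 (extChartAt J q (f ((extChartAt I x).symm z)))).compContinuousLinearMap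
        (fderiv ℝ (fun z => extChartAt J q (f ((extChartAt I x).symm z))) z) := by
    filter_upwards [hO.mem_nhds hyO] with z hz
    exact chartRep_pullback I J hf θ.1 x q hz.1 hz.2
  have hval : extChartAt J q (f ((extChartAt I x).symm y)) = extChartAt J q q := by rw [hsx]
  rw [dK_val, h1.extDeriv_eq, extDeriv_pullback (r := ∞) _ hg
    (by simpa using (ENat.LEInfty.out : (2 : WithTop ℕ∞) ≤ ∞)), hval, pullbackK_val, dK_val]
  · have h2 : diffAt I 𝓘(ℝ, E') (fun z => extChartAt J q (f z)) x =
        (fderiv ℝ (fun z => extChartAt J q (f ((extChartAt I x).symm z))) y).comp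
          (diffAt I 𝓘(ℝ, E) (extChartAt I x) x) := by
      rw [← diffAt_eq_fderiv, ← diffAt_comp]
      · refine diffAt_congr _ _ ?_
        filter_upwards [(isOpen_extChartAt_source (I := I) x).mem_nhds hxs] with z hz
        simp only [Function.comp_apply, (extChartAt I x).left_inv hz]
      · exact (hg.differentiableAt (by simp)).mdifferentiableAt
      · exact mdifferentiableAt_extChartAt (mem_chart_source H x)
    have h3 : diffAt I 𝓘(ℝ, E') (fun z => extChartAt J q (f z)) x =
        (diffAt J 𝓘(ℝ, E') (extChartAt J q) q).comp (diffAt I J f x) :=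
      diffAt_comp _ _ _ _ (mdifferentiableAt_extChartAt (mem_chart_source H' q))
        (hf.mdifferentiableAt (by simp))
    ext v
    simp only [ContinuousAlternatingMap.compContinuousLinearMap_apply]
    congr 1
    funext i
    exact congrArg (fun l : E →L[ℝ] E' => l (v i)) (h2.symm.trans h3)
  · rw [hval]
    exact θ.differentiableAt J q (mem_extChartAt_target q)

theorem dForm_pullback (f : M → N) (hf : ContMDiff I J ∞ f) (φ : Form J N) :
    dForm I (pullback I J f hf φ) = pullback I J f hf (dForm J φ) := by
  funext k
  cases k with
  | zero => exact KForm.ext fun x => rfl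
  | succ k => exact dK_pullbackK I J f hf (φ k)

theorem pullbackK_pullbackK (f : M → N) (hf : ContMDiff I J ∞ f) (g : N → P)
    (hg : ContMDiff J K ∞ g) {k : ℕ} (θ : KForm K P k) :
    pullbackK I J f hf (pullbackK J K g hg θ) = pullbackK I K (g ∘ f) (hg.comp hf) θ := by
  ext1 x
  simp only [pullbackK_val]
  rw [diffAt_comp I J K x (hg.mdifferentiableAt (by simp)) (hf.mdifferentiableAt (by simp))]
  rfl

theorem pullback_pullback (f : M → N) (hf : ContMDiff I J ∞ f) (g : N → P)
    (hg : ContMDiff J K ∞ g) (φ : Form K P) :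
    pullback I J f hf (pullback J K g hg φ) = pullback I K (g ∘ f) (hg.comp hf) φ :=
  funext fun _ => pullbackK_pullbackK I J K f hf g hg _

theorem pullback_congr {f g : M → N} (hf : ContMDiff I J ∞ f) (h : f = g)
    (θ : Form J N) : pullback I J f hf θ = pullback I J g (h ▸ hf) θ := by
  subst h; rfl

theorem pullbackK_id {k : ℕ} (θ : KForm I M k) : pullbackK I I id contMDiff_id θ = θ := by
  ext1 x
  have : diffAt I I (id : M → M) x = ContinuousLinearMap.id ℝ E := mfderiv_id
  rw [pullbackK_val, this]; rfl

theorem pullback_id (φ : Form I M) : pullback I I id contMDiff_id φ = φ :=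
  funext fun _ => pullbackK_id I _

/-- Pull-back as a linear map. -/
def pullbackLM (f : M → N) (hf : ContMDiff I J ∞ f) : Form J N →ₗ[ℝ] Form I M where
  toFun := pullback I J f hf
  map_add' _ _ := rfl
  map_smul' _ _ := rfl

/-- The exterior derivative as a linear map. -/
def dFormLM : Form I M →ₗ[ℝ] Form I M where
  toFun := dForm I
  map_add' := dForm_add I
  map_smul' := dForm_smul I

@[simp] theorem dFormLM_apply (φ : Form I M) : dFormLM I φ = dForm I φ := rfl

/-! #### Degrees -/

theorem KForm.eq_zero_of_finrank_lt {k : ℕ} (hk : Module.finrank ℝ E < k) (θ : KForm I M k) :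
    θ = 0 := KForm.ext fun _ => cam_eq_zero_of_finrank_lt hk _

theorem Form.eq_sum_single (φ : Form I M) :
    φ = ∑ k ∈ Finset.range (Module.finrank ℝ E + 1), Pi.single k (φ k) := by
  funext j
  rw [Finset.sum_apply]
  by_cases hj : j < Module.finrank ℝ E + 1
  · rw [Finset.sum_eq_single j]
    · simp
    · intro b _ hb
      exact Pi.single_eq_of_ne hb.symm _
    · intro h; exact absurd (Finset.mem_range.2 hj) h
  · rw [KForm.eq_zero_of_finrank_lt I (by omega) (φ j), Finset.sum_eq_zero]
    intro b hb
    have : j ≠ b := by rintro rfl; exact hj (Finset.mem_range.1 hb)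
    exact Pi.single_eq_of_ne this _

/-- The sign involution multiplying forms of degree `k` by `(-1)^k`. -/
def twist : Form I M →ₗ[ℝ] Form I M where
  toFun φ k := (-1 : ℝ) ^ k • φ k
  map_add' _ _ := funext fun _ => smul_add _ _ _
  map_smul' c φ := funext fun k => smul_comm ((-1 : ℝ) ^ k) c (φ k)

theorem twist_apply (φ : Form I M) (k : ℕ) : twist I φ k = (-1 : ℝ) ^ k • φ k := rfl

theorem twist_dForm (φ : Form I M) : twist I (dForm I φ) = -dForm I (twist I φ) := by
  funext k
  cases k with
  | zero =>
    rw [twist_apply, dForm_zero_comp, smul_zero]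
    exact neg_zero.symm
  | succ k =>
    change (-1 : ℝ) ^ (k + 1) • dK I (φ k) = -dK I ((-1 : ℝ) ^ k • φ k)
    rw [dK_smul, pow_succ]
    simp

/-! #### Extension by zero of forms given in a coordinate system -/

variable {W : Type*} [NormedAddCommGroup W] [NormedSpace ℝ W] [FiniteDimensional ℝ W]
  {Z : Type*} [NormedAddCommGroup Z] [NormedSpace ℝ Z]

open scoped Classical in
/-- The field of forms that is `e^* g` on `S` and vanishes elsewhere. -/
def extField {k : ℕ} (S : Set M) (e : M → W) (g : W → W [⋀^Fin k]→L[ℝ] ℝ) (x : M) :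
    E [⋀^Fin k]→L[ℝ] ℝ :=
  if x ∈ S then (g (e x)).compContinuousLinearMap (diffAt I 𝓘(ℝ, W) e x) else 0

theorem extField_of_mem {k : ℕ} {S : Set M} {e : M → W} {g : W → W [⋀^Fin k]→L[ℝ] ℝ} {x : M}
    (hx : x ∈ S) : extField I S e g x =
      (g (e x)).compContinuousLinearMap (diffAt I 𝓘(ℝ, W) e x) := if_pos hx

theorem extField_of_notMem {k : ℕ} {S : Set M} {e : M → W} {g : W → W [⋀^Fin k]→L[ℝ] ℝ} {x : M}
    (hx : x ∉ S) : extField I S e g x = 0 := if_neg hx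

theorem contDiffOn_chartRep_extField {k : ℕ} {S : Set M} (hS : IsOpen S) {e : M → W}
    (he : ContMDiffOn I 𝓘(ℝ, W) ∞ e S) {T : Set W} (hT : MapsTo e S T) {O : Set Z}
    (hO : IsOpen O) {g : Z × W → W [⋀^Fin k]→L[ℝ] ℝ} (hg : ContDiffOn ℝ ∞ g (O ×ˢ T))
    (hsupp : ∀ z₀ ∈ O, ∃ C : Set M, IsClosed C ∧ C ⊆ S ∧
      ∀ᶠ z in 𝓝 z₀, ∀ x ∈ S, x ∉ C → g (z, e x) = 0) (p : M) :
    ContDiffOn ℝ ∞ (fun a : Z × E => chartRep I p (extField I S e fun w => g (a.1, w)) a.2)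
      (O ×ˢ (extChartAt I p).target) := by
  rintro ⟨z₀, y₀⟩ ⟨hz₀, hy₀⟩
  refine ContDiffAt.contDiffWithinAt ?_
  have hy₀t := (isOpen_extChartAt_target (I := I) p).mem_nhds hy₀
  have hcont : ContinuousAt (extChartAt I p).symm y₀ := continuousAt_extChartAt_symm'' hy₀
  by_cases hx : (extChartAt I p).symm y₀ ∈ S
  · set D : Set E := (extChartAt I p).target ∩ (extChartAt I p).symm ⁻¹' S with hD
    have hDo : IsOpen D := (continuousOn_extChartAt_symm p).isOpen_inter_preimage
      (isOpen_extChartAt_target p) hS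
    have hsm : ContDiffOn ℝ ∞ (fun y => e ((extChartAt I p).symm y)) D := by
      rw [← contMDiffOn_iff_contDiffOn]
      exact he.comp ((contMDiffOn_extChartAt_symm p).mono inter_subset_left) fun y hy => hy.2
    have h1 : ContDiffOn ℝ ∞ (fun a : Z × E =>
        (g (a.1, e ((extChartAt I p).symm a.2))).compContinuousLinearMap
          (fderiv ℝ (fun y => e ((extChartAt I p).symm y)) a.2)) (O ×ˢ D) := by
      refine contDiffOn_cam fun v => ?_
      refine contDiffOn_cam_apply (g := fun a : Z × E => g (a.1, e ((extChartAt I p).symm a.2)))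
        ?_ fun i => ?_
      · exact hg.comp (contDiffOn_fst.prodMk (hsm.comp contDiffOn_snd fun a ha => ha.2))
          fun a ha => ⟨ha.1, hT ha.2.2⟩
      · exact ((hsm.fderiv_of_isOpen hDo (m := ∞) (by simp)).comp contDiffOn_snd
          fun a ha => ha.2).clm_apply contDiffOn_const
    refine (h1.congr fun a ha => ?_).contDiffAt ((hO.prod hDo).mem_nhds ⟨hz₀, hy₀, hx⟩)
    have hd : diffAt 𝓘(ℝ, E) 𝓘(ℝ, W) (e ∘ (extChartAt I p).symm) a.2 =
        (diffAt I 𝓘(ℝ, W) e ((extChartAt I p).symm a.2)).comp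
          (diffAt 𝓘(ℝ, E) I (extChartAt I p).symm a.2) :=
      diffAt_comp _ _ _ _ ((he.contMDiffAt (hS.mem_nhds ha.2.2)).mdifferentiableAt (by simp))
        (mdiff_symm I p ha.2.1)
    rw [diffAt_eq_fderiv] at hd
    have haS : (extChartAt I p).symm a.2 ∈ S := ha.2.2
    simp only [chartRep, extField_of_mem I haS]
    change _ = ContinuousAlternatingMap.compContinuousLinearMap _
      (fderiv ℝ (e ∘ (extChartAt I p).symm) a.2)
    rw [hd]
    rfl
  · obtain ⟨C, hC, hCS, hev⟩ := hsupp z₀ hz₀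
    have h1 : ∀ᶠ y in 𝓝 y₀, (extChartAt I p).symm y ∉ C :=
      hcont.eventually (hC.isOpen_compl.mem_nhds fun h => hx (hCS h))
    have h2 : (fun a : Z × E => chartRep I p (extField I S e fun w => g (a.1, w)) a.2)
        =ᶠ[𝓝 (z₀, y₀)] fun _ => 0 := by
      rw [nhds_prod_eq]
      filter_upwards [hev.prod_mk h1] with a ha
      by_cases hS' : (extChartAt I p).symm a.2 ∈ S
      · simp only [chartRep, extField_of_mem I hS', ha.1 _ hS' ha.2]; rfl
      · simp only [chartRep, extField_of_notMem I hS']; rfl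
    exact contDiffAt_const.congr_of_eventuallyEq h2

/-- The smooth form that is `e^* g` on `S` and vanishes elsewhere. -/
def extK {k : ℕ} {S : Set M} (hS : IsOpen S) {e : M → W}
    (he : ContMDiffOn I 𝓘(ℝ, W) ∞ e S) {T : Set W} (hT : MapsTo e S T)
    {g : W → W [⋀^Fin k]→L[ℝ] ℝ} (hg : ContDiffOn ℝ ∞ g T)
    (hsupp : ∃ C : Set M, IsClosed C ∧ C ⊆ S ∧ ∀ x ∈ S, x ∉ C → g (e x) = 0) : KForm I M k :=
  ⟨extField I S e g, fun p => by
    have h := contDiffOn_chartRep_extField I (Z := ℝ) hS he hT isOpen_univ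
      (g := fun a => g a.2) (hg.comp contDiffOn_snd fun a ha => ha.2)
      (fun _ _ => by
        obtain ⟨C, hC, hCS, h⟩ := hsupp
        exact ⟨C, hC, hCS, Eventually.of_forall fun _ => h⟩) p
    exact h.comp (contDiff_const (c := (0 : ℝ)).prodMk contDiff_id).contDiffOn
      fun y hy => ⟨mem_univ _, hy⟩⟩

theorem wedge_apply (η θ : Form I M) (r : ℕ) : wedge I η θ r =
    ∑ p : Fin (r + 1), wedgeK I (Nat.add_sub_of_le (Nat.lt_succ_iff.1 p.2)) (η p) (θ (r - p)) := rfl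

theorem wedgeK_congr {p q q' r : ℕ} (h : p + q = r) (hq : q = q') (α : KForm I M p)
    (θ : Form I M) : wedgeK I h α (θ q) = wedgeK I (hq ▸ h) α (θ q') := by
  subst hq; rfl

theorem wedgeK_add_left {p q r : ℕ} (h : p + q = r) (α α' : KForm I M p) (β : KForm I M q) :
    wedgeK I h (α + α') β = wedgeK I h α β + wedgeK I h α' β :=
  KForm.ext fun _ => wedgeCAM_add_left h _ _ _

theorem wedgeK_smul_left {p q r : ℕ} (h : p + q = r) (c : ℝ) (α : KForm I M p) (β : KForm I M q) :
    wedgeK I h (c • α) β = c • wedgeK I h α β :=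
  KForm.ext fun _ => wedgeCAM_smul_left h _ _ _

theorem wedgeK_add_right {p q r : ℕ} (h : p + q = r) (α : KForm I M p) (β β' : KForm I M q) :
    wedgeK I h α (β + β') = wedgeK I h α β + wedgeK I h α β' :=
  KForm.ext fun _ => wedgeCAM_add_right h _ _ _

theorem wedgeK_smul_right {p q r : ℕ} (h : p + q = r) (c : ℝ) (α : KForm I M p)
    (β : KForm I M q) : wedgeK I h α (c • β) = c • wedgeK I h α β :=
  KForm.ext fun _ => wedgeCAM_smul_right h _ _ _

theorem wedgeK_zero_left {p q r : ℕ} (h : p + q = r) (β : KForm I M q) :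
    wedgeK I h (0 : KForm I M p) β = 0 := by
  have := wedgeK_smul_left I h (0 : ℝ) (0 : KForm I M p) β
  simpa using this

theorem wedgeK_zero_right {p q r : ℕ} (h : p + q = r) (α : KForm I M p) :
    wedgeK I h α (0 : KForm I M q) = 0 := by
  have := wedgeK_smul_right I h (0 : ℝ) α (0 : KForm I M q)
  simpa using this

theorem wedge_add_left (η η' θ : Form I M) :
    wedge I (η + η') θ = wedge I η θ + wedge I η' θ := by
  funext r
  simp only [wedge_apply, Pi.add_apply, wedgeK_add_left, Finset.sum_add_distrib]

theorem wedge_smul_left (c : ℝ) (η θ : Form I M) : wedge I (c • η) θ = c • wedge I η θ := by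
  funext r
  simp only [wedge_apply, Pi.smul_apply, wedgeK_smul_left, Finset.smul_sum]

theorem wedge_add_right (η θ θ' : Form I M) :
    wedge I η (θ + θ') = wedge I η θ + wedge I η θ' := by
  funext r
  simp only [wedge_apply, Pi.add_apply, wedgeK_add_right, Finset.sum_add_distrib]

theorem wedge_smul_right (c : ℝ) (η θ : Form I M) : wedge I η (c • θ) = c • wedge I η θ := by
  funext r
  simp only [wedge_apply, Pi.smul_apply, wedgeK_smul_right, Finset.smul_sum]

/-- The wedge product as a bilinear map. -/
def wedgeLM : Form I M →ₗ[ℝ] Form I M →ₗ[ℝ] Form I M :=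
  LinearMap.mk₂ ℝ (wedge I) (wedge_add_left I) (wedge_smul_left I) (wedge_add_right I)
    (wedge_smul_right I)

@[simp] theorem wedgeLM_apply (η θ : Form I M) : wedgeLM I η θ = wedge I η θ := rfl

theorem chartRep_wedgeK {p q r : ℕ} (h : p + q = r) (α : KForm I M p) (β : KForm I M q) (x : M)
    (y : E) : chartRep I x (wedgeK I h α β).1 y =
      wedgeCAM h (chartRep I x α.1 y) (chartRep I x β.1 y) :=
  (wedgeCAM_compContinuousLinearMap h _ _ _).symm

theorem wedge_zero_left (θ : Form I M) : wedge I 0 θ = 0 :=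
  ((wedgeLM I).flip θ).map_zero

theorem single_add {k : ℕ} (α β : KForm I M k) :
    (Pi.single k (α + β) : Form I M) = Pi.single k α + Pi.single k β :=
  Pi.single_add _ _ _

theorem single_smul {k : ℕ} (c : ℝ) (α : KForm I M k) :
    (Pi.single k (c • α) : Form I M) = c • Pi.single k α :=
  Pi.single_smul _ _ _

theorem dForm_eq_zero_iff {φ : Form I M} : dForm I φ = 0 ↔ ∀ k, dK I (φ k) = 0 :=
  ⟨fun h k => congrFun h (k + 1), fun h => funext fun k => by cases k; exacts [rfl, h _]⟩

end FormCalculus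

/-! ### Integration of top degree forms -/

section Aux

theorem integrableOn_of_zero_off_compact {A F : Type*} [NormedAddCommGroup F]
    [TopologicalSpace A] [T2Space A] [MeasurableSpace A] [OpensMeasurableSpace A]
    {μ : Measure A} [IsFiniteMeasureOnCompacts μ] {U K : Set A} (hU : IsOpen U) (hK : IsCompact K)
    (hKU : K ⊆ U) {g : A → F} (hg : ContinuousOn g U) (h0 : ∀ u ∈ U, u ∉ K → g u = 0) :
    IntegrableOn g U μ :=
  (hg.mono hKU).integrableOn_compact hK |>.of_forall_sdiff_eq_zero hU.measurableSet
    fun u hu => h0 u hu.1 hu.2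

open scoped Classical in
theorem contDiff_indicator {A F : Type*} [NormedAddCommGroup A] [NormedSpace ℝ A]
    [NormedAddCommGroup F] [NormedSpace ℝ F] {U K : Set A} (hU : IsOpen U) (hK : IsClosed K)
    (hKU : K ⊆ U) {g : A → F} {n : WithTop ℕ∞} (hg : ContDiffOn ℝ n g U)
    (h0 : ∀ u ∈ U, u ∉ K → g u = 0) : ContDiff ℝ n (U.indicator g) := by
  rw [contDiff_iff_contDiffAt]
  intro a
  by_cases ha : a ∈ K
  · refine (hg.contDiffAt (hU.mem_nhds (hKU ha))).congr_of_eventuallyEq ?_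
    filter_upwards [hU.mem_nhds (hKU ha)] with x hx
    exact indicator_of_mem hx _
  · refine (contDiffAt_const (c := (0 : F))).congr_of_eventuallyEq ?_
    filter_upwards [hK.isOpen_compl.mem_nhds ha] with x hx
    by_cases hxU : x ∈ U
    · rw [indicator_of_mem hxU, h0 x hxU hx]
    · exact indicator_of_notMem hxU _

theorem integral_fderiv_apply_eq_zero {A : Type*} [NormedAddCommGroup A] [NormedSpace ℝ A]
    [FiniteDimensional ℝ A] [MeasurableSpace A] [BorelSpace A] {μ : Measure A} [μ.IsAddHaarMeasure]
    {f : A → ℝ} (hf : ContDiff ℝ 1 f) (hc : HasCompactSupport f) (v : A) :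
    ∫ u, fderiv ℝ f u v ∂μ = 0 := by
  have hi : Integrable (fun u => fderiv ℝ f u v) μ := by
    refine Continuous.integrable_of_hasCompactSupport
      ((hf.continuous_fderiv (by simp)).clm_apply continuous_const) ?_
    exact (hc.fderiv ℝ).comp_left (g := fun l : A →L[ℝ] ℝ => l v) rfl
  have h := integral_mul_fderiv_eq_neg_fderiv_mul_of_integrable (μ := μ) (f := fun _ => (1 : ℝ))
    (g := f) (v := v) (by simp) (by simpa using hi)
    (by simpa using hf.continuous.integrable_of_hasCompactSupport hc)
    (fun x _ => differentiableAt_const _) (fun x _ => hf.differentiable (by simp) x)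
  simpa using h

theorem cam_comp_eq_det {V : Type*} [NormedAddCommGroup V] [NormedSpace ℝ V] {n : ℕ}
    (b : Module.Basis (Fin n) ℝ V) (α : V [⋀^Fin n]→L[ℝ] ℝ) (L : V →L[ℝ] V) :
    α (fun i => L (b i)) = L.det * α b := by
  have h := AlternatingMap.eq_smul_basis_det b α.toAlternatingMap
  have h1 : ∀ v, α v = α b * b.det v := by
    intro v
    have := congrArg (fun f : V [⋀^Fin n]→ₗ[ℝ] ℝ => f v) h
    simpa using this
  rw [h1]
  have := b.det_comp L.toLinearMap b
  rw [b.det_self, mul_one] at this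
  rw [mul_comm]
  congr 1

end Aux

section Integration

variable {E : Type*} [NormedAddCommGroup E] [NormedSpace ℝ E] [NormedSpace ℂ E]
  [IsScalarTower ℝ ℂ E] [FiniteDimensional ℝ E] [FiniteDimensional ℂ E]
  {H : Type*} [TopologicalSpace H] (I : ModelWithCorners ℝ E H) [I.Boundaryless]
  {M : Type*} [TopologicalSpace M] [ChartedSpace H M] [IsManifold I ∞ M]
  [T2Space M] [CompactSpace M]

theorem finrank_eq_realDim (E : Type*) [NormedAddCommGroup E] [NormedSpace ℝ E] [NormedSpace ℂ E]
    [IsScalarTower ℝ ℂ E] [FiniteDimensional ℂ E] : Module.finrank ℝ E = realDim E := by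
  rw [Module.finrank_eq_card_basis (realFrame E), Fintype.card_fin]

/-- The real linear coordinates given by the positively oriented real basis. -/
def frameEquiv (E : Type*) [NormedAddCommGroup E] [NormedSpace ℝ E] [NormedSpace ℂ E]
    [IsScalarTower ℝ ℂ E] [FiniteDimensional ℝ E] [FiniteDimensional ℂ E] :
    (Fin (realDim E) → ℝ) ≃L[ℝ] E := (realFrame E).equivFun.symm.toContinuousLinearEquiv

/-- The point of the chart at `p` with real coordinates `u`. -/
def chartPt (p : M) (u : Fin (realDim E) → ℝ) : M := (extChartAt I p).symm (frameEquiv E u)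

/-- The real coordinates in the chart at `p`. -/
def chartCo (p : M) (x : M) : Fin (realDim E) → ℝ := (frameEquiv E).symm (extChartAt I p x)

/-- The range of the real coordinates in the chart at `p`. -/
def chartDom (p : M) : Set (Fin (realDim E) → ℝ) := {u | frameEquiv E u ∈ (extChartAt I p).target}

theorem isOpen_chartDom (p : M) : IsOpen (chartDom I p) :=
  (isOpen_extChartAt_target p).preimage (frameEquiv E).continuous

theorem chartPt_mem {p : M} {u : Fin (realDim E) → ℝ} (hu : u ∈ chartDom I p) :
    chartPt I p u ∈ (extChartAt I p).source := (extChartAt I p).map_target hu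

theorem chartCo_mem {p x : M} (hx : x ∈ (extChartAt I p).source) : chartCo I p x ∈ chartDom I p := by
  simpa [chartDom, chartCo] using (extChartAt I p).map_source hx

theorem chartPt_chartCo {p x : M} (hx : x ∈ (extChartAt I p).source) :
    chartPt I p (chartCo I p x) = x := by
  simpa [chartPt, chartCo] using (extChartAt I p).left_inv hx

theorem chartCo_chartPt {p : M} {u : Fin (realDim E) → ℝ} (hu : u ∈ chartDom I p) :
    chartCo I p (chartPt I p u) = u := by
  simp only [chartPt, chartCo]
  rw [(extChartAt I p).right_inv hu, ContinuousLinearEquiv.symm_apply_apply]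

theorem continuousOn_chartPt (p : M) : ContinuousOn (chartPt I p) (chartDom I p) :=
  (continuousOn_extChartAt_symm p).comp (frameEquiv E).continuous.continuousOn fun _ hu => hu

theorem continuousOn_chartCo (p : M) : ContinuousOn (chartCo I p) (extChartAt I p).source :=
  (frameEquiv E).symm.continuous.comp_continuousOn (continuousOn_extChartAt p)

theorem contMDiffOn_chartPt (p : M) :
    ContMDiffOn 𝓘(ℝ, Fin (realDim E) → ℝ) I ∞ (chartPt I p) (chartDom I p) :=
  (contMDiffOn_extChartAt_symm p).comp ((frameEquiv E).contDiff.contMDiff.contMDiffOn)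
    fun _ hu => hu

theorem isCompact_image_chartCo {p : M} {C : Set M} (hC : IsClosed C)
    (h : C ⊆ (extChartAt I p).source) : IsCompact (chartCo I p '' C) :=
  hC.isCompact.image_of_continuousOn ((continuousOn_chartCo I p).mono h)

theorem image_chartCo_subset {p : M} {C : Set M}
    (h : C ⊆ (extChartAt I p).source) : chartCo I p '' C ⊆ chartDom I p := by
  rintro _ ⟨x, hx, rfl⟩
  exact chartCo_mem I (h hx)

theorem chartPt_notMem {p : M} {C : Set M} {u : Fin (realDim E) → ℝ} (hu : u ∈ chartDom I p)
    (h : u ∉ chartCo I p '' C) : chartPt I p u ∉ C :=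
  fun hx => h ⟨_, hx, chartCo_chartPt I hu⟩

theorem contDiffOn_chartRep_frame {k : ℕ} (p : M) (θ : KForm I M k) :
    ContDiffOn ℝ ∞ (fun u => chartRep I p θ.1 (frameEquiv E u)) (chartDom I p) :=
  (θ.2 p).comp (frameEquiv E).contDiff.contDiffOn fun _ hu => hu

/-- The coefficient of a top degree form in the chart at `p`. -/
def topCoeff (p : M) (ζ : M → E [⋀^Fin (realDim E)]→L[ℝ] ℝ) (u : Fin (realDim E) → ℝ) : ℝ :=
  chartRep I p ζ (frameEquiv E u) (realFrame E)

theorem contDiffOn_topCoeff (p : M) (ζ : KForm I M (realDim E)) :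
    ContDiffOn ℝ ∞ (topCoeff I p ζ.1) (chartDom I p) :=
  contDiffOn_cam_apply (contDiffOn_chartRep_frame I p ζ) fun _ => contDiffOn_const

variable (M) in
/-- The chart transitions preserve the orientation. -/
def OrientedCharts : Prop := ∀ (p q : M), ∀ y ∈ (extChartAt I p).target,
  (extChartAt I p).symm y ∈ (extChartAt I q).source →
    0 < (fderiv ℝ (fun z => extChartAt I q ((extChartAt I p).symm z)) y).det

/-- The integral of a top degree form supported in the domain of the chart at `p`. -/
def localIntegral (p : M) (ζ : KForm I M (realDim E)) : ℝ := ∫ u in chartDom I p, topCoeff I p ζ.1 u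

theorem integrableOn_topCoeff {p : M} {ζ : KForm I M (realDim E)} {C : Set M} (hC : IsClosed C)
    (hCp : C ⊆ (extChartAt I p).source) (h0 : ∀ x ∉ C, ζ.1 x = 0) :
    IntegrableOn (topCoeff I p ζ.1) (chartDom I p) := by
  refine integrableOn_of_zero_off_compact (isOpen_chartDom I p) (isCompact_image_chartCo I hC hCp)
    (image_chartCo_subset I hCp) (contDiffOn_topCoeff I p ζ).continuousOn fun u hu hn => ?_
  have := h0 _ (chartPt_notMem I hu hn)
  simp only [topCoeff, chartRep]
  change (ζ.1 (chartPt I p u)).compContinuousLinearMap _ _ = 0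
  rw [this]; rfl

/-- The integral of a form supported in two charts can be computed in either. -/
theorem localIntegral_eq (hor : OrientedCharts I M) {p q : M} {ζ : KForm I M (realDim E)} {C : Set M}
    (hCp : C ⊆ (extChartAt I p).source) (hCq : C ⊆ (extChartAt I q).source)
    (h0 : ∀ x ∉ C, ζ.1 x = 0) : localIntegral I p ζ = localIntegral I q ζ := by
  set S : Set M := (extChartAt I p).source ∩ (extChartAt I q).source with hS
  have key : ∀ r : M, S ⊆ (extChartAt I r).source → C ⊆ (extChartAt I r).source →
      localIntegral I r ζ = ∫ u in chartDom I r ∩ chartPt I r ⁻¹' S, topCoeff I r ζ.1 u := by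
    intro r hSr hCr
    refine setIntegral_eq_of_subset_of_forall_sdiff_eq_zero (isOpen_chartDom I r).measurableSet
      inter_subset_left fun u hu => ?_
    have hn : chartPt I r u ∉ C := fun h => hu.2 ⟨hu.1, hCp h, hCq h⟩
    simp only [topCoeff, chartRep]
    change (ζ.1 (chartPt I r u)).compContinuousLinearMap _ _ = 0
    rw [h0 _ hn]; rfl
  rw [key p inter_subset_left hCp, key q inter_subset_right hCq]
  set g : (Fin (realDim E) → ℝ) → (Fin (realDim E) → ℝ) := fun u => chartCo I q (chartPt I p u)
    with hg
  set D := chartDom I p ∩ chartPt I p ⁻¹' S with hD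
  have hDo : IsOpen D := (continuousOn_chartPt I p).isOpen_inter_preimage (isOpen_chartDom I p)
    ((isOpen_extChartAt_source p).inter (isOpen_extChartAt_source q))
  have himg : chartDom I q ∩ chartPt I q ⁻¹' S = g '' D := by
    ext v
    constructor
    · rintro ⟨hv, hvS⟩
      refine ⟨chartCo I p (chartPt I q v), ⟨chartCo_mem I hvS.1, ?_⟩, ?_⟩
      · simp only [mem_preimage, chartPt_chartCo I hvS.1]; exact hvS
      · simp only [hg, chartPt_chartCo I hvS.1, chartCo_chartPt I hv]
    · rintro ⟨u, ⟨hu, huS⟩, rfl⟩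
      refine ⟨chartCo_mem I huS.2, ?_⟩
      simp only [mem_preimage, hg, chartPt_chartCo I huS.2]; exact huS
  have hinj : InjOn g D := by
    intro u hu v hv h
    have : chartPt I p u = chartPt I p v := by
      rw [← chartPt_chartCo I hu.2.2, ← chartPt_chartCo I hv.2.2]; exact congrArg _ h
    rw [← chartCo_chartPt I hu.1, this, chartCo_chartPt I hv.1]
  set A : (Fin (realDim E) → ℝ) → (E →L[ℝ] E) := fun u =>
    fderiv ℝ (fun z => extChartAt I q ((extChartAt I p).symm z)) (frameEquiv E u) with hA
  have hder : ∀ u ∈ D, HasFDerivWithinAt g ((frameEquiv E).symm.toContinuousLinearMap ∘L A u ∘L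
      (frameEquiv E).toContinuousLinearMap) D u := by
    intro u hu
    have hO := isOpen_chartDomain I I (continuous_id (X := M)) p q
    have h1 : HasFDerivAt (fun z => extChartAt I q ((extChartAt I p).symm z)) (A u)
        (frameEquiv E u) :=
      (((contDiffOn_chartExpr I I contMDiff_id p q).contDiffAt
        (hO.mem_nhds ⟨hu.1, hu.2.2⟩)).differentiableAt (by simp)).hasFDerivAt
    have h2 := (frameEquiv E).symm.hasFDerivAt.comp u (h1.comp u (frameEquiv E).hasFDerivAt)
    exact h2.hasFDerivWithinAt
  rw [himg, integral_image_eq_integral_abs_det_fderiv_smul volume hDo.measurableSet hder hinj]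
  refine setIntegral_congr_fun hDo.measurableSet fun u hu => ?_
  have hdet : ((frameEquiv E).symm.toContinuousLinearMap ∘L A u ∘L
      (frameEquiv E).toContinuousLinearMap).det = (A u).det := by
    have := LinearMap.det_conj (A u).toLinearMap (frameEquiv E).symm.toLinearEquiv
    exact this
  have hpos := hor p q (frameEquiv E u) hu.1 hu.2.2
  have hpos' : |(A u).det| = (A u).det := abs_of_pos hpos
  simp only [hdet, hpos', smul_eq_mul, topCoeff]
  rw [chartRep_change I ζ.1 p q hu.1 hu.2.2,
    ContinuousAlternatingMap.compContinuousLinearMap_apply]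
  have e1 : frameEquiv E (g u) = extChartAt I q ((extChartAt I p).symm (frameEquiv E u)) := by
    simp [hg, chartCo, chartPt]
  rw [e1]
  exact cam_comp_eq_det (realFrame E) _ (A u)

theorem chartPartition_subset (p : M) : tsupport (chartPartition I M p) ⊆ (extChartAt I p).source := by
  rw [extChartAt_source]
  exact (SmoothPartitionOfUnity.exists_isSubordinate_chartAt_source I M).choose_spec p

theorem contMDiff_chartPartition (p : M) : ContMDiff I 𝓘(ℝ) ∞ (chartPartition I M p) :=
  (chartPartition I M p).contMDiff

theorem finite_chartPartition : {p : M | (chartPartition I M p : M → ℝ) ≠ 0}.Finite := by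
  refine ((chartPartition I M).locallyFinite.finite_nonempty_of_compact).subset fun p hp => ?_
  rw [mem_ofPred_eq, Function.support_nonempty_iff]
  exact hp

variable (M) in
/-- The centres of the charts that occur in the partition of unity. -/
def chartCenters : Finset M := (finite_chartPartition I (M := M)).toFinset

theorem mem_chartCenters {p : M} :
    p ∈ chartCenters I M ↔ (chartPartition I M p : M → ℝ) ≠ 0 := by
  simp [chartCenters]

theorem sum_chartPartition (x : M) : ∑ p ∈ chartCenters I M, chartPartition I M p x = 1 := by
  rw [← (chartPartition I M).sum_eq_one (mem_univ x)]
  refine (finsum_eq_sum_of_support_subset _ fun p hp => ?_).symm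
  rw [Finset.mem_coe, mem_chartCenters]
  intro h
  exact hp (congrFun h x)

theorem KForm.eq_sum_chartPartition {k : ℕ} (θ : KForm I M k) :
    θ = ∑ p ∈ chartCenters I M, smulK (contMDiff_chartPartition I p) θ := by
  ext1 x
  have h : ∀ s : Finset M, (∑ p ∈ s, smulK (contMDiff_chartPartition I p) θ).1 x =
      ∑ p ∈ s, chartPartition I M p x • θ.1 x := by
    classical
    intro s
    induction s using Finset.induction_on with
    | empty => simp
    | insert a s ha ih => rw [Finset.sum_insert ha, Finset.sum_insert ha, KForm.add_val, ih]; rfl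
  rw [h, ← Finset.sum_smul, sum_chartPartition, one_smul]

theorem smulK_chartPartition_eq_zero {k : ℕ} (θ : KForm I M k) (p : M) {x : M}
    (hx : x ∉ tsupport (chartPartition I M p)) :
    (smulK (contMDiff_chartPartition I p) θ).1 x = 0 := by
  rw [smulK_val, image_eq_zero_of_notMem_tsupport hx, zero_smul]

/-- The integral of a homogeneous form of top degree. -/
def integralK (ζ : KForm I M (realDim E)) : ℝ := integralTop I fun x v => ζ.1 x v

theorem integral_eq_integralK (φ : Form I M) : integral I φ = integralK I (φ (realDim E)) := rfl

theorem integralK_eq_sum (ζ : KForm I M (realDim E)) : integralK I ζ =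
    ∑ p ∈ chartCenters I M, localIntegral I p (smulK (contMDiff_chartPartition I p) ζ) := by
  have h1 : integralK I ζ = ∑ᶠ p : M,
      localIntegral I p (smulK (contMDiff_chartPartition I p) ζ) := rfl
  rw [h1]
  refine finsum_eq_sum_of_support_subset _ fun p hp => ?_
  rw [Finset.mem_coe, mem_chartCenters]
  intro h
  refine hp ?_
  have : smulK (contMDiff_chartPartition I p) ζ = 0 := by
    ext1 x; rw [smulK_val, h]; simp
  change localIntegral I p (smulK (contMDiff_chartPartition I p) ζ) = 0
  rw [this]
  exact integral_zero _ _

theorem localIntegral_add {p : M} {ζ ζ' : KForm I M (realDim E)} {C : Set M} (hC : IsClosed C)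
    (hCp : C ⊆ (extChartAt I p).source) (h0 : ∀ x ∉ C, ζ.1 x = 0) (h0' : ∀ x ∉ C, ζ'.1 x = 0) :
    localIntegral I p (ζ + ζ') = localIntegral I p ζ + localIntegral I p ζ' :=
  integral_add (integrableOn_topCoeff I hC hCp h0) (integrableOn_topCoeff I hC hCp h0')

theorem localIntegral_smul (p : M) (c : ℝ) (ζ : KForm I M (realDim E)) :
    localIntegral I p (c • ζ) = c * localIntegral I p ζ :=
  integral_const_mul _ _

variable (M) in
/-- Integration as a linear map. -/
def integralLM : KForm I M (realDim E) →ₗ[ℝ] ℝ where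
  toFun := integralK I
  map_add' ζ ζ' := by
    simp only [integralK_eq_sum]
    rw [← Finset.sum_add_distrib]
    refine Finset.sum_congr rfl fun p _ => ?_
    rw [← localIntegral_add I (isClosed_tsupport _) (chartPartition_subset I p)
      (fun x hx => smulK_chartPartition_eq_zero I ζ p hx)
      (fun x hx => smulK_chartPartition_eq_zero I ζ' p hx)]
    congr 1
    ext1 x
    simp
  map_smul' c ζ := by
    simp only [integralK_eq_sum]
    rw [RingHom.id_apply, smul_eq_mul, Finset.mul_sum]
    refine Finset.sum_congr rfl fun p _ => ?_
    rw [← localIntegral_smul]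
    congr 1
    ext1 x
    simp [smul_smul, mul_comm]

@[simp] theorem integralLM_apply (ζ : KForm I M (realDim E)) : integralLM I M ζ = integralK I ζ := rfl

/-- The integral of a form supported in a chart. -/
theorem integralK_eq_localIntegral (hor : OrientedCharts I M) {q : M} {ζ : KForm I M (realDim E)}
    {C : Set M} (hC : IsClosed C) (hCq : C ⊆ (extChartAt I q).source) (h0 : ∀ x ∉ C, ζ.1 x = 0) :
    integralK I ζ = localIntegral I q ζ := by
  rw [integralK_eq_sum]
  have h1 : ∀ p, localIntegral I p (smulK (contMDiff_chartPartition I p) ζ) =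
      localIntegral I q (smulK (contMDiff_chartPartition I p) ζ) := by
    intro p
    refine localIntegral_eq I hor (C := C ∩ tsupport (chartPartition I M p))
      (inter_subset_right.trans (chartPartition_subset I p)) (inter_subset_left.trans hCq)
      fun x hx => ?_
    by_cases h : x ∈ C
    · exact smulK_chartPartition_eq_zero I ζ p fun h' => hx ⟨h, h'⟩
    · rw [smulK_val, h0 x h, smul_zero]
  simp only [h1]
  conv_rhs => rw [KForm.eq_sum_chartPartition I ζ]
  have h2 : ∀ s : Finset M, (∑ p ∈ s, localIntegral I q (smulK (contMDiff_chartPartition I p) ζ) =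
      localIntegral I q (∑ p ∈ s, smulK (contMDiff_chartPartition I p) ζ)) ∧
      ∀ x ∉ C, (∑ p ∈ s, smulK (contMDiff_chartPartition I p) ζ).1 x = 0 := by
    classical
    intro s
    induction s using Finset.induction_on with
    | empty =>
      refine ⟨?_, fun x _ => by simp⟩
      simp only [Finset.sum_empty]
      have := localIntegral_smul I q 0 (0 : KForm I M (realDim E))
      simpa using this.symm
    | insert a s ha ih =>
      have h3 : ∀ x ∉ C, (smulK (contMDiff_chartPartition I a) ζ).1 x = 0 := fun x hx => by
        rw [smulK_val, h0 x hx, smul_zero]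
      refine ⟨?_, fun x hx => ?_⟩
      · rw [Finset.sum_insert ha, Finset.sum_insert ha, ih.1,
          localIntegral_add I hC hCq h3 ih.2]
      · rw [Finset.sum_insert ha, KForm.add_val, ih.2 x hx, h3 x hx, add_zero]
  exact (h2 _).1

theorem setIntegral_chartRep_dK_eq_zero {k : ℕ} {q : M} {θ : KForm I M k} {C : Set M}
    (hC : IsClosed C) (hCq : C ⊆ (extChartAt I q).source) (h0 : ∀ x ∉ C, θ.1 x = 0)
    (e : Fin (k + 1) → E) :
    ∫ u in chartDom I q, chartRep I q (dK I θ).1 (frameEquiv E u) e = 0 := by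
  set g : (Fin (realDim E) → ℝ) → E [⋀^Fin k]→L[ℝ] ℝ :=
    (chartDom I q).indicator fun u => chartRep I q θ.1 (frameEquiv E u) with hgdef
  set K := chartCo I q '' C with hK
  have hKc := isCompact_image_chartCo I hC hCq
  have hz : ∀ u ∈ chartDom I q, u ∉ K → chartRep I q θ.1 (frameEquiv E u) = 0 := by
    intro u hu hn
    have := h0 _ (chartPt_notMem I hu hn)
    simp only [chartRep]
    change (θ.1 (chartPt I q u)).compContinuousLinearMap _ = 0
    rw [this]; rfl
  have hg : ContDiff ℝ ∞ g := contDiff_indicator (isOpen_chartDom I q) hKc.isClosed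
    (image_chartCo_subset I hCq) (contDiffOn_chartRep_frame I q θ) hz
  have hgs : ∀ u ∉ K, g u = 0 := by
    intro u hu
    by_cases h : u ∈ chartDom I q
    · rw [hgdef, indicator_of_mem h, hz u h hu]
    · rw [hgdef, indicator_of_notMem h]
  have hterm : ∀ i : Fin (k + 1), ∫ u, fderiv ℝ (fun u => g u (i.removeNth e)) u
      ((frameEquiv E).symm (e i)) = 0 := by
    intro i
    refine integral_fderiv_apply_eq_zero ?_ ?_ _
    · have : ContDiffOn ℝ ∞ (fun u => g u (i.removeNth e)) univ :=
        contDiffOn_cam_apply hg.contDiffOn fun _ => contDiffOn_const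
      exact (contDiffOn_univ.1 this).of_le (by simp)
    · refine HasCompactSupport.intro hKc fun u hu => ?_
      rw [hgs u hu]; rfl
  have hint : ∀ i : Fin (k + 1), Integrable (fun u => fderiv ℝ (fun u => g u (i.removeNth e)) u
      ((frameEquiv E).symm (e i))) := by
    intro i
    have : ContDiffOn ℝ ∞ (fun u => g u (i.removeNth e)) univ :=
        contDiffOn_cam_apply hg.contDiffOn fun _ => contDiffOn_const
    refine Continuous.integrable_of_hasCompactSupport
      (((contDiffOn_univ.1 this).continuous_fderiv (by simp)).clm_apply continuous_const) ?_
    refine HasCompactSupport.comp_left (g := fun l : (Fin (realDim E) → ℝ) →L[ℝ] ℝ => l _)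
      (HasCompactSupport.fderiv ℝ ?_) rfl
    refine HasCompactSupport.intro hKc fun u hu => ?_
    rw [hgs u hu]; rfl
  have hsum : ∀ u ∈ chartDom I q, chartRep I q (dK I θ).1 (frameEquiv E u) e =
      ∑ i : Fin (k + 1), (-1 : ℝ) ^ (i : ℕ) * fderiv ℝ (fun u => g u (i.removeNth e)) u
        ((frameEquiv E).symm (e i)) := by
    intro u hu
    rw [chartRep_dK I θ q hu, extDeriv_apply (θ.differentiableAt I q hu)]
    refine Finset.sum_congr rfl fun i _ => ?_
    rw [zsmul_eq_mul]
    push_cast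
    congr 1
    have hsm : DifferentiableAt ℝ (fun y => chartRep I q θ.1 y (i.removeNth e)) (frameEquiv E u) :=
      ((contDiffOn_cam_apply (θ.2 q) fun _ => contDiffOn_const).contDiffAt
        ((isOpen_extChartAt_target q).mem_nhds hu)).differentiableAt (by simp)
    have h1 : HasFDerivAt (fun u => chartRep I q θ.1 (frameEquiv E u) (i.removeNth e))
        ((fderiv ℝ (fun y => chartRep I q θ.1 y (i.removeNth e)) (frameEquiv E u)).comp
          (frameEquiv E).toContinuousLinearMap) u :=
      hsm.hasFDerivAt.comp u (frameEquiv E).hasFDerivAt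
    have h2 : (fun u => g u (i.removeNth e)) =ᶠ[𝓝 u]
        fun u => chartRep I q θ.1 (frameEquiv E u) (i.removeNth e) := by
      filter_upwards [(isOpen_chartDom I q).mem_nhds hu] with v hv
      rw [hgdef, indicator_of_mem hv]
    rw [h2.fderiv_eq, h1.fderiv]
    simp
  rw [setIntegral_congr_fun (isOpen_chartDom I q).measurableSet hsum]
  rw [setIntegral_eq_integral_of_forall_compl_eq_zero]
  · rw [integral_finsetSum _ fun i _ => (hint i).const_mul _]
    refine Finset.sum_eq_zero fun i _ => ?_
    rw [integral_const_mul, hterm i, mul_zero]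
  · intro u hu
    refine Finset.sum_eq_zero fun i _ => ?_
    have : (fun u => g u (i.removeNth e)) =ᶠ[𝓝 u] fun _ => 0 := by
      filter_upwards [hKc.isClosed.isOpen_compl.mem_nhds
        fun h => hu (image_chartCo_subset I hCq h)] with v hv
      rw [hgs v hv]; rfl
    rw [this.fderiv_eq]
    simp

theorem setIntegral_chartRep_dForm_eq_zero {q : M} {φ : Form I M} {C : Set M}
    (hC : IsClosed C) (hCq : C ⊆ (extChartAt I q).source) (h0 : ∀ k, ∀ x ∉ C, (φ k).1 x = 0)
    {k : ℕ} (e : Fin k → E) :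
    ∫ u in chartDom I q, chartRep I q (dForm I φ k).1 (frameEquiv E u) e = 0 := by
  cases k with
  | zero =>
    rw [dForm_zero_comp]
    exact integral_zero _ _
  | succ k => exact setIntegral_chartRep_dK_eq_zero I hC hCq (h0 k) e

theorem dK_eq_zero_of_notMem {k : ℕ} {θ : KForm I M k} {C : Set M} (hC : IsClosed C)
    (h0 : ∀ x ∉ C, θ.1 x = 0) {x : M} (hx : x ∉ C) : (dK I θ).1 x = 0 := by
  rw [dK_val]
  have h : chartRep I x θ.1 =ᶠ[𝓝 (extChartAt I x x)] fun _ => 0 := by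
    have hc : ContinuousAt (extChartAt I x).symm (extChartAt I x x) := continuousAt_extChartAt_symm x
    have : Cᶜ ∈ 𝓝 ((extChartAt I x).symm (extChartAt I x x)) := by
      rw [extChartAt_to_inv]; exact hC.isOpen_compl.mem_nhds hx
    filter_upwards [hc this] with y hy
    simp only [chartRep, h0 _ hy]; rfl
  have h1 : fderiv ℝ (fun _ : E => (0 : E [⋀^Fin k]→L[ℝ] ℝ)) (extChartAt I x x) = 0 := by simp
  rw [h.extDeriv_eq, extDeriv, h1, ← ContinuousAlternatingMap.alternatizeUncurryFinCLM_apply,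
    map_zero]
  rfl

theorem dForm_eq_zero_of_notMem {φ : Form I M} {C : Set M} (hC : IsClosed C)
    (h0 : ∀ k, ∀ x ∉ C, (φ k).1 x = 0) (k : ℕ) {x : M} (hx : x ∉ C) : (dForm I φ k).1 x = 0 := by
  cases k with
  | zero => rfl
  | succ k => exact dK_eq_zero_of_notMem I hC (h0 k) hx

theorem Form.eq_sum_chartPartition (φ : Form I M) :
    φ = ∑ p ∈ chartCenters I M, smulForm (contMDiff_chartPartition I p) φ := by
  funext k
  rw [Finset.sum_apply]
  exact KForm.eq_sum_chartPartition I (φ k)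

/-- Stokes' theorem on a compact manifold. -/
theorem integral_dForm (hor : OrientedCharts I M) (φ : Form I M) : integral I (dForm I φ) = 0 := by
  have h : ∀ ψ : Form I M, integral I (dForm I ψ) =
    ((integralLM I M).comp ((LinearMap.proj (realDim E)).comp (dFormLM I))) ψ := fun ψ => rfl
  rw [h, Form.eq_sum_chartPartition I φ, map_sum]
  refine Finset.sum_eq_zero fun p _ => ?_
  have h0 : ∀ k, ∀ x ∉ tsupport (chartPartition I M p),
      ((smulForm (contMDiff_chartPartition I p) φ) k).1 x = 0 := fun k x hx =>
    smulK_chartPartition_eq_zero I (φ k) p hx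
  change integralK I (dForm I (smulForm (contMDiff_chartPartition I p) φ) (realDim E)) = 0
  rw [integralK_eq_localIntegral I hor (isClosed_tsupport _) (chartPartition_subset I p)
    fun x hx => dForm_eq_zero_of_notMem I (isClosed_tsupport _) h0 _ hx]
  exact setIntegral_chartRep_dForm_eq_zero I (isClosed_tsupport _) (chartPartition_subset I p) h0 _

end Integration

section Pairing

variable {E : Type*} [NormedAddCommGroup E] [NormedSpace ℝ E] [NormedSpace ℂ E]
  [IsScalarTower ℝ ℂ E] [FiniteDimensional ℝ E] [FiniteDimensional ℂ E]
  {H : Type*} [TopologicalSpace H] (I : ModelWithCorners ℝ E H) [I.Boundaryless]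
  {M : Type*} [TopologicalSpace M] [ChartedSpace H M] [IsManifold I ∞ M]
  [T2Space M] [CompactSpace M]

/-! #### The wedge product in components -/

theorem integral_wedge (η θ : Form I M) : integral I (wedge I η θ) =
    ∑ p : Fin (realDim E + 1), integralK I
      (wedgeK I (Nat.add_sub_of_le (Nat.lt_succ_iff.1 p.2)) (η p) (θ (realDim E - p))) := by
  rw [integral_eq_integralK, ← integralLM_apply, wedge_apply, map_sum]
  rfl

variable (M) in
/-- Integration of forms as a linear map. -/
def integralFormLM : Form I M →ₗ[ℝ] ℝ := (integralLM I M).comp (LinearMap.proj (realDim E))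

@[simp] theorem integralFormLM_apply (φ : Form I M) : integralFormLM I M φ = integral I φ := rfl

theorem integral_wedge_single_right {p q : ℕ} (h : p + q = realDim E) (η : Form I M)
    (β : KForm I M q) : integral I (wedge I η (Pi.single q β)) = integralK I (wedgeK I h (η p) β) := by
  rw [integral_wedge, Finset.sum_eq_single (⟨p, by omega⟩ : Fin (realDim E + 1))]
  · have hq : realDim E - p = q := by omega
    simp only
    rw [wedgeK_congr I _ hq, Pi.single_eq_same]
  · intro b _ hb
    have : realDim E - (b : ℕ) ≠ q := fun h' => hb (Fin.ext (by have := b.2; simp; omega))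
    rw [Pi.single_eq_of_ne this, wedgeK_zero_right, ← integralLM_apply, map_zero]
  · intro h'; exact absurd (Finset.mem_univ _) h'

theorem integral_wedge_single_left {p q : ℕ} (h : p + q = realDim E) (α : KForm I M p)
    (θ : Form I M) : integral I (wedge I (Pi.single p α) θ) = integralK I (wedgeK I h α (θ q)) := by
  rw [integral_wedge, Finset.sum_eq_single (⟨p, by omega⟩ : Fin (realDim E + 1))]
  · have hq : realDim E - p = q := by omega
    simp only
    rw [wedgeK_congr I _ hq, Pi.single_eq_same]
  · intro b _ hb
    have : (b : ℕ) ≠ p := fun h' => hb (Fin.ext h')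
    rw [Pi.single_eq_of_ne this, wedgeK_zero_left, ← integralLM_apply, map_zero]
  · intro h'; exact absurd (Finset.mem_univ _) h'

/-- Multiplication of the component of degree `k` by `s k`. -/
def scaleDeg (s : ℕ → ℝ) : Form I M →ₗ[ℝ] Form I M where
  toFun φ k := s k • φ k
  map_add' _ _ := funext fun _ => smul_add _ _ _
  map_smul' c φ := funext fun k => smul_comm (s k) c (φ k)

@[simp] theorem scaleDeg_apply (s : ℕ → ℝ) (φ : Form I M) (k : ℕ) :
    scaleDeg I s φ k = s k • φ k := rfl

theorem Form.eq_sum_single' (φ : Form I M) :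
    φ = ∑ k ∈ Finset.range (realDim E + 1), Pi.single k (φ k) := by
  rw [← finrank_eq_realDim E]
  exact Form.eq_sum_single I φ

/-- Two linear functionals of forms agree if they agree on homogeneous forms of degree at most the
dimension. -/
theorem formLM_ext {F : Type*} [AddCommGroup F] [Module ℝ F] {L L' : Form I M →ₗ[ℝ] F}
    (h : ∀ k ≤ realDim E, ∀ α : KForm I M k, L (Pi.single k α) = L' (Pi.single k α)) : L = L' := by
  ext φ
  rw [Form.eq_sum_single' I φ, map_sum, map_sum]
  exact Finset.sum_congr rfl fun k hk => h k (by have := Finset.mem_range.1 hk; omega) _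

variable (M) in
theorem exists_integral_wedge_comm : ∃ s : ℕ → ℝ, ∀ η θ : Form I M,
    integral I (wedge I η θ) = integral I (wedge I θ (scaleDeg I s η)) := by
  have h : ∀ k, ∃ s : ℝ, ∀ q (h : k + q = realDim E) (h' : q + k = realDim E) (α : KForm I M k)
      (β : KForm I M q), wedgeK I h α β = wedgeK I h' β (s • α) := by
    intro k
    by_cases hk : k ≤ realDim E
    · obtain ⟨s, hs, hc⟩ := exists_wedgeCAM_comm (V := E) (p := realDim E - k) (q := k)
        (r := realDim E) (by omega) (by omega)
      refine ⟨s, fun q h h' α β => ?_⟩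
      obtain rfl : q = realDim E - k := by omega
      rw [wedgeK_smul_right]
      exact KForm.ext fun x => hc _ _
    · exact ⟨0, fun q h => absurd h (by omega)⟩
  choose s hs using h
  refine ⟨s, fun η θ => ?_⟩
  have : (integralFormLM I M).comp ((wedgeLM I).flip θ) =
      (integralFormLM I M).comp ((wedgeLM I θ).comp (scaleDeg I s)) := by
    refine formLM_ext I fun k hk α => ?_
    simp only [LinearMap.comp_apply, LinearMap.flip_apply, wedgeLM_apply, integralFormLM_apply]
    have e : scaleDeg I s (Pi.single k α) = Pi.single k (s k • α) := by
      funext j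
      rw [scaleDeg_apply]
      by_cases h : j = k
      · subst h; simp
      · simp [Pi.single_eq_of_ne h]
    rw [e, integral_wedge_single_left I (Nat.add_sub_of_le hk),
      integral_wedge_single_right I (Nat.sub_add_cancel hk), hs k]
  exact LinearMap.congr_fun this η

theorem dForm_scaleDeg_eq_zero (s : ℕ → ℝ) {φ : Form I M} (h : dForm I φ = 0) :
    dForm I (scaleDeg I s φ) = 0 := by
  rw [dForm_eq_zero_iff] at h ⊢
  intro k
  rw [scaleDeg_apply, dK_smul, h, smul_zero]

theorem integral_single_wedgeK {p q r : ℕ} (h : p + q = r) (hr : r = realDim E) (α : KForm I M p)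
    (β : KForm I M q) : integral I (Pi.single r (wedgeK I h α β)) =
      integral I (wedge I (Pi.single p α) (Pi.single q β)) := by
  subst hr
  rw [integral_wedge_single_left I h, integral_eq_integralK, Pi.single_eq_same, Pi.single_eq_same]

theorem integral_zero_form : integral I (0 : Form I M) = 0 :=
  (integralFormLM I M).map_zero

theorem scaleDeg_single (s : ℕ → ℝ) {k : ℕ} (α : KForm I M k) :
    scaleDeg I s (Pi.single k α) = s k • Pi.single k α := by
  funext j
  rw [scaleDeg_apply, Pi.smul_apply]
  by_cases h : j = k
  · subst h; simp
  · simp [Pi.single_eq_of_ne h]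

/-- Stokes' theorem for products: up to signs depending only on the degrees, `d` is its own
transpose for the pairing `∫ η ∧ θ`. -/
theorem exists_integral_wedge_dForm (hor : OrientedCharts I M) : ∃ t : ℕ → ℝ, (∀ k, t k ≠ 0) ∧
    ∀ η θ : Form I M,
      integral I (wedge I η (dForm I θ)) = integral I (wedge I (dForm I (scaleDeg I t η)) θ) := by
  have h : ∀ k, ∃ t : ℝ, t ≠ 0 ∧ ∀ (α : KForm I M k) (θ : Form I M),
      integral I (wedge I (Pi.single k α) (dForm I θ)) =
        t * integral I (wedge I (dForm I (Pi.single k α)) θ) := by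
    intro k
    rcases Nat.lt_trichotomy k (realDim E) with hk | hk | hk
    · obtain ⟨m, hm⟩ : ∃ m, k + m + 1 = realDim E := ⟨realDim E - k - 1, by omega⟩
      obtain ⟨s, hs, hd⟩ := exists_dK_wedgeK (M := M) I (p := k) (q := m) rfl
        (show k + 1 + m = k + m + 1 by omega) (by omega)
      have hs0 : s ≠ 0 := by rintro rfl; simp at hs
      refine ⟨-s, neg_ne_zero.2 hs0, fun α θ => ?_⟩
      have h1 := integral_dForm I hor (Pi.single (k + m) (wedgeK I rfl α (θ m)))
      rw [dForm_single, hd, single_add, single_smul, ← integralFormLM_apply, map_add, map_smul,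
        integralFormLM_apply, integralFormLM_apply, integral_single_wedgeK I _ hm,
        integral_single_wedgeK I _ hm, smul_eq_mul,
        integral_wedge_single_left I (q := m) (by omega), Pi.single_eq_same,
        integral_wedge_single_left I (q := m + 1) (by omega), Pi.single_eq_same] at h1
      rw [dForm_single, integral_wedge_single_left I (q := m + 1) (by omega),
        integral_wedge_single_left I (q := m) (by omega), dForm_succ]
      generalize integralK I (wedgeK I _ (dK I α) (θ m)) = a at h1 ⊢
      have h2 : a = -(s * integralK I (wedgeK I (by omega) α (dK I (θ m)))) := by linarith
      rw [h2]
      linear_combination (-(integralK I (wedgeK I (by omega) α (dK I (θ m))))) * hs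
    · refine ⟨1, one_ne_zero, fun α θ => ?_⟩
      rw [integral_wedge_single_left I (q := 0) (by omega), dForm_zero_comp, wedgeK_zero_right,
        dForm_single, KForm.eq_zero_of_finrank_lt I (by rw [finrank_eq_realDim E]; omega) (dK I α),
        Pi.single_zero, wedge_zero_left, integral_zero_form, ← integralLM_apply, map_zero]
      simp
    · refine ⟨1, one_ne_zero, fun α θ => ?_⟩
      rw [KForm.eq_zero_of_finrank_lt I (by rw [finrank_eq_realDim E]; omega) α, dForm_single,
        dK_zero, Pi.single_zero, Pi.single_zero, wedge_zero_left, wedge_zero_left,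
        integral_zero_form, mul_zero]
  choose t ht0 ht using h
  refine ⟨t, ht0, fun η θ => ?_⟩
  have : (integralFormLM I M).comp ((wedgeLM I).flip (dForm I θ)) =
      (integralFormLM I M).comp (((wedgeLM I).flip θ).comp ((dFormLM I).comp (scaleDeg I t))) := by
    refine formLM_ext I fun k hk α => ?_
    simp only [LinearMap.comp_apply, LinearMap.flip_apply, wedgeLM_apply, integralFormLM_apply,
      scaleDeg_single, dFormLM_apply, dForm_smul, wedge_smul_left]
    rw [ht, ← integralFormLM_apply I (wedge I (dForm I (Pi.single k α)) θ), ← integralFormLM_apply,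
      map_smul, smul_eq_mul]
  exact LinearMap.congr_fun this η

/-! #### Fundamental lemma -/

theorem chartRep_extField_chart {k : ℕ} (p : M) (g : E → E [⋀^Fin k]→L[ℝ] ℝ) {y : E}
    (hy : y ∈ (extChartAt I p).target) :
    chartRep I p (extField I (extChartAt I p).source (extChartAt I p) g) y = g y := by
  simp only [chartRep, extField_of_mem I ((extChartAt I p).map_target hy),
    (extChartAt I p).right_inv hy]
  ext v
  simp only [ContinuousAlternatingMap.compContinuousLinearMap_apply]
  congr 1
  funext i
  exact congrArg (fun l : E →L[ℝ] E => l (v i)) (diffAt_comp_diffAt_symm I p hy)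

theorem eq_zero_of_integral_wedge_eq_zero (hor : OrientedCharts I M) {η : Form I M} {U : Set M}
    (hU : IsOpen U) (h : ∀ (θ : Form I M) (C : Set M), IsClosed C → C ⊆ U →
      (∀ k, ∀ x ∉ C, (θ k).1 x = 0) → integral I (wedge I η θ) = 0) (k : ℕ) {x : M} (hx : x ∈ U) :
    (η k).1 x = 0 := by
  rcases lt_or_ge (realDim E) k with hk | hk
  · rw [KForm.eq_zero_of_finrank_lt I (by rw [finrank_eq_realDim E]; omega) (η k)]; rfl
  obtain ⟨m, hm⟩ : ∃ m, k + m = realDim E := ⟨realDim E - k, by omega⟩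
  refine eq_of_chartRep_eq I (θ' := fun _ => 0) x (mem_extChartAt_source x) ?_
  have hzero : chartRep I x (fun _ => (0 : E [⋀^Fin k]→L[ℝ] ℝ)) (extChartAt I x x) = 0 := rfl
  rw [hzero]
  refine eq_zero_of_wedgeCAM_eq_zero (finrank_eq_realDim E) hm _ fun β => ?_
  set f : (Fin (realDim E) → ℝ) → ℝ := fun u =>
    wedgeCAM hm (chartRep I x (η k).1 (frameEquiv E u)) β (realFrame E) with hf
  have hfc : ContinuousOn f (chartDom I x) := by
    simp only [hf, wedgeCAM_apply]
    refine continuousOn_finsetSum _ fun σ _ =>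
      continuousOn_const.mul (ContinuousOn.mul ?_ continuousOn_const)
    exact (contDiffOn_cam_apply (contDiffOn_chartRep_frame I x (η k))
      fun i => contDiffOn_const).continuousOn
  set W : Set (Fin (realDim E) → ℝ) := chartDom I x ∩ chartPt I x ⁻¹' U with hW
  have hWo : IsOpen W := (continuousOn_chartPt I x).isOpen_inter_preimage (isOpen_chartDom I x) hU
  have hae : ∀ᵐ u, u ∈ W → f u = 0 := by
    refine hWo.ae_eq_zero_of_integral_contDiff_smul_eq_zero
      ((hfc.mono inter_subset_left).locallyIntegrableOn hWo.measurableSet) fun g hg hgc hgW => ?_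
    set C : Set M := chartPt I x '' tsupport g with hC
    have hCc : IsClosed C := (hgc.isCompact.image_of_continuousOn
      ((continuousOn_chartPt I x).mono (hgW.trans inter_subset_left))).isClosed
    have hCU : C ⊆ U := by rintro _ ⟨u, hu, rfl⟩; exact (hgW hu).2
    have hCs : C ⊆ (extChartAt I x).source := by
      rintro _ ⟨u, hu, rfl⟩; exact chartPt_mem I (hgW hu).1
    have hoff : ∀ y ∈ (extChartAt I x).source, y ∉ C →
        g ((frameEquiv E).symm (extChartAt I x y)) = 0 := by
      intro y hy hyC
      refine image_eq_zero_of_notMem_tsupport fun h' => hyC ⟨_, h', ?_⟩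
      exact chartPt_chartCo I hy
    set θ : KForm I M m := extK I (isOpen_extChartAt_source x)
      (e := extChartAt I x) ((contMDiffOn_extChartAt (x := x)).mono (by simp))
      (T := (extChartAt I x).target) (extChartAt I x).mapsTo
      (g := fun y => g ((frameEquiv E).symm y) • β)
      (((hg.comp (frameEquiv E).symm.contDiff).smul contDiff_const).contDiffOn)
      ⟨C, hCc, hCs, fun y hy hyC => by rw [hoff y hy hyC, zero_smul]⟩ with hθ
    have hθv : θ.1 = extField I (extChartAt I x).source (extChartAt I x)
      (fun y => g ((frameEquiv E).symm y) • β) := rfl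
    have hθC : ∀ y ∉ C, θ.1 y = 0 := by
      intro y hyC
      rw [hθv]
      by_cases hy : y ∈ (extChartAt I x).source
      · rw [extField_of_mem I hy, hoff y hy hyC, zero_smul]; rfl
      · exact extField_of_notMem I hy
    have hθs : ∀ j, ∀ y ∉ C, ((Pi.single m θ : Form I M) j).1 y = 0 := by
      intro j y hy
      by_cases hj : j = m
      · subst hj; rw [Pi.single_eq_same]; exact hθC y hy
      · rw [Pi.single_eq_of_ne hj]; rfl
    have h1 := h (Pi.single m θ) C hCc hCU hθs
    rw [integral_wedge_single_right I hm, integralK_eq_localIntegral I hor hCc hCs] at h1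
    · rw [← h1, localIntegral, ← integral_indicator (isOpen_chartDom I x).measurableSet]
      congr 1
      funext u
      by_cases hu : u ∈ chartDom I x
      · rw [indicator_of_mem hu, topCoeff, chartRep_wedgeK]
        have : chartRep I x θ.1 (frameEquiv E u) = g u • β := by
          refine (chartRep_extField_chart I x _ hu).trans ?_
          rw [ContinuousLinearEquiv.symm_apply_apply]
        rw [this, wedgeCAM_smul_right]
        rfl
      · rw [indicator_of_notMem hu, image_eq_zero_of_notMem_tsupport fun h' => hu (hgW h').1,
          zero_smul]
    · intro y hy
      change wedgeCAM hm _ (θ.1 y) = 0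
      rw [hθC y hy]
      exact (wedgeBilin (V := E) hm _).map_zero
  have hev : EqOn f (fun _ => 0) W := Measure.eqOn_open_of_ae_eq (μ := volume)
    ((ae_restrict_iff' hWo.measurableSet).2 hae) hWo (hfc.mono inter_subset_left) continuousOn_const
  have hxs := mem_extChartAt_source (I := I) x
  have hxW : chartCo I x x ∈ W := ⟨chartCo_mem I hxs, by
    rw [mem_preimage, chartPt_chartCo I hxs]; exact hx⟩
  have h2 := hev hxW
  have e : frameEquiv E (chartCo I x x) = extChartAt I x x := by simp [chartCo]
  simp only [hf, e] at h2
  have : ∀ γ : E [⋀^Fin (realDim E)]→L[ℝ] ℝ, γ (realFrame E) = 0 → γ = 0 := by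
    intro γ hγ
    have h3 := AlternatingMap.eq_smul_basis_det (realFrame E) γ.toAlternatingMap
    ext v
    have := congrArg (fun f : E [⋀^Fin (realDim E)]→ₗ[ℝ] ℝ => f v) h3
    have h4 : γ.toAlternatingMap (realFrame E) = 0 := hγ
    rw [h4, zero_smul] at this
    exact this
  exact this _ h2

/-- A form is determined by its pairings. -/
theorem eq_zero_of_forall_integral_wedge (hor : OrientedCharts I M) {η : Form I M}
    (h : ∀ θ : Form I M, integral I (wedge I η θ) = 0) : η = 0 :=
  funext fun k => KForm.ext fun x =>
    eq_zero_of_integral_wedge_eq_zero I hor isOpen_univ (fun θ _ _ _ _ => h θ) k (mem_univ x)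

theorem dForm_eq_zero_of_integral_wedge (hor : OrientedCharts I M) {η : Form I M}
    (h : ∀ θ : Form I M, integral I (wedge I η (dForm I θ)) = 0) : dForm I η = 0 := by
  obtain ⟨t, ht0, ht⟩ := exists_integral_wedge_dForm I hor
  have h1 : dForm I (scaleDeg I t η) = 0 :=
    eq_zero_of_forall_integral_wedge I hor fun θ => by rw [← ht, h]
  rw [dForm_eq_zero_iff] at h1 ⊢
  intro k
  have h2 := h1 k
  rw [scaleDeg_apply, dK_smul] at h2
  exact (smul_eq_zero.1 h2).resolve_left (ht0 k)

/-! #### Closed currents and products -/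

theorem apply_eq_sum_single {F : Type*} [AddCommGroup F] [Module ℝ F] (T : Form I M →ₗ[ℝ] F)
    (φ : Form I M) : T φ = ∑ k ∈ Finset.range (realDim E + 1), T (Pi.single k (φ k)) := by
  conv_lhs => rw [Form.eq_sum_single' I φ]
  rw [map_sum]

theorem map_wedge_dForm_eq_zero (T : Form I M →ₗ[ℝ] ℝ) (hT : ∀ φ, T (dForm I φ) = 0)
    {η : Form I M} (hη : dForm I η = 0) (ψ : Form I M) : T (wedge I η (dForm I ψ)) = 0 := by
  rw [dForm_eq_zero_iff] at hη
  rw [apply_eq_sum_single]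
  refine Finset.sum_eq_zero fun r _ => ?_
  have key : ∀ p q (h : p + q = r), T (Pi.single r (wedgeK I h (η p) (dForm I ψ q))) = 0 := by
    intro p q h
    cases q with
    | zero => rw [dForm_zero_comp, wedgeK_zero_right, Pi.single_zero, map_zero]
    | succ q =>
      subst h
      obtain ⟨s, hs, hd⟩ := exists_dK_wedgeK (M := M) I (p := p) (q := q) rfl
        (show p + 1 + q = p + q + 1 by omega) rfl
      have h1 := hT (Pi.single (p + q) (wedgeK I rfl (η p) (ψ q)))
      rw [dForm_single, hd, hη, wedgeK_zero_left, zero_add, single_smul, map_smul, smul_eq_mul] at h1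
      exact (mul_eq_zero.1 h1).resolve_left (by rintro rfl; simp at hs)
  rw [wedge_apply, ← LinearMap.single_apply (R := ℝ), map_sum, map_sum]
  exact Finset.sum_eq_zero fun p _ => key _ _ _

theorem map_dForm_wedge_eq_zero (T : Form I M →ₗ[ℝ] ℝ) (hT : ∀ φ, T (dForm I φ) = 0)
    (η : Form I M) {ψ : Form I M} (hψ : dForm I ψ = 0) : T (wedge I (dForm I η) ψ) = 0 := by
  rw [dForm_eq_zero_iff] at hψ
  rw [apply_eq_sum_single]
  refine Finset.sum_eq_zero fun r _ => ?_
  have key : ∀ p q (h : p + q = r), T (Pi.single r (wedgeK I h (dForm I η p) (ψ q))) = 0 := by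
    intro p q h
    cases p with
    | zero => rw [dForm_zero_comp, wedgeK_zero_left, Pi.single_zero, map_zero]
    | succ p =>
      obtain ⟨r, rfl⟩ : ∃ r', r = r' + 1 := ⟨p + q, by omega⟩
      obtain ⟨s, hs, hd⟩ := exists_dK_wedgeK (M := M) I (p := p) (q := q) (r := r) (by omega)
        h (by omega)
      have h1 := hT (Pi.single r (wedgeK I (by omega) (η p) (ψ q)))
      rw [dForm_single, hd, hψ, wedgeK_zero_right, smul_zero, add_zero] at h1
      exact h1
  rw [wedge_apply, ← LinearMap.single_apply (R := ℝ), map_sum, map_sum]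
  exact Finset.sum_eq_zero fun p _ => key _ _ _

end Pairing

/-! #### Orientation of complex manifolds and of products -/

section Orientation

theorem det_restrictScalars_pos {E : Type*} [NormedAddCommGroup E] [NormedSpace ℂ E]
    [FiniteDimensional ℂ E] (f : E →L[ℂ] E) (hf : IsUnit f.toLinearMap) :
    0 < (f.restrictScalars ℝ).det := by
  have h : (f.restrictScalars ℝ).det = Algebra.norm ℝ (LinearMap.det f.toLinearMap) :=
    LinearMap.det_restrictScalars ..
  rw [h, Algebra.norm_complex_eq]
  exact Complex.normSq_pos.2 (LinearMap.isUnit_det _ hf).ne_zero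

theorem orientedCharts_of_isManifold {E : Type*} [NormedAddCommGroup E] [NormedSpace ℂ E]
    [FiniteDimensional ℂ E] {X : Type*} [TopologicalSpace X] [ChartedSpace E X]
    [IsManifold 𝓘(ℂ, E) ω X] : OrientedCharts 𝓘(ℝ, E) X := by
  have hhol : ∀ (p q : X), ∀ y ∈ (extChartAt 𝓘(ℂ, E) p).target,
      (extChartAt 𝓘(ℂ, E) p).symm y ∈ (extChartAt 𝓘(ℂ, E) q).source → DifferentiableAt ℂ
        (fun z => extChartAt 𝓘(ℂ, E) q ((extChartAt 𝓘(ℂ, E) p).symm z)) y := by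
    intro p q y hy hq
    have h1 : ContMDiffAt 𝓘(ℂ, E) 𝓘(ℂ, E) ω
        (fun z => extChartAt 𝓘(ℂ, E) q ((extChartAt 𝓘(ℂ, E) p).symm z)) y := by
      refine ContMDiffAt.comp y (contMDiffAt_extChartAt' (by simpa using hq)) ?_
      exact (contMDiffOn_extChartAt_symm p).contMDiffAt ((isOpen_extChartAt_target p).mem_nhds hy)
    exact (contMDiffAt_iff_contDiffAt.1 h1).differentiableAt (by simp)
  intro p q y hy hq
  have e : ∀ r : X, extChartAt 𝓘(ℝ, E) r = extChartAt 𝓘(ℂ, E) r := fun r => by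
    rfl
  rw [e] at hy hq
  rw [e] at hq
  have h1 := hhol p q y hy hq
  set g := fun z => extChartAt 𝓘(ℂ, E) q ((extChartAt 𝓘(ℂ, E) p).symm z) with hg
  have hgy : g y ∈ (extChartAt 𝓘(ℂ, E) q).target := (extChartAt 𝓘(ℂ, E) q).map_source hq
  have h2 := hhol q p (g y) hgy (by
    simp only [hg]; rw [(extChartAt 𝓘(ℂ, E) q).left_inv hq]
    exact (extChartAt 𝓘(ℂ, E) p).map_target hy)
  have h3 : (fderiv ℂ (fun z => extChartAt 𝓘(ℂ, E) p ((extChartAt 𝓘(ℂ, E) q).symm z)) (g y)).comp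
      (fderiv ℂ g y) = ContinuousLinearMap.id ℂ E := by
    rw [← fderiv_comp y h2 h1]
    have hO : IsOpen ((extChartAt 𝓘(ℂ, E) p).target ∩
        (extChartAt 𝓘(ℂ, E) p).symm ⁻¹' (extChartAt 𝓘(ℂ, E) q).source) :=
      (continuousOn_extChartAt_symm p).isOpen_inter_preimage (isOpen_extChartAt_target p)
        (isOpen_extChartAt_source q)
    have : ((fun z => extChartAt 𝓘(ℂ, E) p ((extChartAt 𝓘(ℂ, E) q).symm z)) ∘ g) =ᶠ[𝓝 y] id := by
      filter_upwards [hO.mem_nhds ⟨hy, hq⟩] with z hz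
      simp only [hg, Function.comp_apply]
      rw [(extChartAt 𝓘(ℂ, E) q).left_inv hz.2, (extChartAt 𝓘(ℂ, E) p).right_inv hz.1]
      rfl
    rw [this.fderiv_eq, fderiv_id]
  have hunit : IsUnit (fderiv ℂ g y).toLinearMap := by
    have h4 : (fderiv ℂ (fun z => extChartAt 𝓘(ℂ, E) p ((extChartAt 𝓘(ℂ, E) q).symm z))
        (g y)).toLinearMap * (fderiv ℂ g y).toLinearMap = 1 :=
      congrArg ContinuousLinearMap.toLinearMap h3
    exact IsUnit.of_mul_eq_one_right _ h4
  have h5 : fderiv ℝ (fun z => extChartAt 𝓘(ℝ, E) q ((extChartAt 𝓘(ℝ, E) p).symm z)) y =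
      (fderiv ℂ g y).restrictScalars ℝ := (h1.hasFDerivAt.restrictScalars ℝ).fderiv
  rw [h5]
  exact det_restrictScalars_pos _ hunit

theorem orientedCharts_prod
    {E : Type*} [NormedAddCommGroup E] [NormedSpace ℝ E] [FiniteDimensional ℝ E]
    [NormedSpace ℂ E] [IsScalarTower ℝ ℂ E] [FiniteDimensional ℂ E]
    {H : Type*} [TopologicalSpace H] {I : ModelWithCorners ℝ E H} [I.Boundaryless]
    {M : Type*} [TopologicalSpace M] [ChartedSpace H M] [IsManifold I ∞ M] [T2Space M]
    [CompactSpace M]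
    {E' : Type*} [NormedAddCommGroup E'] [NormedSpace ℝ E'] [FiniteDimensional ℝ E']
    [NormedSpace ℂ E'] [IsScalarTower ℝ ℂ E'] [FiniteDimensional ℂ E']
    {H' : Type*} [TopologicalSpace H'] {J : ModelWithCorners ℝ E' H'} [J.Boundaryless]
    {N : Type*} [TopologicalSpace N] [ChartedSpace H' N] [IsManifold J ∞ N] [T2Space N]
    [CompactSpace N]
    (hI : OrientedCharts I M) (hJ : OrientedCharts J N) : OrientedCharts (I.prod J) (M × N) := by
  rintro ⟨p, p'⟩ ⟨q, q'⟩ ⟨y, y'⟩ hy hq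
  simp only [extChartAt_prod, PartialEquiv.prod_target, mem_prod] at hy
  simp only [extChartAt_prod, PartialEquiv.prod_symm, PartialEquiv.prod_source,
    PartialEquiv.prod_coe, mem_prod] at hq
  have h1 : ∀ {p q : M} {y : E}, y ∈ (extChartAt I p).target →
      (extChartAt I p).symm y ∈ (extChartAt I q).source →
      DifferentiableAt ℝ (fun z => extChartAt I q ((extChartAt I p).symm z)) y := by
    intro p q y hy hq
    exact ((contDiffOn_chartExpr I I contMDiff_id p q).contDiffAt
      ((isOpen_chartDomain I I continuous_id p q).mem_nhds ⟨hy, hq⟩)).differentiableAt (by simp)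
  have h2 : DifferentiableAt ℝ (fun z => extChartAt J q' ((extChartAt J p').symm z)) y' :=
    ((contDiffOn_chartExpr J J contMDiff_id p' q').contDiffAt
      ((isOpen_chartDomain J J continuous_id p' q').mem_nhds ⟨hy.2, hq.2⟩)).differentiableAt (by simp)
  have h3 := ((h1 hy.1 hq.1).hasFDerivAt.prodMap (y, y') h2.hasFDerivAt).fderiv
  have h4 : (fun z => extChartAt (I.prod J) (q, q') ((extChartAt (I.prod J) (p, p')).symm z)) =
      Prod.map (fun z => extChartAt I q ((extChartAt I p).symm z))
        (fun z => extChartAt J q' ((extChartAt J p').symm z)) := by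
    simp only [extChartAt_prod, PartialEquiv.prod_symm, PartialEquiv.prod_coe]
    rfl
  rw [h4, h3]
  have := mul_pos (hI p q y hy.1 hq.1) (hJ p' q' y' hy.2 hq.2)
  rw [ContinuousLinearMap.det, ContinuousLinearMap.det, ← LinearMap.det_prodMap] at this
  exact this

end Orientation

/-! ### Calculus with parameters -/

section ParamCalculus

variable {Q : Type*} [NormedAddCommGroup Q] [NormedSpace ℝ Q]
  {E : Type*} [NormedAddCommGroup E] [NormedSpace ℝ E]
  {E' : Type*} [NormedAddCommGroup E'] [NormedSpace ℝ E']
  {A : Type*} [NormedAddCommGroup A] [NormedSpace ℝ A]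
  {B : Type*} [NormedAddCommGroup B] [NormedSpace ℝ B]

/-- The iterated derivative with respect to the second variable. -/
def iterSnd (j : ℕ) (g : Q × E → A) (a : Q × E) : E [×j]→L[ℝ] A :=
  iteratedFDeriv ℝ j (fun u => g (a.1, u)) a.2

theorem hasFDerivAt_snd {g : Q × E → A} {a : Q × E} (hg : DifferentiableAt ℝ g a) :
    HasFDerivAt (fun u => g (a.1, u)) ((fderiv ℝ g a).comp (ContinuousLinearMap.inr ℝ Q E)) a.2 :=
  HasFDerivAt.comp a.2 (f := fun u => (a.1, u)) hg.hasFDerivAt (hasFDerivAt_prodMk_right a.1 a.2)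

theorem hasFDerivAt_fst' {g : Q × E → A} {a : Q × E} (hg : DifferentiableAt ℝ g a) :
    HasFDerivAt (fun q => g (q, a.2)) ((fderiv ℝ g a).comp (ContinuousLinearMap.inl ℝ Q E)) a.1 :=
  HasFDerivAt.comp a.1 (f := fun q => (q, a.2)) hg.hasFDerivAt (hasFDerivAt_prodMk_left a.1 a.2)

theorem iterSnd_succ (j : ℕ) (g : Q × E → A) (a : Q × E) : iterSnd (j + 1) g a =
    (continuousMultilinearCurryLeftEquiv ℝ (fun _ : Fin (j + 1) => E) A).symm
      (fderiv ℝ (fun u => iterSnd j g (a.1, u)) a.2) := rfl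

theorem iterSnd_zero (g : Q × E → A) :
    iterSnd 0 g = (continuousMultilinearCurryFin0 ℝ E A).symm ∘ g := by
  funext a
  simp only [iterSnd, iteratedFDeriv_zero_eq_comp, Function.comp_apply]

theorem contDiffOn_iterSnd {g : Q × E → A} {O : Set (Q × E)} (hO : IsOpen O)
    (hg : ContDiffOn ℝ ∞ g O) (j : ℕ) : ContDiffOn ℝ ∞ (iterSnd j g) O := by
  induction j with
  | zero =>
    rw [iterSnd_zero]
    exact (continuousMultilinearCurryFin0 ℝ E A).symm.contDiff.comp_contDiffOn hg
  | succ j ih =>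
    have h1 : ContDiffOn ℝ ∞ (fun a => (fderiv ℝ (iterSnd j g) a).comp
        (ContinuousLinearMap.inr ℝ Q E)) O :=
      (ih.fderiv_of_isOpen hO (m := ∞) (by simp)).clm_comp contDiffOn_const
    refine ((continuousMultilinearCurryLeftEquiv ℝ
      (fun _ : Fin (j + 1) => E) A).symm.contDiff.comp_contDiffOn h1).congr fun a ha => ?_
    have hd : DifferentiableAt ℝ (iterSnd j g) a :=
      (ih.contDiffAt (hO.mem_nhds ha)).differentiableAt (by simp)
    rw [iterSnd_succ, (hasFDerivAt_snd hd).fderiv]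
    rfl

theorem hasFDerivAt_clm_apply_const {X Y Z : Type*} [NormedAddCommGroup X] [NormedSpace ℝ X]
    [NormedAddCommGroup Y] [NormedSpace ℝ Y] [NormedAddCommGroup Z] [NormedSpace ℝ Z]
    {D : Z → Y →L[ℝ] X} {D' : Z →L[ℝ] Y →L[ℝ] X} {a : Z} (hD : HasFDerivAt D D' a) (h : Y) :
    HasFDerivAt (fun b => D b h) ((ContinuousLinearMap.apply ℝ X h).comp D') a :=
  (ContinuousLinearMap.apply ℝ X h).hasFDerivAt.comp a hD

theorem fderiv_comp_inr_apply {X Y : Type*} [NormedAddCommGroup X] [NormedSpace ℝ X]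
    [NormedAddCommGroup Y] [NormedSpace ℝ Y] (Φ : (E →L[ℝ] X) →L[ℝ] Y)
    {D : Q × E → (Q × E →L[ℝ] X)} {D' : Q × E →L[ℝ] (Q × E →L[ℝ] X)} {a : Q × E}
    (hD : HasFDerivAt D D' a) (h : Q × E) :
    fderiv ℝ (fun b => Φ ((D b).comp (ContinuousLinearMap.inr ℝ Q E))) a h =
      Φ ((D' h).comp (ContinuousLinearMap.inr ℝ Q E)) := by
  let Ψ : ((Q × E) →L[ℝ] X) →L[ℝ] (E →L[ℝ] X) :=
    (ContinuousLinearMap.compL ℝ E (Q × E) X).flip (ContinuousLinearMap.inr ℝ Q E)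
  have h1 : HasFDerivAt (fun b => Ψ (D b)) (Ψ.comp D') a := Ψ.hasFDerivAt.comp a hD
  have h2 : HasFDerivAt (fun b => Φ (Ψ (D b))) (Φ.comp (Ψ.comp D')) a := Φ.hasFDerivAt.comp a h1
  exact congrArg (fun l : Q × E →L[ℝ] Y => l h) h2.fderiv

theorem fderiv_iterSnd_inl {g : Q × E → A} {O : Set (Q × E)} (hO : IsOpen O)
    (hg : ContDiffOn ℝ ∞ g O) (h : Q) (j : ℕ) : ∀ a ∈ O,
    fderiv ℝ (iterSnd j g) a (h, 0) = iterSnd j (fun b => fderiv ℝ g b (h, 0)) a := by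
  induction j with
  | zero =>
    intro a ha
    have hd : DifferentiableAt ℝ g a := (hg.contDiffAt (hO.mem_nhds ha)).differentiableAt (by simp)
    rw [iterSnd_zero, iterSnd_zero]
    have := ((continuousMultilinearCurryFin0 ℝ E
      A).symm.toContinuousLinearEquiv.hasFDerivAt.comp a hd.hasFDerivAt).fderiv
    change fderiv ℝ ((continuousMultilinearCurryFin0 ℝ E A).symm.toContinuousLinearEquiv ∘ g) a
      (h, 0) = _
    rw [this]; rfl
  | succ j ih =>
    intro a ha
    set G := iterSnd j g with hG
    have hGs : ContDiffOn ℝ ∞ G O := contDiffOn_iterSnd hO hg j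
    have hGd : ∀ b ∈ O, DifferentiableAt ℝ G b := fun b hb =>
      (hGs.contDiffAt (hO.mem_nhds hb)).differentiableAt (by simp)
    have hDG : ContDiffOn ℝ ∞ (fderiv ℝ G) O := hGs.fderiv_of_isOpen hO (by simp)
    have hDGd : DifferentiableAt ℝ (fderiv ℝ G) a :=
      (hDG.contDiffAt (hO.mem_nhds ha)).differentiableAt (by simp)
    let Φ : (E →L[ℝ] E [×j]→L[ℝ] A) ≃L[ℝ] (E [×(j + 1)]→L[ℝ] A) :=
      (continuousMultilinearCurryLeftEquiv ℝ (fun _ : Fin (j + 1) => E)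
        A).symm.toContinuousLinearEquiv
    have e1 : iterSnd (j + 1) g =ᶠ[𝓝 a] fun b => Φ ((fderiv ℝ G b).comp
        (ContinuousLinearMap.inr ℝ Q E)) := by
      filter_upwards [hO.mem_nhds ha] with b hb
      rw [iterSnd_succ, (hasFDerivAt_snd (hGd b hb)).fderiv]
      rfl
    have hc := fderiv_comp_inr_apply Φ.toContinuousLinearMap hDGd.hasFDerivAt (h, 0)
    rw [e1.fderiv_eq]
    refine hc.trans ?_
    rw [iterSnd_succ]
    have e2 : (fun u => iterSnd j (fun b => fderiv ℝ g b (h, 0)) (a.1, u)) =ᶠ[𝓝 a.2]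
        fun u => fderiv ℝ G (a.1, u) (h, 0) := by
      have : (fun u : E => (a.1, u)) ⁻¹' O ∈ 𝓝 a.2 :=
        (hO.preimage (by fun_prop)).mem_nhds ha
      filter_upwards [this] with u hu
      exact (ih _ hu).symm
    have e3 := hasFDerivAt_clm_apply_const hDGd.hasFDerivAt (h, (0 : E))
    have e4 := hasFDerivAt_snd e3.differentiableAt
    rw [e2.fderiv_eq, e4.fderiv, e3.fderiv]
    have hsymm : IsSymmSndFDerivAt ℝ G a :=
      (hGs.contDiffAt (hO.mem_nhds ha)).isSymmSndFDerivAt (by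
        simpa using (ENat.LEInfty.out : (2 : WithTop ℕ∞) ≤ ∞))
    change Φ _ = Φ _
    congr 1
    ext1 w
    exact hsymm.eq (h, 0) (0, w)

/-- Differentiability in the parameter, uniformly on compact sets. -/
theorem eventually_norm_sub_sub_le {g : Q × E → A} {O : Set (Q × E)} (hO : IsOpen O)
    (hg : ContDiffOn ℝ ∞ g O) {q₀ : Q} {C : Set E} (hC : IsCompact C)
    (hCO : ∀ u ∈ C, (q₀, u) ∈ O) {ε : ℝ} (hε : 0 < ε) :
    ∀ᶠ q in 𝓝 q₀, ∀ u ∈ C,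
      ‖g (q, u) - g (q₀, u) - fderiv ℝ g (q₀, u) (q - q₀, 0)‖ ≤ ε * ‖q - q₀‖ := by
  refine hC.eventually_forall_of_forall_eventually fun u₀ hu₀ => ?_
  have hca := hg.contDiffAt (hO.mem_nhds (hCO u₀ hu₀))
  have hs : HasStrictFDerivAt g (fderiv ℝ g (q₀, u₀)) (q₀, u₀) :=
    hca.hasStrictFDerivAt (by simp)
  have h1 := hs.isLittleO.def (half_pos hε)
  have hfc : ContinuousAt (fderiv ℝ g) (q₀, u₀) :=
    ((hg.fderiv_of_isOpen hO (m := ∞) (by simp)).continuousOn).continuousAt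
      (hO.mem_nhds (hCO u₀ hu₀))
  have h2 : ∀ᶠ b in 𝓝 (q₀, u₀), ‖fderiv ℝ g b - fderiv ℝ g (q₀, u₀)‖ < ε / 2 := by
    have := Metric.continuousAt_iff'.1 hfc (ε / 2) (half_pos hε)
    simpa [dist_eq_norm] using this
  have hm1 : Tendsto (fun z : Q × E => ((z.1, z.2), (q₀, z.2))) (𝓝 (q₀, u₀))
      (𝓝 ((q₀, u₀), (q₀, u₀))) :=
    (Continuous.tendsto (by fun_prop) (q₀, u₀))
  have hm2 : Tendsto (fun z : Q × E => (q₀, z.2)) (𝓝 (q₀, u₀)) (𝓝 (q₀, u₀)) :=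
    (Continuous.tendsto (by fun_prop) (q₀, u₀))
  filter_upwards [hm1.eventually h1, hm2.eventually h2] with z hz1 hz2
  have e : ((z.1, z.2) : Q × E) - (q₀, z.2) = (z.1 - q₀, 0) := by
    rw [Prod.mk_sub_mk, sub_self]
  simp only [e] at hz1
  have hn : ‖((z.1 - q₀, 0) : Q × E)‖ = ‖z.1 - q₀‖ := by
    rw [Prod.norm_def]; simp
  rw [hn] at hz1
  calc ‖g (z.1, z.2) - g (q₀, z.2) - fderiv ℝ g (q₀, z.2) (z.1 - q₀, 0)‖
      = ‖(g (z.1, z.2) - g (q₀, z.2) - fderiv ℝ g (q₀, u₀) (z.1 - q₀, 0)) -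
        (fderiv ℝ g (q₀, z.2) - fderiv ℝ g (q₀, u₀)) (z.1 - q₀, 0)‖ := by
        congr 1
        simp only [sub_apply]
        abel
    _ ≤ ε / 2 * ‖z.1 - q₀‖ + ε / 2 * ‖z.1 - q₀‖ := by
        refine (norm_sub_le _ _).trans (add_le_add hz1 ?_)
        refine (ContinuousLinearMap.le_opNorm _ _).trans ?_
        rw [hn]
        gcongr
    _ = ε * ‖z.1 - q₀‖ := by ring

/-- Local bounds for the derivatives of `L(q, u) (f (ς(q, u)))` in terms of those of `f`. -/
theorem exists_norm_iteratedFDeriv_le {L : Q × E → B →L[ℝ] A} {ς : Q × E → E'}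
    {O : Set (Q × E)} (hO : IsOpen O) (hL : ContDiffOn ℝ ∞ L O) (hς : ContDiffOn ℝ ∞ ς O)
    {T : Set E'} (hT : IsOpen T) (hςT : MapsTo ς O T) {Z : Set (Q × E)} (hZ : IsCompact Z)
    (hZO : Z ⊆ O) (j : ℕ) : ∃ c : ℝ, 0 ≤ c ∧ ∀ a ∈ Z, ∀ f : E' → B, ContDiffOn ℝ ∞ f T →
      ∀ N : ℝ, (∀ i ≤ j, ‖iteratedFDeriv ℝ i f (ς a)‖ ≤ N) →
        ‖iteratedFDeriv ℝ j (fun u => L (a.1, u) (f (ς (a.1, u)))) a.2‖ ≤ c * N := by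
  have hLb : ∀ i, ∃ D : ℝ, 0 ≤ D ∧ ∀ a ∈ Z, ‖iterSnd i L a‖ ≤ D := by
    intro i
    obtain ⟨D, hD⟩ := hZ.exists_bound_of_continuousOn
      ((contDiffOn_iterSnd hO hL i).continuousOn.mono hZO)
    exact ⟨max D 0, le_max_right _ _, fun a ha => (hD a ha).trans (le_max_left _ _)⟩
  have hςb : ∀ i, ∃ D : ℝ, 0 ≤ D ∧ ∀ a ∈ Z, ‖iterSnd i ς a‖ ≤ D := by
    intro i
    obtain ⟨D, hD⟩ := hZ.exists_bound_of_continuousOn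
      ((contDiffOn_iterSnd hO hς i).continuousOn.mono hZO)
    exact ⟨max D 0, le_max_right _ _, fun a ha => (hD a ha).trans (le_max_left _ _)⟩
  choose DL hDL0 hDL using hLb
  choose Dς hDς0 hDς using hςb
  set D : ℝ := 1 + ∑ i ∈ Finset.range (j + 1), Dς i with hD
  have hD1 : 1 ≤ D := le_add_of_nonneg_right (Finset.sum_nonneg fun i _ => hDς0 i)
  have hDi : ∀ i ≤ j, Dς i ≤ D := by
    intro i hi
    have : Dς i ≤ ∑ i ∈ Finset.range (j + 1), Dς i :=
      Finset.single_le_sum (fun i _ => hDς0 i) (Finset.mem_range.2 (by omega))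
    linarith
  refine ⟨∑ i ∈ Finset.range (j + 1), (j.choose i : ℝ) * DL i * ((j - i).factorial * D ^ (j - i)),
    Finset.sum_nonneg fun i _ => by have := hDL0 i; positivity, fun a ha f hf N hN => ?_⟩
  set V : Set E := (fun u => (a.1, u)) ⁻¹' O with hV
  have hVo : IsOpen V := hO.preimage (by fun_prop)
  have haV : a.2 ∈ V := hZO ha
  have hmaps : MapsTo (fun u : E => (a.1, u)) V O := fun u hu => hu
  have hin : ContDiffOn ℝ ∞ (fun u : E => (a.1, u)) V :=
    (contDiff_const.prodMk contDiff_id).contDiffOn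
  have hςV : ContDiffOn ℝ ∞ (fun u => ς (a.1, u)) V := hς.comp hin hmaps
  have hLV : ContDiffOn ℝ ∞ (fun u => L (a.1, u)) V := hL.comp hin hmaps
  have hmT : MapsTo (fun u => ς (a.1, u)) V T := hςT.comp hmaps
  have hfς : ContDiffOn ℝ ∞ (fun u => f (ς (a.1, u))) V := hf.comp hςV hmT
  have h1 : ∀ m ≤ j, ‖iteratedFDerivWithin ℝ m (fun u => f (ς (a.1, u))) V a.2‖ ≤
      m.factorial * N * D ^ m := by
    intro m hm
    refine norm_iteratedFDerivWithin_comp_le (g := f) (t := T) hf hςV (N := ∞)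
      (by exact_mod_cast le_top) hT.uniqueDiffOn hVo.uniqueDiffOn hmT haV ?_ ?_
    · intro i hi
      rw [iteratedFDerivWithin_of_isOpen i hT (hmT haV)]
      exact hN i (hi.trans hm)
    · intro i hi1 hi
      rw [iteratedFDerivWithin_of_isOpen i hVo haV]
      exact (hDς i a ha).trans ((hDi i (hi.trans hm)).trans (le_self_pow₀ hD1 (by omega)))
  rw [← iteratedFDerivWithin_of_isOpen j hVo haV]
  refine (norm_iteratedFDerivWithin_clm_apply (N := ∞) hLV hfς hVo.uniqueDiffOn haV
    (by exact_mod_cast le_top)).trans ?_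
  rw [Finset.sum_mul]
  refine Finset.sum_le_sum fun i hi => ?_
  have h2 : ‖iteratedFDerivWithin ℝ i (fun u => L (a.1, u)) V a.2‖ ≤ DL i := by
    rw [iteratedFDerivWithin_of_isOpen i hVo haV]
    exact hDL i a ha
  have h3 := h1 (j - i) (Nat.sub_le _ _)
  calc _ ≤ (j.choose i : ℝ) * DL i * ((j - i).factorial * N * D ^ (j - i)) := by
        have := hDL0 i
        gcongr
    _ = _ := by ring

end ParamCalculus

section ParamIntegral

variable {Y : Type*} [NormedAddCommGroup Y] [NormedSpace ℝ Y] [FiniteDimensional ℝ Y]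
  [MeasurableSpace Y] [BorelSpace Y] (μ : Measure Y) [IsFiniteMeasureOnCompacts μ]
  {E : Type*} [NormedAddCommGroup E] [NormedSpace ℝ E] [FiniteDimensional ℝ E]
  {A : Type*} [NormedAddCommGroup A] [NormedSpace ℝ A]

theorem fderiv_eq_zero_of_notMem {U : Set E} (hU : IsOpen U) {g : Y × E → A} {K : Set Y}
    (hK : IsClosed K) (h0 : ∀ y ∉ K, ∀ u ∈ U, g (y, u) = 0) {y : Y} (hy : y ∉ K) {u : E}
    (hu : u ∈ U) : fderiv ℝ g (y, u) = 0 := by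
  have : g =ᶠ[𝓝 (y, u)] fun _ => 0 := by
    filter_upwards [(hK.isOpen_compl.prod hU).mem_nhds (⟨hy, hu⟩ : (y, u) ∈ Kᶜ ×ˢ U)] with b hb
    exact h0 _ hb.1 _ hb.2
  rw [this.fderiv_eq]; simp

theorem integrable_of_compact_param {U : Set E} {g : Y × E → A}
    (hg : ContinuousOn g (univ ×ˢ U)) {K : Set Y} (hK : IsCompact K)
    (h0 : ∀ y ∉ K, ∀ u ∈ U, g (y, u) = 0) {u : E} (hu : u ∈ U) :
    Integrable (fun y => g (y, u)) μ := by
  refine Continuous.integrable_of_hasCompactSupport ?_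
    (HasCompactSupport.intro hK fun y hy => h0 y hy u hu)
  have : ContinuousOn (fun y => g (y, u)) univ :=
    hg.comp (Continuous.continuousOn (by fun_prop)) fun y _ => ⟨mem_univ _, hu⟩
  exact continuousOn_univ.1 this

theorem hasFDerivAt_integral_param {U : Set E} (hU : IsOpen U) {g : Y × E → A}
    (hg : ContDiffOn ℝ ∞ g (univ ×ˢ U)) {K : Set Y} (hK : IsCompact K)
    (h0 : ∀ y ∉ K, ∀ u ∈ U, g (y, u) = 0) {u : E} (hu : u ∈ U) :
    HasFDerivAt (fun u => ∫ y, g (y, u) ∂μ)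
      (∫ y, (fderiv ℝ g (y, u)).comp (ContinuousLinearMap.inr ℝ Y E) ∂μ) u := by
  have hO : IsOpen (univ ×ˢ U : Set (Y × E)) := isOpen_univ.prod hU
  have hD : ContinuousOn (fun a => (fderiv ℝ g a).comp (ContinuousLinearMap.inr ℝ Y E))
      (univ ×ˢ U) :=
    ((hg.fderiv_of_isOpen hO (m := ∞) (by simp)).clm_comp contDiffOn_const).continuousOn
  obtain ⟨V, hVc, hVu, hVU⟩ : ∃ V : Set E, IsCompact V ∧ V ∈ 𝓝 u ∧ V ⊆ U := by
    obtain ⟨V, hV, hVU, hVc⟩ := local_compact_nhds (hU.mem_nhds hu)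
    exact ⟨V, hVc, hV, hVU⟩
  have hKV : IsCompact (K ×ˢ V) := hK.prod hVc
  obtain ⟨c, hc⟩ := hKV.exists_bound_of_continuousOn
    (hD.mono fun a ha => ⟨mem_univ _, hVU ha.2⟩)
  have hD0 : ∀ y ∉ K, ∀ u ∈ U, (fderiv ℝ g (y, u)).comp (ContinuousLinearMap.inr ℝ Y E) = 0 := by
    intro y hy u hu
    rw [fderiv_eq_zero_of_notMem hU hK.isClosed h0 hy hu, ContinuousLinearMap.zero_comp]
  refine hasFDerivAt_integral_of_dominated_of_fderiv_le (s := V)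
    (F := fun u y => g (y, u))
    (F' := fun u y => (fderiv ℝ g (y, u)).comp (ContinuousLinearMap.inr ℝ Y E))
    (bound := K.indicator fun _ => c) hVu ?_ ?_ ?_ ?_ ?_ ?_
  · filter_upwards [hU.mem_nhds hu] with v hv
    exact (integrable_of_compact_param μ hg.continuousOn hK h0 hv).aestronglyMeasurable
  · exact integrable_of_compact_param μ hg.continuousOn hK h0 hu
  · exact (integrable_of_compact_param μ hD hK hD0 hu).aestronglyMeasurable
  · refine Eventually.of_forall fun y v hv => ?_
    by_cases hy : y ∈ K
    · rw [indicator_of_mem hy]; exact hc (y, v) ⟨hy, hv⟩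
    · rw [indicator_of_notMem hy, hD0 y hy v (hVU hv), norm_zero]
  · exact (integrable_indicator_iff hK.measurableSet).2
      (integrableOn_const hK.measure_lt_top.ne)
  · refine Eventually.of_forall fun y v hv => ?_
    have hd : DifferentiableAt ℝ g (y, v) :=
      (hg.contDiffAt (hO.mem_nhds ⟨mem_univ _, hVU hv⟩)).differentiableAt (by simp)
    exact hasFDerivAt_snd hd

theorem contDiffOn_integral_param {U : Set E} (hU : IsOpen U) {g : Y × E → A}
    (hg : ContDiffOn ℝ ∞ g (univ ×ˢ U)) {K : Set Y} (hK : IsCompact K)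
    (h0 : ∀ y ∉ K, ∀ u ∈ U, g (y, u) = 0) : ContDiffOn ℝ ∞ (fun u => ∫ y, g (y, u) ∂μ) U := by
  have hO : IsOpen (univ ×ˢ U : Set (Y × E)) := isOpen_univ.prod hU
  rw [contDiffOn_infty]
  intro n
  induction n generalizing g with
  | zero =>
    exact contDiffOn_zero.2 fun u hu =>
      (hasFDerivAt_integral_param μ hU hg hK h0 hu).continuousAt.continuousWithinAt
  | succ n ih =>
    push_cast
    rw [contDiffOn_succ_iff_fderiv_apply hU.uniqueDiffOn]
    refine ⟨fun u hu =>
      (hasFDerivAt_integral_param μ hU hg hK h0 hu).differentiableAt.differentiableWithinAt,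
      fun h => absurd h (by simp), fun w => ?_⟩
    have hD : ContDiffOn ℝ ∞ (fun a => (fderiv ℝ g a).comp (ContinuousLinearMap.inr ℝ Y E))
      (univ ×ˢ U) := (hg.fderiv_of_isOpen hO (m := ∞) (by simp)).clm_comp contDiffOn_const
    have hD0 : ∀ y ∉ K, ∀ u ∈ U, (fderiv ℝ g (y, u)).comp (ContinuousLinearMap.inr ℝ Y E) = 0 := by
      intro y hy u hu
      rw [fderiv_eq_zero_of_notMem hU hK.isClosed h0 hy hu, ContinuousLinearMap.zero_comp]
    have h1 := ih (g := fun a => (fderiv ℝ g a).comp (ContinuousLinearMap.inr ℝ Y E) w)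
      (hD.clm_apply contDiffOn_const) (fun y hy u hu => by rw [hD0 y hy u hu]; rfl)
    refine h1.congr fun u hu => ?_
    rw [fderivWithin_of_isOpen hU hu, (hasFDerivAt_integral_param μ hU hg hK h0 hu).fderiv,
      ContinuousLinearMap.integral_apply (integrable_of_compact_param μ hD.continuousOn hK hD0 hu)]

theorem iteratedFDeriv_integral_param {U : Set E} (hU : IsOpen U) {g : Y × E → A}
    (hg : ContDiffOn ℝ ∞ g (univ ×ˢ U)) {K : Set Y} (hK : IsCompact K)
    (h0 : ∀ y ∉ K, ∀ u ∈ U, g (y, u) = 0) (j : ℕ) : ∀ u ∈ U,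
      iteratedFDeriv ℝ j (fun u => ∫ y, g (y, u) ∂μ) u = ∫ y, iterSnd j g (y, u) ∂μ := by
  have hO : IsOpen (univ ×ˢ U : Set (Y × E)) := isOpen_univ.prod hU
  have hI0 : ∀ j, ∀ y ∉ K, ∀ u ∈ U, iterSnd j g (y, u) = 0 := by
    intro j y hy u hu
    have : (fun u => g (y, u)) =ᶠ[𝓝 u] fun _ => 0 := by
      filter_upwards [hU.mem_nhds hu] with v hv
      exact h0 y hy v hv
    simp only [iterSnd]
    rw [(this.iteratedFDeriv (𝕜 := ℝ) j).eq_of_nhds]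
    simp
  induction j with
  | zero =>
    intro u hu
    rw [iterSnd_zero]
    simp only [iteratedFDeriv_zero_eq_comp, Function.comp_apply]
    exact ((continuousMultilinearCurryFin0 ℝ E
      A).symm.toContinuousLinearEquiv.integral_comp_comm (μ := μ) fun y => g (y, u)).symm
  | succ j ih =>
    intro u hu
    have e : iteratedFDeriv ℝ j (fun u => ∫ y, g (y, u) ∂μ) =ᶠ[𝓝 u]
        fun u => ∫ y, iterSnd j g (y, u) ∂μ := by
      filter_upwards [hU.mem_nhds hu] with v hv
      exact ih v hv
    have hd := hasFDerivAt_integral_param μ hU (contDiffOn_iterSnd hO hg j) hK (hI0 j) hu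
    rw [iteratedFDeriv_succ_eq_comp_left, Function.comp_apply, e.fderiv_eq, hd.fderiv]
    refine (ContinuousLinearEquiv.integral_comp_comm (𝕜 := ℝ) (E := E →L[ℝ] E [×j]→L[ℝ] A)
      (F := E [×(j + 1)]→L[ℝ] A) (μ := μ)
      (continuousMultilinearCurryLeftEquiv ℝ (fun _ : Fin (j + 1) => E)
        A).symm.toContinuousLinearEquiv _).symm.trans ?_
    congr 1
    funext y
    rw [iterSnd_succ]
    have hd : DifferentiableAt ℝ (iterSnd j g) (y, u) :=
      ((contDiffOn_iterSnd hO hg j).contDiffAt (hO.mem_nhds ⟨mem_univ _, hu⟩)).differentiableAt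
        (by simp)
    rw [(hasFDerivAt_snd hd).fderiv]
    rfl

end ParamIntegral

/-! ### The topology of the space of forms -/

/-- A linear functional bounded by the norm of a linear map into a normed space factors through
it (Hahn–Banach). -/
theorem exists_factor_of_bound {V X : Type*} [AddCommGroup V] [Module ℝ V] [NormedAddCommGroup X]
    [NormedSpace ℝ X] (J : V →ₗ[ℝ] X) (T : V →ₗ[ℝ] ℝ) {c : ℝ} (hc : 0 ≤ c)
    (h : ∀ v, ‖T v‖ ≤ c * ‖J v‖) : ∃ S : X →L[ℝ] ℝ, ‖S‖ ≤ c ∧ ∀ v, S (J v) = T v := by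
  have hker : LinearMap.ker J ≤ LinearMap.ker T := fun v hv => by
    have := h v
    rw [LinearMap.mem_ker.1 hv, norm_zero, mul_zero] at this
    exact norm_eq_zero.1 (le_antisymm this (norm_nonneg _))
  let f : LinearMap.range J →ₗ[ℝ] ℝ :=
    ((LinearMap.ker J).liftQ T hker).comp J.quotKerEquivRange.symm.toLinearMap
  have hf : ∀ v, f ⟨J v, v, rfl⟩ = T v := by
    intro v
    have e : J.quotKerEquivRange.symm ⟨J v, v, rfl⟩ = (LinearMap.ker J).mkQ v := by
      rw [LinearEquiv.symm_apply_eq]; rfl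
    simp only [f, LinearMap.comp_apply, LinearEquiv.coe_coe, e]
    rfl
  let g : LinearMap.range J →L[ℝ] ℝ := f.mkContinuous c (by
    rintro ⟨_, v, rfl⟩
    rw [hf]
    exact h v)
  obtain ⟨S, hS, hn⟩ := exists_extension_norm_eq (LinearMap.range J) g
  refine ⟨S, hn.trans_le (LinearMap.mkContinuous_norm_le _ hc _), fun v => ?_⟩
  exact (hS ⟨J v, v, rfl⟩).trans (hf v)

section Jets

variable {E : Type*} [NormedAddCommGroup E] [NormedSpace ℝ E] [FiniteDimensional ℝ E]
  {H : Type*} [TopologicalSpace H] (I : ModelWithCorners ℝ E H) [I.Boundaryless]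
  {M : Type*} [TopologicalSpace M] [ChartedSpace H M] [IsManifold I ∞ M]
  {E' : Type*} [NormedAddCommGroup E'] [NormedSpace ℝ E'] [FiniteDimensional ℝ E']
  {H' : Type*} [TopologicalSpace H'] (J : ModelWithCorners ℝ E' H') [J.Boundaryless]
  {N : Type*} [TopologicalSpace N] [ChartedSpace H' N] [IsManifold J ∞ N]
  {F : Type*} [NormedAddCommGroup F] [NormedSpace ℝ F]
  {Q : Type*} [NormedAddCommGroup Q] [NormedSpace ℝ Q] [FiniteDimensional ℝ Q]

variable (E) in
/-- The values of the derivatives of order `j` of alternating forms of degree `k`. -/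
def JetSpace (k j : ℕ) : Type _ := E [×j]→L[ℝ] (E [⋀^Fin k]→L[ℝ] ℝ)

instance (k j : ℕ) : NormedAddCommGroup (JetSpace E k j) :=
  inferInstanceAs (NormedAddCommGroup (E [×j]→L[ℝ] (E [⋀^Fin k]→L[ℝ] ℝ)))

instance (k j : ℕ) : NormedSpace ℝ (JetSpace E k j) :=
  inferInstanceAs (NormedSpace ℝ (E [×j]→L[ℝ] (E [⋀^Fin k]→L[ℝ] ℝ)))

instance (k j : ℕ) : CompleteSpace (JetSpace E k j) := by
  have := finiteDimensional_cam (V := E) k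
  have : CompleteSpace (E [⋀^Fin k]→L[ℝ] ℝ) := FiniteDimensional.complete ℝ _
  exact inferInstanceAs (CompleteSpace (E [×j]→L[ℝ] (E [⋀^Fin k]→L[ℝ] ℝ)))

variable (M) in
/-- The data of a seminorm of the `C^∞` topology: a degree, a chart, an order of derivation and a
compact subset of the chart. -/
structure JetIdx where
  deg : ℕ
  center : M
  order : ℕ
  carrier : Set E
  isCompact : IsCompact carrier
  subset : carrier ⊆ (extChartAt I center).target

instance (i : JetIdx I M) : CompactSpace i.carrier := isCompact_iff_compactSpace.1 i.isCompact

theorem continuousOn_iteratedFDeriv_chartRep {k : ℕ} (θ : KForm I M k) (p : M) (j : ℕ) :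
    ContinuousOn (iteratedFDeriv ℝ j (chartRep I p θ.1)) (extChartAt I p).target := by
  have hO := isOpen_extChartAt_target (I := I) p
  refine ((θ.2 p).continuousOn_iteratedFDerivWithin (m := j) (by exact_mod_cast le_top)
    hO.uniqueDiffOn).congr fun y hy => ?_
  exact (iteratedFDerivWithin_of_isOpen j hO hy).symm

/-- The jet of a form along a compact subset of a chart. -/
def jetLM (i : JetIdx I M) :
    Form I M →ₗ[ℝ] C(i.carrier, JetSpace E i.deg i.order) where
  toFun φ := ⟨fun u : i.carrier => (iteratedFDeriv ℝ i.order (chartRep I i.center (φ i.deg).1) u.1 :),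
    continuousOn_iff_continuous_domRestrict.1
      ((continuousOn_iteratedFDeriv_chartRep I (φ i.deg) i.center i.order).mono i.subset)⟩
  map_add' φ ψ := by
    ext1 u
    exact iteratedFDeriv_add_apply
      (((φ i.deg).contDiffAt I i.center (i.subset u.2)).of_le (by exact_mod_cast le_top))
      (((ψ i.deg).contDiffAt I i.center (i.subset u.2)).of_le (by exact_mod_cast le_top))
  map_smul' c φ := by
    ext1 u
    exact iteratedFDeriv_const_smul_apply (𝕜 := ℝ) (R := ℝ) (F := E [⋀^Fin i.deg]→L[ℝ] ℝ)
      (((φ i.deg).contDiffAt I i.center (i.subset u.2)).of_le (by exact_mod_cast le_top))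

theorem jetLM_apply (i : JetIdx I M) (φ : Form I M) (u : i.carrier) : jetLM I i φ u =
    iteratedFDeriv ℝ i.order (chartRep I i.center (φ i.deg).1) u := rfl

/-- The seminorms of the `C^∞` topology. -/
def jetNorm (i : JetIdx I M) (φ : Form I M) : ℝ := ‖jetLM I i φ‖

theorem jetNorm_nonneg (i : JetIdx I M) (φ : Form I M) : 0 ≤ jetNorm I i φ := norm_nonneg _

theorem le_jetNorm (i : JetIdx I M) (φ : Form I M) {u : E} (hu : u ∈ i.carrier) :
    ‖iteratedFDeriv ℝ i.order (chartRep I i.center (φ i.deg).1) u‖ ≤ jetNorm I i φ :=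
  (jetLM I i φ).norm_coe_le_norm ⟨u, hu⟩

theorem jetNorm_le (i : JetIdx I M) {φ : Form I M} {c : ℝ} (hc : 0 ≤ c)
    (h : ∀ u ∈ i.carrier,
      ‖iteratedFDeriv ℝ i.order (chartRep I i.center (φ i.deg).1) u‖ ≤ c) : jetNorm I i φ ≤ c :=
  (ContinuousMap.norm_le _ hc).2 fun u => h u.1 u.2

theorem isInducing_coe_uniformFun {K W : Type*} [TopologicalSpace K] [CompactSpace K]
    [NormedAddCommGroup W] :
    IsInducing (fun f : C(K, W) => UniformFun.ofFun (f : K → W)) :=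
  BoundedContinuousFunction.isInducing_coeFn.comp
    (ContinuousMap.isUniformEmbedding_equivBoundedOfCompact K W).isInducing

theorem form_topology_eq : (Pi.topologicalSpace : TopologicalSpace (Form I M)) =
    ⨅ i : JetIdx I M, TopologicalSpace.induced (jetLM I i) inferInstance := by
  have key : ∀ i : JetIdx I M, TopologicalSpace.induced (jetLM I i) inferInstance =
      TopologicalSpace.induced (fun φ : Form I M => UniformFun.ofFun (i.carrier.domRestrict
        (iteratedFDeriv ℝ i.order (chartRep I i.center (φ i.deg).1))))
        (UniformFun.topologicalSpace _ _) := by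
    intro i
    rw [isInducing_coe_uniformFun.eq_induced, induced_compose]
    rfl
  have h : (Pi.topologicalSpace : TopologicalSpace (Form I M)) =
      ⨅ (k : ℕ) (p : M) (j : ℕ) (C : Set E)
      (_ : C ∈ {C : Set E | IsCompact C ∧ C ⊆ (extChartAt I p).target}),
      TopologicalSpace.induced (fun φ : Form I M => UniformFun.ofFun (C.domRestrict
        (iteratedFDeriv ℝ j (chartRep I p (φ k).1)))) (UniformFun.topologicalSpace _ _) := by
    simp only [Pi.topologicalSpace, instTopologicalSpaceKForm, UniformOnFun.topologicalSpace_eq,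
      induced_iInf, induced_compose]
    rfl
  rw [h]
  refine le_antisymm (le_iInf fun i => ?_) (le_iInf fun k => le_iInf fun p => le_iInf fun j =>
    le_iInf fun C => le_iInf fun hC => ?_)
  · rw [key]
    exact iInf_le_of_le i.deg <| iInf_le_of_le i.center <| iInf_le_of_le i.order <|
      iInf_le_of_le i.carrier <| iInf_le_of_le ⟨i.isCompact, i.subset⟩ le_rfl
  · refine iInf_le_of_le ⟨k, p, j, C, hC.1, hC.2⟩ ?_
    rw [key]

theorem form_withSeminorms : WithSeminorms (𝕜 := ℝ) (E := Form I M)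
    (SeminormFamily.sigma fun i : JetIdx I M =>
      SeminormFamily.comp (fun _ : Fin 1 => normSeminorm ℝ _) (jetLM I i)) := by
  have := withSeminorms_iInf (𝕜 := ℝ) (E := Form I M)
    (t := fun i : JetIdx I M => TopologicalSpace.induced (jetLM I i) inferInstance)
    (p := fun i : JetIdx I M =>
      SeminormFamily.comp (fun _ : Fin 1 => normSeminorm ℝ _) (jetLM I i))
    fun i => LinearMap.withSeminorms_induced (norm_withSeminorms ℝ _) (jetLM I i)
  rwa [← form_topology_eq] at this

/-- A nonnegative function of forms is controlled by finitely many jets of order at most `n`. -/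
def JetBound (n : ℕ∞) (f : Form I M → ℝ) : Prop :=
  ∃ s : Finset (JetIdx I M), (∀ i ∈ s, (i.order : ℕ∞) ≤ n) ∧ ∃ c : ℝ, 0 ≤ c ∧
    ∀ φ, f φ ≤ c * ∑ i ∈ s, jetNorm I i φ

theorem sum_jetNorm_nonneg (s : Finset (JetIdx I M)) (φ : Form I M) :
    0 ≤ ∑ i ∈ s, jetNorm I i φ := Finset.sum_nonneg fun i _ => jetNorm_nonneg I i φ

theorem jetBound_jetNorm (i : JetIdx I M) : JetBound I i.order (jetNorm I i) :=
  ⟨{i}, by simp, 1, zero_le_one, fun φ => by simp⟩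

variable {I} in
theorem JetBound.mono {n : ℕ∞} {f g : Form I M → ℝ} (hg : JetBound I n g) (h : ∀ φ, f φ ≤ g φ) :
    JetBound I n f := by
  obtain ⟨s, hs, c, hc, hb⟩ := hg
  exact ⟨s, hs, c, hc, fun φ => (h φ).trans (hb φ)⟩

variable {I} in
theorem JetBound.mono_order {n m : ℕ∞} {f : Form I M → ℝ} (hf : JetBound I n f) (h : n ≤ m) :
    JetBound I m f := by
  obtain ⟨s, hs, c, hc, hb⟩ := hf
  exact ⟨s, fun i hi => (hs i hi).trans h, c, hc, hb⟩

open scoped Classical in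
variable {I} in
theorem JetBound.add {n : ℕ∞} {f g : Form I M → ℝ} (hf : JetBound I n f) (hg : JetBound I n g) :
    JetBound I n (fun φ => f φ + g φ) := by
  obtain ⟨s, hs, c, hc, hb⟩ := hf
  obtain ⟨s', hs', c', hc', hb'⟩ := hg
  refine ⟨s ∪ s', fun i hi => (Finset.mem_union.1 hi).elim (hs i) (hs' i), c + c',
    add_nonneg hc hc', fun φ => ?_⟩
  rw [add_mul]
  refine add_le_add ((hb φ).trans ?_) ((hb' φ).trans ?_)
  · exact mul_le_mul_of_nonneg_left (Finset.sum_le_sum_of_subset_of_nonneg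
      Finset.subset_union_left fun i _ _ => jetNorm_nonneg I i φ) hc
  · exact mul_le_mul_of_nonneg_left (Finset.sum_le_sum_of_subset_of_nonneg
      Finset.subset_union_right fun i _ _ => jetNorm_nonneg I i φ) hc'

variable {I} in
theorem JetBound.const_mul {n : ℕ∞} {f : Form I M → ℝ} (hf : JetBound I n f) {a : ℝ} (ha : 0 ≤ a) :
    JetBound I n (fun φ => a * f φ) := by
  obtain ⟨s, hs, c, hc, hb⟩ := hf
  refine ⟨s, hs, a * c, mul_nonneg ha hc, fun φ => ?_⟩
  rw [mul_assoc]
  exact mul_le_mul_of_nonneg_left (hb φ) ha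

theorem jetBound_zero (n : ℕ∞) : JetBound I n (fun _ : Form I M => 0) :=
  ⟨∅, by simp, 0, le_rfl, fun φ => by simp⟩

open scoped Classical in
variable {I} in
theorem JetBound.sum {n : ℕ∞} {ι : Type*} {s : Finset ι} {f : ι → Form I M → ℝ}
    (hf : ∀ i ∈ s, JetBound I n (f i)) : JetBound I n (fun φ => ∑ i ∈ s, f i φ) := by
  induction s using Finset.induction_on with
  | empty => simpa using jetBound_zero I n
  | insert a s ha ih =>
    simp only [Finset.sum_insert ha]
    exact (hf a (Finset.mem_insert_self _ _)).add
      (ih fun i hi => hf i (Finset.mem_insert_of_mem hi))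

open scoped Classical in
theorem jetBound_of_continuous (T : Form I M →L[ℝ] F) : JetBound I ⊤ (fun φ => ‖T φ‖) := by
  obtain ⟨s, C, -, hC⟩ := Seminorm.bound_of_continuous (form_withSeminorms I)
    ((normSeminorm ℝ F).comp T.toLinearMap) (continuous_norm.comp T.continuous)
  refine ⟨s.image Sigma.fst, fun i _ => le_top, C, C.2, fun φ => (hC φ).trans ?_⟩
  rw [smul_apply]
  refine mul_le_mul_of_nonneg_left ?_ C.2
  refine Seminorm.finset_sup_apply_le (sum_jetNorm_nonneg I _ φ) fun i hi => ?_
  exact Finset.single_le_sum (f := fun i => jetNorm I i φ) (fun i _ => jetNorm_nonneg I i φ)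
    (Finset.mem_image_of_mem Sigma.fst hi)

theorem continuous_jetLM (i : JetIdx I M) : Continuous (jetLM I i) := by
  rw [form_topology_eq]
  exact continuous_iInf_dom (i := i) continuous_induced_dom

variable {I} in
/-- A linear map bounded by jets is continuous. -/
theorem JetBound.continuous {n : ℕ∞} {T : Form I M →ₗ[ℝ] F} (h : JetBound I n (fun φ => ‖T φ‖)) :
    Continuous T := by
  obtain ⟨s, -, c, hc, hb⟩ := h
  have hcont : Continuous fun φ : Form I M => c * ∑ i ∈ s, jetNorm I i φ :=
    continuous_const.mul (continuous_finsetSum _ fun i _ => (continuous_jetLM I i).norm)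
  have : IsTopologicalAddGroup (Form I M) := (form_withSeminorms I).topologicalAddGroup
  refine continuous_of_continuousAt_zero T ?_
  rw [ContinuousAt, map_zero]
  refine squeeze_zero_norm hb ?_
  have := hcont.tendsto 0
  simpa [jetNorm] using this

/-! #### Smooth families of forms -/

/-- Families of forms that are jointly smooth in the charts. -/
def SmoothFamilyOn (O : Set Q) (Φ : Q → Form I M) : Prop :=
  ∀ (k : ℕ) (p : M), ContDiffOn ℝ ∞ (fun a : Q × E => chartRep I p (Φ a.1 k).1 a.2)
    (O ×ˢ (extChartAt I p).target)

theorem isOpen_prod_target {O : Set Q} (hO : IsOpen O) (p : M) :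
    IsOpen (O ×ˢ (extChartAt I p).target) := hO.prod (isOpen_extChartAt_target p)

variable {I} in
theorem SmoothFamilyOn.differentiableAt_chartRep {O : Set Q} {Φ : Q → Form I M}
    (hΦ : SmoothFamilyOn I O Φ) (hO : IsOpen O) {q : Q} (hq : q ∈ O) (k : ℕ) (p : M) {y : E}
    (hy : y ∈ (extChartAt I p).target) :
    DifferentiableAt ℝ (fun a : Q × E => chartRep I p (Φ a.1 k).1 a.2) (q, y) :=
  ((hΦ k p).contDiffAt ((isOpen_prod_target I hO p).mem_nhds ⟨hq, hy⟩)).differentiableAt (by simp)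

/-- Composition with a linear map, as a continuous linear map of alternating forms. -/
def camComp (k : ℕ) (A : E →L[ℝ] E') : (E' [⋀^Fin k]→L[ℝ] ℝ) →L[ℝ] (E [⋀^Fin k]→L[ℝ] ℝ) :=
  have := finiteDimensional_cam (V := E') k
  LinearMap.toContinuousLinearMap
    { toFun := fun α => α.compContinuousLinearMap A
      map_add' := fun _ _ => rfl
      map_smul' := fun _ _ => rfl }

@[simp] theorem camComp_apply (k : ℕ) (A : E →L[ℝ] E') (α : E' [⋀^Fin k]→L[ℝ] ℝ) :
    camComp k A α = α.compContinuousLinearMap A := rfl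

variable {I} in
theorem SmoothFamilyOn.differentiableAt_val {O : Set Q} {Φ : Q → Form I M}
    (hΦ : SmoothFamilyOn I O Φ) (hO : IsOpen O) {q : Q} (hq : q ∈ O) (k : ℕ) (x : M) :
    DifferentiableAt ℝ (fun q => (Φ q k).1 x) q := by
  have h1 := (hasFDerivAt_fst' (hΦ.differentiableAt_chartRep hO hq k x
    (mem_extChartAt_target x))).differentiableAt
  have h2 := (camComp k (diffAt I 𝓘(ℝ, E) (extChartAt I x) x)).differentiableAt.comp q h1
  refine h2.congr_of_eventuallyEq (Eventually.of_forall fun q => ?_)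
  exact eq_chartRep_comp I (Φ q k).1 x (mem_extChartAt_source x)

variable {I} in
theorem SmoothFamilyOn.chartRep_fderiv {O : Set Q} {Φ : Q → Form I M}
    (hΦ : SmoothFamilyOn I O Φ) (hO : IsOpen O) {q : Q} (hq : q ∈ O) (h : Q) (k : ℕ) (p : M) {y : E}
    (hy : y ∈ (extChartAt I p).target) :
    chartRep I p (fun x => fderiv ℝ (fun q => (Φ q k).1 x) q h) y =
      fderiv ℝ (fun a : Q × E => chartRep I p (Φ a.1 k).1 a.2) (q, y) (h, 0) := by
  have h1 := hasFDerivAt_fst' (hΦ.differentiableAt_chartRep hO hq k p hy)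
  have h2 := (camComp k (diffAt 𝓘(ℝ, E) I (extChartAt I p).symm y)).hasFDerivAt.comp q
    (hΦ.differentiableAt_val hO hq k ((extChartAt I p).symm y)).hasFDerivAt
  have h3 := congrArg (fun l : Q →L[ℝ] E [⋀^Fin k]→L[ℝ] ℝ => l h) (h1.unique h2)
  exact h3.symm

variable {I} in
/-- The derivative of a smooth family of homogeneous forms with respect to the parameter. -/
def SmoothFamilyOn.derivK {O : Set Q} {Φ : Q → Form I M} (hΦ : SmoothFamilyOn I O Φ)
    (hO : IsOpen O) (h : Q) {q : Q} (hq : q ∈ O) (k : ℕ) : KForm I M k :=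
  ⟨fun x => fderiv ℝ (fun q => (Φ q k).1 x) q h, fun p => by
    have h1 : ContDiffOn ℝ ∞ (fun a : Q × E =>
        fderiv ℝ (fun a : Q × E => chartRep I p (Φ a.1 k).1 a.2) a (h, 0))
        (O ×ˢ (extChartAt I p).target) :=
      ((hΦ k p).fderiv_of_isOpen (isOpen_prod_target I hO p) (m := ∞) (by simp)).clm_apply
        contDiffOn_const
    refine (h1.comp (f := fun y => (q, y)) (contDiff_const.prodMk contDiff_id).contDiffOn
      fun y hy => ⟨hq, hy⟩).congr fun y hy => ?_
    exact hΦ.chartRep_fderiv hO hq h k p hy⟩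

open scoped Classical in
variable {I} in
/-- The derivative of a smooth family of forms with respect to the parameter. -/
def SmoothFamilyOn.deriv {O : Set Q} {Φ : Q → Form I M} (hΦ : SmoothFamilyOn I O Φ)
    (hO : IsOpen O) (h q : Q) : Form I M := fun k =>
  if hq : q ∈ O then hΦ.derivK hO h hq k else 0

variable {I} in
theorem SmoothFamilyOn.deriv_eq {O : Set Q} {Φ : Q → Form I M} (hΦ : SmoothFamilyOn I O Φ)
    (hO : IsOpen O) (h : Q) {q : Q} (hq : q ∈ O) (k : ℕ) :
    hΦ.deriv hO h q k = hΦ.derivK hO h hq k := dif_pos hq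

variable {I} in
theorem SmoothFamilyOn.deriv_val {O : Set Q} {Φ : Q → Form I M} (hΦ : SmoothFamilyOn I O Φ)
    (hO : IsOpen O) (h : Q) {q : Q} (hq : q ∈ O) (k : ℕ) (x : M) :
    (hΦ.deriv hO h q k).1 x = fderiv ℝ (fun q => (Φ q k).1 x) q h := by
  rw [hΦ.deriv_eq hO h hq]; rfl

variable {I} in
theorem SmoothFamilyOn.chartRep_deriv {O : Set Q} {Φ : Q → Form I M} (hΦ : SmoothFamilyOn I O Φ)
    (hO : IsOpen O) (h : Q) {q : Q} (hq : q ∈ O) (k : ℕ) (p : M) {y : E}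
    (hy : y ∈ (extChartAt I p).target) : chartRep I p (hΦ.deriv hO h q k).1 y =
      fderiv ℝ (fun a : Q × E => chartRep I p (Φ a.1 k).1 a.2) (q, y) (h, 0) := by
  rw [hΦ.deriv_eq hO h hq]
  exact hΦ.chartRep_fderiv hO hq h k p hy

variable {I} in
theorem SmoothFamilyOn.smoothFamilyOn_deriv {O : Set Q} {Φ : Q → Form I M}
    (hΦ : SmoothFamilyOn I O Φ) (hO : IsOpen O) (h : Q) : SmoothFamilyOn I O (hΦ.deriv hO h) := by
  intro k p
  have h1 : ContDiffOn ℝ ∞ (fun a : Q × E =>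
        fderiv ℝ (fun a : Q × E => chartRep I p (Φ a.1 k).1 a.2) a (h, 0))
        (O ×ˢ (extChartAt I p).target) :=
      ((hΦ k p).fderiv_of_isOpen (isOpen_prod_target I hO p) (m := ∞) (by simp)).clm_apply
        contDiffOn_const
  exact h1.congr fun a ha => hΦ.chartRep_deriv hO h ha.1 k p ha.2

variable {I} in
theorem SmoothFamilyOn.hasFDerivAt {O : Set Q} {Φ : Q → Form I M} (hΦ : SmoothFamilyOn I O Φ)
    (hO : IsOpen O) (T : Form I M →L[ℝ] F) {q₀ : Q} (hq : q₀ ∈ O) :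
    ∃ D : Q →L[ℝ] F, HasFDerivAt (fun q => T (Φ q)) D q₀ ∧ ∀ h, D h = T (hΦ.deriv hO h q₀) := by
  let D : Q →ₗ[ℝ] F :=
    { toFun := fun h => T (hΦ.deriv hO h q₀)
      map_add' := fun h h' => by
        rw [← map_add]
        congr 1
        funext k
        refine KForm.ext fun x => ?_
        rw [hΦ.deriv_val hO _ hq, map_add]
        exact congrArg₂ (· + ·) (hΦ.deriv_val hO _ hq k x).symm (hΦ.deriv_val hO _ hq k x).symm
      map_smul' := fun c h => by
        rw [RingHom.id_apply, ← map_smul]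
        congr 1
        funext k
        refine KForm.ext fun x => ?_
        rw [hΦ.deriv_val hO _ hq, map_smul]
        exact congrArg (c • ·) (hΦ.deriv_val hO _ hq k x).symm }
  refine ⟨LinearMap.toContinuousLinearMap D, ?_, fun h => rfl⟩
  obtain ⟨s, -, c, hc, hb⟩ := jetBound_of_continuous I T
  rw [hasFDerivAt_iff_isLittleO, Asymptotics.isLittleO_iff]
  intro ε hε
  obtain ⟨δ, hδ, hδε⟩ : ∃ δ > 0, c * (s.card * δ) ≤ ε := by
    refine ⟨ε / (c * s.card + 1), by positivity, ?_⟩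
    have h1 : 0 < c * s.card + 1 := by positivity
    rw [← mul_assoc, mul_div_assoc', div_le_iff₀ h1]
    nlinarith [mul_nonneg hc (Nat.cast_nonneg (α := ℝ) s.card)]
  have hev : ∀ i ∈ s, ∀ᶠ q in 𝓝 q₀, ∀ u ∈ i.carrier,
      ‖iterSnd i.order (fun a : Q × E => chartRep I i.center (Φ a.1 i.deg).1 a.2) (q, u) -
        iterSnd i.order (fun a : Q × E => chartRep I i.center (Φ a.1 i.deg).1 a.2) (q₀, u) -
        fderiv ℝ (iterSnd i.order
          (fun a : Q × E => chartRep I i.center (Φ a.1 i.deg).1 a.2)) (q₀, u) (q - q₀, 0)‖ ≤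
        δ * ‖q - q₀‖ := fun i _ =>
    eventually_norm_sub_sub_le (isOpen_prod_target I hO i.center)
      (contDiffOn_iterSnd (isOpen_prod_target I hO i.center) (hΦ i.deg i.center) i.order)
      i.isCompact (fun u hu => ⟨hq, i.subset hu⟩) hδ
  filter_upwards [(Finset.eventually_all s).2 hev, hO.mem_nhds hq] with q hq1 hqO
  have e : T (Φ q) - T (Φ q₀) - LinearMap.toContinuousLinearMap D (q - q₀) =
      T (Φ q - Φ q₀ - hΦ.deriv hO (q - q₀) q₀) := by
    rw [map_sub T, map_sub T]; rfl
  rw [e]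
  refine (hb _).trans ?_
  have h1 : ∀ i ∈ s, jetNorm I i (Φ q - Φ q₀ - hΦ.deriv hO (q - q₀) q₀) ≤ δ * ‖q - q₀‖ := by
    intro i hi
    refine jetNorm_le I i (by positivity) fun u hu => ?_
    have hut := i.subset hu
    have h2 := hq1 i hi u hu
    rw [fderiv_iterSnd_inl (isOpen_prod_target I hO i.center) (hΦ i.deg i.center) (q - q₀)
      i.order (q₀, u) ⟨hq, hut⟩] at h2
    have h3 : iterSnd i.order (fun b => fderiv ℝ (fun a : Q × E =>
        chartRep I i.center (Φ a.1 i.deg).1 a.2) b (q - q₀, 0)) (q₀, u) =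
        iteratedFDeriv ℝ i.order
          (chartRep I i.center (hΦ.deriv hO (q - q₀) q₀ i.deg).1) u := by
      have hev : (fun u => fderiv ℝ (fun a : Q × E =>
          chartRep I i.center (Φ a.1 i.deg).1 a.2) (q₀, u) (q - q₀, 0)) =ᶠ[𝓝 u]
          chartRep I i.center (hΦ.deriv hO (q - q₀) q₀ i.deg).1 := by
        filter_upwards [(isOpen_extChartAt_target i.center).mem_nhds hut] with v hv
        exact (hΦ.chartRep_deriv hO _ hq _ _ hv).symm
      exact (hev.iteratedFDeriv (𝕜 := ℝ) i.order).eq_of_nhds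
    rw [h3] at h2
    have h4 : iteratedFDeriv ℝ i.order (chartRep I i.center
        ((Φ q - Φ q₀ - hΦ.deriv hO (q - q₀) q₀) i.deg).1) u =
        jetLM I i (Φ q - Φ q₀ - hΦ.deriv hO (q - q₀) q₀) ⟨u, hu⟩ := rfl
    rw [h4, map_sub, map_sub]
    exact h2
  calc c * ∑ i ∈ s, jetNorm I i (Φ q - Φ q₀ - hΦ.deriv hO (q - q₀) q₀)
      ≤ c * ∑ i ∈ s, δ * ‖q - q₀‖ := by gcongr with i hi; exact h1 i hi
    _ = c * (s.card * δ) * ‖q - q₀‖ := by rw [Finset.sum_const, nsmul_eq_mul]; ring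
    _ ≤ ε * ‖q - q₀‖ := by gcongr

variable {I} in
theorem SmoothFamilyOn.fderiv_apply {O : Set Q} {Φ : Q → Form I M} (hΦ : SmoothFamilyOn I O Φ)
    (hO : IsOpen O) (T : Form I M →L[ℝ] F) {q : Q} (hq : q ∈ O) (h : Q) :
    fderiv ℝ (fun q => T (Φ q)) q h = T (hΦ.deriv hO h q) := by
  obtain ⟨D, hD, hh⟩ := hΦ.hasFDerivAt hO T hq
  rw [hD.fderiv, hh]

variable {I} in
/-- A continuous linear map of a smooth family is smooth. -/
theorem SmoothFamilyOn.contDiffOn {O : Set Q} {Φ : Q → Form I M} (hΦ : SmoothFamilyOn I O Φ)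
    (hO : IsOpen O) (T : Form I M →L[ℝ] F) : ContDiffOn ℝ ∞ (fun q => T (Φ q)) O := by
  have hd : ∀ {Φ : Q → Form I M}, SmoothFamilyOn I O Φ → DifferentiableOn ℝ (fun q => T (Φ q)) O :=
    fun hΦ q hq => by
      obtain ⟨D, hD, -⟩ := hΦ.hasFDerivAt hO T hq
      exact hD.differentiableAt.differentiableWithinAt
  rw [contDiffOn_infty]
  intro n
  induction n generalizing Φ with
  | zero => exact contDiffOn_zero.2 (hd hΦ).continuousOn
  | succ n ih =>
    push_cast
    rw [contDiffOn_succ_iff_fderiv_apply hO.uniqueDiffOn]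
    refine ⟨hd hΦ, fun h => absurd h (by simp), fun w => ?_⟩
    refine (ih (hΦ.smoothFamilyOn_deriv hO w)).congr fun q hq => ?_
    rw [fderivWithin_of_isOpen hO hq, hΦ.fderiv_apply hO T hq]

end Jets

section LocalFamilies

variable {E : Type*} [NormedAddCommGroup E] [NormedSpace ℝ E] [FiniteDimensional ℝ E]
  {H : Type*} [TopologicalSpace H] (I : ModelWithCorners ℝ E H) [I.Boundaryless]
  {M : Type*} [TopologicalSpace M] [ChartedSpace H M] [IsManifold I ∞ M]
  {E' : Type*} [NormedAddCommGroup E'] [NormedSpace ℝ E'] [FiniteDimensional ℝ E']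
  {H' : Type*} [TopologicalSpace H'] (J : ModelWithCorners ℝ E' H') [J.Boundaryless]
  {N : Type*} [TopologicalSpace N] [ChartedSpace H' N] [IsManifold J ∞ N]
  {E'' : Type*} [NormedAddCommGroup E''] [NormedSpace ℝ E''] [FiniteDimensional ℝ E'']
  {H'' : Type*} [TopologicalSpace H''] (K : ModelWithCorners ℝ E'' H'') [K.Boundaryless]
  {P : Type*} [TopologicalSpace P] [ChartedSpace H'' P] [IsManifold K ∞ P]
  {F : Type*} [NormedAddCommGroup F] [NormedSpace ℝ F]
  {Q : Type*} [NormedAddCommGroup Q] [NormedSpace ℝ Q] [FiniteDimensional ℝ Q]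
  {Y : Type*} [NormedAddCommGroup Y] [NormedSpace ℝ Y] [FiniteDimensional ℝ Y]

/-! #### Integration of smooth families -/

section Integration

variable [MeasurableSpace Y] [BorelSpace Y] (μ : Measure Y) [IsFiniteMeasureOnCompacts μ]

variable {I} in
/-- The integral of a compactly supported smooth family of forms. -/
def SmoothFamilyOn.integral {Φ : Y → Form I M} (hΦ : SmoothFamilyOn I univ Φ) {K : Set Y}
    (hK : IsCompact K) (h0 : ∀ y ∉ K, Φ y = 0) : Form I M := fun k =>
  ⟨fun x => ∫ y, (Φ y k).1 x ∂μ, fun p => by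
    refine (contDiffOn_integral_param μ (isOpen_extChartAt_target p) (hΦ k p) hK
      fun y hy u hu => ?_).congr fun u hu => ?_
    · rw [h0 y hy]; rfl
    · have hc : Continuous fun y => (Φ y k).1 ((extChartAt I p).symm u) :=
        continuous_iff_continuousAt.2 fun y =>
          (hΦ.differentiableAt_val isOpen_univ (mem_univ y) k _).continuousAt
      have := finiteDimensional_cam (V := E) k
      have : CompleteSpace (E [⋀^Fin k]→L[ℝ] ℝ) := FiniteDimensional.complete ℝ _
      exact ((camComp k (diffAt 𝓘(ℝ, E) I (extChartAt I p).symm u)).integral_comp_comm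
        (hc.integrable_of_hasCompactSupport (HasCompactSupport.intro hK fun y hy => by
          rw [h0 y hy]; rfl))).symm⟩

variable {I} in
theorem SmoothFamilyOn.continuous_apply {Φ : Y → Form I M} (hΦ : SmoothFamilyOn I univ Φ)
    (T : Form I M →L[ℝ] F) : Continuous fun y => T (Φ y) :=
  continuousOn_univ.1 (hΦ.contDiffOn isOpen_univ T).continuousOn

variable {I} in
theorem SmoothFamilyOn.integrable_apply {Φ : Y → Form I M} (hΦ : SmoothFamilyOn I univ Φ)
    {K : Set Y} (hK : IsCompact K) (h0 : ∀ y ∉ K, Φ y = 0) (T : Form I M →L[ℝ] F) :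
    Integrable (fun y => T (Φ y)) μ :=
  (hΦ.continuous_apply T).integrable_of_hasCompactSupport
    (HasCompactSupport.intro hK fun y hy => by rw [h0 y hy, map_zero])

variable {I} in
theorem SmoothFamilyOn.jetLM_integral {Φ : Y → Form I M} (hΦ : SmoothFamilyOn I univ Φ)
    {K : Set Y} (hK : IsCompact K) (h0 : ∀ y ∉ K, Φ y = 0) (i : JetIdx I M) :
    ∫ y, jetLM I i (Φ y) ∂μ = jetLM I i (hΦ.integral μ hK h0) := by
  let T : Form I M →L[ℝ] C(i.carrier, JetSpace E i.deg i.order) := ⟨jetLM I i, continuous_jetLM I i⟩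
  have hint : Integrable (fun y => jetLM I i (Φ y)) μ := hΦ.integrable_apply μ hK h0 T
  ext1 u
  have h1 := ContinuousLinearMap.integral_comp_comm
    (ContinuousMap.evalCLM ℝ u : C(i.carrier, JetSpace E i.deg i.order) →L[ℝ] _) hint
  refine h1.symm.trans ?_
  have hg := hΦ i.deg i.center
  have h2 := iteratedFDeriv_integral_param μ (isOpen_extChartAt_target (I := I) i.center) hg hK
    (fun y hy u hu => by rw [h0 y hy]; rfl) i.order u.1 (i.subset u.2)
  refine h2.symm.trans ?_
  rw [jetLM_apply]
  refine (Filter.EventuallyEq.iteratedFDeriv (𝕜 := ℝ) ?_ i.order).eq_of_nhds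
  filter_upwards [(isOpen_extChartAt_target (I := I) i.center).mem_nhds (i.subset u.2)] with v hv
  have hc : Continuous fun y => (Φ y i.deg).1 ((extChartAt I i.center).symm v) :=
    continuous_iff_continuousAt.2 fun y =>
      (hΦ.differentiableAt_val isOpen_univ (mem_univ y) i.deg _).continuousAt
  have := finiteDimensional_cam (V := E) i.deg
  have : CompleteSpace (E [⋀^Fin i.deg]→L[ℝ] ℝ) := FiniteDimensional.complete ℝ _
  exact ((camComp i.deg (diffAt 𝓘(ℝ, E) I (extChartAt I i.center).symm v)).integral_comp_comm
    (hc.integrable_of_hasCompactSupport (HasCompactSupport.intro hK fun y hy => by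
      rw [h0 y hy]; rfl)))

variable {I} in
theorem SmoothFamilyOn.integral_apply_real {Φ : Y → Form I M} (hΦ : SmoothFamilyOn I univ Φ)
    {K : Set Y} (hK : IsCompact K) (h0 : ∀ y ∉ K, Φ y = 0) (T : Form I M →L[ℝ] ℝ) :
    ∫ y, T (Φ y) ∂μ = T (hΦ.integral μ hK h0) := by
  obtain ⟨s, -, c, hc, hb⟩ := jetBound_of_continuous I T
  let X := ∀ i : s, C(i.1.carrier, JetSpace E i.1.deg i.1.order)
  let Jm : Form I M →ₗ[ℝ] X := LinearMap.pi fun i => jetLM I i.1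
  obtain ⟨S, -, hS⟩ := exists_factor_of_bound Jm T.toLinearMap (c := c * s.card) (by positivity)
    fun φ => by
      refine (hb φ).trans ?_
      rw [mul_assoc]
      refine mul_le_mul_of_nonneg_left ?_ hc
      rw [← nsmul_eq_mul]
      refine Finset.sum_le_card_nsmul _ _ _ fun i hi => ?_
      exact norm_le_pi_norm (Jm φ) ⟨i, hi⟩
  have hint : ∀ i : s, Integrable (fun y => Jm (Φ y) i) μ := fun i =>
    hΦ.integrable_apply μ hK h0 ⟨jetLM I i.1, continuous_jetLM I i.1⟩
  have hJ : Integrable (fun y => Jm (Φ y)) μ := Integrable.of_eval hint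
  have e : ∫ y, Jm (Φ y) ∂μ = Jm (hΦ.integral μ hK h0) := by
    funext i
    rw [eval_integral hint]
    exact hΦ.jetLM_integral μ hK h0 i.1
  have h1 := S.integral_comp_comm hJ
  rw [e] at h1
  simp only [hS] at h1
  exact h1

variable {I} in
/-- A continuous linear map can be interchanged with the integral of a smooth family. -/
theorem SmoothFamilyOn.integral_apply [CompleteSpace F] {Φ : Y → Form I M}
    (hΦ : SmoothFamilyOn I univ Φ) {K : Set Y} (hK : IsCompact K) (h0 : ∀ y ∉ K, Φ y = 0)
    (T : Form I M →L[ℝ] F) : ∫ y, T (Φ y) ∂μ = T (hΦ.integral μ hK h0) := by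
  refine (SeparatingDual.eq_iff_forall_dual_eq (R := ℝ)).2 fun l => ?_
  have h1 := l.integral_comp_comm (hΦ.integrable_apply μ hK h0 T)
  rw [← h1]
  exact hΦ.integral_apply_real μ hK h0 (l.comp T)

end Integration

/-! #### Local families of operators -/

/-- Families of operators on homogeneous forms that are locally of the form
`θ ↦ L(q, u) (θ(ς(q, u)))` in charts, with smooth `L` and `ς`. -/
def LocalFamily {l k : ℕ} (Op : Q → KForm J N l → KForm I M k) : Prop :=
  ∀ (q₀ : Q) (p : M), ∀ u₀ ∈ (extChartAt I p).target, ∃ (p' : N) (O : Set (Q × E))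
    (ς : Q × E → E') (L : Q × E → (E' [⋀^Fin l]→L[ℝ] ℝ) →L[ℝ] (E [⋀^Fin k]→L[ℝ] ℝ)),
    IsOpen O ∧ (q₀, u₀) ∈ O ∧ ContDiffOn ℝ ∞ ς O ∧ ContDiffOn ℝ ∞ L O ∧
    MapsTo ς O (extChartAt J p').target ∧ ∀ a ∈ O, ∀ θ : KForm J N l,
      chartRep I p (Op a.1 θ).1 a.2 = L a (chartRep J p' θ.1 (ς a))

open scoped Classical in
variable {I J} in
theorem LocalFamily.exists_bound {l k : ℕ} {Op : Q → KForm J N l → KForm I M k}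
    (hOp : LocalFamily I J Op) {Z : Set Q} (hZ : IsCompact Z) {p : M} {C : Set E}
    (hC : IsCompact C) (hCp : C ⊆ (extChartAt I p).target) (j : ℕ) :
    ∃ s : Finset (JetIdx J N), (∀ i ∈ s, i.order ≤ j) ∧ ∃ c : ℝ, 0 ≤ c ∧ ∀ q ∈ Z, ∀ u ∈ C,
      ∀ φ : Form J N, ‖iteratedFDeriv ℝ j (chartRep I p (Op q (φ l)).1) u‖ ≤
        c * ∑ i ∈ s, jetNorm J i φ := by
  have key : ∃ s : Finset (JetIdx J N), (∀ i ∈ s, i.order ≤ j) ∧ ∃ c : ℝ, 0 ≤ c ∧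
      ∀ a ∈ Z ×ˢ C, ∀ φ : Form J N, ‖iteratedFDeriv ℝ j (chartRep I p (Op a.1 (φ l)).1) a.2‖ ≤
        c * ∑ i ∈ s, jetNorm J i φ := by
    refine (hZ.prod hC).induction_on (p := fun S => ∃ s : Finset (JetIdx J N),
      (∀ i ∈ s, i.order ≤ j) ∧ ∃ c : ℝ, 0 ≤ c ∧ ∀ a ∈ S, ∀ φ : Form J N,
        ‖iteratedFDeriv ℝ j (chartRep I p (Op a.1 (φ l)).1) a.2‖ ≤
        c * ∑ i ∈ s, jetNorm J i φ) ⟨∅, by simp, 0, le_rfl, by simp⟩ ?_ ?_ ?_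
    · rintro S S' hSS' ⟨s, hs, c, hc, h⟩
      exact ⟨s, hs, c, hc, fun a ha => h a (hSS' ha)⟩
    · rintro S S' ⟨s, hs, c, hc, h⟩ ⟨s', hs', c', hc', h'⟩
      refine ⟨s ∪ s', fun i hi => (Finset.mem_union.1 hi).elim (hs i) (hs' i), c + c', by positivity,
        fun a ha φ => ?_⟩
      have m1 : ∑ i ∈ s, jetNorm J i φ ≤ ∑ i ∈ s ∪ s', jetNorm J i φ :=
        Finset.sum_le_sum_of_subset_of_nonneg Finset.subset_union_left
          fun i _ _ => jetNorm_nonneg J i φ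
      have m2 : ∑ i ∈ s', jetNorm J i φ ≤ ∑ i ∈ s ∪ s', jetNorm J i φ :=
        Finset.sum_le_sum_of_subset_of_nonneg Finset.subset_union_right
          fun i _ _ => jetNorm_nonneg J i φ
      have n3 := sum_jetNorm_nonneg J (s ∪ s') φ
      rcases ha with ha | ha
      · refine (h a ha φ).trans ?_
        nlinarith [mul_le_mul_of_nonneg_left m1 hc, mul_nonneg hc' n3]
      · refine (h' a ha φ).trans ?_
        nlinarith [mul_le_mul_of_nonneg_left m2 hc', mul_nonneg hc n3]
    · rintro ⟨q₀, u₀⟩ ⟨hq₀, hu₀⟩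
      obtain ⟨p', O, ς, L, hO, hm, hς, hL, hmaps, hf⟩ := hOp q₀ p u₀ (hCp hu₀)
      obtain ⟨V, hV, hVO, hVc⟩ := local_compact_nhds (hO.mem_nhds hm)
      obtain ⟨c, hc, hb⟩ := exists_norm_iteratedFDeriv_le hO hL hς
        (isOpen_extChartAt_target (I := J) p') hmaps hVc hVO j
      have hVi : IsCompact (ς '' V) := hVc.image_of_continuousOn (hς.continuousOn.mono hVO)
      have hVs : ς '' V ⊆ (extChartAt J p').target := by
        rintro _ ⟨a, ha, rfl⟩; exact hmaps (hVO ha)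
      let idx : ℕ → JetIdx J N := fun i => ⟨l, p', i, ς '' V, hVi, hVs⟩
      refine ⟨V, mem_nhdsWithin_of_mem_nhds hV, (Finset.range (j + 1)).image idx, ?_, c, hc,
        fun a ha φ => ?_⟩
      · intro i hi
        obtain ⟨m, hm, rfl⟩ := Finset.mem_image.1 hi
        have := Finset.mem_range.1 hm
        change m ≤ j
        omega
      · have h1 := hb a ha (chartRep J p' (φ l).1) ((φ l).2 p')
          (∑ i ∈ (Finset.range (j + 1)).image idx, jetNorm J i φ) fun i hi => ?_
        · refine le_trans (le_of_eq ?_) h1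
          congr 1
          refine (Filter.EventuallyEq.iteratedFDeriv (𝕜 := ℝ) ?_ j).eq_of_nhds
          have : (fun u : E => (a.1, u)) ⁻¹' O ∈ 𝓝 a.2 :=
            (hO.preimage (by fun_prop)).mem_nhds (hVO ha)
          filter_upwards [this] with u hu
          exact hf (a.1, u) hu (φ l)
        · refine (le_jetNorm J (idx i) φ (mem_image_of_mem ς ha)).trans ?_
          exact Finset.single_le_sum (f := fun i => jetNorm J i φ)
            (fun i _ => jetNorm_nonneg J i φ)
            (Finset.mem_image_of_mem idx (Finset.mem_range.2 (by omega)))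
  obtain ⟨s, hs, c, hc, h⟩ := key
  exact ⟨s, hs, c, hc, fun q hq u hu φ => h (q, u) ⟨hq, hu⟩ φ⟩

variable {I J} in
theorem LocalFamily.contDiffOn_chartRep {l k : ℕ} {Op : Q → KForm J N l → KForm I M k}
    (hOp : LocalFamily I J Op) (θ : KForm J N l) (p : M) :
    ContDiffOn ℝ ∞ (fun a : Q × E => chartRep I p (Op a.1 θ).1 a.2)
      (univ ×ˢ (extChartAt I p).target) := by
  rintro ⟨q₀, u₀⟩ ⟨-, hu₀⟩
  obtain ⟨p', O, ς, L, hO, hm, hς, hL, hmaps, hf⟩ := hOp q₀ p u₀ hu₀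
  have h1 : ContDiffOn ℝ ∞ (fun a => L a (chartRep J p' θ.1 (ς a))) O :=
    hL.clm_apply ((θ.2 p').comp hς hmaps)
  exact ((h1.congr fun a ha => hf a ha θ).contDiffAt (hO.mem_nhds hm)).contDiffWithinAt

/-- Families of operators on forms whose components are local. -/
def LocalFormFamily (Op : Q → Form J N → Form I M) : Prop :=
  ∀ k, ∃ (l : ℕ) (op : Q → KForm J N l → KForm I M k), LocalFamily I J op ∧
    ∀ q φ, Op q φ k = op q (φ l)

variable {I J} in
theorem LocalFormFamily.smoothFamilyOn {Op : Q → Form J N → Form I M}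
    (hOp : LocalFormFamily I J Op) (φ : Form J N) : SmoothFamilyOn I univ (fun q => Op q φ) := by
  intro k p
  obtain ⟨l, op, hop, h⟩ := hOp k
  simp only [h]
  exact hop.contDiffOn_chartRep (φ l) p

open scoped Classical in
variable {I J} in
/-- Uniform bounds for local families of operators, with control of the orders. -/
theorem LocalFormFamily.exists_bound {Op : Q → Form J N → Form I M}
    (hOp : LocalFormFamily I J Op) {Z : Set Q} (hZ : IsCompact Z) {n : ℕ∞} {f : Form I M → ℝ}
    (hf : JetBound I n f) : ∃ s : Finset (JetIdx J N), (∀ i ∈ s, (i.order : ℕ∞) ≤ n) ∧ ∃ c : ℝ,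
      0 ≤ c ∧ ∀ q ∈ Z, ∀ φ, f (Op q φ) ≤ c * ∑ i ∈ s, jetNorm J i φ := by
  obtain ⟨s, hs, c, hc, hb⟩ := hf
  have h1 : ∀ i : JetIdx I M, ∃ s' : Finset (JetIdx J N), (∀ i' ∈ s', i'.order ≤ i.order) ∧
      ∃ c' : ℝ, 0 ≤ c' ∧ ∀ q ∈ Z, ∀ φ, jetNorm I i (Op q φ) ≤ c' * ∑ i' ∈ s', jetNorm J i' φ := by
    intro i
    obtain ⟨l, op, hop, h⟩ := hOp i.deg
    obtain ⟨s', hs', c', hc', h'⟩ := hop.exists_bound hZ i.isCompact i.subset i.order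
    refine ⟨s', hs', c', hc', fun q hq φ => ?_⟩
    refine jetNorm_le I i (mul_nonneg hc' (sum_jetNorm_nonneg J s' φ)) fun u hu => ?_
    rw [h]
    exact h' q hq u hu φ
  choose S hS C hC hSC using h1
  refine ⟨s.biUnion S, fun i hi => ?_, c * ∑ i ∈ s, C i,
    mul_nonneg hc (Finset.sum_nonneg fun i _ => hC i), fun q hq φ => (hb _).trans ?_⟩
  · obtain ⟨a, ha, hai⟩ := Finset.mem_biUnion.1 hi
    exact le_trans (by exact_mod_cast hS a i hai) (hs a ha)
  · rw [mul_assoc, Finset.sum_mul]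
    refine mul_le_mul_of_nonneg_left (Finset.sum_le_sum fun i hi => (hSC i q hq φ).trans ?_) hc
    exact mul_le_mul_of_nonneg_left (Finset.sum_le_sum_of_subset_of_nonneg
      (Finset.subset_biUnion_of_mem S hi) fun i _ _ => jetNorm_nonneg J i φ) (hC i)

variable {I J} in
theorem LocalFormFamily.jetBound_comp {Op : Q → Form J N → Form I M}
    (hOp : LocalFormFamily I J Op) (q : Q) {n : ℕ∞} {f : Form I M → ℝ} (hf : JetBound I n f) :
    JetBound J n (fun φ => f (Op q φ)) := by
  obtain ⟨s, hs, c, hc, h⟩ := hOp.exists_bound (isCompact_singleton (x := q)) hf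
  exact ⟨s, hs, c, hc, fun φ => h q rfl φ⟩

variable {I J K} in
theorem LocalFamily.comp {l k m : ℕ} {Op : Q → KForm J N l → KForm I M k}
    {Op' : Q → KForm K P m → KForm J N l} (hOp : LocalFamily I J Op) (hOp' : LocalFamily J K Op') :
    LocalFamily I K (fun q θ => Op q (Op' q θ)) := by
  intro q₀ p u₀ hu₀
  obtain ⟨p', O, ς, L, hO, hm, hς, hL, hmaps, hf⟩ := hOp q₀ p u₀ hu₀
  obtain ⟨p'', O', ς', L', hO', hm', hς', hL', hmaps', hf'⟩ := hOp' q₀ p' (ς (q₀, u₀)) (hmaps hm)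
  have hin : ContDiffOn ℝ ∞ (fun a : Q × E => (a.1, ς a)) O := contDiffOn_fst.prodMk hς
  refine ⟨p'', O ∩ (fun a : Q × E => (a.1, ς a)) ⁻¹' O', fun a => ς' (a.1, ς a),
    fun a => (L a).comp (L' (a.1, ς a)), hin.continuousOn.isOpen_inter_preimage hO hO',
    ⟨hm, hm'⟩, hς'.comp (hin.mono inter_subset_left) fun a ha => ha.2,
    (hL.mono inter_subset_left).clm_comp
      (hL'.comp (hin.mono inter_subset_left) fun a ha => ha.2),
    fun a ha => hmaps' ha.2, fun a ha θ => ?_⟩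
  rw [hf a ha.1, hf' (a.1, ς a) ha.2]
  rfl

theorem contDiffOn_camComp {k : ℕ} {Z : Type*} [NormedAddCommGroup Z] [NormedSpace ℝ Z]
    {s : Set Z} {A : Z → E →L[ℝ] E'} (hA : ContDiffOn ℝ ∞ A s) :
    ContDiffOn ℝ ∞ (fun z => camComp k (A z)) s := by
  have := finiteDimensional_cam (V := E') k
  rw [contDiffOn_clm_apply]
  intro α
  refine contDiffOn_cam fun v => ?_
  exact contDiffOn_cam_apply (g := fun _ => α) contDiffOn_const fun i => hA.clm_apply contDiffOn_const

/-- Pull-back by a smooth family of maps is a local family. -/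
theorem localFamily_pullbackK {f : Q → M → N} (hf : ∀ q, ContMDiff I J ∞ (f q))
    (hjoint : ContMDiff (𝓘(ℝ, Q).prod I) J ∞ fun z : Q × M => f z.1 z.2) (k : ℕ) :
    LocalFamily I J (fun q (θ : KForm J N k) => pullbackK I J (f q) (hf q) θ) := by
  intro q₀ p u₀ hu₀
  set p' := f q₀ ((extChartAt I p).symm u₀) with hp'
  set O : Set (Q × E) := (univ ×ˢ (extChartAt I p).target) ∩
    (fun a : Q × E => f a.1 ((extChartAt I p).symm a.2)) ⁻¹' (extChartAt J p').source with hO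
  have hin : ContMDiffOn 𝓘(ℝ, Q × E) (𝓘(ℝ, Q).prod I) ∞
      (fun a : Q × E => (a.1, (extChartAt I p).symm a.2)) (univ ×ˢ (extChartAt I p).target) := by
    refine ContMDiffOn.prodMk contDiff_fst.contMDiff.contMDiffOn ?_
    exact (contMDiffOn_extChartAt_symm p).comp contDiff_snd.contMDiff.contMDiffOn fun a ha => ha.2
  have hcomp : ContMDiffOn 𝓘(ℝ, Q × E) J ∞
      (fun a : Q × E => f a.1 ((extChartAt I p).symm a.2)) (univ ×ˢ (extChartAt I p).target) :=
    hjoint.comp_contMDiffOn hin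
  have hOo : IsOpen O := hcomp.continuousOn.isOpen_inter_preimage
    (isOpen_univ.prod (isOpen_extChartAt_target p)) (isOpen_extChartAt_source p')
  have hς : ContDiffOn ℝ ∞ (fun a : Q × E => extChartAt J p' (f a.1 ((extChartAt I p).symm a.2))) O := by
    rw [← contMDiffOn_iff_contDiffOn]
    exact (contMDiffOn_extChartAt (x := p')).comp (hcomp.mono inter_subset_left)
      fun a ha => by simpa using ha.2
  have hD : ContDiffOn ℝ ∞ (fun a : Q × E => (fderiv ℝ (fun a : Q × E =>
      extChartAt J p' (f a.1 ((extChartAt I p).symm a.2))) a).comp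
        (ContinuousLinearMap.inr ℝ Q E)) O :=
    (hς.fderiv_of_isOpen hOo (m := ∞) (by simp)).clm_comp contDiffOn_const
  refine ⟨p', O, fun a => extChartAt J p' (f a.1 ((extChartAt I p).symm a.2)),
    fun a => camComp k ((fderiv ℝ (fun a : Q × E =>
      extChartAt J p' (f a.1 ((extChartAt I p).symm a.2))) a).comp
        (ContinuousLinearMap.inr ℝ Q E)), hOo, ⟨⟨mem_univ _, hu₀⟩, mem_extChartAt_source p'⟩, hς,
    contDiffOn_camComp hD, fun a ha => (extChartAt J p').map_source ha.2, fun a ha θ => ?_⟩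
  have h1 := chartRep_pullback I J (hf a.1) θ.1 p p' ha.1.2 ha.2
  refine h1.trans ?_
  have hd := hasFDerivAt_snd ((hς.contDiffAt (hOo.mem_nhds ha)).differentiableAt (by simp))
  rw [camComp_apply, ← hd.fderiv]

theorem localFormFamily_pullback {f : Q → M → N} (hf : ∀ q, ContMDiff I J ∞ (f q))
    (hjoint : ContMDiff (𝓘(ℝ, Q).prod I) J ∞ fun z : Q × M => f z.1 z.2) :
    LocalFormFamily I J (fun q (φ : Form J N) => pullback I J (f q) (hf q) φ) :=
  fun k => ⟨k, _, localFamily_pullbackK I J hf hjoint k, fun _ _ => rfl⟩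

/-- Multiplication by a fixed form is a local operator. -/
theorem localFamily_wedgeK {p q r : ℕ} (h : p + q = r) (β : KForm I M q) :
    LocalFamily I I (fun _ : Q => fun α : KForm I M p => wedgeK I h α β) := by
  intro q₀ x u₀ hu₀
  have := finiteDimensional_cam (V := E) p
  let L : Q × E → (E [⋀^Fin p]→L[ℝ] ℝ) →L[ℝ] (E [⋀^Fin r]→L[ℝ] ℝ) := fun a =>
    LinearMap.toContinuousLinearMap
      { toFun := fun α => wedgeCAM h α (chartRep I x β.1 a.2)
        map_add' := fun α α' => wedgeCAM_add_left h α α' _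
        map_smul' := fun c α => wedgeCAM_smul_left h c α _ }
  refine ⟨x, univ ×ˢ (extChartAt I x).target, fun a => a.2, L,
    isOpen_univ.prod (isOpen_extChartAt_target x), ⟨mem_univ _, hu₀⟩, contDiffOn_snd, ?_,
    fun a ha => ha.2, fun a ha α => (wedgeCAM_compContinuousLinearMap h _ _ _).symm⟩
  rw [contDiffOn_clm_apply]
  intro α
  refine contDiffOn_cam fun v => ?_
  change ContDiffOn ℝ ∞ (fun a : Q × E => wedgeCAM h α (chartRep I x β.1 a.2) v) _
  simp only [wedgeCAM_apply]
  refine ContDiffOn.sum fun σ _ => contDiffOn_const.mul (contDiffOn_const.mul ?_)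
  exact contDiffOn_cam_apply ((β.2 x).comp contDiffOn_snd fun a ha => ha.2) fun i => contDiffOn_const

end LocalFamilies

section FormOperators

variable {E : Type*} [NormedAddCommGroup E] [NormedSpace ℝ E] [FiniteDimensional ℝ E]
  {H : Type*} [TopologicalSpace H] (I : ModelWithCorners ℝ E H) [I.Boundaryless]
  {M : Type*} [TopologicalSpace M] [ChartedSpace H M] [IsManifold I ∞ M]
  {E' : Type*} [NormedAddCommGroup E'] [NormedSpace ℝ E'] [FiniteDimensional ℝ E']
  {H' : Type*} [TopologicalSpace H'] (J : ModelWithCorners ℝ E' H') [J.Boundaryless]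
  {N : Type*} [TopologicalSpace N] [ChartedSpace H' N] [IsManifold J ∞ N]
  {Q : Type*} [NormedAddCommGroup Q] [NormedSpace ℝ Q] [FiniteDimensional ℝ Q]

/-! #### Continuous operators on forms -/

variable {I J} in
/-- A linear operator on forms is continuous if it is bounded by jets. -/
theorem continuous_of_jetBound {R : Form J N →ₗ[ℝ] Form I M}
    (h : ∀ i : JetIdx I M, JetBound J ⊤ (fun φ => jetNorm I i (R φ))) : Continuous R := by
  rw [form_topology_eq I]
  refine continuous_iInf_rng.2 fun i => continuous_induced_rng.2 ?_
  exact JetBound.continuous (T := (jetLM I i).comp R) (h i)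

variable {I J} in
theorem LocalFormFamily.continuous {Op : Q → Form J N → Form I M} (hOp : LocalFormFamily I J Op)
    (q : Q) {R : Form J N →ₗ[ℝ] Form I M} (hR : ∀ φ, R φ = Op q φ) : Continuous R :=
  continuous_of_jetBound fun i => by
    simp only [hR]
    exact hOp.jetBound_comp q ((jetBound_jetNorm I i).mono_order le_top)

/-- The pull-back of forms, as a continuous linear map. -/
def pullbackCLM (f : M → N) (hf : ContMDiff I J ∞ f) : Form J N →L[ℝ] Form I M :=
  ⟨pullbackLM I J f hf, (localFormFamily_pullback I J (Q := ℝ) (fun _ => hf)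
    (hf.comp contMDiff_snd)).continuous 0 fun _ => rfl⟩

theorem jetNorm_twist (i : JetIdx I M) (φ : Form I M) :
    jetNorm I i (twist I φ) = jetNorm I i φ := by
  have h : jetLM I i (twist I φ) = (-1 : ℝ) ^ i.deg • jetLM I i φ := by
    rw [← map_smul]; rfl
  rw [jetNorm, h, norm_smul]
  simp [jetNorm]

/-- The sign `(-1) ^ k` on forms of degree `k`, as a continuous linear map. -/
def twistCLM : Form I M →L[ℝ] Form I M :=
  ⟨twist I, continuous_of_jetBound fun i => by
    simp only [jetNorm_twist]
    exact (jetBound_jetNorm I i).mono_order le_top⟩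

theorem exists_norm_iteratedFDeriv_comp_fderiv_le {V W : Type*} [NormedAddCommGroup V]
    [NormedSpace ℝ V] [NormedAddCommGroup W] [NormedSpace ℝ W] (L : (E →L[ℝ] V) →L[ℝ] W) (j : ℕ) :
    ∃ c : ℝ, 0 ≤ c ∧ ∀ (g : E → V) (u : E), ContDiffAt ℝ ∞ g u →
      ‖iteratedFDeriv ℝ j (fun v => L (fderiv ℝ g v)) u‖ ≤ c * ‖iteratedFDeriv ℝ (j + 1) g u‖ := by
  refine ⟨‖L‖, L.opNorm_nonneg, fun g u hg => ?_⟩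
  rw [← norm_iteratedFDeriv_fderiv]
  exact L.norm_iteratedFDeriv_comp_left (hg.fderiv_right (m := ∞) (by simp))
    (by exact_mod_cast le_top)

/-- The exterior derivative increases the order of jets by one. -/
theorem jetBound_dForm (i : JetIdx I M) :
    JetBound I (i.order + 1 : ℕ) (fun φ => jetNorm I i (dForm I φ)) := by
  rcases i with ⟨k, p, j, C, hC, hCp⟩
  cases k with
  | zero =>
    refine (jetBound_zero I _).mono fun φ => jetNorm_le I _ le_rfl fun u hu => ?_
    have : chartRep I p (dForm I φ 0).1 = fun _ => 0 := rfl
    refine (congrArg norm (congrFun (congrArg (iteratedFDeriv ℝ j) this) u)).trans_le ?_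
    rw [iteratedFDeriv_fun_zero]
    simp
  | succ k =>
    let i' : JetIdx I M := ⟨k, p, j + 1, C, hC, hCp⟩
    obtain ⟨c, hc, hL⟩ := exists_norm_iteratedFDeriv_comp_fderiv_le (E := E)
      (ContinuousAlternatingMap.alternatizeUncurryFinCLM ℝ E ℝ (n := k)) j
    refine ((jetBound_jetNorm I i').const_mul hc).mono fun φ =>
      jetNorm_le I _ (mul_nonneg hc (jetNorm_nonneg I i' φ)) fun u hu => ?_
    have hO := isOpen_extChartAt_target (I := I) p
    have e : chartRep I p (dForm I φ (k + 1)).1 =ᶠ[𝓝 u] fun v =>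
        ContinuousAlternatingMap.alternatizeUncurryFinCLM ℝ E ℝ
          (fderiv ℝ (chartRep I p (φ k).1) v) := by
      filter_upwards [hO.mem_nhds (hCp hu)] with v hv
      exact chartRep_dK I (φ k) p hv
    have e1 := (e.iteratedFDeriv (𝕜 := ℝ) j).eq_of_nhds
    refine (congrArg norm e1).trans_le ?_
    refine (hL _ u ((φ k).contDiffAt I p (hCp hu))).trans ?_
    exact mul_le_mul_of_nonneg_left (le_jetNorm I i' φ hu) hc

/-- The exterior derivative, as a continuous linear map. -/
def dFormCLM : Form I M →L[ℝ] Form I M :=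
  ⟨dFormLM I, continuous_of_jetBound fun i => (jetBound_dForm I i).mono_order le_top⟩

/-- Exterior multiplication by a fixed form, as a continuous linear map. -/
def wedgeRightCLM (ψ : Form I M) : Form I M →L[ℝ] Form I M :=
  ⟨(wedgeLM I).flip ψ, continuous_of_jetBound fun i => by
    have h1 : ∀ p : Fin (i.deg + 1), JetBound I ⊤ (fun φ => jetNorm I i (Pi.single i.deg
        (wedgeK I (Nat.add_sub_of_le (Nat.lt_succ_iff.1 p.2)) (φ p) (ψ (i.deg - p))))) := by
      intro p
      obtain ⟨s, -, c, hc, hb⟩ := (localFamily_wedgeK I (Q := ℝ)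
        (Nat.add_sub_of_le (Nat.lt_succ_iff.1 p.2)) (ψ (i.deg - p))).exists_bound
        (isCompact_singleton (x := 0)) i.isCompact i.subset i.order
      refine ⟨s, fun _ _ => le_top, c, hc, fun φ => jetNorm_le I i
        (mul_nonneg hc (sum_jetNorm_nonneg I s φ)) fun u hu => ?_⟩
      rw [Pi.single_eq_same]
      exact hb 0 rfl u hu φ
    refine (JetBound.sum (s := Finset.univ) fun p _ => h1 p).mono fun φ => ?_
    have h2 : jetLM I i (wedge I φ ψ) = ∑ p : Fin (i.deg + 1), jetLM I i (Pi.single i.deg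
        (wedgeK I (Nat.add_sub_of_le (Nat.lt_succ_iff.1 p.2)) (φ p) (ψ (i.deg - p)))) := by
      rw [← map_sum]
      have : ∀ α β : Form I M, α i.deg = β i.deg → jetLM I i α = jetLM I i β := fun α β h => by
        ext1 u; rw [jetLM_apply, jetLM_apply, h]
      refine this _ _ ?_
      rw [Finset.sum_apply]
      simp only [Pi.single_eq_same]
      rfl
    change ‖jetLM I i (wedge I φ ψ)‖ ≤ _
    rw [h2]
    exact norm_sum_le _ _⟩

/-- The value of a form at a point, as a continuous linear map. -/
def evalCLM (k : ℕ) (x : M) : Form I M →L[ℝ] (E [⋀^Fin k]→L[ℝ] ℝ) :=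
  ⟨{ toFun := fun φ => (φ k).1 x
     map_add' := fun _ _ => rfl
     map_smul' := fun _ _ => rfl }, by
    let i : JetIdx I M := ⟨k, x, 0, {extChartAt I x x}, isCompact_singleton, by
      simp⟩
    let A := camComp k (diffAt I 𝓘(ℝ, E) (extChartAt I x) x)
    refine JetBound.continuous (((jetBound_jetNorm I i).const_mul
      (norm_nonneg A)).mono_order le_top |>.mono fun φ => ?_)
    have h1 := eq_chartRep_comp I (φ k).1 x (mem_extChartAt_source (I := I) x)
    refine (congrArg norm h1).trans_le ((A.le_opNorm _).trans ?_)
    refine mul_le_mul_of_nonneg_left ?_ (norm_nonneg A)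
    rw [← norm_iteratedFDeriv_zero (𝕜 := ℝ)]
    exact le_jetNorm I i φ rfl⟩

end FormOperators

section Slices

variable {E : Type*} [NormedAddCommGroup E] [NormedSpace ℝ E] [FiniteDimensional ℝ E]
  {H : Type*} [TopologicalSpace H] (I : ModelWithCorners ℝ E H) [I.Boundaryless]
  {M : Type*} [TopologicalSpace M] [ChartedSpace H M] [IsManifold I ∞ M]
  {E' : Type*} [NormedAddCommGroup E'] [NormedSpace ℝ E'] [FiniteDimensional ℝ E']
  {H' : Type*} [TopologicalSpace H'] (J : ModelWithCorners ℝ E' H') [J.Boundaryless]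
  {N : Type*} [TopologicalSpace N] [ChartedSpace H' N] [IsManifold J ∞ N]

/-! #### Slices of forms on products -/

theorem diffAt_extChartAt_prod_symm (p : M) (q : N) {u : E} {t : E'}
    (hu : u ∈ (extChartAt I p).target) (ht : t ∈ (extChartAt J q).target) :
    diffAt 𝓘(ℝ, E × E') (I.prod J) (extChartAt (I.prod J) (p, q)).symm (u, t) =
      (diffAt 𝓘(ℝ, E) I (extChartAt I p).symm u).prodMap
        (diffAt 𝓘(ℝ, E') J (extChartAt J q).symm t) := by
  have e : ((extChartAt (I.prod J) (p, q)).symm : E × E' → M × N) =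
      Prod.map (extChartAt I p).symm (extChartAt J q).symm := by
    rw [extChartAt_prod]; rfl
  rw [e, modelWithCornersSelf_prod, ← chartedSpaceSelf_prod]
  exact mfderiv_prodMap (p := (u, t)) (mdiff_symm I p hu) (mdiff_symm J q ht)

/-- The coordinate expression of the slices along a coordinate frame of the second factor. -/
theorem chartRep_slice_frame {k m : ℕ} (θ : M × N → (E × E') [⋀^Fin (k + m)]→L[ℝ] ℝ) (p : M)
    (q : N) {u : E} {t : E'} (hu : u ∈ (extChartAt I p).target)
    (ht : t ∈ (extChartAt J q).target) (b : Fin m → E') :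
    chartRep I p (fun x => sliceAlt (θ (x, (extChartAt J q).symm t)) fun j =>
      diffAt 𝓘(ℝ, E') J (extChartAt J q).symm t (b j)) u =
      sliceAlt (chartRep (I.prod J) (p, q) θ (u, t)) b := by
  have e : (extChartAt (I.prod J) (p, q)).symm (u, t) =
      ((extChartAt I p).symm u, (extChartAt J q).symm t) := by
    rw [extChartAt_prod]; rfl
  ext v
  simp only [chartRep, ContinuousAlternatingMap.compContinuousLinearMap_apply, sliceAlt_apply]
  rw [e, diffAt_extChartAt_prod_symm I J p q hu ht]
  congr 1
  funext j
  refine Fin.addCases (fun j => ?_) (fun j => ?_) j <;>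
  simp [Fin.append_left, Fin.append_right]

/-- The slice of a form on a product over a point of the second factor. -/
def sliceForm (m : ℕ) (φ : Form (I.prod J) (M × N)) (y : N) (w : Fin m → E') : Form I M :=
  fun k => sliceK I J (φ (k + m)) y w

theorem chartRep_sliceForm {m : ℕ} (φ : Form (I.prod J) (M × N)) (p : M)
    (q : N) {u : E} {t : E'} (hu : u ∈ (extChartAt I p).target)
    (ht : t ∈ (extChartAt J q).target) (b : Fin m → E') (k : ℕ) :
    chartRep I p (sliceForm I J m φ ((extChartAt J q).symm t) (fun j =>
      diffAt 𝓘(ℝ, E') J (extChartAt J q).symm t (b j)) k).1 u =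
      sliceAlt (chartRep (I.prod J) (p, q) (φ (k + m)).1 (u, t)) b :=
  chartRep_slice_frame I J (φ (k + m)).1 p q hu ht b

theorem mem_target_prod {p : M} {q : N} {u : E} {t : E'} (hu : u ∈ (extChartAt I p).target)
    (ht : t ∈ (extChartAt J q).target) : (u, t) ∈ (extChartAt (I.prod J) (p, q)).target := by
  rw [extChartAt_prod]; exact ⟨hu, ht⟩

theorem contDiffOn_sliceAlt {Z : Type*} [NormedAddCommGroup Z] [NormedSpace ℝ Z] {s : Set Z}
    {k m : ℕ} {g : Z → (E × E') [⋀^Fin (k + m)]→L[ℝ] ℝ} (hg : ContDiffOn ℝ ∞ g s)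
    {b : Z → Fin m → E'} (hb : ContDiffOn ℝ ∞ b s) :
    ContDiffOn ℝ ∞ (fun z => sliceAlt (k := k) (g z) (b z)) s := by
  refine contDiffOn_cam fun v => ?_
  refine contDiffOn_cam_apply hg fun j => ?_
  refine Fin.addCases (fun j => ?_) (fun j => ?_) j
  · simp only [Fin.append_left]; exact contDiffOn_const
  · simp only [Fin.append_right]
    exact contDiffOn_const.prodMk ((contDiff_apply ℝ E' j).comp_contDiffOn hb)

theorem smoothFamilyOn_sliceForm {m : ℕ} (φ : Form (I.prod J) (M × N)) (q : N) (b : Fin m → E') :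
    SmoothFamilyOn I (extChartAt J q).target (fun t => sliceForm I J m φ ((extChartAt J q).symm t)
      fun j => diffAt 𝓘(ℝ, E') J (extChartAt J q).symm t (b j)) := by
  intro k p
  refine ContDiffOn.congr ?_ fun a ha => chartRep_sliceForm I J φ p q ha.2 ha.1 b k
  refine contDiffOn_sliceAlt (((φ (k + m)).2 (p, q)).comp
    (contDiff_snd.prodMk contDiff_fst).contDiffOn fun a ha => ?_) contDiffOn_const
  exact mem_target_prod I J ha.2 ha.1

theorem smoothFamilyOn_sliceForm_vec {m : ℕ} (φ : Form (I.prod J) (M × N)) (y : N) :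
    SmoothFamilyOn I univ (fun w : Fin m → E' => sliceForm I J m φ y w) := by
  intro k p
  have h : ContDiffOn ℝ ∞ (fun a : (Fin m → E') × E => sliceAlt (k := k)
      (chartRep (I.prod J) (p, y) (φ (k + m)).1 (a.2, extChartAt J y y))
      (fun j => diffAt J 𝓘(ℝ, E') (extChartAt J y) y (a.1 j)))
      (univ ×ˢ (extChartAt I p).target) := by
    refine contDiffOn_sliceAlt (((φ (k + m)).2 (p, y)).comp
      (contDiff_snd.prodMk contDiff_const).contDiffOn fun a ha =>
        mem_target_prod I J ha.2 (mem_extChartAt_target y)) ?_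
    exact contDiffOn_pi.2 fun j => (ContinuousLinearMap.contDiff _).comp_contDiffOn
      ((contDiff_apply ℝ E' j).comp contDiff_fst).contDiffOn
  refine h.congr fun a ha => ContinuousAlternatingMap.ext fun v => ?_
  exact chartRep_slice I J (φ (k + m)).1 y a.1 p ha.2 v

theorem append_update_right {V : Type*} {k l : ℕ} [DecidableEq (Fin l)] (v : Fin k → V)
    (w : Fin l → V) (j : Fin l) (a : V) : Fin.append v (Function.update w j a) =
      Function.update (Fin.append v w) (Fin.natAdd k j) a := by
  funext i
  refine Fin.addCases (fun i => ?_) (fun i => ?_) i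
  · rw [Fin.append_left, Function.update_of_ne, Fin.append_left]
    exact fun h => absurd (congrArg Fin.val h) (by simp; omega)
  · rw [Fin.append_right]
    by_cases h : i = j
    · subst h; simp
    · rw [Function.update_of_ne h, Function.update_of_ne, Fin.append_right]
      exact fun h' => h (Fin.natAdd_injective _ _ h')

theorem sliceAlt_update {k l : ℕ} [DecidableEq (Fin l)] (α : (E × E') [⋀^Fin (k + l)]→L[ℝ] ℝ)
    (w : Fin l → E') (j : Fin l) (a : E') (v : Fin k → E) :
    sliceAlt α (Function.update w j a) v = α (Function.update
      (Fin.append (fun i => ((v i, 0) : E × E')) fun j => (0, w j)) (Fin.natAdd k j) (0, a)) := by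
  rw [sliceAlt_apply, ← append_update_right]
  congr 2
  funext i
  by_cases h : i = j
  · subst h; simp
  · simp [Function.update_of_ne h]

theorem sliceAlt_update_add {k l : ℕ} [DecidableEq (Fin l)] (α : (E × E') [⋀^Fin (k + l)]→L[ℝ] ℝ)
    (w : Fin l → E') (j : Fin l) (a b : E') :
    sliceAlt (k := k) α (Function.update w j (a + b)) =
      sliceAlt α (Function.update w j a) + sliceAlt α (Function.update w j b) := by
  ext v
  rw [ContinuousAlternatingMap.add_apply, sliceAlt_update, sliceAlt_update, sliceAlt_update,
    ← α.map_update_add]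
  simp

theorem sliceAlt_update_smul {k l : ℕ} [DecidableEq (Fin l)] (α : (E × E') [⋀^Fin (k + l)]→L[ℝ] ℝ)
    (w : Fin l → E') (j : Fin l) (c : ℝ) (a : E') :
    sliceAlt (k := k) α (Function.update w j (c • a)) =
      c • sliceAlt α (Function.update w j a) := by
  ext v
  rw [ContinuousAlternatingMap.smul_apply, sliceAlt_update, sliceAlt_update,
    ← α.map_update_smul]
  simp

theorem sliceAlt_eq_zero {k l : ℕ} (α : (E × E') [⋀^Fin (k + l)]→L[ℝ] ℝ) {w : Fin l → E'}
    {i j : Fin l} (h : w i = w j) (hij : i ≠ j) : sliceAlt (k := k) α w = 0 := by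
  ext v
  rw [sliceAlt_apply]
  refine α.map_eq_zero_of_eq _ (i := Fin.natAdd k i) (j := Fin.natAdd k j) ?_
    fun h' => hij (Fin.natAdd_injective _ _ h')
  simp [h]

/-- The values of a continuous functional on the slices of a form over a point. -/
def sliceEvalAt (T : Form I M →L[ℝ] ℝ) (m : ℕ) (φ : Form (I.prod J) (M × N)) (y : N) :
    E' [⋀^Fin m]→L[ℝ] ℝ :=
  let A : E' [⋀^Fin m]→ₗ[ℝ] ℝ :=
    { toFun := fun w => T (sliceForm I J m φ y w)
      map_update_add' := fun w i a b => by
        rw [← map_add]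
        congr 1
        exact funext fun k => KForm.ext fun x => sliceAlt_update_add _ w i a b
      map_update_smul' := fun w i c a => by
        rw [← map_smul]
        congr 1
        exact funext fun k => KForm.ext fun x => sliceAlt_update_smul _ w i c a
      map_eq_zero_of_eq' := fun w i j hw hij => by
        rw [← map_zero T]
        congr 1
        exact funext fun k => KForm.ext fun x => sliceAlt_eq_zero _ hw hij }
  { A with
    cont := continuousOn_univ.1
      ((smoothFamilyOn_sliceForm_vec I J φ y).contDiffOn isOpen_univ T).continuousOn }

/-- A continuous functional applied to the slices of a form is a smooth form on the second
factor. -/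
def sliceEval (T : Form I M →L[ℝ] ℝ) (m : ℕ) (φ : Form (I.prod J) (M × N)) : KForm J N m :=
  ⟨sliceEvalAt I J T m φ, fun q => by
    refine contDiffOn_cam fun b => ?_
    exact (smoothFamilyOn_sliceForm I J φ q b).contDiffOn (isOpen_extChartAt_target q) T⟩

theorem chartRep_sliceEval (T : Form I M →L[ℝ] ℝ) (m : ℕ) (φ : Form (I.prod J) (M × N)) (q : N)
    (t : E') (b : Fin m → E') : chartRep J q (sliceEval I J T m φ).1 t b =
      T (sliceForm I J m φ ((extChartAt J q).symm t)
        fun j => diffAt 𝓘(ℝ, E') J (extChartAt J q).symm t (b j)) := rfl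

/-- Evaluation of alternating forms on fixed vectors, as a continuous linear map. -/
def camEval {k : ℕ} (v : Fin k → E) : (E [⋀^Fin k]→L[ℝ] ℝ) →L[ℝ] ℝ :=
  have := finiteDimensional_cam (V := E) k
  LinearMap.toContinuousLinearMap
    { toFun := fun α => α v
      map_add' := fun _ _ => rfl
      map_smul' := fun _ _ => rfl }

theorem fderiv_cam_apply {Z : Type*} [NormedAddCommGroup Z] [NormedSpace ℝ Z] {k : ℕ}
    {g : Z → E [⋀^Fin k]→L[ℝ] ℝ} {z : Z} (hg : DifferentiableAt ℝ g z) (h : Z) (v : Fin k → E) :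
    fderiv ℝ g z h v = fderiv ℝ (fun z => g z v) z h := by
  have h1 := (camEval v).hasFDerivAt.comp z hg.hasFDerivAt
  exact (congrArg (fun l : Z →L[ℝ] ℝ => l h) h1.fderiv).symm

theorem extDeriv_apply_eq_sum {k : ℕ} {g : E → E [⋀^Fin k]→L[ℝ] ℝ} {x : E}
    (hg : DifferentiableAt ℝ g x) (v : Fin (k + 1) → E) : extDeriv g x v =
      ∑ i, (-1 : ℝ) ^ i.val * fderiv ℝ (fun y => g y (i.removeNth v)) x (v i) := by
  rw [extDeriv_apply hg]
  refine Finset.sum_congr rfl fun i _ => ?_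
  rw [zsmul_eq_mul]
  push_cast
  rfl

theorem removeNth_natAdd_append {V : Type*} {k m : ℕ} (v : Fin k → V) (b : Fin (m + 1) → V)
    (j : Fin (m + 1)) : Fin.removeNth (n := k + m) (Fin.natAdd k j) (@Fin.append k (m + 1) V v b) =
      Fin.append v (j.removeNth b) := by
  funext i
  refine Fin.addCases (fun i => ?_) (fun i => ?_) i
  · rw [Fin.append_left, Fin.removeNth, Fin.succAbove_of_castSucc_lt _ _ (by
      simp [Fin.lt_def]; omega)]
    exact Fin.append_left v b i
  · rw [Fin.append_right, Fin.removeNth, Fin.removeNth]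
    by_cases h : i.castSucc < j
    · rw [Fin.succAbove_of_castSucc_lt _ _ h, Fin.succAbove_of_castSucc_lt _ _ (by
        simpa [Fin.lt_def] using h)]
      exact Fin.append_right v b i.castSucc
    · rw [Fin.succAbove_of_le_castSucc _ _ (not_lt.1 h), Fin.succAbove_of_le_castSucc _ _ (by
        simpa [Fin.le_def] using h)]
      exact Fin.append_right v b i.succ

theorem removeNth_castAdd_append {V : Type*} {k m : ℕ} (v : Fin (k + 1) → V) (b : Fin (m + 1) → V)
    (j : Fin (k + 1)) (h : k + 1 + m = k + (m + 1)) :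
    Fin.removeNth (n := k + 1 + m) (Fin.castAdd (m + 1) j)
      (@Fin.append (k + 1) (m + 1) V v b) =
      fun i => Fin.append (j.removeNth v) b (Fin.cast h i) := by
  funext i
  obtain ⟨i, rfl⟩ : ∃ i', i = Fin.cast h.symm i' := ⟨Fin.cast h i, rfl⟩
  refine Fin.addCases (fun i => ?_) (fun i => ?_) i
  · rw [Fin.cast_cast, Fin.cast_eq_self, Fin.append_left, Fin.removeNth, Fin.removeNth]
    by_cases h : i.castSucc < j
    · rw [Fin.succAbove_of_castSucc_lt _ _ h, Fin.succAbove_of_castSucc_lt _ _ (by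
        simpa [Fin.lt_def] using h)]
      exact Fin.append_left v b i.castSucc
    · rw [Fin.succAbove_of_le_castSucc _ _ (not_lt.1 h), Fin.succAbove_of_le_castSucc _ _ (by
        simpa [Fin.le_def] using h)]
      exact Fin.append_left v b i.succ
  · rw [Fin.cast_cast, Fin.cast_eq_self, Fin.append_right, Fin.removeNth,
      Fin.succAbove_of_le_castSucc _ _ (by simp [Fin.le_def]; omega)]
    refine Eq.trans (congrArg _ (Fin.ext ?_)) (Fin.append_right v b i)
    simp
    omega

theorem KForm.cast_apply {k l : ℕ} (φ : Form I M) (h : k = l) (p : M) (y : E) (v : Fin l → E) :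
    chartRep I p (φ k).1 y (fun i => v (Fin.cast h i)) = chartRep I p (φ l).1 y v := by
  subst h; rfl

/-- Slices of the exterior derivative. -/
theorem sliceForm_dForm {m : ℕ} (φ : Form (I.prod J) (M × N)) (q : N) {t : E'}
    (ht : t ∈ (extChartAt J q).target) (b : Fin (m + 1) → E') :
    sliceForm I J (m + 1) (dForm (I.prod J) φ) ((extChartAt J q).symm t)
        (fun j => diffAt 𝓘(ℝ, E') J (extChartAt J q).symm t (b j)) =
      dForm I (sliceForm I J (m + 1) φ ((extChartAt J q).symm t)
        (fun j => diffAt 𝓘(ℝ, E') J (extChartAt J q).symm t (b j))) +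
      twist I (∑ j : Fin (m + 1), (-1 : ℝ) ^ (j : ℕ) •
        (smoothFamilyOn_sliceForm I J φ q (j.removeNth b)).deriv
          (isOpen_extChartAt_target q) (b j) t) := by
  funext k
  refine KForm.ext_chartRep I fun p u hu => ContinuousAlternatingMap.ext fun v => ?_
  have hz := mem_target_prod I J hu ht
  have hO := isOpen_extChartAt_target (I := I.prod J) (p, q)
  set ζ : E × E' → (E × E') [⋀^Fin (k + m)]→L[ℝ] ℝ := chartRep (I.prod J) (p, q) (φ (k + m)).1
    with hζ
  have hζd : DifferentiableAt ℝ ζ (u, t) := (φ (k + m)).differentiableAt (I.prod J) (p, q) hz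
  set W : Fin (k + (m + 1)) → E × E' :=
    Fin.append (fun i => ((v i, 0) : E × E')) fun j => (0, b j) with hW
  have hL : chartRep I p (sliceForm I J (m + 1) (dForm (I.prod J) φ) ((extChartAt J q).symm t)
        (fun j => diffAt 𝓘(ℝ, E') J (extChartAt J q).symm t (b j)) k).1 u v =
      extDeriv ζ (u, t) W := by
    rw [chartRep_sliceForm I J _ p q hu ht, sliceAlt_apply]
    exact congrArg (fun α : (E × E') [⋀^Fin (k + (m + 1))]→L[ℝ] ℝ => α W)
      (chartRep_dK (I.prod J) (φ (k + m)) (p, q) hz)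
  have hR2 : ∀ j : Fin (m + 1), chartRep I p
      ((smoothFamilyOn_sliceForm I J φ q (j.removeNth b)).deriv
        (isOpen_extChartAt_target q) (b j) t k).1 u v =
      fderiv ℝ (fun z => ζ z (Fin.removeNth (n := k + m) (Fin.natAdd k j) W)) (u, t) (0, b j) := by
    intro j
    have hs := smoothFamilyOn_sliceForm I J φ q (j.removeNth b)
    rw [hs.chartRep_deriv (isOpen_extChartAt_target q) (b j) ht k p hu,
      fderiv_cam_apply (hs.differentiableAt_chartRep (isOpen_extChartAt_target q) ht k p hu)]
    have e : (fun a : E' × E => chartRep I p (sliceForm I J m φ ((extChartAt J q).symm a.1)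
        (fun i => diffAt 𝓘(ℝ, E') J (extChartAt J q).symm a.1 (j.removeNth b i)) k).1 a.2 v)
        =ᶠ[𝓝 (t, u)] (fun z => ζ z (Fin.removeNth (n := k + m) (Fin.natAdd k j) W)) ∘
          ((ContinuousLinearMap.snd ℝ E' E).prod (ContinuousLinearMap.fst ℝ E' E)) := by
      filter_upwards [((isOpen_extChartAt_target q).prod (isOpen_extChartAt_target p)).mem_nhds
        (show (t, u) ∈ (extChartAt J q).target ×ˢ (extChartAt I p).target from ⟨ht, hu⟩)] with a ha
      rw [chartRep_sliceForm I J φ p q ha.2 ha.1, sliceAlt_apply, hW, removeNth_natAdd_append]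
      rfl
    rw [e.fderiv_eq]
    have hd : DifferentiableAt ℝ
        (fun z => ζ z (Fin.removeNth (n := k + m) (Fin.natAdd k j) W)) (u, t) :=
      (camEval (Fin.removeNth (n := k + m) (Fin.natAdd k j) W)).differentiableAt.comp (u, t) hζd
    rw [fderiv_comp (t, u) hd (ContinuousLinearMap.differentiableAt _),
      ContinuousLinearMap.fderiv]
    rfl
  have hR2' : chartRep I p (twist I (∑ j : Fin (m + 1), (-1 : ℝ) ^ (j : ℕ) •
        (smoothFamilyOn_sliceForm I J φ q (j.removeNth b)).deriv
          (isOpen_extChartAt_target q) (b j) t) k).1 u v =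
      ∑ j : Fin (m + 1), (-1 : ℝ) ^ (k + (j : ℕ)) *
        fderiv ℝ (fun z => ζ z (Fin.removeNth (n := k + m) (Fin.natAdd k j) W)) (u, t)
          (0, b j) := by
    let ℓ : Form I M →L[ℝ] ℝ := (camEval v).comp ((camComp k
      (diffAt 𝓘(ℝ, E) I (extChartAt I p).symm u)).comp (evalCLM I k ((extChartAt I p).symm u)))
    have hℓ : ∀ θ : Form I M, ℓ (twist I θ) = (-1 : ℝ) ^ k * ℓ θ := fun θ => by
      rw [← smul_eq_mul, ← map_smul]; rfl
    refine (hℓ _).trans ?_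
    rw [map_sum, Finset.mul_sum]
    refine Finset.sum_congr rfl fun j _ => ?_
    rw [map_smul, smul_eq_mul, pow_add, mul_assoc]
    exact congrArg (fun r => (-1 : ℝ) ^ k * ((-1) ^ (j : ℕ) * r)) (hR2 j)
  have hsum : extDeriv ζ (u, t) W =
      ∑ i : Fin k, (-1 : ℝ) ^ (i : ℕ) *
        fderiv ℝ (fun z => ζ z (Fin.removeNth (n := k + m) (Fin.castAdd (m + 1) i) W)) (u, t)
          (v i, 0) +
      ∑ j : Fin (m + 1), (-1 : ℝ) ^ (k + (j : ℕ)) *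
        fderiv ℝ (fun z => ζ z (Fin.removeNth (n := k + m) (Fin.natAdd k j) W)) (u, t)
          (0, b j) := by
    rw [extDeriv_apply_eq_sum hζd]
    refine (Fin.sum_univ_add (a := k) (b := m + 1) _).trans ?_
    congr 1
    · refine Finset.sum_congr rfl fun i _ => ?_
      simp only [Fin.val_castAdd]
      congr 2
      exact Fin.append_left _ _ i
    · refine Finset.sum_congr rfl fun j _ => ?_
      simp only [Fin.val_natAdd]
      congr 2
      exact Fin.append_right _ _ j
  refine hL.trans (hsum.trans ?_)
  rw [← hR2']
  refine congrArg₂ (· + ·) ?_ rfl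
  cases k with
  | zero => simp; rfl
  | succ k =>
    set θ := sliceForm I J (m + 1) φ ((extChartAt J q).symm t)
      (fun j => diffAt 𝓘(ℝ, E') J (extChartAt J q).symm t (b j)) with hθ
    have e0 : chartRep I p (dForm I θ (k + 1)).1 u = extDeriv (chartRep I p (θ k).1) u :=
      chartRep_dK I (θ k) p hu
    refine Eq.trans ?_ (congrArg (fun α : E [⋀^Fin (k + 1)]→L[ℝ] ℝ => α v) e0).symm
    rw [extDeriv_apply_eq_sum ((θ k).differentiableAt I p hu)]
    refine Finset.sum_congr rfl fun i _ => ?_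
    refine congrArg ((-1 : ℝ) ^ (i : ℕ) * ·) ?_
    have e : (fun a : E => chartRep I p (θ k).1 a (i.removeNth v)) =ᶠ[𝓝 u]
        (fun z => ζ z (Fin.removeNth (n := k + 1 + m) (Fin.castAdd (m + 1) i) W)) ∘
          fun a => (a, t) := by
      filter_upwards [(isOpen_extChartAt_target (I := I) p).mem_nhds hu] with a ha
      rw [hθ, chartRep_sliceForm I J φ p q ha ht, sliceAlt_apply, hW,
        removeNth_castAdd_append _ _ _ (by omega)]
      exact (KForm.cast_apply (I.prod J) φ (by omega) (p, q) (a, t) _).symm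
    have hd : DifferentiableAt ℝ
        (fun z => ζ z (Fin.removeNth (n := k + 1 + m) (Fin.castAdd (m + 1) i) W)) (u, t) :=
      (camEval (Fin.removeNth (n := k + 1 + m) (Fin.castAdd (m + 1) i) W)).differentiableAt.comp
        (u, t) hζd
    have hin : HasFDerivAt (fun a : E => (a, t)) (ContinuousLinearMap.inl ℝ E E') u :=
      (hasFDerivAt_id u).prodMk (hasFDerivAt_const t u)
    rw [e.fderiv_eq, (hd.hasFDerivAt.comp u hin).fderiv]
    rfl

variable {J} in
/-- The exterior derivative of the form of values of a functional on slices. -/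
theorem sliceEval_dForm (S T : Form I M →L[ℝ] ℝ) (hT : ∀ φ, T φ = S (dForm I φ)) (m : ℕ)
    (φ : Form (I.prod J) (M × N)) : sliceEval I J S (m + 1) (dForm (I.prod J) φ) =
      sliceEval I J T (m + 1) φ + dK J (sliceEval I J (S.comp (twistCLM I)) m φ) := by
  refine KForm.ext_chartRep J fun q t ht => ContinuousAlternatingMap.ext fun b => ?_
  have hd := (sliceEval I J (S.comp (twistCLM I)) m φ).differentiableAt J q ht
  have e : chartRep J q (dK J (sliceEval I J (S.comp (twistCLM I)) m φ)).1 t b =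
      ∑ j : Fin (m + 1), (-1 : ℝ) ^ (j : ℕ) * S (twist I
        ((smoothFamilyOn_sliceForm I J φ q (j.removeNth b)).deriv
          (isOpen_extChartAt_target q) (b j) t)) := by
    rw [chartRep_dK J _ q ht, extDeriv_apply_eq_sum hd]
    refine Finset.sum_congr rfl fun j _ => ?_
    refine congrArg ((-1 : ℝ) ^ (j : ℕ) * ·) ?_
    exact (smoothFamilyOn_sliceForm I J φ q (j.removeNth b)).fderiv_apply
      (isOpen_extChartAt_target q) (S.comp (twistCLM I)) ht (b j)
  change chartRep J q (sliceEval I J S (m + 1) (dForm (I.prod J) φ)).1 t b =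
    chartRep J q (sliceEval I J T (m + 1) φ).1 t b +
      chartRep J q (dK J (sliceEval I J (S.comp (twistCLM I)) m φ)).1 t b
  rw [e, chartRep_sliceEval, chartRep_sliceEval, sliceForm_dForm I J φ q ht b, map_add, hT]
  congr 1
  rw [map_sum (twist I), map_sum S]
  refine Finset.sum_congr rfl fun j _ => ?_
  rw [map_smul (twist I), map_smul S, smul_eq_mul]

end Slices

section SliceZero

variable {E : Type*} [NormedAddCommGroup E] [NormedSpace ℝ E] [FiniteDimensional ℝ E]
  {H : Type*} [TopologicalSpace H] (I : ModelWithCorners ℝ E H) [I.Boundaryless]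
  {M : Type*} [TopologicalSpace M] [ChartedSpace H M] [IsManifold I ∞ M]
  {E' : Type*} [NormedAddCommGroup E'] [NormedSpace ℝ E'] [FiniteDimensional ℝ E']
  {H' : Type*} [TopologicalSpace H'] (J : ModelWithCorners ℝ E' H') [J.Boundaryless]
  {N : Type*} [TopologicalSpace N] [ChartedSpace H' N] [IsManifold J ∞ N]

theorem sliceForm_zero (φ : Form (I.prod J) (M × N)) (y : N) (w : Fin 0 → E') :
    sliceForm I J 0 φ y w = pullback I (I.prod J) (fun x : M => (x, y))
      (contMDiff_id.prodMk contMDiff_const) φ := by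
  funext k
  refine KForm.ext fun x => ContinuousAlternatingMap.ext fun v => ?_
  have e5 : diffAt I (I.prod J) (fun x : M => (x, y)) x =
      ContinuousLinearMap.inl ℝ E E' := mfderiv_prod_left
  change (φ k).1 (x, y) (Fin.append (fun i => ((v i, 0) : E × E')) fun j => (0, w j)) =
    (φ k).1 (x, y) fun i => diffAt I (I.prod J) (fun x : M => (x, y)) x (v i)
  rw [e5]
  congr 1
  funext j
  exact Fin.append_left (fun i => ((v i, 0) : E × E')) (fun j => (0, w j)) j

/-- The form of values of a functional on the slices of a form on a product. -/
def sliceEvalForm (T : Form I M →L[ℝ] ℝ) (φ : Form (I.prod J) (M × N)) : Form J N :=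
  fun m => sliceEval I J T m φ

variable {J} in
theorem sliceEvalForm_dForm (S T : Form I M →L[ℝ] ℝ) (hT : ∀ φ, T φ = S (dForm I φ))
    (φ : Form (I.prod J) (M × N)) : sliceEvalForm I J S (dForm (I.prod J) φ) =
      sliceEvalForm I J T φ + dForm J (sliceEvalForm I J (S.comp (twistCLM I)) φ) := by
  funext m
  cases m with
  | zero =>
    refine KForm.ext fun y => ContinuousAlternatingMap.ext fun w => ?_
    change S (sliceForm I J 0 (dForm (I.prod J) φ) y w) = T (sliceForm I J 0 φ y w) + 0
    rw [sliceForm_zero, sliceForm_zero, hT, dForm_pullback, add_zero]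
  | succ m => exact sliceEval_dForm I S T hT m φ

end SliceZero

section CrossTop

variable {E : Type*} [NormedAddCommGroup E] [NormedSpace ℝ E] [NormedSpace ℂ E]
  [IsScalarTower ℝ ℂ E] [FiniteDimensional ℝ E] [FiniteDimensional ℂ E]
  {H : Type*} [TopologicalSpace H] (I : ModelWithCorners ℝ E H) [I.Boundaryless]
  {M : Type*} [TopologicalSpace M] [ChartedSpace H M] [IsManifold I ∞ M]
  [T2Space M] [CompactSpace M]
  {E' : Type*} [NormedAddCommGroup E'] [NormedSpace ℝ E'] [NormedSpace ℂ E']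
  [IsScalarTower ℝ ℂ E'] [FiniteDimensional ℝ E'] [FiniteDimensional ℂ E']
  {H' : Type*} [TopologicalSpace H'] (J : ModelWithCorners ℝ E' H') [J.Boundaryless]
  {N : Type*} [TopologicalSpace N] [ChartedSpace H' N] [IsManifold J ∞ N]
  [T2Space N] [CompactSpace N]

theorem crossTop_eq_integral (T : Current I M) (φ : Form (I.prod J) (M × N)) :
    crossTop I J T φ = integral J (sliceEvalForm I J T φ) := rfl

variable {I J} in
theorem crossTop_dForm (hor : OrientedCharts J N) {S T : Current I M}
    (hT : ∀ φ, T φ = S (dForm I φ)) (φ : Form (I.prod J) (M × N)) :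
    crossTop I J S (dForm (I.prod J) φ) = crossTop I J T φ := by
  rw [crossTop_eq_integral, crossTop_eq_integral, sliceEvalForm_dForm I S T hT]
  have h := (integralFormLM J N).map_add (sliceEvalForm I J T φ)
    (dForm J (sliceEvalForm I J (S.comp (twistCLM I)) φ))
  exact h.trans ((congrArg (_ + ·) (integral_dForm J hor _)).trans (add_zero _))

variable {I J} in
theorem topCross_dForm (hor : OrientedCharts I M) {S T : Current J N}
    (hT : ∀ φ, T φ = S (dForm J φ)) (φ : Form (I.prod J) (M × N)) :
    topCross I J S (dForm (I.prod J) φ) = topCross I J T φ := by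
  rw [topCross, topCross, ← crossTop_dForm hor hT, dForm_pullback]

variable {I J} in
theorem crossTop_eq_zero {T : Current I M} {φ : Form (I.prod J) (M × N)}
    (h : ∀ y w, T (sliceForm I J (realDim E') φ y w) = 0) : crossTop I J T φ = 0 := by
  have : sliceEvalForm I J T φ (realDim E') = 0 :=
    KForm.ext fun y => ContinuousAlternatingMap.ext fun w => h y w
  rw [crossTop_eq_integral, integral_eq_integralK, this]
  exact (integralLM J N).map_zero

end CrossTop

section Homotopy

variable {E : Type*} [NormedAddCommGroup E] [NormedSpace ℝ E] [FiniteDimensional ℝ E]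
  {H : Type*} [TopologicalSpace H] (I : ModelWithCorners ℝ E H) [I.Boundaryless]
  {M : Type*} [TopologicalSpace M] [ChartedSpace H M] [IsManifold I ∞ M]
  {E' : Type*} [NormedAddCommGroup E'] [NormedSpace ℝ E'] [FiniteDimensional ℝ E']
  {H' : Type*} [TopologicalSpace H'] (J : ModelWithCorners ℝ E' H') [J.Boundaryless]
  {N : Type*} [TopologicalSpace N] [ChartedSpace H' N] [IsManifold J ∞ N]
  {F : Type*} [NormedAddCommGroup F] [NormedSpace ℝ F]
  {Q : Type*} [NormedAddCommGroup Q] [NormedSpace ℝ Q] [FiniteDimensional ℝ Q]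
  {V : Type*} [NormedAddCommGroup V] [NormedSpace ℝ V] [FiniteDimensional ℝ V]

variable {I J} in
theorem LocalFamily.smul {l k : ℕ} {Op : Q → KForm J N l → KForm I M k}
    (hOp : LocalFamily I J Op) {c : Q → ℝ} (hc : ContDiff ℝ ∞ c) :
    LocalFamily I J (fun q θ => c q • Op q θ) := by
  intro q₀ p u₀ hu₀
  obtain ⟨p', O, ς, L, hO, hm, hς, hL, hmaps, hf⟩ := hOp q₀ p u₀ hu₀
  have := finiteDimensional_cam (V := E') l
  refine ⟨p', O, ς, fun a => c a.1 • L a, hO, hm, hς, contDiffOn_clm_apply.2 fun α =>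
    (hc.comp contDiff_fst).contDiffOn.smul (hL.clm_apply contDiffOn_const), hmaps,
    fun a ha θ => ?_⟩
  have : chartRep I p (c a.1 • Op a.1 θ).1 a.2 = c a.1 • chartRep I p (Op a.1 θ).1 a.2 := rfl
  rw [this, hf a ha θ]
  rfl

variable {I J} in
theorem LocalFormFamily.smul {Op : Q → Form J N → Form I M} (hOp : LocalFormFamily I J Op)
    {c : Q → ℝ} (hc : ContDiff ℝ ∞ c) : LocalFormFamily I J (fun q φ => c q • Op q φ) := by
  intro k
  obtain ⟨l, op, hop, h⟩ := hOp k
  refine ⟨l, _, hop.smul hc, fun q φ => ?_⟩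
  rw [← h]; rfl

theorem localFamily_sliceK (k m : ℕ) {c : Q → V} (hc : ContDiff ℝ ∞ c) {w : Q → Fin m → V}
    (hw : ContDiff ℝ ∞ w) : LocalFamily I (I.prod 𝓘(ℝ, V))
      (fun q (θ : KForm (I.prod 𝓘(ℝ, V)) (M × V) (k + m)) => sliceK I 𝓘(ℝ, V) θ (c q) (w q)) := by
  intro q₀ p u₀ hu₀
  have := finiteDimensional_cam (V := E × V) (k + m)
  let L : Q × E → ((E × V) [⋀^Fin (k + m)]→L[ℝ] ℝ) →L[ℝ] (E [⋀^Fin k]→L[ℝ] ℝ) := fun a =>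
    LinearMap.toContinuousLinearMap
      { toFun := fun α => sliceAlt α (w a.1)
        map_add' := fun _ _ => rfl
        map_smul' := fun _ _ => rfl }
  refine ⟨(p, c q₀), univ ×ˢ (extChartAt I p).target, fun a => (a.2, c a.1), L,
    isOpen_univ.prod (isOpen_extChartAt_target p), ⟨mem_univ _, hu₀⟩,
    (contDiff_snd.prodMk (hc.comp contDiff_fst)).contDiffOn, ?_,
    fun a ha => mem_target_prod I 𝓘(ℝ, V) ha.2
      (by rw [extChartAt_model_space_eq_id]; trivial), fun a ha θ => ?_⟩
  · rw [contDiffOn_clm_apply]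
    intro α
    exact contDiffOn_sliceAlt contDiffOn_const (hw.comp contDiff_fst).contDiffOn
  · have h := chartRep_slice_frame I 𝓘(ℝ, V) θ.1 p (c q₀) (t := c a.1) ha.2
      (by rw [extChartAt_model_space_eq_id]; trivial) (w a.1)
    have e : diffAt 𝓘(ℝ, V) 𝓘(ℝ, V) (extChartAt 𝓘(ℝ, V) (c q₀)).symm (c a.1) =
        ContinuousLinearMap.id ℝ V := by
      have : ((extChartAt 𝓘(ℝ, V) (c q₀)).symm : V → V) = id := by
        rw [extChartAt_model_space_eq_id]; rfl
      rw [this]; exact mfderiv_id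
    simp only [e] at h
    exact h

/-- Linear operators on forms that do not increase the order of jets. -/
def OrderBounded (R : Form J N → Form I M) : Prop :=
  ∀ i : JetIdx I M, JetBound J i.order (fun φ => jetNorm I i (R φ))

variable {I J} in
theorem OrderBounded.jetBound_comp {R : Form J N → Form I M} (hR : OrderBounded I J R) {n : ℕ∞}
    {f : Form I M → ℝ} (hf : JetBound I n f) : JetBound J n (fun φ => f (R φ)) := by
  obtain ⟨s, hs, c, hc, h⟩ := hf
  exact ((JetBound.sum fun i hi => (hR i).mono_order (hs i hi)).const_mul hc).mono fun φ => h _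

variable {I J} in
theorem OrderBounded.continuous {R : Form J N →ₗ[ℝ] Form I M} (hR : OrderBounded I J R) :
    Continuous R := continuous_of_jetBound fun i => (hR i).mono_order le_top

theorem jetNorm_add_le (i : JetIdx I M) (φ ψ : Form I M) :
    jetNorm I i (φ + ψ) ≤ jetNorm I i φ + jetNorm I i ψ := by
  rw [jetNorm, map_add]; exact norm_add_le _ _

variable {I} in
theorem OrderBounded.comp {R R' : Form I M → Form I M} (hR : OrderBounded I I R)
    (hR' : OrderBounded I I R') : OrderBounded I I (fun φ => R (R' φ)) :=
  fun i => hR'.jetBound_comp (hR i)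

variable {I} in
theorem OrderBounded.add {R R' : Form I M → Form I M} (hR : OrderBounded I I R)
    (hR' : OrderBounded I I R') : OrderBounded I I (fun φ => R φ + R' φ) :=
  fun i => ((hR i).add (hR' i)).mono fun _ => jetNorm_add_le I i _ _

section Integral

variable {Y : Type*} [NormedAddCommGroup Y] [NormedSpace ℝ Y] [FiniteDimensional ℝ Y]
  [MeasurableSpace Y] [BorelSpace Y] (μ : Measure Y) [IsFiniteMeasureOnCompacts μ]

theorem form_ext_of_functional {φ ψ : Form I M} (h : ∀ T : Form I M →L[ℝ] ℝ, T φ = T ψ) :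
    φ = ψ :=
  funext fun k => KForm.ext fun x => ContinuousAlternatingMap.ext fun v =>
    h ((camEval v).comp (evalCLM I k x))

theorem LocalFormFamily.smoothFamilyOn_apply {Op : Y → Form J N →ₗ[ℝ] Form I M}
    (hOp : LocalFormFamily I J fun y φ => Op y φ) (φ : Form J N) :
    SmoothFamilyOn I univ fun y => Op y φ := hOp.smoothFamilyOn φ

theorem operator_apply_eq_zero {Op : Y → Form J N →ₗ[ℝ] Form I M} {K : Set Y}
    (h0 : ∀ y ∉ K, Op y = 0) (φ : Form J N) : ∀ y ∉ K, Op y φ = 0 := fun y hy => by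
  rw [h0 y hy]; rfl

variable {I J} in
/-- The integral of a compactly supported local family of operators, as a linear map. -/
def LocalFormFamily.integralLM {Op : Y → Form J N →ₗ[ℝ] Form I M}
    (hOp : LocalFormFamily I J fun y φ => Op y φ) {K : Set Y} (hK : IsCompact K)
    (h0 : ∀ y ∉ K, Op y = 0) : Form J N →ₗ[ℝ] Form I M where
  toFun φ := (hOp.smoothFamilyOn_apply I J φ).integral μ hK (operator_apply_eq_zero I J h0 φ)
  map_add' φ ψ := form_ext_of_functional I fun T => by
    rw [map_add, ← SmoothFamilyOn.integral_apply, ← SmoothFamilyOn.integral_apply,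
      ← SmoothFamilyOn.integral_apply, ← integral_add
        ((hOp.smoothFamilyOn_apply I J φ).integrable_apply μ hK (operator_apply_eq_zero I J h0 φ) T)
        ((hOp.smoothFamilyOn_apply I J ψ).integrable_apply μ hK (operator_apply_eq_zero I J h0 ψ) T)]
    simp only [map_add]
  map_smul' c φ := form_ext_of_functional I fun T => by
    rw [RingHom.id_apply, map_smul, ← SmoothFamilyOn.integral_apply,
      ← SmoothFamilyOn.integral_apply, ← integral_smul]
    simp only [map_smul]

variable {I J} in
theorem LocalFormFamily.orderBounded_integralLM {Op : Y → Form J N →ₗ[ℝ] Form I M}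
    (hOp : LocalFormFamily I J fun y φ => Op y φ) {K : Set Y} (hK : IsCompact K)
    (h0 : ∀ y ∉ K, Op y = 0) : OrderBounded I J (hOp.integralLM μ hK h0) := by
  intro i
  obtain ⟨s, hs', c, hc, hb⟩ := hOp.exists_bound hK (jetBound_jetNorm I i)
  refine ⟨s, hs', c * μ.real K, by positivity, fun φ => ?_⟩
  have h1 : jetLM I i (hOp.integralLM μ hK h0 φ) = ∫ y, jetLM I i (Op y φ) ∂μ :=
    ((hOp.smoothFamilyOn_apply I J φ).jetLM_integral μ hK (operator_apply_eq_zero I J h0 φ) i).symm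
  have h2 : ∫ y, jetLM I i (Op y φ) ∂μ = ∫ y in K, jetLM I i (Op y φ) ∂μ := by
    refine (setIntegral_eq_integral_of_forall_compl_eq_zero fun y hy => ?_).symm
    rw [operator_apply_eq_zero I J h0 φ y hy, map_zero]
  change ‖jetLM I i (hOp.integralLM μ hK h0 φ)‖ ≤ _
  rw [h1, h2, mul_assoc, mul_comm (μ.real K), ← mul_assoc]
  exact norm_setIntegral_le_of_norm_le_const hK.measure_lt_top fun y hy => hb y hy φ

variable {I J} in
/-- The integral of a compactly supported local family of operators. -/
def LocalFormFamily.integral {Op : Y → Form J N →ₗ[ℝ] Form I M}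
    (hOp : LocalFormFamily I J fun y φ => Op y φ) {K : Set Y} (hK : IsCompact K)
    (h0 : ∀ y ∉ K, Op y = 0) : Form J N →L[ℝ] Form I M :=
  ⟨hOp.integralLM μ hK h0, (hOp.orderBounded_integralLM μ hK h0).continuous⟩

variable {I J} in
theorem LocalFormFamily.orderBounded_integral {Op : Y → Form J N →ₗ[ℝ] Form I M}
    (hOp : LocalFormFamily I J fun y φ => Op y φ) {K : Set Y} (hK : IsCompact K)
    (h0 : ∀ y ∉ K, Op y = 0) : OrderBounded I J (hOp.integral μ hK h0) :=
  hOp.orderBounded_integralLM μ hK h0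

variable {I J} in
theorem LocalFormFamily.apply_integral [CompleteSpace F] {Op : Y → Form J N →ₗ[ℝ] Form I M}
    (hOp : LocalFormFamily I J fun y φ => Op y φ) {K : Set Y} (hK : IsCompact K)
    (h0 : ∀ y ∉ K, Op y = 0) (T : Form I M →L[ℝ] F) (φ : Form J N) :
    T (hOp.integral μ hK h0 φ) = ∫ y, T (Op y φ) ∂μ :=
  ((hOp.smoothFamilyOn_apply I J φ).integral_apply μ hK (operator_apply_eq_zero I J h0 φ) T).symm

end Integral

end Homotopy

section SliceLinear

variable {E : Type*} [NormedAddCommGroup E] [NormedSpace ℝ E] [FiniteDimensional ℝ E]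
  {H : Type*} [TopologicalSpace H] (I : ModelWithCorners ℝ E H) [I.Boundaryless]
  {M : Type*} [TopologicalSpace M] [ChartedSpace H M] [IsManifold I ∞ M]
  {E' : Type*} [NormedAddCommGroup E'] [NormedSpace ℝ E'] [FiniteDimensional ℝ E']
  {H' : Type*} [TopologicalSpace H'] (J : ModelWithCorners ℝ E' H') [J.Boundaryless]
  {N : Type*} [TopologicalSpace N] [ChartedSpace H' N] [IsManifold J ∞ N]

/-- The slices of forms on a product, as a linear map. -/
def sliceFormLM (m : ℕ) (y : N) (w : Fin m → E') : Form (I.prod J) (M × N) →ₗ[ℝ] Form I M where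
  toFun φ := sliceForm I J m φ y w
  map_add' _ _ := rfl
  map_smul' _ _ := rfl

end SliceLinear

section Actions

variable {E : Type*} [NormedAddCommGroup E] [NormedSpace ℝ E] [FiniteDimensional ℝ E]
  {H : Type*} [TopologicalSpace H] (I : ModelWithCorners ℝ E H) [I.Boundaryless]
  (M : Type*) [TopologicalSpace M] [ChartedSpace H M] [IsManifold I ∞ M]
  (V : Type*) [NormedAddCommGroup V] [NormedSpace ℝ V] [FiniteDimensional ℝ V]

/-- Smooth actions of the additive group of a vector space on a manifold. -/
structure VectorAction where
  shift : V → M → M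
  smooth : ContMDiff (𝓘(ℝ, V).prod I) I ∞ fun z : V × M => shift z.1 z.2
  shift_zero : ∀ x, shift 0 x = x
  shift_add : ∀ y y' x, shift (y + y') x = shift y (shift y' x)

namespace VectorAction

variable {I M V} (s : VectorAction I M V)

theorem contMDiff_shift (y : V) : ContMDiff I I ∞ (s.shift y) :=
  s.smooth.comp (contMDiff_const.prodMk contMDiff_id)

theorem contMDiff_uncurry_swap : ContMDiff (I.prod 𝓘(ℝ, V)) I ∞ fun z : M × V => s.shift z.2 z.1 :=
  s.smooth.comp (contMDiff_snd.prodMk contMDiff_fst)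

theorem shift_neg_shift (y : V) (x : M) : s.shift (-y) (s.shift y x) = x := by
  rw [← s.shift_add, neg_add_cancel, s.shift_zero]

theorem shift_shift_neg (y : V) (x : M) : s.shift y (s.shift (-y) x) = x := by
  rw [← s.shift_add, add_neg_cancel, s.shift_zero]

/-- The pull-back of forms by an element of the group. -/
def pull (y : V) : Form I M →L[ℝ] Form I M := pullbackCLM I I (s.shift y) (s.contMDiff_shift y)

theorem pull_eq (y : V) (φ : Form I M) :
    s.pull y φ = pullback I I (s.shift y) (s.contMDiff_shift y) φ := rfl

theorem pull_dForm (y : V) (φ : Form I M) : s.pull y (dForm I φ) = dForm I (s.pull y φ) :=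
  (dForm_pullback I I (s.shift y) (s.contMDiff_shift y) φ).symm

theorem pull_zero (φ : Form I M) : s.pull 0 φ = φ := by
  have : s.shift 0 = id := funext s.shift_zero
  rw [pull_eq, pullback_congr I I (s.contMDiff_shift 0) this, pullback_id]

theorem pull_neg_pull (y : V) (φ : Form I M) : s.pull (-y) (s.pull y φ) = φ := by
  rw [pull_eq, pull_eq, pullback_pullback, pullback_congr I I _ (f := s.shift y ∘ s.shift (-y))
    (g := id) (funext fun x => s.shift_shift_neg y x), pullback_id]

theorem localFormFamily_pull : LocalFormFamily I I (fun y φ => s.pull y φ) :=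
  localFormFamily_pullback I I s.contMDiff_shift s.smooth

/-- The contraction of the pull-back of a form by the action with the direction `y`, at time `t`
along the line spanned by `y`. -/
def contraction (a : V × ℝ) : Form I M →ₗ[ℝ] Form I M :=
  (twist I).comp ((sliceFormLM I 𝓘(ℝ, V) 1 (a.2 • a.1) fun _ => a.1).comp
    (pullbackLM (I.prod 𝓘(ℝ, V)) I (fun z : M × V => s.shift z.2 z.1) s.contMDiff_uncurry_swap))

theorem localFormFamily_contraction {g : V × ℝ → ℝ} (hg : ContDiff ℝ ∞ g) :
    LocalFormFamily I I (fun a φ => (g a • s.contraction a) φ) := by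
  intro k
  have h1 := localFamily_sliceK I (M := M) (Q := V × ℝ) k 1 (c := fun a => a.2 • a.1)
    (w := fun a _ => a.1) (contDiff_snd.smul contDiff_fst) (contDiff_pi.2 fun _ => contDiff_fst)
  have h2 := localFamily_pullbackK (I.prod 𝓘(ℝ, V)) I (Q := V × ℝ)
    (f := fun _ (z : M × V) => s.shift z.2 z.1) (fun _ => s.contMDiff_uncurry_swap)
    (s.contMDiff_uncurry_swap.comp contMDiff_snd) (k + 1)
  exact ⟨k + 1, _, ((h1.comp h2).smul (c := fun _ => (-1 : ℝ) ^ k) contDiff_const).smul hg,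
    fun q φ => rfl⟩

/-- Cartan's formula. -/
theorem hasDerivAt_pull (T : Form I M →L[ℝ] ℝ) (φ : Form I M) (y : V) (t : ℝ) :
    HasDerivAt (fun t : ℝ => T (s.pull (t • y) φ))
      (T (s.contraction (y, t) (dForm I φ)) + T (dForm I (s.contraction (y, t) φ))) t := by
  set ψ := pullback (I.prod 𝓘(ℝ, V)) I (fun z : M × V => s.shift z.2 z.1)
    s.contMDiff_uncurry_swap φ with hψ
  have hs0 : ∀ z : V, sliceForm I 𝓘(ℝ, V) 0 ψ z Fin.elim0 = s.pull z φ := by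
    intro z
    rw [sliceForm_zero, hψ, pullback_pullback]
    rfl
  have e : ∀ z : V, diffAt 𝓘(ℝ, V) 𝓘(ℝ, V) (extChartAt 𝓘(ℝ, V) (0 : V)).symm z =
      ContinuousLinearMap.id ℝ V := fun z => by
    have : ((extChartAt 𝓘(ℝ, V) (0 : V)).symm : V → V) = id := by
      rw [extChartAt_model_space_eq_id]; rfl
    rw [this]; exact mfderiv_id
  have htt : ∀ z : V, z ∈ (extChartAt 𝓘(ℝ, V) (0 : V)).target := fun z => by
    rw [extChartAt_model_space_eq_id]; trivial
  have hsy : ∀ z : V, (extChartAt 𝓘(ℝ, V) (0 : V)).symm z = z := fun z => by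
    rw [extChartAt_model_space_eq_id]; rfl
  let b : Fin 1 → V := fun _ => y
  have hfam := smoothFamilyOn_sliceForm I 𝓘(ℝ, V) ψ 0 ((0 : Fin 1).removeNth b)
  have hO := isOpen_extChartAt_target (I := 𝓘(ℝ, V)) (0 : V)
  have key := sliceForm_dForm I 𝓘(ℝ, V) ψ (0 : V) (htt (t • y)) b
  obtain ⟨D, hD, hDh⟩ := hfam.hasFDerivAt hO T (htt (t • y))
  have hfun : (fun z => T (sliceForm I 𝓘(ℝ, V) 0 ψ ((extChartAt 𝓘(ℝ, V) (0 : V)).symm z)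
      fun j => diffAt 𝓘(ℝ, V) 𝓘(ℝ, V) (extChartAt 𝓘(ℝ, V) (0 : V)).symm z
        ((0 : Fin 1).removeNth b j))) = fun z => T (s.pull z φ) := by
    funext z
    rw [hsy, ← hs0]
    congr 2
    exact Subsingleton.elim _ _
  rw [hfun] at hD
  have hline : HasDerivAt (fun t : ℝ => t • y) y t := by
    simpa using (hasDerivAt_id t).smul_const y
  have h1 := hD.comp_hasDerivAt t hline
  refine h1.congr_deriv ?_
  rw [hDh]
  simp only [e, hsy, ContinuousLinearMap.id_apply] at key
  have h2 : s.contraction (y, t) (dForm I φ) = twist I (sliceForm I 𝓘(ℝ, V) 1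
      (dForm (I.prod 𝓘(ℝ, V)) ψ) (t • y) b) := by
    rw [hψ, dForm_pullback]; rfl
  have htw : ∀ θ : Form I M, twist I (twist I θ) = θ := fun θ => funext fun k => by
    rw [twist_apply, twist_apply, smul_smul, ← pow_add, Even.neg_one_pow ⟨k, rfl⟩, one_smul]
  have h3 : dForm I (s.contraction (y, t) φ) = -twist I (dForm I (sliceForm I 𝓘(ℝ, V) 1 ψ
      (t • y) b)) := by
    rw [twist_dForm, neg_neg]; rfl
  rw [← map_add, h2, h3]
  congr 1
  have key2 := congrArg (twist I) key
  rw [map_add (twist I), htw] at key2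
  refine Eq.trans ?_ (congrArg (· + -twist I (dForm I (sliceForm I 𝓘(ℝ, V) 1 ψ (t • y) b)))
    key2).symm
  simp [b]

end VectorAction

end Actions

section Regularization

variable {E : Type*} [NormedAddCommGroup E] [NormedSpace ℝ E] [FiniteDimensional ℝ E]
  {H : Type*} [TopologicalSpace H] (I : ModelWithCorners ℝ E H) [I.Boundaryless]
  (M : Type*) [TopologicalSpace M] [ChartedSpace H M] [IsManifold I ∞ M]
  (V : Type*) [NormedAddCommGroup V] [NormedSpace ℝ V] [FiniteDimensional ℝ V]
  [MeasureSpace V] [BorelSpace V] [IsFiniteMeasureOnCompacts (volume : Measure V)]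

/-- Smooth compactly supported functions with integral `1`. -/
structure Mollifier where
  toFun : V → ℝ
  smooth : ContDiff ℝ ∞ toFun
  hasCompactSupport : HasCompactSupport toFun
  integral_eq_one : ∫ y, toFun y = 1

variable {V} in
theorem Mollifier.integrable (f : Mollifier V) : Integrable f.toFun :=
  f.smooth.continuous.integrable_of_hasCompactSupport f.hasCompactSupport

variable {I M V} (s : VectorAction I M V) (f : Mollifier V)

namespace VectorAction

theorem localFormFamily_smul_pull : LocalFormFamily I I
    (fun y φ => (f.toFun y • (s.pull y : Form I M →ₗ[ℝ] Form I M)) φ) :=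
  s.localFormFamily_pull.smul f.smooth

theorem smul_pull_eq_zero : ∀ y ∉ tsupport f.toFun,
    f.toFun y • (s.pull y : Form I M →ₗ[ℝ] Form I M) = 0 := fun y hy => by
  rw [image_eq_zero_of_notMem_tsupport hy, zero_smul]

/-- The regularization of forms by averaging over an action. -/
def regularize : Form I M →L[ℝ] Form I M :=
  (s.localFormFamily_smul_pull f).integral volume f.hasCompactSupport.isCompact
    (s.smul_pull_eq_zero f)

theorem orderBounded_regularize : OrderBounded I I (s.regularize f) :=
  (s.localFormFamily_smul_pull f).orderBounded_integral volume f.hasCompactSupport.isCompact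
    (s.smul_pull_eq_zero f)

theorem apply_regularize {F : Type*} [NormedAddCommGroup F] [NormedSpace ℝ F] [CompleteSpace F]
    (T : Form I M →L[ℝ] F) (φ : Form I M) :
    T (s.regularize f φ) = ∫ y, f.toFun y • T (s.pull y φ) := by
  refine ((s.localFormFamily_smul_pull f).apply_integral volume _ _ T φ).trans
    (integral_congr_ae (Eventually.of_forall fun y => ?_))
  exact map_smul T _ _

/-- A cut-off function of time. -/
def timeBump : ContDiffBump (1 / 2 : ℝ) := ⟨1, 2, one_pos, one_lt_two⟩

theorem timeBump_eq_one {t : ℝ} (ht : t ∈ Icc (0 : ℝ) 1) : timeBump t = 1 := by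
  refine timeBump.one_of_mem_closedBall ?_
  rw [Metric.mem_closedBall, Real.dist_eq, abs_le]
  change _ ≤ _ ∧ _ ≤ (1 : ℝ)
  constructor
  · change -(1 : ℝ) ≤ _; linarith [ht.1]
  · linarith [ht.2]

theorem localFormFamily_smul_contraction : LocalFormFamily I I
    (fun a φ => ((f.toFun a.1 * timeBump a.2) • s.contraction a) φ) :=
  s.localFormFamily_contraction ((f.smooth.comp contDiff_fst).mul
    (timeBump.contDiff.comp contDiff_snd))

theorem smul_contraction_eq_zero : ∀ a ∉ tsupport f.toFun ×ˢ tsupport timeBump,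
    (f.toFun a.1 * timeBump a.2) • s.contraction a = 0 := fun a ha => by
  rw [mem_prod, not_and_or] at ha
  rcases ha with h | h
  · rw [image_eq_zero_of_notMem_tsupport h, zero_mul, zero_smul]
  · rw [image_eq_zero_of_notMem_tsupport h, mul_zero, zero_smul]

/-- The homotopy between the regularization operator and the identity. -/
def homotopy : Form I M →L[ℝ] Form I M :=
  (s.localFormFamily_smul_contraction f).integral
    ((volume : Measure V).prod ((volume : Measure ℝ).restrict (Icc 0 1)))
    (f.hasCompactSupport.isCompact.prod timeBump.hasCompactSupport) (s.smul_contraction_eq_zero f)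

theorem orderBounded_homotopy : OrderBounded I I (s.homotopy f) :=
  (s.localFormFamily_smul_contraction f).orderBounded_integral _ _ _

theorem integrable_smul_contraction (T : Form I M →L[ℝ] ℝ) (φ : Form I M) :
    Integrable (fun a : V × ℝ => T (((f.toFun a.1 * timeBump a.2) • s.contraction a) φ))
      ((volume : Measure V).prod ((volume : Measure ℝ).restrict (Icc 0 1))) :=
  ((s.localFormFamily_smul_contraction f).smoothFamilyOn_apply I I φ).integrable_apply _
    (f.hasCompactSupport.isCompact.prod timeBump.hasCompactSupport)
    (operator_apply_eq_zero I I (s.smul_contraction_eq_zero f) φ) T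

theorem homotopy_formula (φ : Form I M) :
    s.regularize f φ - φ = dForm I (s.homotopy f φ) + s.homotopy f (dForm I φ) := by
  refine form_ext_of_functional I fun T => ?_
  set ν : Measure (V × ℝ) := (volume : Measure V).prod ((volume : Measure ℝ).restrict (Icc 0 1))
    with hν
  have h1 : T (dForm I (s.homotopy f φ)) = ∫ a, T (dForm I
      (((f.toFun a.1 * timeBump a.2) • s.contraction a) φ)) ∂ν :=
    (s.localFormFamily_smul_contraction f).apply_integral ν _ _ (T.comp (dFormCLM I)) φ
  have h2 : T (s.homotopy f (dForm I φ)) = ∫ a, T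
      (((f.toFun a.1 * timeBump a.2) • s.contraction a) (dForm I φ)) ∂ν :=
    (s.localFormFamily_smul_contraction f).apply_integral ν _ _ T (dForm I φ)
  have i1 := s.integrable_smul_contraction f (T.comp (dFormCLM I)) φ
  have i2 := s.integrable_smul_contraction f T (dForm I φ)
  have hin : ∀ y : V, ∫ t in Icc (0 : ℝ) 1, (T (dForm I
      (((f.toFun y * timeBump t) • s.contraction (y, t)) φ)) +
      T (((f.toFun y * timeBump t) • s.contraction (y, t)) (dForm I φ))) =
      f.toFun y * T (s.pull y φ) - f.toFun y * T φ := by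
    intro y
    set D : ℝ → ℝ := fun t => T (s.contraction (y, t) (dForm I φ)) +
      T (dForm I (s.contraction (y, t) φ)) with hD
    have e1 : ∀ t ∈ Icc (0 : ℝ) 1, T (dForm I
      (((f.toFun y * timeBump t) • s.contraction (y, t)) φ)) +
      T (((f.toFun y * timeBump t) • s.contraction (y, t)) (dForm I φ)) = f.toFun y * D t := by
      intro t ht
      rw [timeBump_eq_one ht, mul_one, hD]
      have : dForm I ((f.toFun y • s.contraction (y, t)) φ) =
          f.toFun y • dForm I (s.contraction (y, t) φ) := (dFormLM I).map_smul _ _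
      rw [this, map_smul T, LinearMap.smul_apply, map_smul T, smul_eq_mul, smul_eq_mul]
      ring
    rw [setIntegral_congr_fun measurableSet_Icc e1, integral_const_mul,
      integral_Icc_eq_integral_Ioc, ← intervalIntegral.integral_of_le zero_le_one]
    have hcont : Continuous D := by
      have c1 : LocalFormFamily I I (fun a φ => ((1 : ℝ) • s.contraction a) φ) :=
        s.localFormFamily_contraction (g := fun _ => 1) contDiff_const
      have c2 : ∀ (T : Form I M →L[ℝ] ℝ) φ, Continuous fun t => T (s.contraction (y, t) φ) := by
        intro T φ
        have := ((c1.smoothFamilyOn_apply I I (Op := fun a => (1 : ℝ) • s.contraction a) φ).contDiffOn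
          isOpen_univ T).continuousOn
        simp only [one_smul] at this
        exact (continuousOn_univ.1 this).comp (by fun_prop)
      exact (c2 T _).add (c2 (T.comp (dFormCLM I)) φ)
    rw [intervalIntegral.integral_eq_sub_of_hasDerivAt
      (f := fun t : ℝ => T (s.pull (t • y) φ)) (fun t _ => s.hasDerivAt_pull T φ y t)
      (hcont.intervalIntegrable _ _), one_smul, zero_smul, s.pull_zero, mul_sub]
  rw [map_add, h1, h2, map_sub]
  refine Eq.symm ((integral_add i1 i2).symm.trans ((integral_prod _ (i1.add i2)).trans
    ((integral_congr_ae (Eventually.of_forall hin)).trans ?_)))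
  have i3 : Integrable (fun y => f.toFun y * T (s.pull y φ)) := by
    have := ((s.localFormFamily_smul_pull f).smoothFamilyOn_apply I I φ).integrable_apply volume
      f.hasCompactSupport.isCompact (operator_apply_eq_zero I I (s.smul_pull_eq_zero f) φ) T
    refine this.congr (Eventually.of_forall fun y => ?_)
    exact map_smul T _ _
  rw [integral_sub i3 (f.integrable.mul_const _), integral_mul_const, f.integral_eq_one, one_mul,
    apply_regularize]
  rfl

theorem regularize_dForm (φ : Form I M) :
    s.regularize f (dForm I φ) = dForm I (s.regularize f φ) := by
  refine form_ext_of_functional I fun T => ?_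
  have h := s.apply_regularize f (T.comp (dFormCLM I)) φ
  refine (s.apply_regularize f T (dForm I φ)).trans (Eq.trans ?_ h.symm)
  simp only [pull_dForm]
  rfl

end VectorAction

end Regularization

section IntegralInvariance

variable {E : Type*} [NormedAddCommGroup E] [NormedSpace ℝ E] [NormedSpace ℂ E]
  [IsScalarTower ℝ ℂ E] [FiniteDimensional ℝ E] [FiniteDimensional ℂ E]
  {H : Type*} [TopologicalSpace H] (I : ModelWithCorners ℝ E H) [I.Boundaryless]
  (M : Type*) [TopologicalSpace M] [ChartedSpace H M] [IsManifold I ∞ M]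
  [T2Space M] [CompactSpace M]
  {V : Type*} [NormedAddCommGroup V] [NormedSpace ℝ V] [FiniteDimensional ℝ V]

theorem jetBound_integral : JetBound I 0 (fun φ : Form I M => ‖integral I φ‖) := by
  have h1 : ∀ p : M, JetBound I 0 (fun φ : Form I M => ‖localIntegral I p
      (smulK (contMDiff_chartPartition I p) (φ (realDim E)))‖) := by
    intro p
    set C := tsupport (chartPartition I M p) with hC
    have hCc : IsClosed C := isClosed_tsupport _
    have hK := isCompact_image_chartCo I hCc (chartPartition_subset I p)
    have hKs := image_chartCo_subset I (chartPartition_subset I p)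
    let i : JetIdx I M := ⟨realDim E, p, 0, frameEquiv E '' (chartCo I p '' C),
      hK.image (frameEquiv E).continuous, by rintro _ ⟨u, hu, rfl⟩; exact hKs hu⟩
    set c : ℝ := (∏ j, ‖realFrame E j‖) * (volume : Measure (Fin (realDim E) → ℝ)).real
      (chartCo I p '' C) with hc
    have hc0 : 0 ≤ c := by positivity
    refine ((jetBound_jetNorm I i).const_mul hc0).mono fun φ => ?_
    have e : localIntegral I p (smulK (contMDiff_chartPartition I p) (φ (realDim E))) =
        ∫ u in chartCo I p '' C,
          topCoeff I p (smulK (contMDiff_chartPartition I p) (φ (realDim E))).1 u := by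
      refine setIntegral_eq_of_subset_of_forall_sdiff_eq_zero (isOpen_chartDom I p).measurableSet
        hKs fun u hu => ?_
      have := smulK_chartPartition_eq_zero I (φ (realDim E)) p (chartPt_notMem I hu.1 hu.2)
      simp only [topCoeff, chartRep]
      change ((smulK (contMDiff_chartPartition I p) (φ (realDim E))).1
        (chartPt I p u)).compContinuousLinearMap _ _ = 0
      rw [this]; rfl
    rw [e, hc]
    refine (norm_setIntegral_le_of_norm_le_const (C := (∏ j, ‖realFrame E j‖) * jetNorm I i φ)
      hK.measure_lt_top fun u hu => ?_).trans (le_of_eq (by ring))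
    have e2 : topCoeff I p (smulK (contMDiff_chartPartition I p) (φ (realDim E))).1 u =
        chartPartition I M p (chartPt I p u) * topCoeff I p (φ (realDim E)).1 u := rfl
    have h3 : ‖chartPartition I M p (chartPt I p u)‖ ≤ 1 := by
      rw [Real.norm_of_nonneg ((chartPartition I M).nonneg _ _)]
      exact (chartPartition I M).le_one _ _
    have h4 : ‖chartRep I p (φ (realDim E)).1 (frameEquiv E u)‖ ≤ jetNorm I i φ := by
      rw [← norm_iteratedFDeriv_zero (𝕜 := ℝ)]
      exact le_jetNorm I i φ (mem_image_of_mem _ hu)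
    rw [e2, norm_mul]
    refine (mul_le_of_le_one_left (norm_nonneg _) h3).trans ?_
    refine ((chartRep I p (φ (realDim E)).1 (frameEquiv E u)).le_opNorm _).trans ?_
    rw [mul_comm]
    exact mul_le_mul_of_nonneg_left h4 (Finset.prod_nonneg fun _ _ => norm_nonneg _)
  refine (JetBound.sum (s := chartCenters I M) fun p _ => h1 p).mono fun φ => ?_
  rw [integral_eq_integralK, integralK_eq_sum]
  exact norm_sum_le _ _

/-- Integration of forms, as a continuous linear map. -/
def integralCLM : Form I M →L[ℝ] ℝ :=
  ⟨integralFormLM I M, JetBound.continuous (I := I) (n := 0) (jetBound_integral I M)⟩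

variable {M} in
@[simp] theorem integralCLM_apply (φ : Form I M) : integralCLM I M φ = integral I φ := rfl

variable {I M} in
/-- The integral is invariant under the action of a vector space. -/
theorem VectorAction.integral_pull (hor : OrientedCharts I M) (s : VectorAction I M V) (y : V)
    (φ : Form I M) : integral I (s.pull y φ) = integral I φ := by
  have h0 : ∀ ψ : Form I M, (∀ k, k ≠ realDim E → ψ k = 0) →
      integral I (s.pull y ψ) = integral I ψ := by
    intro ψ hψ
    have hd : dForm I ψ = 0 := by
      rw [dForm_eq_zero_iff]
      intro k
      by_cases hk : k = realDim E
      · exact KForm.eq_zero_of_finrank_lt I (by rw [finrank_eq_realDim]; omega) _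
      · rw [hψ k hk, dK_zero]
    have hder : ∀ t : ℝ, HasDerivAt (fun t : ℝ => integralCLM I M (s.pull (t • y) ψ)) 0 t := by
      intro t
      have h := s.hasDerivAt_pull (integralCLM I M) ψ y t
      rw [hd, map_zero, map_zero, integralCLM_apply, integral_dForm I hor, add_zero] at h
      exact h
    have := is_const_of_deriv_eq_zero (fun t => (hder t).differentiableAt)
      (fun t => (hder t).deriv) 1 0
    simpa [s.pull_zero] using this
  have h1 := h0 (Pi.single (realDim E) (φ (realDim E))) fun k hk => Pi.single_eq_of_ne hk _
  have h2 : ∀ ψ ψ' : Form I M, ψ (realDim E) = ψ' (realDim E) → integral I ψ = integral I ψ' :=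
    fun ψ ψ' h => by rw [integral_eq_integralK, integral_eq_integralK, h]
  rw [h2 (s.pull y φ) (s.pull y (Pi.single (realDim E) (φ (realDim E)))) ?_, h1]
  · exact h2 _ _ (Pi.single_eq_same _ _)
  · change pullbackK I I (s.shift y) (s.contMDiff_shift y) (φ (realDim E)) =
      pullbackK I I (s.shift y) (s.contMDiff_shift y) ((Pi.single (realDim E) (φ (realDim E)) :
        Form I M) (realDim E))
    rw [Pi.single_eq_same]

end IntegralInvariance

section SmoothNear

variable {E : Type*} [NormedAddCommGroup E] [NormedSpace ℝ E] [NormedSpace ℂ E]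
  [IsScalarTower ℝ ℂ E] [FiniteDimensional ℝ E] [FiniteDimensional ℂ E]
  {H : Type*} [TopologicalSpace H] (I : ModelWithCorners ℝ E H) [I.Boundaryless]
  {M : Type*} [TopologicalSpace M] [ChartedSpace H M] [IsManifold I ∞ M]
  [T2Space M] [CompactSpace M]

/-- The form `θ` vanishes off a closed subset of `U`. -/
def SupportedIn (U : Set M) (θ : Form I M) : Prop :=
  ∃ C : Set M, IsClosed C ∧ C ⊆ U ∧ ∀ k, ∀ x ∉ C, (θ k).1 x = 0

variable {I} in
theorem SupportedIn.mono {U U' : Set M} (h : U ⊆ U') {θ : Form I M} (hθ : SupportedIn I U θ) :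
    SupportedIn I U' θ := by
  obtain ⟨C, hC, hCU, h0⟩ := hθ
  exact ⟨C, hC, hCU.trans h, h0⟩

/-- On the forms supported in `U`, the functional `T` is the integration against `η`. -/
def RepresentedOn (T : Form I M →L[ℝ] ℝ) (U : Set M) (η : Form I M) : Prop :=
  ∀ θ : Form I M, SupportedIn I U θ → T θ = integral I (wedge I η θ)

/-- The functional `T` is given by a smooth form near the point `q`. -/
def SmoothNear (T : Form I M →L[ℝ] ℝ) (q : M) : Prop :=
  ∃ U : Set M, IsOpen U ∧ q ∈ U ∧ ∃ η : Form I M, RepresentedOn I T U η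

variable {I} in
theorem KForm.sum_val {k : ℕ} {ι : Type*} (s : Finset ι) (θ : ι → KForm I M k) (x : M) :
    (∑ i ∈ s, θ i).1 x = ∑ i ∈ s, (θ i).1 x := by
  refine (congrFun (map_sum (Submodule.subtype (smoothForms I M k)) _ _) x).trans ?_
  rw [Finset.sum_apply]; rfl

theorem integral_add_form (φ ψ : Form I M) :
    integral I (φ + ψ) = integral I φ + integral I ψ := (integralFormLM I M).map_add φ ψ

theorem wedge_smulForm {χ : M → ℝ} (hχ : ContMDiff I 𝓘(ℝ) ∞ χ) (η θ : Form I M) :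
    wedge I η (smulForm hχ θ) = wedge I (smulForm hχ η) θ := by
  funext r
  rw [wedge_apply, wedge_apply]
  refine Finset.sum_congr rfl fun p _ => KForm.ext fun x => ?_
  exact (wedgeCAM_smul_right _ (χ x) _ _).trans (wedgeCAM_smul_left _ (χ x) _ _).symm

variable {I}

theorem SmoothNear.sum {ι : Type*} {s : Finset ι} {T : ι → Form I M →L[ℝ] ℝ} {q : M}
    (h : ∀ i ∈ s, SmoothNear I (T i) q) : SmoothNear I (∑ i ∈ s, T i) q := by
  classical
  induction s using Finset.induction_on with
  | empty =>
    refine ⟨univ, isOpen_univ, mem_univ q, 0, fun θ _ => ?_⟩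
    rw [Finset.sum_empty, wedge_zero_left, integral_zero_form]; rfl
  | insert a s ha ih =>
    obtain ⟨U, hU, hq, η, hη⟩ := h a (Finset.mem_insert_self a s)
    obtain ⟨U', hU', hq', η', hη'⟩ := ih fun i hi => h i (Finset.mem_insert_of_mem hi)
    refine ⟨U ∩ U', hU.inter hU', ⟨hq, hq'⟩, η + η', fun θ hθ => ?_⟩
    rw [Finset.sum_insert ha, wedge_add_left, integral_add_form, ← hη θ (hθ.mono inter_subset_left),
      ← hη' θ (hθ.mono inter_subset_right)]
    rfl

/-- Local smooth representatives can be glued. -/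
theorem exists_representedOn {T : Form I M →L[ℝ] ℝ} {K : Set M} (hK : IsCompact K)
    (h : ∀ q ∈ K, SmoothNear I T q) :
    ∃ W : Set M, IsOpen W ∧ K ⊆ W ∧ ∃ η : Form I M, RepresentedOn I T W η := by
  classical
  choose! U hU hqU η hη using h
  let V : M → Set M := fun q => if q ∈ K then U q else Kᶜ
  have hVo : ∀ q, IsOpen (V q) := fun q => by
    by_cases hq : q ∈ K
    · simp only [V, if_pos hq]; exact hU q hq
    · simp only [V, if_neg hq]; exact hK.isClosed.isOpen_compl
  have hVc : (univ : Set M) ⊆ ⋃ q, V q := fun q _ => mem_iUnion.2 ⟨q, by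
    by_cases hq : q ∈ K
    · simp only [V, if_pos hq]; exact hqU q hq
    · simp only [V, if_neg hq]; exact hq⟩
  have : SigmaCompactSpace M := inferInstance
  obtain ⟨ρ, hρ⟩ := SmoothPartitionOfUnity.exists_isSubordinate I isClosed_univ V hVo hVc
  have hfin : {q | (Function.support (ρ q)).Nonempty}.Finite := by
    have := ρ.locallyFinite.finite_nonempty_of_compact
    exact this
  let N := hfin.toFinset
  have hN : ∀ q ∉ N, ∀ x, ρ q x = 0 := fun q hq x => by
    by_contra hx
    exact hq (hfin.mem_toFinset.2 ⟨x, hx⟩)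
  have hsum : ∀ x, ∑ q ∈ N, ρ q x = 1 := fun x => by
    rw [← ρ.sum_eq_one (mem_univ x), finsum_eq_sum_of_support_subset]
    intro q hq
    by_contra hn
    exact hq (hN q hn x)
  refine ⟨(⋃ q ∈ N.filter (· ∉ K), tsupport (ρ q))ᶜ, ?_, ?_,
    ∑ q ∈ N.filter (· ∈ K), smulForm (ρ q).contMDiff (η q), ?_⟩
  · exact (isClosed_biUnion_finset fun q _ => isClosed_tsupport _).isOpen_compl
  · intro x hx hx'
    simp only [mem_iUnion, Finset.mem_filter] at hx'
    obtain ⟨q, hq, hxq⟩ := hx'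
    have := hρ q hxq
    simp only [V, if_neg hq.2] at this
    exact this hx
  · rintro θ ⟨C, hC, hCW, h0⟩
    have e : θ = ∑ q ∈ N.filter (· ∈ K), smulForm (ρ q).contMDiff θ := by
      funext k
      rw [Finset.sum_apply]
      refine KForm.ext fun x => ?_
      rw [KForm.sum_val]
      change (θ k).1 x = ∑ q ∈ N.filter (· ∈ K), ρ q x • (θ k).1 x
      rw [← Finset.sum_smul]
      by_cases hx : x ∈ C
      · have e2 : ∑ q ∈ N.filter (· ∈ K), ρ q x = 1 := by
          rw [← hsum x, Finset.sum_filter_of_ne]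
          intro q hq hne
          by_contra hqK
          refine hCW hx ?_
          simp only [mem_iUnion, Finset.mem_filter]
          exact ⟨q, ⟨hq, hqK⟩, subset_tsupport _ hne⟩
        rw [e2, one_smul]
      · rw [h0 k x hx, smul_zero]
    have e3 : ∀ q ∈ N.filter (· ∈ K), T (smulForm (ρ q).contMDiff θ) =
        integral I (wedge I (smulForm (ρ q).contMDiff (η q)) θ) := by
      intro q hq
      have hqK := (Finset.mem_filter.1 hq).2
      rw [← wedge_smulForm]
      refine hη q hqK _ ⟨tsupport (ρ q), isClosed_tsupport _, ?_, fun k x hx => ?_⟩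
      · have := hρ q
        simpa only [V, if_pos hqK] using this
      · change ρ q x • (θ k).1 x = 0
        rw [image_eq_zero_of_notMem_tsupport hx, zero_smul]
    calc T θ = ∑ q ∈ N.filter (· ∈ K), T (smulForm (ρ q).contMDiff θ) := by
          conv_lhs => rw [e]
          rw [map_sum]
      _ = _ := by
          rw [Finset.sum_congr rfl e3]
          have := map_sum ((integralFormLM I M).comp ((wedgeLM I).flip θ))
            (fun q => smulForm (ρ q).contMDiff (η q)) (N.filter (· ∈ K))
          exact this.symm

theorem exists_representedOn_univ {T : Form I M →L[ℝ] ℝ} (h : ∀ q, SmoothNear I T q) :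
    ∃ η : Form I M, ∀ θ, T θ = integral I (wedge I η θ) := by
  obtain ⟨W, -, hW, η, hη⟩ := exists_representedOn isCompact_univ fun q _ => h q
  exact ⟨η, fun θ => hη θ ⟨univ, isClosed_univ, hW, fun k x hx => (hx (mem_univ x)).elim⟩⟩

section Action

variable {V : Type*} [NormedAddCommGroup V] [NormedSpace ℝ V] [FiniteDimensional ℝ V]
  [MeasureSpace V] [BorelSpace V] [(volume : Measure V).IsAddHaarMeasure]

/-- Reflection of mollifiers. -/
def Mollifier.neg (f : Mollifier V) : Mollifier V where
  toFun y := f.toFun (-y)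
  smooth := f.smooth.comp contDiff_neg
  hasCompactSupport := f.hasCompactSupport.comp_homeomorph (Homeomorph.neg V)
  integral_eq_one := by
    rw [integral_neg_eq_self f.toFun]; exact f.integral_eq_one

theorem VectorAction.pull_wedge (s : VectorAction I M V) (y : V) (η θ : Form I M) :
    s.pull y (wedge I η θ) = wedge I (s.pull y η) (s.pull y θ) := by
  funext r
  refine KForm.ext fun x => ?_
  have h1 : ∀ ζ : Form I M, (s.pull y ζ r).1 x =
      camComp r (diffAt I I (s.shift y) x) ((ζ r).1 (s.shift y x)) := fun _ => rfl
  rw [h1, wedge_apply, wedge_apply, KForm.sum_val, KForm.sum_val, map_sum]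
  refine Finset.sum_congr rfl fun p _ => ?_
  exact (wedgeCAM_compContinuousLinearMap _ _ _ _).symm

/-- Averaging over an action preserves smoothness of functionals. -/
theorem SmoothNear.regularize (hor : OrientedCharts I M) (s : VectorAction I M V) (f : Mollifier V)
    {T : Form I M →L[ℝ] ℝ} {q : M} (h : ∀ y ∈ tsupport f.toFun, SmoothNear I T (s.shift (-y) q)) :
    SmoothNear I (T.comp (s.regularize f)) q := by
  have hcs : Continuous fun z : V × M => s.shift (-z.1) z.2 :=
    s.smooth.continuous.comp ((continuous_fst.neg).prodMk continuous_snd)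
  have hK := f.hasCompactSupport.isCompact
  obtain ⟨W, hW, hKW, η, hη⟩ := exists_representedOn (K := (fun y => s.shift (-y) q) ''
      tsupport f.toFun) (hK.image (hcs.comp (continuous_id.prodMk continuous_const)))
    (by rintro _ ⟨y, hy, rfl⟩; exact h y hy)
  obtain ⟨A, U, -, hU, hA, hqU, hAU⟩ := generalized_tube_lemma hK (isCompact_singleton (x := q))
    (hW.preimage hcs) (by
      rintro ⟨y, x⟩ ⟨hy, rfl⟩
      exact hKW ⟨y, hy, rfl⟩)
  refine ⟨U, hU, hqU rfl, s.regularize f.neg η, ?_⟩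
  rintro θ ⟨C, hC, hCU, h0⟩
  have e1 : ∀ y, f.toFun y • T (s.pull y θ) =
      f.toFun y • integral I (wedge I (s.pull (-y) η) θ) := by
    intro y
    by_cases hy : y ∈ tsupport f.toFun
    · congr 1
      rw [hη (s.pull y θ) ⟨s.shift y ⁻¹' C, hC.preimage (s.contMDiff_shift y).continuous, ?_, ?_⟩]
      · rw [← s.integral_pull hor (-y) (wedge I η (s.pull y θ)), s.pull_wedge, s.pull_neg_pull]
      · intro x hx
        have := hAU (mk_mem_prod (hA hy) (hCU hx))
        simpa only [mem_preimage, s.shift_neg_shift] using this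
      · intro k x hx
        change ((θ k).1 (s.shift y x)).compContinuousLinearMap _ = 0
        rw [h0 k _ hx]; rfl
    · rw [image_eq_zero_of_notMem_tsupport hy, zero_smul, zero_smul]
  have e2 := s.apply_regularize f.neg ((integralCLM I M).comp (wedgeRightCLM I θ)) η
  refine (s.apply_regularize f T θ).trans ((integral_congr_ae (Eventually.of_forall e1)).trans
    (Eq.trans ?_ e2.symm))
  rw [← integral_neg_eq_self]
  refine integral_congr_ae (Eventually.of_forall fun y => ?_)
  simp only [neg_neg]
  rfl

end Action

end SmoothNear

section VectorSpaceForms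

variable {V : Type*} [NormedAddCommGroup V] [NormedSpace ℝ V] [FiniteDimensional ℝ V]

theorem chartRep_self {k : ℕ} (p : V) (θ : V → V [⋀^Fin k]→L[ℝ] ℝ) :
    chartRep 𝓘(ℝ, V) p θ = θ := by
  funext y
  have e : diffAt 𝓘(ℝ, V) 𝓘(ℝ, V) (extChartAt 𝓘(ℝ, V) p).symm y =
      ContinuousLinearMap.id ℝ V := by
    rw [extChartAt_model_space_eq_id]; exact mfderiv_id
  rw [chartRep, e, extChartAt_model_space_eq_id]
  rfl

theorem contDiff_val {k : ℕ} (θ : KForm 𝓘(ℝ, V) V k) : ContDiff ℝ ∞ θ.1 := by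
  have h := θ.2 (0 : V)
  rw [chartRep_self, extChartAt_model_space_eq_id] at h
  exact contDiffOn_univ.1 h

end VectorSpaceForms

variable {E : Type*} [NormedAddCommGroup E] [NormedSpace ℝ E] [FiniteDimensional ℝ E]
  {H : Type*} [TopologicalSpace H] (I : ModelWithCorners ℝ E H) [I.Boundaryless]
  (M : Type*) [TopologicalSpace M] [ChartedSpace H M] [IsManifold I ∞ M]
  (V : Type*) [NormedAddCommGroup V] [NormedSpace ℝ V] [FiniteDimensional ℝ V]

/-- An action of a vector space which, in a coordinate system on an open set, is the action by
translations. -/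
structure TranslationPatch extends VectorAction I M V where
  source : Set M
  isOpen_source : IsOpen source
  coord : M → V
  coordSymm : V → M
  contMDiffOn_coord : ContMDiffOn I 𝓘(ℝ, V) ∞ coord source
  contMDiff_coordSymm : ContMDiff 𝓘(ℝ, V) I ∞ coordSymm
  coordSymm_mem : ∀ v, coordSymm v ∈ source
  coordSymm_coord : ∀ x ∈ source, coordSymm (coord x) = x
  coord_coordSymm : ∀ v, coord (coordSymm v) = v
  shift_mem : ∀ y, ∀ x ∈ source, shift y x ∈ source
  coord_shift : ∀ y, ∀ x ∈ source, coord (shift y x) = coord x + y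

namespace TranslationPatch

variable {I M V} [T2Space M] [CompactSpace M] [MeasureSpace V] [BorelSpace V]
  [(volume : Measure V).IsAddHaarMeasure] (P : TranslationPatch I M V) (f : Mollifier V)

theorem kernel_support {k : ℕ} {v v₀ : V} (hv : v ∈ Metric.closedBall v₀ 1)
    (α : V [⋀^Fin k]→L[ℝ] ℝ) {x : M} (hx : x ∈ P.source)
    (hxC : x ∉ P.coordSymm '' ((fun a : V × V => a.1 - a.2) ''
      (Metric.closedBall v₀ 1 ×ˢ tsupport f.toFun))) :
    f.toFun (v - P.coord x) • α = 0 := by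
  refine (congrArg (· • α) (image_eq_zero_of_notMem_tsupport fun h => ?_)).trans (zero_smul ℝ α)
  exact hxC ⟨P.coord x, ⟨(v, v - P.coord x), ⟨hv, h⟩, sub_sub_cancel _ _⟩, P.coordSymm_coord x hx⟩

theorem isClosed_kernel_support (v₀ : V) : IsClosed (P.coordSymm '' ((fun a : V × V => a.1 - a.2) ''
      (Metric.closedBall v₀ 1 ×ˢ tsupport f.toFun))) := by
  have : ProperSpace V := FiniteDimensional.proper ℝ V
  exact ((((isCompact_closedBall v₀ 1).prod f.hasCompactSupport.isCompact).image
    (by fun_prop)).image P.contMDiff_coordSymm.continuous).isClosed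

theorem image_coordSymm_subset (S : Set V) : P.coordSymm '' S ⊆ P.source := by
  rintro _ ⟨v, -, rfl⟩
  exact P.coordSymm_mem v

/-- The form `f (v - x) α` in the coordinates `x` of the patch. -/
def kernelK (k : ℕ) (v : V) (α : V [⋀^Fin k]→L[ℝ] ℝ) : KForm I M k :=
  extK I P.isOpen_source P.contMDiffOn_coord (mapsTo_univ _ _)
    (g := fun w => f.toFun (v - w) • α)
    (((f.smooth.comp (contDiff_const.sub contDiff_id)).smul contDiff_const).contDiffOn)
    ⟨_, P.isClosed_kernel_support f v, P.image_coordSymm_subset _, fun _ hx hxC =>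
      P.kernel_support f (Metric.mem_closedBall_self zero_le_one) α hx hxC⟩

theorem kernelK_of_mem (k : ℕ) (v : V) (α : V [⋀^Fin k]→L[ℝ] ℝ) {x : M} (hx : x ∈ P.source) :
    (P.kernelK f k v α).1 x =
      f.toFun (v - P.coord x) • camComp k (diffAt I 𝓘(ℝ, V) P.coord x) α := by
  refine Eq.trans (extField_of_mem I (e := P.coord) (g := fun w => f.toFun (v - w) • α) hx) ?_
  exact (camComp k (diffAt I 𝓘(ℝ, V) P.coord x)).map_smul _ _

theorem kernelK_of_notMem (k : ℕ) (v : V) (α : V [⋀^Fin k]→L[ℝ] ℝ) {x : M} (hx : x ∉ P.source) :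
    (P.kernelK f k v α).1 x = 0 :=
  extField_of_notMem I (e := P.coord) (g := fun w => f.toFun (v - w) • α) hx

theorem smoothFamilyOn_kernel (k : ℕ) {β : V → V [⋀^Fin k]→L[ℝ] ℝ} (hβ : ContDiff ℝ ∞ β) :
    SmoothFamilyOn I univ (fun v => (Pi.single k (P.kernelK f k v (β v)) : Form I M)) := by
  intro j p
  by_cases hj : j = k
  · subst hj
    simp only [Pi.single_eq_same]
    refine contDiffOn_chartRep_extField I P.isOpen_source P.contMDiffOn_coord (mapsTo_univ _ _)
      isOpen_univ (g := fun a => f.toFun (a.1 - a.2) • β a.1)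
      ((f.smooth.comp (contDiff_fst.sub contDiff_snd)).smul (hβ.comp contDiff_fst)).contDiffOn
      (fun v₀ _ => ⟨_, P.isClosed_kernel_support f v₀, P.image_coordSymm_subset _, ?_⟩) p
    filter_upwards [Metric.closedBall_mem_nhds v₀ one_pos] with v hv x hx hxC
    exact P.kernel_support f hv (β v) hx hxC
  · simp only [Pi.single_eq_of_ne hj]
    exact contDiffOn_const (c := (0 : E [⋀^Fin j]→L[ℝ] ℝ))

/-- The expression of a form in the coordinates of the patch. -/
def expr {k : ℕ} (θ : KForm I M k) : KForm 𝓘(ℝ, V) V k :=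
  pullbackK 𝓘(ℝ, V) I P.coordSymm P.contMDiff_coordSymm θ

theorem pull_of_mem (θ : Form I M) (k : ℕ) (y : V) {x : M} (hx : x ∈ P.source) :
    (P.pull y θ k).1 x = camComp k (diffAt I 𝓘(ℝ, V) P.coord x)
      ((P.expr (θ k)).1 (P.coord x + y)) := by
  have he : P.shift y =ᶠ[𝓝 x] P.coordSymm ∘ (fun z => P.coord z + y) := by
    filter_upwards [P.isOpen_source.mem_nhds hx] with z hz
    change _ = P.coordSymm (P.coord z + y)
    rw [← P.coord_shift y z hz, P.coordSymm_coord _ (P.shift_mem y z hz)]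
  have hc : MDifferentiableAt I 𝓘(ℝ, V) P.coord x :=
    (P.contMDiffOn_coord.contMDiffAt (P.isOpen_source.mem_nhds hx)).mdifferentiableAt (by simp)
  have ht : MDifferentiableAt 𝓘(ℝ, V) 𝓘(ℝ, V) (fun v => v + y) (P.coord x) :=
    (differentiableAt_id.add_const y).mdifferentiableAt
  have hcy : MDifferentiableAt I 𝓘(ℝ, V) (fun z => P.coord z + y) x := ht.comp x hc
  have hd : diffAt I 𝓘(ℝ, V) (fun z => P.coord z + y) x = diffAt I 𝓘(ℝ, V) P.coord x := by
    refine (diffAt_comp I 𝓘(ℝ, V) 𝓘(ℝ, V) x ht hc).trans ?_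
    rw [diffAt_eq_fderiv, fderiv_add_const, fderiv_fun_id]
    rfl
  have hs := (diffAt_congr I I he).trans (diffAt_comp I 𝓘(ℝ, V) I x
    (P.contMDiff_coordSymm.contMDiffAt.mdifferentiableAt (by simp)) hcy)
  rw [hd] at hs
  change ((θ k).1 (P.shift y x)).compContinuousLinearMap (diffAt I I (P.shift y) x) = _
  rw [hs, he.self_of_nhds]
  rfl

theorem shift_notMem (y : V) {x : M} (hx : x ∉ P.source) : P.shift y x ∉ P.source := fun h =>
  hx (by simpa only [P.shift_neg_shift] using P.shift_mem (-y) _ h)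

theorem regularize_val {θ : Form I M} (hθ : SupportedIn I P.source θ) (k : ℕ) (x : M) :
    (P.regularize f θ k).1 x = ∫ v, (P.kernelK f k v ((P.expr (θ k)).1 v)).1 x := by
  have := finiteDimensional_cam (V := E) k
  have h : (P.regularize f θ k).1 x = ∫ y, f.toFun y • (P.pull y θ k).1 x :=
    P.apply_regularize f (evalCLM I k x) θ
  rw [h]
  by_cases hx : x ∈ P.source
  · have e := integral_add_right_eq_self (μ := (volume : Measure V))
      (fun v => (P.kernelK f k v ((P.expr (θ k)).1 v)).1 x) (P.coord x)
    rw [← e]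
    refine integral_congr_ae (Eventually.of_forall fun y => ?_)
    simp only
    rw [P.kernelK_of_mem f k _ _ hx, P.pull_of_mem θ k y hx, add_sub_cancel_right, add_comm y]
  · refine integral_congr_ae (Eventually.of_forall fun y => ?_)
    obtain ⟨C, -, hC, h0⟩ := hθ
    simp only
    rw [P.kernelK_of_notMem f k _ _ hx]
    have : (P.pull y θ k).1 x =
      ((θ k).1 (P.shift y x)).compContinuousLinearMap (diffAt I I (P.shift y) x) := rfl
    rw [this, h0 k _ fun h => P.shift_notMem y hx (hC h)]
    exact smul_zero _

/-- The functional `T`, on forms of degree `k`, applied to the kernel. -/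
def density (T : Form I M →L[ℝ] ℝ) (k : ℕ) (v : V) : (V [⋀^Fin k]→L[ℝ] ℝ) →L[ℝ] ℝ :=
  have := finiteDimensional_cam (V := V) k
  LinearMap.toContinuousLinearMap
    { toFun := fun α => T (Pi.single k (P.kernelK f k v α))
      map_add' := fun α β => by
        rw [← map_add, ← single_add]
        congr 2
        refine KForm.ext fun x => ?_
        by_cases hx : x ∈ P.source
        · simp only [KForm.add_val, P.kernelK_of_mem f k v _ hx, map_add, smul_add]
        · simp only [KForm.add_val, P.kernelK_of_notMem f k v _ hx, add_zero]
      map_smul' := fun c α => by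
        rw [RingHom.id_apply, ← map_smul, ← single_smul]
        congr 2
        refine KForm.ext fun x => ?_
        by_cases hx : x ∈ P.source
        · simp only [KForm.smul_val, P.kernelK_of_mem f k v _ hx, map_smul]
          exact smul_comm _ _ _
        · simp only [KForm.smul_val, P.kernelK_of_notMem f k v _ hx, smul_zero] }

theorem contDiff_density (T : Form I M →L[ℝ] ℝ) (k : ℕ) : ContDiff ℝ ∞ (P.density f T k) := by
  have := finiteDimensional_cam (V := V) k
  rw [contDiff_clm_apply_iff]
  intro α
  exact contDiffOn_univ.1 ((P.smoothFamilyOn_kernel f k (contDiff_const (c := α))).contDiffOn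
    isOpen_univ T)

theorem expr_eq_zero {θ : Form I M} {C : Set M}
    (h0 : ∀ k, ∀ x ∉ C, (θ k).1 x = 0) (k : ℕ) {v : V} (hv : v ∉ P.coord '' C) :
    (P.expr (θ k)).1 v = 0 := by
  have : (P.expr (θ k)).1 v = ((θ k).1 (P.coordSymm v)).compContinuousLinearMap
    (diffAt 𝓘(ℝ, V) I P.coordSymm v) := rfl
  rw [this, h0 k _ fun h => hv ⟨_, h, P.coord_coordSymm v⟩]
  rfl

theorem apply_single_regularize (T : Form I M →L[ℝ] ℝ) {θ : Form I M}
    (hθ : SupportedIn I P.source θ) (k : ℕ) : T (Pi.single k (P.regularize f θ k)) =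
      ∫ v, P.density f T k v ((P.expr (θ k)).1 v) := by
  obtain ⟨C, hC, hCs, h0⟩ := id hθ
  have hK : IsCompact (P.coord '' C) :=
    hC.isCompact.image_of_continuousOn (P.contMDiffOn_coord.continuousOn.mono hCs)
  have hfam := P.smoothFamilyOn_kernel f k (contDiff_val (P.expr (θ k)))
  have hz : ∀ v ∉ P.coord '' C,
      (Pi.single k (P.kernelK f k v ((P.expr (θ k)).1 v)) : Form I M) = 0 := by
    intro v hv
    rw [P.expr_eq_zero h0 k hv]
    have h1 : P.kernelK f k v 0 = 0 := KForm.ext fun x => by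
      by_cases hx : x ∈ P.source
      · rw [P.kernelK_of_mem f k v _ hx, map_zero, smul_zero]; rfl
      · rw [P.kernelK_of_notMem f k v _ hx]; rfl
    rw [h1, Pi.single_zero]
  refine Eq.trans ?_ (hfam.integral_apply volume hK hz T).symm
  congr 1
  funext j
  refine KForm.ext fun x => ?_
  have e : (hfam.integral volume hK hz j).1 x = ∫ v, ((Pi.single k
    (P.kernelK f k v ((P.expr (θ k)).1 v)) : Form I M) j).1 x := rfl
  rw [e]
  by_cases hj : j = k
  · subst hj
    simp only [Pi.single_eq_same]
    exact P.regularize_val f hθ j x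
  · simp only [Pi.single_eq_of_ne hj, KForm.zero_val, integral_zero]

end TranslationPatch

section Duality

variable {W : Type*} [NormedAddCommGroup W] [NormedSpace ℝ W] [FiniteDimensional ℝ W]

/-- Functionals on `k`-forms are given by the exterior product with forms of the complementary
degree. -/
theorem exists_wedgeCAM_dual {m k n : ℕ} (h : m + k = n) (b : Module.Basis (Fin n) ℝ W) :
    ∃ (N : ℕ) (γ : Fin N → W [⋀^Fin k]→L[ℝ] ℝ) (δ : Fin N → W [⋀^Fin m]→L[ℝ] ℝ),
      ∀ (l : (W [⋀^Fin k]→L[ℝ] ℝ) →ₗ[ℝ] ℝ) α, wedgeCAM h (∑ i, l (γ i) • δ i) α b = l α := by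
  have := finiteDimensional_cam (V := W) k
  have := finiteDimensional_cam (V := W) m
  have hn : Module.finrank ℝ W = n := by simpa using Module.finrank_eq_card_basis b
  have h0 : ∀ ζ : W [⋀^Fin n]→L[ℝ] ℝ, ζ b = 0 → ζ = 0 := fun ζ hζ => by
    have := AlternatingMap.eq_smul_basis_det b ζ.toAlternatingMap
    ext v
    have h1 := congrArg (fun g : W [⋀^Fin n]→ₗ[ℝ] ℝ => g v) this
    refine h1.trans ?_
    change ζ b * b.det v = 0
    rw [hζ, zero_mul]
  let p : (W [⋀^Fin m]→L[ℝ] ℝ) →ₗ[ℝ] (W [⋀^Fin k]→L[ℝ] ℝ) →ₗ[ℝ] ℝ :=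
    LinearMap.mk₂ ℝ (fun α β => wedgeCAM h α β b)
      (fun α α' β => by rw [wedgeCAM_add_left]; rfl) (fun c α β => by rw [wedgeCAM_smul_left]; rfl)
      (fun α β β' => by rw [wedgeCAM_add_right]; rfl) (fun c α β => by rw [wedgeCAM_smul_right]; rfl)
  have hp : p.IsPerfPair := LinearMap.IsPerfPair.of_injective
    ((injective_iff_map_eq_zero p).2 fun α hα => eq_zero_of_wedgeCAM_eq_zero hn h α fun β =>
      h0 _ (congrArg (fun l : (W [⋀^Fin k]→L[ℝ] ℝ) →ₗ[ℝ] ℝ => l β) hα))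
    ((injective_iff_map_eq_zero p.flip).2 fun β hβ =>
      eq_zero_of_wedgeCAM_eq_zero hn ((add_comm k m).trans h) β fun α => by
        obtain ⟨c, -, hc⟩ := exists_wedgeCAM_comm (V := W) h ((add_comm k m).trans h)
        refine (hc α β).trans ((congrArg (c • ·) (h0 _ ?_)).trans (smul_zero c))
        exact congrArg (fun l : (W [⋀^Fin m]→L[ℝ] ℝ) →ₗ[ℝ] ℝ => l α) hβ)
  let e := LinearEquiv.ofBijective p (LinearMap.IsPerfPair.bijective_left p)
  let B := Module.finBasis ℝ (W [⋀^Fin k]→L[ℝ] ℝ)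
  refine ⟨_, B, fun i => e.symm (B.coord i), fun l α => ?_⟩
  have h1 : e (∑ i, l (B i) • e.symm (B.coord i)) = l := by
    rw [map_sum]
    refine B.ext fun j => ?_
    rw [LinearMap.sum_apply, Finset.sum_eq_single j]
    · simp
    · intro i _ hij
      simp [hij.symm]
    · simp
  exact congrArg (fun g : (W [⋀^Fin k]→L[ℝ] ℝ) →ₗ[ℝ] ℝ => g α) h1

variable {Z : Type*} [NormedAddCommGroup Z] [NormedSpace ℝ Z]

theorem contDiffOn_det {n : ℕ} {s : Set Z} {A : Z → (Fin n → ℝ) →L[ℝ] (Fin n → ℝ)}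
    (hA : ContDiffOn ℝ ∞ A s) : ContDiffOn ℝ ∞ (fun z => (A z).det) s := by
  let b := Pi.basisFun ℝ (Fin n)
  have e : ∀ z, (A z).det = Matrix.det (Matrix.of fun i j => A z (b j) i) := fun z => by
    rw [ContinuousLinearMap.det, ← LinearMap.det_toMatrix b]
    congr 1
    ext i j
    rw [LinearMap.toMatrix_apply]
    rfl
  have e2 : (fun z => (A z).det) = fun z => ∑ σ : Equiv.Perm (Fin n),
      (Equiv.Perm.sign σ : ℤ) • ∏ i, A z (b i) (σ i) := by
    funext z
    rw [e, Matrix.det_apply]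
    rfl
  rw [e2]
  refine ContDiffOn.sum fun σ _ => ContDiffOn.const_smul _ (contDiffOn_prod fun i _ => ?_)
  exact contDiffOn_pi.1 (hA.clm_apply contDiffOn_const) _

end Duality

section Density

variable {E : Type*} [NormedAddCommGroup E] [NormedSpace ℝ E] [NormedSpace ℂ E]
  [IsScalarTower ℝ ℂ E] [FiniteDimensional ℝ E] [FiniteDimensional ℂ E]
  {H : Type*} [TopologicalSpace H] {I : ModelWithCorners ℝ E H} [I.Boundaryless]
  {M : Type*} [TopologicalSpace M] [ChartedSpace H M] [IsManifold I ∞ M]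
  [T2Space M] [CompactSpace M]

/-- A functional with a smooth density in a chart is given by a smooth form near the centre. -/
theorem smoothNear_of_density (hor : OrientedCharts I M) {T : Form I M →L[ℝ] ℝ} {q : M} {k : ℕ}
    (hk : k ≤ realDim E) {O : Set (Fin (realDim E) → ℝ)} (hO : IsOpen O) (hOq : O ⊆ chartDom I q)
    (hq : chartCo I q q ∈ O) {ρ : (Fin (realDim E) → ℝ) → (E [⋀^Fin k]→L[ℝ] ℝ) →ₗ[ℝ] ℝ}
    (hρ : ∀ α, ContDiffOn ℝ ∞ (fun u => ρ u α) O)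
    (h : ∀ θ : Form I M, SupportedIn I (chartPt I q '' O) θ →
      T θ = ∫ u in O, ρ u (chartRep I q (θ k).1 (frameEquiv E u))) : SmoothNear I T q := by
  obtain ⟨m, hm⟩ : ∃ m, m + k = realDim E := ⟨realDim E - k, by omega⟩
  obtain ⟨N, γ, δ, hΛ⟩ := exists_wedgeCAM_dual hm (realFrame E)
  obtain ⟨r, hr, hrO⟩ := Metric.isOpen_iff.1 hO _ hq
  let χ : ContDiffBump (chartCo I q q) := ⟨r / 4, r / 2, by positivity, by linarith⟩
  have hball : Metric.closedBall (chartCo I q q) (r / 2) ⊆ O :=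
    (Metric.closedBall_subset_ball (by linarith)).trans hrO
  have hχ0 : ∀ u ∉ Metric.closedBall (chartCo I q q) (r / 2), χ u = 0 := fun u hu => by
    refine image_eq_zero_of_notMem_tsupport (f := χ) ?_
    rw [χ.tsupport_eq]; exact hu
  set g : (Fin (realDim E) → ℝ) → E [⋀^Fin m]→L[ℝ] ℝ := O.indicator fun u => χ u • ∑ i, ρ u (γ i) • δ i with hg
  have hgs : ContDiff ℝ ∞ g := by
    refine contDiff_indicator hO Metric.isClosed_closedBall hball
      (χ.contDiff.contDiffOn.smul
      (ContDiffOn.sum fun i _ => (hρ (γ i)).smul contDiffOn_const)) fun u _ hu => ?_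
    rw [hχ0 u hu, zero_smul]
  have hcl : IsClosed (chartPt I q '' Metric.closedBall (chartCo I q q) (r / 2)) :=
    ((isCompact_closedBall _ _).image_of_continuousOn
      ((continuousOn_chartPt I q).mono (hball.trans hOq))).isClosed
  let η : KForm I M m := extK I (isOpen_extChartAt_source q) (S := (extChartAt I q).source)
    (e := extChartAt I q) (by simpa using contMDiffOn_extChartAt (I := I) (n := ∞) (x := q))
    (mapsTo_univ _ _) (g := fun y => g ((frameEquiv E).symm y))
    (hgs.comp (frameEquiv E).symm.contDiff).contDiffOn
    ⟨_, hcl, ?_, fun x hx hxC => ?_⟩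
  refine ⟨(extChartAt I q).source ∩ chartCo I q ⁻¹' Metric.ball (chartCo I q q) (r / 4),
    (continuousOn_chartCo I q).isOpen_inter_preimage (isOpen_extChartAt_source q) Metric.isOpen_ball,
    ⟨mem_extChartAt_source q, Metric.mem_ball_self (by positivity)⟩, Pi.single m η, ?_⟩
  rintro θ ⟨C, hC, hCU, h0⟩
  have hCs : C ⊆ (extChartAt I q).source := fun x hx => (hCU hx).1
  have hCO : ∀ u ∈ chartDom I q, u ∉ O → chartPt I q u ∉ C := fun u hu huO hx => by
    have := (hCU hx).2
    rw [mem_preimage, chartCo_chartPt I hu] at this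
    exact huO (hball (Metric.ball_subset_closedBall (Metric.ball_subset_ball (by linarith) this)))
  have hrep : ∀ u, chartPt I q u ∉ C → chartRep I q (θ k).1 (frameEquiv E u) = 0 := fun u hu => by
    have h1 := h0 k _ hu
    simp only [chartRep]
    change ((θ k).1 (chartPt I q u)).compContinuousLinearMap _ = 0
    rw [h1]; rfl
  have hηrep : ∀ u ∈ chartDom I q, chartRep I q η.1 (frameEquiv E u) = g u := fun u hu => by
    refine (chartRep_extField_chart I q (fun y => g ((frameEquiv E).symm y)) hu).trans ?_
    rw [ContinuousLinearEquiv.symm_apply_apply]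
  rw [h θ ⟨C, hC, fun x hx => ⟨chartCo I q x, ?_, chartPt_chartCo I (hCs hx)⟩, h0⟩,
    integral_wedge_single_left I hm, integralK_eq_localIntegral I hor hC hCs, localIntegral]
  · refine Eq.symm ((setIntegral_eq_of_subset_of_forall_sdiff_eq_zero
      (isOpen_chartDom I q).measurableSet hOq fun u hu => ?_).trans
      (setIntegral_congr_fun hO.measurableSet fun u hu => ?_))
    · rw [topCoeff, chartRep_wedgeK, hrep u (hCO u hu.1 hu.2)]
      exact congrArg (fun z : E [⋀^Fin (realDim E)]→L[ℝ] ℝ => z (realFrame E))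
        (((wedgeBilin hm) _).map_zero)
    · rw [topCoeff, chartRep_wedgeK, hηrep u (hOq hu), hg, indicator_of_mem hu]
      by_cases hx : chartPt I q u ∈ C
      · have h1 : χ u = 1 := χ.one_of_mem_closedBall (by
          have := (hCU hx).2
          rw [mem_preimage, chartCo_chartPt I (hOq hu)] at this
          exact Metric.ball_subset_closedBall this)
        rw [h1, one_smul, hΛ]
      · rw [hrep u hx, map_zero]
        exact congrArg (fun z : E [⋀^Fin (realDim E)]→L[ℝ] ℝ => z (realFrame E))
          (((wedgeBilin hm) _).map_zero)
  · intro x hx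
    change wedgeCAM hm (η.1 x) ((θ k).1 x) = 0
    rw [h0 k x hx]
    exact ((wedgeBilin hm) _).map_zero
  · exact hball (Metric.ball_subset_closedBall
      (Metric.ball_subset_ball (by linarith) (hCU hx).2))
  · rintro _ ⟨u, hu, rfl⟩
    exact chartPt_mem I (hOq (hball hu))
  · have hu : chartCo I q x ∉ Metric.closedBall (chartCo I q q) (r / 2) := fun hu =>
      hxC ⟨_, hu, chartPt_chartCo I hx⟩
    change O.indicator (fun u => χ u • ∑ i, ρ u (γ i) • δ i) (chartCo I q x) = 0
    by_cases hxO : chartCo I q x ∈ O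
    · rw [indicator_of_mem hxO, hχ0 _ hu, zero_smul]
    · exact indicator_of_notMem hxO _

end Density

section Smoothing

variable {E : Type*} [NormedAddCommGroup E] [NormedSpace ℝ E] [NormedSpace ℂ E]
  [IsScalarTower ℝ ℂ E] [FiniteDimensional ℝ E] [FiniteDimensional ℂ E]
  {H : Type*} [TopologicalSpace H] {I : ModelWithCorners ℝ E H} [I.Boundaryless]
  {M : Type*} [TopologicalSpace M] [ChartedSpace H M] [IsManifold I ∞ M]
  [T2Space M] [CompactSpace M]

variable (I M) in
/-- The projection to the forms of degree `k`. -/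
def degreeCLM (k : ℕ) : Form I M →L[ℝ] Form I M :=
  ⟨{ toFun := fun φ => Pi.single k (φ k)
     map_add' := fun φ ψ => single_add I (φ k) (ψ k)
     map_smul' := fun c φ => single_smul I c (φ k) },
    (continuous_single k).comp (continuous_apply k)⟩

variable (P : TranslationPatch I M (Fin (realDim E) → ℝ))

/-- Passage from the chart at `q` to the coordinates of a patch. -/
def TranslationPatch.transition (q : M) (u : Fin (realDim E) → ℝ) : Fin (realDim E) → ℝ :=
  P.coord (chartPt I q u)

/-- The coordinates of the chart at `q` that correspond to points of a patch. -/
def TranslationPatch.overlap (q : M) : Set (Fin (realDim E) → ℝ) :=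
  chartDom I q ∩ chartPt I q ⁻¹' P.source

theorem TranslationPatch.isOpen_overlap (q : M) : IsOpen (P.overlap q) :=
  (continuousOn_chartPt I q).isOpen_inter_preimage (isOpen_chartDom I q) P.isOpen_source

theorem TranslationPatch.contDiffOn_transition (q : M) :
    ContDiffOn ℝ ∞ (P.transition q) (P.overlap q) := by
  rw [← contMDiffOn_iff_contDiffOn]
  exact P.contMDiffOn_coord.comp ((contMDiffOn_chartPt I q).mono inter_subset_left)
    fun u hu => hu.2

theorem TranslationPatch.coordSymm_transition {q : M} {u : Fin (realDim E) → ℝ}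
    (hu : u ∈ P.overlap q) : P.coordSymm (P.transition q u) = chartPt I q u :=
  P.coordSymm_coord _ hu.2

theorem TranslationPatch.contDiffOn_chart_coordSymm (q : M) :
    ContDiffOn ℝ ∞ (fun v => extChartAt I q (P.coordSymm v))
      (P.coordSymm ⁻¹' (extChartAt I q).source) := by
  rw [← contMDiffOn_iff_contDiffOn]
  exact (contMDiffOn_extChartAt (x := q)).comp P.contMDiff_coordSymm.contMDiffOn
    fun v hv => by simpa using hv

theorem TranslationPatch.injOn_transition (q : M) : InjOn (P.transition q) (P.overlap q) := by
  intro u hu u' hu' h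
  rw [← chartCo_chartPt I hu.1, ← chartCo_chartPt I hu'.1, ← P.coordSymm_transition hu,
    ← P.coordSymm_transition hu', h]

theorem TranslationPatch.det_transition_ne_zero {q : M} {u : Fin (realDim E) → ℝ}
    (hu : u ∈ P.overlap q) : (fderiv ℝ (P.transition q) u).det ≠ 0 := by
  have hO := (P.isOpen_overlap q).mem_nhds hu
  have h1 := ((P.contDiffOn_transition q).contDiffAt hO).differentiableAt (by simp)
  have hmem : P.coordSymm (P.transition q u) ∈ (extChartAt I q).source := by
    rw [P.coordSymm_transition hu]; exact chartPt_mem I hu.1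
  have h2 := (((P.contDiffOn_chart_coordSymm q).contDiffAt
    (((isOpen_extChartAt_source q).preimage P.contMDiff_coordSymm.continuous).mem_nhds
      hmem)).differentiableAt (by simp)).hasFDerivAt
  have h3 := ((frameEquiv E).symm.toContinuousLinearMap.hasFDerivAt.comp _ h2).comp u h1.hasFDerivAt
  have h4 : (((frameEquiv E).symm.toContinuousLinearMap : E → _) ∘
      (fun v => extChartAt I q (P.coordSymm v))) ∘ P.transition q =ᶠ[𝓝 u] id := by
    filter_upwards [hO] with w hw
    change (frameEquiv E).symm (extChartAt I q (P.coordSymm (P.transition q w))) = w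
    rw [P.coordSymm_transition hw]
    exact chartCo_chartPt I hw.1
  have h5 := (h3.congr_of_eventuallyEq h4.symm).unique (hasFDerivAt_id u)
  intro h0
  have h6 := congrArg (fun A : (Fin (realDim E) → ℝ) →L[ℝ] (Fin (realDim E) → ℝ) =>
    LinearMap.det (A : (Fin (realDim E) → ℝ) →ₗ[ℝ] (Fin (realDim E) → ℝ))) h5
  have h7 : LinearMap.det ((ContinuousLinearMap.id ℝ (Fin (realDim E) → ℝ) :
      (Fin (realDim E) → ℝ) →L[ℝ] (Fin (realDim E) → ℝ)) :
        (Fin (realDim E) → ℝ) →ₗ[ℝ] (Fin (realDim E) → ℝ)) = 1 := LinearMap.det_id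
  simp only [h7, ContinuousLinearMap.toLinearMap_comp, LinearMap.det_comp] at h6
  rw [show LinearMap.det (fderiv ℝ (P.transition q) u :
    (Fin (realDim E) → ℝ) →ₗ[ℝ] (Fin (realDim E) → ℝ)) = 0 from h0, mul_zero] at h6
  exact zero_ne_one h6

theorem TranslationPatch.expr_transition {q : M} {u : Fin (realDim E) → ℝ}
    (hu : u ∈ P.overlap q) {k : ℕ} (θ : KForm I M k) : (P.expr θ).1 (P.transition q u) =
      camComp k (fderiv ℝ (fun v => extChartAt I q (P.coordSymm v)) (P.transition q u))
        (chartRep I q θ.1 (frameEquiv E u)) := by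
  have ht : P.transition q u ∈ (extChartAt 𝓘(ℝ, Fin (realDim E) → ℝ)
      (0 : Fin (realDim E) → ℝ)).target := by
    rw [extChartAt_model_space_eq_id]; trivial
  have hs : ∀ v, (extChartAt 𝓘(ℝ, Fin (realDim E) → ℝ) (0 : Fin (realDim E) → ℝ)).symm v = v :=
    fun v => by rw [extChartAt_model_space_eq_id]; rfl
  have hu' : P.coordSymm (P.transition q u) ∈ (extChartAt I q).source := by
    rw [P.coordSymm_transition hu]; exact chartPt_mem I hu.1
  have h := chartRep_pullback 𝓘(ℝ, Fin (realDim E) → ℝ) I P.contMDiff_coordSymm θ.1 0 q ht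
    (by rw [hs]; exact hu')
  rw [chartRep_self] at h
  simp only [hs] at h
  refine h.trans ?_
  have e : extChartAt I q (P.coordSymm (P.transition q u)) = frameEquiv E u := by
    rw [P.coordSymm_transition hu]; exact (extChartAt I q).right_inv hu.1
  rw [e]
  rfl

theorem TranslationPatch.smoothNear_regularize (hor : OrientedCharts I M)
    (f : Mollifier (Fin (realDim E) → ℝ)) (T : Form I M →L[ℝ] ℝ) {q : M} (hq : q ∈ P.source) :
    SmoothNear I (T.comp (P.regularize f)) q := by
  have hsum : T.comp (P.regularize f) = ∑ k ∈ Finset.range (realDim E + 1),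
      (T.comp (degreeCLM I M k)).comp (P.regularize f) := by
    ext θ
    rw [sum_apply]
    change T (P.regularize f θ) = _
    conv_lhs => rw [Form.eq_sum_single' I (P.regularize f θ), map_sum]
    rfl
  rw [hsum]
  refine SmoothNear.sum fun k hk => ?_
  have hO := P.isOpen_overlap q
  have hB : ContDiffOn ℝ ∞ (fun u => fderiv ℝ (fun v => extChartAt I q (P.coordSymm v))
      (P.transition q u)) (P.overlap q) := by
    refine ((P.contDiffOn_chart_coordSymm q).fderiv_of_isOpen
      ((isOpen_extChartAt_source q).preimage P.contMDiff_coordSymm.continuous) (m := ∞)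
      (by simp)).comp (P.contDiffOn_transition q) fun u hu => ?_
    rw [mem_preimage, P.coordSymm_transition hu]
    exact chartPt_mem I hu.1
  refine smoothNear_of_density hor (by have := Finset.mem_range.1 hk; omega) hO inter_subset_left
    ⟨chartCo_mem I (mem_extChartAt_source q), ?_⟩
    (ρ := fun u => |(fderiv ℝ (P.transition q) u).det| •
      ((P.density f T k (P.transition q u)).toLinearMap.comp (camComp k (fderiv ℝ
        (fun v => extChartAt I q (P.coordSymm v)) (P.transition q u))).toLinearMap)) ?_ ?_
  · rw [mem_preimage, chartPt_chartCo I (mem_extChartAt_source q)]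
    exact hq
  · intro α
    refine ContDiffOn.smul (fun u hu => ?_) (((P.contDiff_density f T k).comp_contDiffOn
      (P.contDiffOn_transition q)).clm_apply
      ((contDiffOn_camComp hB).clm_apply contDiffOn_const))
    exact (((contDiffOn_det ((P.contDiffOn_transition q).fderiv_of_isOpen hO (m := ∞)
      (by simp))).contDiffAt (hO.mem_nhds hu)).abs
        (P.det_transition_ne_zero hu)).contDiffWithinAt
  · rintro θ ⟨C, hC, hCO, h0⟩
    have hCs : C ⊆ P.source := fun x hx => by
      obtain ⟨u, hu, rfl⟩ := hCO hx
      exact hu.2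
    refine (P.apply_single_regularize f T ⟨C, hC, hCs, h0⟩ k).trans ?_
    have e1 : ∫ v, P.density f T k v ((P.expr (θ k)).1 v) =
        ∫ v in P.transition q '' P.overlap q, P.density f T k v ((P.expr (θ k)).1 v) := by
      refine (setIntegral_eq_integral_of_forall_compl_eq_zero fun v hv => ?_).symm
      rw [P.expr_eq_zero h0 k, map_zero]
      rintro ⟨x, hx, rfl⟩
      obtain ⟨u, hu, rfl⟩ := hCO hx
      exact hv ⟨u, hu, rfl⟩
    rw [e1, integral_image_eq_integral_abs_det_fderiv_smul volume hO.measurableSet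
      (fun u hu => ((((P.contDiffOn_transition q).contDiffAt (hO.mem_nhds hu)).differentiableAt
        (by simp)).hasFDerivAt).hasFDerivWithinAt) (P.injOn_transition q)]
    refine setIntegral_congr_fun hO.measurableSet fun u hu => ?_
    simp only [P.expr_transition hu]
    rfl

end Smoothing

section Regularizer

theorem exists_mollifier {V : Type*} [NormedAddCommGroup V] [NormedSpace ℝ V]
    [FiniteDimensional ℝ V] [MeasureSpace V] [BorelSpace V] [(volume : Measure V).IsAddHaarMeasure]
    {N : Set V} (hN : N ∈ 𝓝 (0 : V)) : ∃ f : Mollifier V, tsupport f.toFun ⊆ N := by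
  obtain ⟨r, hr, hrN⟩ := Metric.mem_nhds_iff.1 hN
  let χ : ContDiffBump (0 : V) := ⟨r / 4, r / 2, by positivity, by linarith⟩
  refine ⟨⟨χ.normed volume, χ.contDiff_normed, χ.hasCompactSupport_normed, χ.integral_normed⟩, ?_⟩
  change tsupport (χ.normed volume) ⊆ N
  rw [χ.tsupport_normed_eq]
  exact (Metric.closedBall_subset_ball (by change r / 2 < r; linarith)).trans hrN

variable {E : Type*} [NormedAddCommGroup E] [NormedSpace ℝ E] [NormedSpace ℂ E]
  [IsScalarTower ℝ ℂ E] [FiniteDimensional ℝ E] [FiniteDimensional ℂ E]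
  {H : Type*} [TopologicalSpace H] (I : ModelWithCorners ℝ E H) [I.Boundaryless]
  (M : Type*) [TopologicalSpace M] [ChartedSpace H M] [IsManifold I ∞ M]
  [T2Space M] [CompactSpace M]

/-- An operator on forms which is homotopic to the identity and smooths functionals on `U`. -/
structure Regularizer (U : Set M) where
  op : Form I M →L[ℝ] Form I M
  homotopy : Form I M →ₗ[ℝ] Form I M
  orderBounded_op : OrderBounded I I op
  orderBounded_homotopy : OrderBounded I I homotopy
  op_dForm : ∀ φ, op (dForm I φ) = dForm I (op φ)
  op_sub : ∀ φ, op φ - φ = dForm I (homotopy φ) + homotopy (dForm I φ)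
  smoothNear : ∀ T : Form I M →L[ℝ] ℝ, ∀ q ∈ U, SmoothNear I (T.comp op) q

variable {I M}

/-- The identity, as a regularizer on the empty set. -/
def Regularizer.id : Regularizer I M ∅ where
  op := ContinuousLinearMap.id ℝ _
  homotopy := 0
  orderBounded_op i := jetBound_jetNorm I i
  orderBounded_homotopy i := (jetBound_zero I _).mono fun φ => by
    rw [LinearMap.zero_apply, jetNorm, map_zero, norm_zero]
  op_dForm _ := rfl
  op_sub φ := by
    have h := (dFormLM I : Form I M →ₗ[ℝ] Form I M).map_zero
    rw [LinearMap.zero_apply, LinearMap.zero_apply, add_zero]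
    exact (sub_self φ).trans h.symm
  smoothNear _ _ hq := hq.elim

/-- Composition of a regularizer with the regularization along a patch. -/
def Regularizer.step (hor : OrientedCharts I M) {U : Set M} (R : Regularizer I M U)
    (P : TranslationPatch I M (Fin (realDim E) → ℝ)) (f : Mollifier (Fin (realDim E) → ℝ)) :
    Regularizer I M (P.source ∪ {q | ∀ y ∈ tsupport f.toFun, P.shift (-y) q ∈ U}) where
  op := R.op.comp (P.regularize f)
  homotopy := R.homotopy.comp (P.regularize f).toLinearMap + (P.homotopy f).toLinearMap
  orderBounded_op := R.orderBounded_op.comp (P.orderBounded_regularize f)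
  orderBounded_homotopy := by
    change OrderBounded I I fun φ => R.homotopy (P.regularize f φ) + P.homotopy f φ
    exact OrderBounded.add (R := fun φ => R.homotopy (P.regularize f φ))
      (R.orderBounded_homotopy.comp (P.orderBounded_regularize f)) (P.orderBounded_homotopy f)
  op_dForm φ := by
    change R.op (P.regularize f (dForm I φ)) = dForm I (R.op (P.regularize f φ))
    rw [P.regularize_dForm, R.op_dForm]
  op_sub φ := by
    have h1 := R.op_sub (P.regularize f φ)
    have h2 := P.homotopy_formula f φ
    rw [← P.regularize_dForm] at h1
    change R.op (P.regularize f φ) - φ =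
      dForm I (R.homotopy (P.regularize f φ) + P.homotopy f φ) +
        (R.homotopy (P.regularize f (dForm I φ)) + P.homotopy f (dForm I φ))
    rw [dForm_add, ← sub_add_sub_cancel _ (P.regularize f φ) φ, h1, h2]
    abel
  smoothNear T q hq := by
    rcases hq with hq | hq
    · exact P.smoothNear_regularize hor f (T.comp R.op) hq
    · exact SmoothNear.regularize hor P.toVectorAction f (T := T.comp R.op) fun y hy =>
        R.smoothNear T _ (hq y hy)

/-- Patches that cover a compact manifold give a global regularizer. -/
theorem exists_regularizer (hor : OrientedCharts I M) {ι : Type*} [Finite ι]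
    (P : ι → TranslationPatch I M (Fin (realDim E) → ℝ)) (hP : ⋃ i, (P i).source = univ) :
    Nonempty (Regularizer I M univ) := by
  classical
  have := Fintype.ofFinite ι
  obtain ⟨K, hK, hKs, hKu⟩ := isCompact_univ.finite_compact_cover (Finset.univ : Finset ι)
    (fun i => (P i).source) (fun i _ => (P i).isOpen_source) (by simp [hP])
  have key : ∀ t : Finset ι, ∃ U : Set M, IsOpen U ∧ (⋃ i ∈ t, K i) ⊆ U ∧
      Nonempty (Regularizer I M U) := by
    intro t
    induction t using Finset.induction_on with
    | empty => exact ⟨∅, isOpen_empty, by simp, ⟨Regularizer.id⟩⟩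
    | insert a t ha ih =>
      obtain ⟨U, hU, hKU, ⟨R⟩⟩ := ih
      have hC : IsCompact (⋃ i ∈ t, K i) := t.isCompact_biUnion fun i _ => hK i
      have hcs : Continuous fun z : (Fin (realDim E) → ℝ) × M => (P a).shift (-z.1) z.2 :=
        (P a).smooth.continuous.comp ((continuous_fst.neg).prodMk continuous_snd)
      obtain ⟨N, W, hN, hW, h0N, hCW, hNW⟩ := generalized_tube_lemma
        (isCompact_singleton (x := (0 : Fin (realDim E) → ℝ))) hC (hU.preimage hcs) (by
          rintro ⟨y, x⟩ ⟨hy, hx⟩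
          rw [mem_preimage]
          have hy0 : y = 0 := hy
          simp only [hy0, neg_zero, (P a).shift_zero]
          exact hKU hx)
      obtain ⟨f, hf⟩ := exists_mollifier (hN.mem_nhds (h0N rfl))
      have hsub : (P a).source ∪ W ⊆
          (P a).source ∪ {q | ∀ y ∈ tsupport f.toFun, (P a).shift (-y) q ∈ U} :=
        union_subset_union_right _ fun q hq y hy => hNW (mk_mem_prod (hf hy) hq)
      refine ⟨(P a).source ∪ W, (P a).isOpen_source.union hW, ?_,
        ⟨{ R.step hor (P a) f with
           smoothNear := fun T q hq => (R.step hor (P a) f).smoothNear T q (hsub hq) }⟩⟩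
      rw [Finset.set_biUnion_insert]
      exact union_subset_union (hKs a) hCW
  obtain ⟨U, -, hU, ⟨R⟩⟩ := key Finset.univ
  rw [← hKu] at hU
  exact ⟨{ R with smoothNear := fun T q _ => R.smoothNear T q (hU (mem_univ q)) }⟩

theorem Regularizer.exists_form (R : Regularizer I M univ) (T : Form I M →L[ℝ] ℝ) :
    ∃ η : Form I M, ∀ θ, T (R.op θ) = integral I (wedge I η θ) :=
  exists_representedOn_univ fun q => R.smoothNear T q (mem_univ q)

/-- A form that is orthogonal to the closed forms is annihilated by the closed currents. -/
theorem apply_eq_zero_of_integral_wedge (hor : OrientedCharts I M) (R : Regularizer I M univ)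
    {T : Form I M →L[ℝ] ℝ} (hT : ∀ φ, T (dForm I φ) = 0) {η : Form I M}
    (hη : ∀ θ, dForm I θ = 0 → integral I (wedge I η θ) = 0) : T η = 0 := by
  have hd : dForm I η = 0 := dForm_eq_zero_of_integral_wedge I hor fun θ => hη _ (dForm_dForm I θ)
  obtain ⟨w, hw⟩ := R.exists_form T
  have hwd : dForm I w = 0 := dForm_eq_zero_of_integral_wedge I hor fun θ => by
    rw [← hw, R.op_dForm, hT]
  obtain ⟨s, hs⟩ := exists_integral_wedge_comm I M
  have h1 : T (R.op η) - T η = 0 := by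
    rw [← map_sub, R.op_sub, hd, map_zero, add_zero, hT]
  have h2 : T (R.op η) = 0 := by
    rw [hw, hs]
    exact hη _ (dForm_scaleDeg_eq_zero I s hwd)
  rw [h2, zero_sub, neg_eq_zero] at h1
  exact h1

end Regularizer

section Limits

theorem hasFTaylorSeriesUpToOn_of_tendsto {E F : Type*} [NormedAddCommGroup E] [NormedSpace ℝ E]
    [NormedAddCommGroup F] [NormedSpace ℝ F] {U : Set E} (hU : IsOpen U) {f : ℕ → E → F}
    (hf : ∀ n, ContDiffOn ℝ ∞ (f n) U) {g : E → F} {h : E → FormalMultilinearSeries ℝ E F}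
    (hg : ∀ x ∈ U, (h x 0).curry0 = g x)
    (hh : ∀ j, TendstoLocallyUniformlyOn (fun n => iteratedFDeriv ℝ j (f n)) (fun x => h x j)
      atTop U) : HasFTaylorSeriesUpToOn ∞ g h U := by
  have hd : ∀ (j n : ℕ), ∀ x ∈ U, HasFDerivAt (iteratedFDeriv ℝ j (f n))
      (iteratedFDeriv ℝ (j + 1) (f n) x).curryLeft x := by
    intro j n x hx
    have h1 := (((hf n).contDiffAt (hU.mem_nhds hx)).differentiableAt_iteratedFDeriv (m := j)
      (by exact_mod_cast WithTop.coe_lt_top _)).hasFDerivAt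
    convert h1 using 1
    ext v m
    simp [iteratedFDeriv_succ_apply_left]
  have key : ∀ j : ℕ, ∀ x ∈ U, HasFDerivAt (fun x => h x j) (h x (j + 1)).curryLeft x := by
    intro j x hx
    refine hasFDerivAt_of_tendstoLocallyUniformlyOn hU (g' := fun x => (h x (j + 1)).curryLeft)
      (f := fun n => iteratedFDeriv ℝ j (f n))
      (f' := fun n x => (iteratedFDeriv ℝ (j + 1) (f n) x).curryLeft) (l := atTop) ?_ (hd j)
      (fun x hx => (hh j).tendsto_at hx) hx
    exact (continuousMultilinearCurryLeftEquiv ℝ (fun _ : Fin (j + 1) => E)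
      F).toContinuousLinearEquiv.toContinuousLinearMap.uniformContinuous.comp_tendstoLocallyUniformlyOn
      (hh (j + 1))
  exact ⟨hg, fun j _ x hx => (key j x hx).hasFDerivWithinAt,
    fun j _ x hx => (key j x hx).continuousAt.continuousWithinAt⟩

variable {E : Type*} [NormedAddCommGroup E] [NormedSpace ℝ E] [FiniteDimensional ℝ E]
  {H : Type*} [TopologicalSpace H] (I : ModelWithCorners ℝ E H) [I.Boundaryless]
  {M : Type*} [TopologicalSpace M] [ChartedSpace H M] [IsManifold I ∞ M]

/-- Sequences of forms all of whose jets converge uniformly on compact sets have a limit. -/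
theorem exists_form_limit {ψ : ℕ → Form I M} (hψ : ∀ i : JetIdx I M,
    CauchySeq fun n => jetLM I i (ψ n)) :
    ∃ φ : Form I M, ∀ i, Tendsto (fun n => jetNorm I i (ψ n - φ)) atTop (𝓝 0) := by
  have hl : ∀ i : JetIdx I M, ∃ L, Tendsto (fun n => jetLM I i (ψ n)) atTop (𝓝 L) := fun i =>
    cauchySeq_tendsto_of_complete (hψ i)
  choose L hL using hl
  let pt : ∀ (_ : ℕ) (p : M) (_ : ℕ) (y : E), y ∈ (extChartAt I p).target → JetIdx I M :=
    fun k p j y hy => ⟨k, p, j, {y}, isCompact_singleton, singleton_subset_iff.2 hy⟩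
  classical
  let h : ∀ (k : ℕ) (p : M), E → FormalMultilinearSeries ℝ E (E [⋀^Fin k]→L[ℝ] ℝ) :=
    fun k p y j => if hy : y ∈ (extChartAt I p).target then L (pt k p j y hy) ⟨y, rfl⟩ else 0
  have hpt : ∀ (i : JetIdx I M) (u : i.carrier), Tendsto (fun n => iteratedFDeriv ℝ i.order
      (chartRep I i.center (ψ n i.deg).1) u) atTop (𝓝 (L i u)) := fun i u =>
    (ContinuousMap.tendsto_iff_tendstoUniformly.1 (hL i)).tendsto_at u
  have hLh : ∀ (i : JetIdx I M) (u : i.carrier), L i u = h i.deg i.center u i.order := by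
    intro i u
    refine Eq.trans ?_ (dif_pos (i.subset u.2)).symm
    exact tendsto_nhds_unique (X := E [×i.order]→L[ℝ] (E [⋀^Fin i.deg]→L[ℝ] ℝ)) (hpt i u) (hpt (pt i.deg i.center i.order u (i.subset u.2)) ⟨u, rfl⟩)
  have hconv : ∀ k p j, TendstoLocallyUniformlyOn
      (fun n => iteratedFDeriv ℝ j (chartRep I p (ψ n k).1)) (fun y => h k p y j) atTop
      (extChartAt I p).target := by
    intro k p j
    rw [tendstoLocallyUniformlyOn_iff_forall_isCompact (isOpen_extChartAt_target p)]
    intro K hKt hK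
    have : CompactSpace K := isCompact_iff_compactSpace.1 hK
    let i : JetIdx I M := ⟨k, p, j, K, hK, hKt⟩
    rw [tendstoUniformlyOn_iff_tendstoUniformly_comp_coe]
    have h1 := ContinuousMap.tendsto_iff_tendstoUniformly.1 (hL i)
    have h2 : (fun u : i.carrier => h k p u j) = L i := funext fun u => (hLh i u).symm
    have h3 : ((fun y => h k p y j) ∘ fun u : K => (u : E)) = L i := h2
    rw [h3]
    exact h1
  let φ : ∀ (k : ℕ) (x : M), E [⋀^Fin k]→L[ℝ] ℝ := fun k x =>
    camComp k (diffAt I 𝓘(ℝ, E) (extChartAt I x) x) ((h k x (extChartAt I x x) 0).curry0)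
  have hval : ∀ k x, Tendsto (fun n => (ψ n k).1 x) atTop (𝓝 (φ k x)) := by
    intro k x
    have h1 := (hconv k x 0).tendsto_at (mem_extChartAt_target (I := I) x)
    have h2 := (((camComp k (diffAt I 𝓘(ℝ, E) (extChartAt I x) x)).continuous.comp
      (continuousMultilinearCurryFin0 ℝ E (E [⋀^Fin k]→L[ℝ] ℝ)).continuous).tendsto _).comp h1
    refine h2.congr fun n => ?_
    exact (eq_chartRep_comp I (ψ n k).1 x (mem_extChartAt_source x)).symm
  have hrep : ∀ k p, ∀ y ∈ (extChartAt I p).target, (h k p y 0).curry0 = chartRep I p (φ k) y := by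
    intro k p y hy
    have h1 := ((continuousMultilinearCurryFin0 ℝ E (E [⋀^Fin k]→L[ℝ] ℝ)).continuous.tendsto
      _).comp ((hconv k p 0).tendsto_at hy)
    have h2 := ((camComp k (diffAt 𝓘(ℝ, E) I (extChartAt I p).symm y)).continuous.tendsto _).comp
      (hval k ((extChartAt I p).symm y))
    exact tendsto_nhds_unique h1 h2
  have hT : ∀ k p, HasFTaylorSeriesUpToOn ∞ (chartRep I p (φ k)) (h k p)
      (extChartAt I p).target := fun k p =>
    hasFTaylorSeriesUpToOn_of_tendsto (isOpen_extChartAt_target p) (fun n => (ψ n k).2 p)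
      (hrep k p) (hconv k p)
  refine ⟨fun k => ⟨φ k, fun p => (hT k p).contDiffOn⟩, fun i => ?_⟩
  have e : L i = jetLM I i (fun k => ⟨φ k, fun p => (hT k p).contDiffOn⟩) := by
    ext1 u
    have hu := i.subset u.2
    have hO := isOpen_extChartAt_target (I := I) i.center
    refine (hLh i u).trans (((hT i.deg i.center).eq_iteratedFDerivWithin_of_uniqueDiffOn (m := i.order)
      (by exact_mod_cast le_top) hO.uniqueDiffOn hu).trans
      (iteratedFDerivWithin_of_isOpen _ hO hu))
  have := (tendsto_iff_norm_sub_tendsto_zero.1 (hL i))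
  rw [e] at this
  exact this.congr fun n => congrArg norm ((jetLM I i).map_sub _ _).symm

end Limits

theorem exists_bilinear_bound {A B C : Type*} [NormedAddCommGroup A] [NormedSpace ℝ A]
    [NormedAddCommGroup B] [NormedSpace ℝ B] [NormedAddCommGroup C] [NormedSpace ℝ C]
    (L : A →L[ℝ] B →L[ℝ] C) : ∃ c : ℝ, 0 ≤ c ∧ ∀ a b, ‖L a b‖ ≤ c * ‖a‖ * ‖b‖ :=
  ⟨‖L‖, L.opNorm_nonneg, fun a b => L.le_opNorm₂ a b⟩

/-- A linear map which is weakly bounded relative to another one is bounded relative to it. -/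
theorem exists_bound_of_weak_bound {V X X' : Type*} [AddCommGroup V] [Module ℝ V]
    [NormedAddCommGroup X] [NormedSpace ℝ X] [NormedAddCommGroup X'] [NormedSpace ℝ X']
    (J : V →ₗ[ℝ] X) (K : V →ₗ[ℝ] X')
    (h : ∀ l : X →L[ℝ] ℝ, ∃ c : ℝ, ∀ v, |l (J v)| ≤ c * ‖K v‖) :
    ∃ c : ℝ, 0 ≤ c ∧ ∀ v, ‖J v‖ ≤ c * ‖K v‖ := by
  obtain ⟨c, hc⟩ := banach_steinhaus
    (g := fun v : {v : V // ‖K v‖ ≤ 1} => NormedSpace.inclusionInDoubleDual ℝ X (J v.1)) fun l => by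
      obtain ⟨c, hc⟩ := h l
      refine ⟨|c|, fun v => (hc v.1).trans ?_⟩
      calc c * ‖K v.1‖ ≤ |c| * ‖K v.1‖ :=
            mul_le_mul_of_nonneg_right (le_abs_self c) (norm_nonneg _)
        _ ≤ |c| * 1 := mul_le_mul_of_nonneg_left v.2 (abs_nonneg c)
        _ = |c| := mul_one _
  have hc0 : 0 ≤ c := (norm_nonneg _).trans (hc ⟨0, by simp⟩)
  refine ⟨c, hc0, fun v => ?_⟩
  have key : ∀ δ > 0, ‖J v‖ ≤ c * (‖K v‖ + δ) := by
    intro δ hδ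
    have hp : 0 < ‖K v‖ + δ := add_pos_of_nonneg_of_pos (norm_nonneg _) hδ
    have h1 := hc ⟨(‖K v‖ + δ)⁻¹ • v, by
      rw [map_smul, norm_smul, norm_inv, Real.norm_of_nonneg hp.le, inv_mul_le_iff₀ hp]
      linarith⟩
    have h2 := (NormedSpace.inclusionInDoubleDualLi (E := X) ℝ).norm_map
      (J ((‖K v‖ + δ)⁻¹ • v))
    change ‖NormedSpace.inclusionInDoubleDual ℝ X _‖ = _ at h2
    rw [h2, map_smul, norm_smul, norm_inv, Real.norm_of_nonneg hp.le, inv_mul_le_iff₀ hp,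
      mul_comm] at h1
    exact h1
  refine le_of_forall_pos_le_add fun ε hε => ?_
  refine (key (ε / (c + 1)) (by positivity)).trans ?_
  rw [mul_add]
  have : c * (ε / (c + 1)) ≤ ε := by
    rw [mul_div_assoc', div_le_iff₀ (by positivity)]
    nlinarith
  linarith

section JetFamilies

variable {E : Type*} [NormedAddCommGroup E] [NormedSpace ℝ E] [FiniteDimensional ℝ E]
  {H : Type*} [TopologicalSpace H] (I : ModelWithCorners ℝ E H) [I.Boundaryless]
  {M : Type*} [TopologicalSpace M] [ChartedSpace H M] [IsManifold I ∞ M]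

/-- A finite family of jets of forms. -/
def jetsLM (s : Finset (JetIdx I M)) :
    Form I M →ₗ[ℝ] ∀ i : s, C(i.1.carrier, JetSpace E i.1.deg i.1.order) :=
  LinearMap.pi fun i => jetLM I i.1

theorem jetNorm_le_jetsLM {s : Finset (JetIdx I M)} {i : JetIdx I M} (hi : i ∈ s) (φ : Form I M) :
    jetNorm I i φ ≤ ‖jetsLM I s φ‖ := norm_le_pi_norm (jetsLM I s φ) ⟨i, hi⟩

theorem sum_jetNorm_le (s : Finset (JetIdx I M)) (φ : Form I M) :
    ∑ i ∈ s, jetNorm I i φ ≤ s.card * ‖jetsLM I s φ‖ := by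
  rw [← nsmul_eq_mul]
  exact Finset.sum_le_card_nsmul _ _ _ fun i hi => jetNorm_le_jetsLM I hi φ

theorem tendsto_jetsLM {s : Finset (JetIdx I M)} {φ : ℕ → Form I M}
    (h : ∀ i ∈ s, Tendsto (fun n => jetNorm I i (φ n)) atTop (𝓝 0)) :
    Tendsto (fun n => ‖jetsLM I s (φ n)‖) atTop (𝓝 0) := by
  rw [← tendsto_zero_iff_norm_tendsto_zero, tendsto_pi_nhds]
  exact fun i => tendsto_zero_iff_norm_tendsto_zero.2 (h i.1 i.2)

theorem JetSpace.finiteDimensional (k j : ℕ) : FiniteDimensional ℝ (JetSpace E k j) := by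
  have := finiteDimensional_cam (V := E) k
  let b := Module.finBasis ℝ E
  let f : JetSpace E k j →ₗ[ℝ] (Fin j → Fin (Module.finrank ℝ E)) → (E [⋀^Fin k]→L[ℝ] ℝ) :=
    { toFun := fun α t => ContinuousMultilinearMap.toMultilinearMap α fun i => b (t i)
      map_add' := fun _ _ => rfl
      map_smul' := fun _ _ => rfl }
  refine FiniteDimensional.of_injective f fun α β h => ?_
  have h' : ContinuousMultilinearMap.toMultilinearMap α =
      ContinuousMultilinearMap.toMultilinearMap β :=
    Module.Basis.ext_multilinear (fun _ => b) fun t => congrFun h t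
  exact ContinuousMultilinearMap.toMultilinearMap_injective h'

/-- Bounded sequences of forms have relatively compact jets. -/
theorem exists_isCompact_jetLM {χ : ℕ → Form I M}
    (hb : ∀ i : JetIdx I M, ∃ c : ℝ, ∀ n, jetNorm I i (χ n) ≤ c) (i : JetIdx I M) :
    ∃ A : Set C(i.carrier, JetSpace E i.deg i.order), IsCompact A ∧ ∀ n, jetLM I i (χ n) ∈ A := by
  have := JetSpace.finiteDimensional (E := E) i.deg i.order
  have : ProperSpace (JetSpace E i.deg i.order) := FiniteDimensional.proper ℝ _
  let e := ContinuousMap.equivBoundedOfCompact i.carrier (JetSpace E i.deg i.order)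
  obtain ⟨c, hc⟩ := hb i
  have hcomp := BoundedContinuousFunction.arzela_ascoli
    (Metric.closedBall (0 : JetSpace E i.deg i.order) c) (isCompact_closedBall _ _)
    (range fun n => e (jetLM I i (χ n))) (by
      rintro _ x ⟨n, rfl⟩
      rw [mem_closedBall_zero_iff]
      exact (le_jetNorm I i (χ n) x.2).trans (hc n)) (by
      intro x₀
      rw [Metric.equicontinuousAt_iff]
      intro ε hε
      obtain ⟨r, hr, hrt⟩ := Metric.nhds_basis_closedBall.mem_iff.1
        ((isOpen_extChartAt_target (I := I) i.center).mem_nhds (i.subset x₀.2))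
      have : ProperSpace E := FiniteDimensional.proper ℝ E
      let i' : JetIdx I M := ⟨i.deg, i.center, i.order + 1, Metric.closedBall x₀.1 r,
        isCompact_closedBall _ _, hrt⟩
      obtain ⟨c', hc'⟩ := hb i'
      have hc'0 : 0 ≤ c' := (jetNorm_nonneg I i' _).trans (hc' 0)
      refine ⟨min r (ε / (c' + 1)), by positivity, ?_⟩
      rintro x hx ⟨_, n, rfl⟩
      have hxr : dist x.1 x₀.1 < r := hx.trans_le (min_le_left _ _)
      have hxε : dist x.1 x₀.1 < ε / (c' + 1) := hx.trans_le (min_le_right _ _)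
      have h1 := Convex.norm_image_sub_le_of_norm_fderiv_le (𝕜 := ℝ)
        (f := iteratedFDeriv ℝ i.order (chartRep I i.center (χ n i.deg).1)) (C := c')
        (s := Metric.closedBall x₀.1 r)
        (fun y hy => (((χ n i.deg).contDiffAt I i.center
          (hrt hy)).differentiableAt_iteratedFDeriv (m := i.order)
            (by exact_mod_cast WithTop.coe_lt_top _)))
        (fun y hy => by
          rw [norm_fderiv_iteratedFDeriv]
          exact (le_jetNorm I i' (χ n) hy).trans (hc' n))
        (convex_closedBall _ _) (Metric.mem_closedBall.2 hxr.le)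
        (Metric.mem_closedBall_self hr.le)
      refine lt_of_le_of_lt ((dist_eq_norm _ _).le.trans h1) ?_
      rw [← dist_eq_norm, dist_comm]
      rw [lt_div_iff₀ (by positivity)] at hxε
      nlinarith [dist_nonneg (x := x.1) (y := x₀.1)])
  have hi : Continuous e.symm := (ContinuousMap.isUniformEmbedding_equivBoundedOfCompact
    i.carrier (JetSpace E i.deg i.order)).isUniformInducing.isInducing.continuous_iff.2 (by
      have : e ∘ e.symm = id := funext e.apply_symm_apply
      rw [this]; exact continuous_id)
  exact ⟨_, hcomp.image hi, fun n => ⟨_, subset_closure ⟨n, rfl⟩, e.symm_apply_apply _⟩⟩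

/-- Bounded sequences of forms have subsequences whose jets in a finite family converge. -/
theorem exists_subseq_jetsLM {χ : ℕ → Form I M}
    (hb : ∀ i : JetIdx I M, ∃ c : ℝ, ∀ n, jetNorm I i (χ n) ≤ c) (s : Finset (JetIdx I M)) :
    ∃ a, ∃ ν : ℕ → ℕ, StrictMono ν ∧ Tendsto (fun n => jetsLM I s (χ (ν n))) atTop (𝓝 a) := by
  choose A hA hmem using exists_isCompact_jetLM I hb
  obtain ⟨a, -, ν, hν, h⟩ := (isCompact_univ_pi fun i : s => hA i.1).tendsto_subseq
    (x := fun n => jetsLM I s (χ n)) fun n i _ => hmem i.1 n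
  exact ⟨a, ν, hν, h⟩

end JetFamilies

section IntegralBound

variable {E : Type*} [NormedAddCommGroup E] [NormedSpace ℝ E] [NormedSpace ℂ E]
  [IsScalarTower ℝ ℂ E] [FiniteDimensional ℝ E] [FiniteDimensional ℂ E]
  {H : Type*} [TopologicalSpace H] (I : ModelWithCorners ℝ E H) [I.Boundaryless]
  (M : Type*) [TopologicalSpace M] [ChartedSpace H M] [IsManifold I ∞ M]
  [T2Space M] [CompactSpace M]

variable {M} in
theorem chartRep_wedge (η θ : Form I M) (r : ℕ) (p : M) (y : E) :
    chartRep I p (wedge I η θ r).1 y = ∑ q : Fin (r + 1), wedgeBilin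
      (Nat.add_sub_of_le (Nat.lt_succ_iff.1 q.2)) (chartRep I p (η q).1 y)
      (chartRep I p (θ (r - q)).1 y) := by
  rw [wedge_apply]
  change camComp r (diffAt 𝓘(ℝ, E) I (extChartAt I p).symm y)
    ((∑ q : Fin (r + 1), _ : KForm I M r).1 ((extChartAt I p).symm y)) = _
  rw [KForm.sum_val, map_sum]
  exact Finset.sum_congr rfl fun q _ => chartRep_wedgeK I _ (η q) (θ (r - q)) p y

open scoped Classical in
/-- A fixed finite family of jets bounds the integration against every form. -/
theorem exists_integral_wedge_bound : ∃ s : Finset (JetIdx I M), ∀ η : Form I M, ∃ c : ℝ,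
    ∀ θ, |integral I (wedge I η θ)| ≤ c * ‖jetsLM I s θ‖ := by
  obtain ⟨s, hs, c, hc, hb⟩ := jetBound_integral I M
  let lo : JetIdx I M → ℕ → JetIdx I M := fun i k => ⟨k, i.center, 0, i.carrier, i.isCompact, i.subset⟩
  refine ⟨s.biUnion fun i => (Finset.range (i.deg + 1)).image (lo i), fun η => ?_⟩
  set s' := s.biUnion fun i => (Finset.range (i.deg + 1)).image (lo i)
  have key : ∀ i ∈ s, ∃ C : ℝ, ∀ θ, jetNorm I i (wedge I η θ) ≤ C * ‖jetsLM I s' θ‖ := by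
    intro i hi
    have h0 : i.order = 0 := by simpa using hs i hi
    choose C hC0 hC using fun q : Fin (i.deg + 1) => exists_bilinear_bound
      (wedgeBilin (V := E) (Nat.add_sub_of_le (Nat.lt_succ_iff.1 q.2)))
    have hval : ∀ (k : ℕ) (θ : Form I M), ∀ u ∈ i.carrier,
        ‖chartRep I i.center (θ k).1 u‖ ≤ jetNorm I (lo i k) θ := fun k θ u hu => by
      rw [← norm_iteratedFDeriv_zero (𝕜 := ℝ)]
      exact le_jetNorm I (lo i k) θ hu
    refine ⟨∑ q : Fin (i.deg + 1), C q * jetNorm I (lo i q) η, fun θ => ?_⟩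
    have hpos : 0 ≤ ∑ q : Fin (i.deg + 1), C q * jetNorm I (lo i q) η :=
      Finset.sum_nonneg fun q _ => mul_nonneg (hC0 q) (jetNorm_nonneg I _ η)
    refine jetNorm_le I i (mul_nonneg hpos (norm_nonneg _)) fun u hu => ?_
    rw [h0, norm_iteratedFDeriv_zero, chartRep_wedge, Finset.sum_mul]
    refine norm_sum_le_of_le _ fun q _ => (hC q _ _).trans ?_
    refine mul_le_mul (mul_le_mul_of_nonneg_left (hval q η u hu) (hC0 q))
      ((hval _ θ u hu).trans (jetNorm_le_jetsLM I ?_ θ)) (norm_nonneg _)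
      (mul_nonneg (hC0 q) (jetNorm_nonneg I _ η))
    exact Finset.mem_biUnion.2 ⟨i, hi, Finset.mem_image.2 ⟨i.deg - q, by simp, rfl⟩⟩
  choose! C hC using key
  refine ⟨c * ∑ i ∈ s, C i, fun θ => (hb _).trans ?_⟩
  rw [mul_assoc, Finset.sum_mul]
  exact mul_le_mul_of_nonneg_left (Finset.sum_le_sum fun i hi => hC i hi θ) hc

end IntegralBound

section Potential

variable {E : Type*} [NormedAddCommGroup E] [NormedSpace ℝ E] [NormedSpace ℂ E]
  [IsScalarTower ℝ ℂ E] [FiniteDimensional ℝ E] [FiniteDimensional ℂ E]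
  {H : Type*} [TopologicalSpace H] {I : ModelWithCorners ℝ E H} [I.Boundaryless]
  {M : Type*} [TopologicalSpace M] [ChartedSpace H M] [IsManifold I ∞ M]
  [T2Space M] [CompactSpace M]

theorem continuous_jetsLM (s : Finset (JetIdx I M)) : Continuous (jetsLM I s) :=
  continuous_pi fun i => continuous_jetLM I i.1

/-- A finite family of jets controls all smoothed functionals. -/
theorem Regularizer.exists_bound (R : Regularizer I M univ) :
    ∃ s₀ : Finset (JetIdx I M), (∀ T : Form I M →L[ℝ] ℝ, ∃ c : ℝ, 0 ≤ c ∧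
        ∀ θ, |T (R.op θ)| ≤ c * ‖jetsLM I s₀ θ‖) ∧
      ∀ s : Finset (JetIdx I M), ∃ c : ℝ, 0 ≤ c ∧
        ∀ θ, ‖jetsLM I s (R.op θ)‖ ≤ c * ‖jetsLM I s₀ θ‖ := by
  obtain ⟨s₀, hs₀⟩ := exists_integral_wedge_bound I M
  have h1 : ∀ T : Form I M →L[ℝ] ℝ, ∃ c : ℝ, ∀ θ, |T (R.op θ)| ≤ c * ‖jetsLM I s₀ θ‖ := by
    intro T
    obtain ⟨η, hη⟩ := R.exists_form T
    obtain ⟨c, hc⟩ := hs₀ η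
    exact ⟨c, fun θ => hη θ ▸ hc θ⟩
  refine ⟨s₀, fun T => ?_, fun s => ?_⟩
  · obtain ⟨c, hc⟩ := h1 T
    exact ⟨|c|, abs_nonneg c, fun θ => (hc θ).trans
      (mul_le_mul_of_nonneg_right (le_abs_self c) (norm_nonneg _))⟩
  · refine exists_bound_of_weak_bound ((jetsLM I s).comp R.op.toLinearMap) (jetsLM I s₀) fun l => ?_
    exact h1 ⟨l.toLinearMap.comp (jetsLM I s), l.continuous.comp (continuous_jetsLM s)⟩

theorem Regularizer.exists_homotopy_bound (R : Regularizer I M univ) (s : Finset (JetIdx I M)) :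
    ∃ s₁ : Finset (JetIdx I M), ∃ c : ℝ, 0 ≤ c ∧
      ∀ θ, ‖jetsLM I s (R.homotopy θ)‖ ≤ c * ‖jetsLM I s₁ θ‖ := by
  obtain ⟨s₁, -, c, hc, h⟩ := JetBound.sum (s := s) (n := ⊤)
    fun i _ => (R.orderBounded_homotopy i).mono_order le_top
  refine ⟨s₁, c * s₁.card, by positivity, fun θ => ?_⟩
  have h1 : ‖jetsLM I s (R.homotopy θ)‖ ≤ ∑ i ∈ s, jetNorm I i (R.homotopy θ) :=
    (pi_norm_le_iff_of_nonneg (Finset.sum_nonneg fun i _ => jetNorm_nonneg I i _)).2 fun i =>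
      Finset.single_le_sum (f := fun i => jetNorm I i (R.homotopy θ))
        (fun i _ => jetNorm_nonneg I i _) i.2
  refine h1.trans ((h θ).trans ?_)
  rw [mul_assoc]
  exact mul_le_mul_of_nonneg_left (sum_jetNorm_le I s₁ θ) hc

theorem jetsLM_mono {s t : Finset (JetIdx I M)} (h : s ⊆ t) (φ : Form I M) :
    ‖jetsLM I s φ‖ ≤ ‖jetsLM I t φ‖ :=
  (pi_norm_le_iff_of_nonneg (norm_nonneg _)).2 fun i => jetNorm_le_jetsLM I (h i.2) φ

theorem Regularizer.op_op (R : Regularizer I M univ) (φ : Form I M) :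
    R.op (R.op φ) = φ + dForm I (R.homotopy (φ + R.op φ)) +
      R.homotopy (dForm I φ + R.op (dForm I φ)) := by
  have h1 := R.op_sub φ
  have h2 := R.op_sub (R.op φ)
  rw [sub_eq_iff_eq_add] at h1 h2
  rw [map_add, map_add, dForm_add, R.op_dForm, h2]
  generalize dForm I (R.homotopy (R.op φ)) = x
  generalize R.homotopy (dForm I (R.op φ)) = y
  rw [h1]
  abel

/-- Sequences with small differentials cannot stay away from the closed forms. -/
theorem Regularizer.not_separated (R : Regularizer I M univ) {s₀ s₁ : Finset (JetIdx I M)}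
    (hT : ∀ T : Form I M →L[ℝ] ℝ, ∃ c : ℝ, 0 ≤ c ∧ ∀ θ, |T (R.op θ)| ≤ c * ‖jetsLM I s₀ θ‖)
    (hR : ∀ s : Finset (JetIdx I M), ∃ c : ℝ, 0 ≤ c ∧
      ∀ θ, ‖jetsLM I s (R.op θ)‖ ≤ c * ‖jetsLM I s₀ θ‖)
    {c₁ : ℝ} (hA : ∀ θ, ‖jetsLM I s₀ (R.homotopy θ)‖ ≤ c₁ * ‖jetsLM I s₁ θ‖)
    {φ : ℕ → Form I M} (hφ : ∀ n, ‖jetsLM I s₀ (φ n)‖ ≤ 2)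
    (hd₀ : Tendsto (fun n => ‖jetsLM I s₀ (dForm I (φ n))‖) atTop (𝓝 0))
    (hd₁ : Tendsto (fun n => ‖jetsLM I s₁ (dForm I (φ n))‖) atTop (𝓝 0))
    (hsep : ∀ n θ, dForm I θ = 0 → 1 ≤ ‖jetsLM I s₀ (φ n - θ)‖) : False := by
  obtain ⟨a, ν, hν, ha⟩ := exists_subseq_jetsLM I (χ := fun n => R.op (φ n)) (fun i => by
    obtain ⟨c, hc, h⟩ := hR {i}
    exact ⟨c * 2, fun n => (jetNorm_le_jetsLM I (Finset.mem_singleton_self i) _).trans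
      ((h _).trans (mul_le_mul_of_nonneg_left (hφ n) hc))⟩) s₀
  have hcau := ha.cauchySeq
  obtain ⟨ψ, hψ⟩ := exists_form_limit I (ψ := fun n => R.op (R.op (φ (ν n)))) fun i => by
    obtain ⟨c, hc, h⟩ := hR {i}
    rw [Metric.cauchySeq_iff] at hcau ⊢
    intro ε hε
    obtain ⟨n, hn⟩ := hcau (ε / (c + 1)) (by positivity)
    refine ⟨n, fun k hk l hl => ?_⟩
    have h1 := hn k hk l hl
    rw [dist_eq_norm, ← map_sub] at h1 ⊢
    have h2 := (jetNorm_le_jetsLM I (Finset.mem_singleton_self i) _).trans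
      (h (R.op (φ (ν k)) - R.op (φ (ν l))))
    rw [map_sub] at h2
    refine lt_of_le_of_lt h2 ?_
    rw [lt_div_iff₀ (by positivity)] at h1
    nlinarith [norm_nonneg (jetsLM I s₀ (R.op (φ (ν k)) - R.op (φ (ν l))))]
  have hclosed : dForm I ψ = 0 := by
    refine form_ext_of_functional I fun T => ?_
    rw [map_zero]
    obtain ⟨s, -, c, hc, hb⟩ := jetBound_of_continuous I (T.comp (dFormCLM I))
    obtain ⟨c', hc', hb'⟩ := hT (T.comp R.op)
    have h1 : Tendsto (fun n => c * ∑ i ∈ s, jetNorm I i (R.op (R.op (φ (ν n))) - ψ) +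
        c' * ‖jetsLM I s₀ (dForm I (φ (ν n)))‖) atTop (𝓝 (c * ∑ i ∈ s, 0 + c' * 0)) :=
      ((tendsto_finsetSum _ fun i _ => hψ i).const_mul c).add
        ((hd₀.comp hν.tendsto_atTop).const_mul c')
    rw [Finset.sum_const_zero, mul_zero, mul_zero, add_zero] at h1
    refine abs_nonpos_iff.1 (ge_of_tendsto' h1 fun n => ?_)
    have h2 := hb (R.op (R.op (φ (ν n))) - ψ)
    have h3 := hb' (dForm I (φ (ν n)))
    have h4 : (T.comp (dFormCLM I)) (R.op (R.op (φ (ν n))) - ψ) =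
        (T.comp R.op) (R.op (dForm I (φ (ν n)))) - T (dForm I ψ) := by
      rw [map_sub]
      change T (dForm I (R.op (R.op (φ (ν n))))) - _ = T (R.op (R.op (dForm I (φ (ν n))))) - _
      rw [R.op_dForm, R.op_dForm]
      rfl
    beta_reduce at h2
    rw [Real.norm_eq_abs, h4] at h2
    rw [abs_le] at h2 h3 ⊢
    constructor <;> linarith [h2.1, h2.2, h3.1, h3.2]
  obtain ⟨c₂, hc₂, hb₂⟩ := hR s₁
  have hc₁ : ∀ n, ‖jetsLM I s₀ (R.homotopy (dForm I (φ n) + R.op (dForm I (φ n))))‖ ≤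
      |c₁| * (‖jetsLM I s₁ (dForm I (φ n))‖ + c₂ * ‖jetsLM I s₀ (dForm I (φ n))‖) := fun n => by
    refine (hA _).trans (mul_le_mul (le_abs_self _) ?_ (norm_nonneg _) (abs_nonneg _))
    rw [map_add]
    exact (norm_add_le _ _).trans (add_le_add_right (hb₂ _) _)
  have hlim : Tendsto (fun n => ‖jetsLM I s₀ (R.op (R.op (φ (ν n))) - ψ)‖ +
      |c₁| * (‖jetsLM I s₁ (dForm I (φ (ν n)))‖ + c₂ * ‖jetsLM I s₀ (dForm I (φ (ν n)))‖))
      atTop (𝓝 (0 + |c₁| * (0 + c₂ * 0))) :=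
    (tendsto_jetsLM I fun i _ => hψ i).add (((hd₁.comp hν.tendsto_atTop).add
      ((hd₀.comp hν.tendsto_atTop).const_mul c₂)).const_mul _)
  rw [mul_zero, add_zero, mul_zero, add_zero] at hlim
  have : (1 : ℝ) ≤ 0 := ge_of_tendsto' hlim fun n => by
    have h1 := hsep (ν n) (ψ - dForm I (R.homotopy (φ (ν n) + R.op (φ (ν n))))) (by
      refine (map_sub (dFormLM I : Form I M →ₗ[ℝ] Form I M) _ _).trans ?_
      change dForm I ψ - dForm I (dForm I _) = 0
      rw [hclosed, dForm_dForm, sub_zero])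
    have h2 : φ (ν n) - (ψ - dForm I (R.homotopy (φ (ν n) + R.op (φ (ν n))))) =
        (R.op (R.op (φ (ν n))) - ψ) -
          R.homotopy (dForm I (φ (ν n)) + R.op (dForm I (φ (ν n)))) := by
      rw [R.op_op]; abel
    rw [h2, map_sub] at h1
    exact h1.trans ((norm_sub_le _ _).trans (add_le_add_right (hc₁ _) _))
  norm_num at this

theorem Regularizer.exists_infDist_le (R : Regularizer I M univ) {s₀ s₁ : Finset (JetIdx I M)}
    (hT : ∀ T : Form I M →L[ℝ] ℝ, ∃ c : ℝ, 0 ≤ c ∧ ∀ θ, |T (R.op θ)| ≤ c * ‖jetsLM I s₀ θ‖)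
    (hR : ∀ s : Finset (JetIdx I M), ∃ c : ℝ, 0 ≤ c ∧
      ∀ θ, ‖jetsLM I s (R.op θ)‖ ≤ c * ‖jetsLM I s₀ θ‖)
    {c₁ : ℝ} (hA : ∀ θ, ‖jetsLM I s₀ (R.homotopy θ)‖ ≤ c₁ * ‖jetsLM I s₁ θ‖)
    {s : Finset (JetIdx I M)} (h₀ : s₀ ⊆ s) (h₁ : s₁ ⊆ s) :
    ∃ C : ℝ, 0 ≤ C ∧ ∀ φ : Form I M,
      Metric.infDist (jetsLM I s₀ φ) (jetsLM I s₀ '' {θ | dForm I θ = 0}) ≤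
        C * ‖jetsLM I s (dForm I φ)‖ := by
  by_contra! hcon
  have key : ∀ n : ℕ, ∃ φ : Form I M, ‖jetsLM I s₀ φ‖ ≤ 2 ∧
      ‖jetsLM I s (dForm I φ)‖ ≤ 1 / ((n : ℝ) + 1) ∧
      ∀ θ, dForm I θ = 0 → 1 ≤ ‖jetsLM I s₀ (φ - θ)‖ := by
    intro n
    obtain ⟨φ, hφ⟩ := hcon ((n : ℝ) + 1) (by positivity)
    set δ := Metric.infDist (jetsLM I s₀ φ) (jetsLM I s₀ '' {θ | dForm I θ = 0}) with hδ
    have hpos : 0 < δ := lt_of_le_of_lt (by positivity) hφ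
    have hz : dForm I (0 : Form I M) = 0 := (dFormLM I : Form I M →ₗ[ℝ] Form I M).map_zero
    obtain ⟨_, ⟨θ, hθ, rfl⟩, hlt⟩ := (Metric.infDist_lt_iff (r := 2 * δ)
      (⟨_, mem_image_of_mem _ hz⟩ : (jetsLM I s₀ '' {θ | dForm I θ = 0}).Nonempty)).1
        (by rw [← hδ]; linarith)
    rw [dist_eq_norm, ← map_sub] at hlt
    have hd : dForm I (δ⁻¹ • (φ - θ)) = δ⁻¹ • dForm I φ := by
      refine ((dFormLM I : Form I M →ₗ[ℝ] Form I M).map_smul _ _).trans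
        (congrArg _ ((map_sub (dFormLM I : Form I M →ₗ[ℝ] Form I M) _ _).trans ?_))
      change dForm I φ - dForm I θ = _
      rw [show dForm I θ = 0 from hθ, sub_zero]
    refine ⟨δ⁻¹ • (φ - θ), ?_, ?_, fun θ' hθ' => ?_⟩
    · rw [map_smul, norm_smul, norm_inv, Real.norm_of_nonneg hpos.le, inv_mul_le_iff₀ hpos]
      linarith
    · rw [hd, map_smul, norm_smul, norm_inv, Real.norm_of_nonneg hpos.le, inv_mul_le_iff₀ hpos,
        mul_one_div, le_div_iff₀ (by positivity)]
      linarith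
    · have h1 : δ⁻¹ • (φ - θ) - θ' = δ⁻¹ • (φ - (θ + δ • θ')) := by
        rw [← sub_sub, smul_sub δ⁻¹ (φ - θ), inv_smul_smul₀ hpos.ne']
      have hcl : dForm I (θ + δ • θ') = 0 := by
        rw [dForm_add, dForm_smul, hθ', show dForm I θ = 0 from hθ, smul_zero, add_zero]
      rw [h1, map_smul, norm_smul, norm_inv, Real.norm_of_nonneg hpos.le, le_inv_mul_iff₀ hpos,
        mul_one, map_sub, ← dist_eq_norm]
      exact Metric.infDist_le_dist_of_mem (mem_image_of_mem _ hcl)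
  choose φ h2 hd hsep using key
  have hlim : ∀ t ⊆ s, Tendsto (fun n => ‖jetsLM I t (dForm I (φ n))‖) atTop (𝓝 0) := fun t ht =>
    squeeze_zero (fun n => norm_nonneg _) (fun n => (jetsLM_mono ht _).trans (hd n))
      tendsto_one_div_add_atTop_nhds_zero_nat
  exact R.not_separated hT hR hA h2 (hlim _ h₀) (hlim _ h₁) hsep

open scoped Classical in
/-- A current that annihilates the closed forms is a boundary. -/
theorem exists_potential (R : Regularizer I M univ)
    {G : Form I M →L[ℝ] ℝ} (hG : ∀ φ, dForm I φ = 0 → G φ = 0) :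
    ∃ S : Form I M →L[ℝ] ℝ, ∀ φ, G φ = S (dForm I φ) := by
  obtain ⟨s₀, hT, hR⟩ := R.exists_bound
  obtain ⟨s₁, c₁, -, hA⟩ := R.exists_homotopy_bound s₀
  obtain ⟨C, hC, hinf⟩ := R.exists_infDist_le hT hR hA (s := s₀ ∪ s₁)
    Finset.subset_union_left Finset.subset_union_right
  obtain ⟨c, hc, hb⟩ := hT G
  have hz : dForm I (0 : Form I M) = 0 := (dFormLM I : Form I M →ₗ[ℝ] Form I M).map_zero
  have hbound : ∀ φ, |G (R.op φ)| ≤ c * C * ‖jetsLM I (s₀ ∪ s₁) (dForm I φ)‖ := by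
    intro φ
    have h1 : |G (R.op φ)| ≤
        c * Metric.infDist (jetsLM I s₀ φ) (jetsLM I s₀ '' {θ | dForm I θ = 0}) := by
      refine le_of_forall_pos_le_add fun ε hε => ?_
      obtain ⟨_, ⟨θ, hθ, rfl⟩, hlt⟩ := (Metric.infDist_lt_iff
        (⟨_, mem_image_of_mem _ hz⟩ : (jetsLM I s₀ '' {θ | dForm I θ = 0}).Nonempty)).1
          (lt_add_of_pos_right (Metric.infDist (jetsLM I s₀ φ) (jetsLM I s₀ '' {θ | dForm I θ = 0}))
            (show 0 < ε / (c + 1) by positivity))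
      have h2 := hb (φ - θ)
      have h3 : G (R.op θ) = 0 := hG _ (by
        rw [← R.op_dForm, show dForm I θ = 0 from hθ, map_zero])
      rw [map_sub, map_sub, h3, sub_zero, map_sub, ← dist_eq_norm] at h2
      have h4 : c * (ε / (c + 1)) ≤ ε := by
        rw [mul_div_assoc', div_le_iff₀ (by positivity)]
        nlinarith
      nlinarith [mul_le_mul_of_nonneg_left hlt.le hc]
    rw [mul_assoc]
    exact h1.trans (mul_le_mul_of_nonneg_left (hinf φ) hc)
  obtain ⟨S, -, hS⟩ := exists_factor_of_bound
    ((jetsLM I (s₀ ∪ s₁)).comp (dFormLM I : Form I M →ₗ[ℝ] Form I M))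
    (G.toLinearMap.comp R.op.toLinearMap) (mul_nonneg hc hC) hbound
  let S₁ : Form I M →L[ℝ] ℝ :=
    ⟨S.toLinearMap.comp (jetsLM I (s₀ ∪ s₁)), S.continuous.comp (continuous_jetsLM _)⟩
  let S₂ : Form I M →L[ℝ] ℝ :=
    ⟨G.toLinearMap.comp R.homotopy, G.continuous.comp R.orderBounded_homotopy.continuous⟩
  refine ⟨S₁ - S₂, fun φ => ?_⟩
  change G φ = S (jetsLM I _ (dForm I φ)) - G (R.homotopy (dForm I φ))
  have h1 : S (jetsLM I _ (dForm I φ)) = G (R.op φ) := hS φ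
  have h2 := congrArg G (R.op_sub φ)
  rw [map_sub, map_add, hG _ (dForm_dForm I _)] at h2
  rw [h1]
  linarith

end Potential

section PatchConstructions

variable {E : Type*} [NormedAddCommGroup E] [NormedSpace ℝ E] [FiniteDimensional ℝ E]
  {H : Type*} [TopologicalSpace H] {I : ModelWithCorners ℝ E H} [I.Boundaryless]
  {M : Type*} [TopologicalSpace M] [ChartedSpace H M] [IsManifold I ∞ M]
  {E' : Type*} [NormedAddCommGroup E'] [NormedSpace ℝ E'] [FiniteDimensional ℝ E']
  {H' : Type*} [TopologicalSpace H'] {J : ModelWithCorners ℝ E' H'} [J.Boundaryless]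
  {N : Type*} [TopologicalSpace N] [ChartedSpace H' N] [IsManifold J ∞ N]
  {V : Type*} [NormedAddCommGroup V] [NormedSpace ℝ V] [FiniteDimensional ℝ V]
  {W : Type*} [NormedAddCommGroup W] [NormedSpace ℝ W] [FiniteDimensional ℝ W]

/-- The product of two translation patches. -/
def TranslationPatch.prod (P : TranslationPatch I M V) (Q : TranslationPatch J N W) :
    TranslationPatch (I.prod J) (M × N) (V × W) where
  shift y := Prod.map (P.shift y.1) (Q.shift y.2)
  smooth := by
    have h1 : ContMDiff 𝓘(ℝ, V × W) 𝓘(ℝ, V) ∞ (Prod.fst : V × W → V) :=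
      (ContinuousLinearMap.fst ℝ V W).contMDiff
    have h2 : ContMDiff 𝓘(ℝ, V × W) 𝓘(ℝ, W) ∞ (Prod.snd : V × W → W) :=
      (ContinuousLinearMap.snd ℝ V W).contMDiff
    exact (P.smooth.comp ((h1.comp contMDiff_fst).prodMk
        (contMDiff_fst.comp contMDiff_snd))).prodMk
      (Q.smooth.comp ((h2.comp contMDiff_fst).prodMk (contMDiff_snd.comp contMDiff_snd)))
  shift_zero x := Prod.ext (P.shift_zero x.1) (Q.shift_zero x.2)
  shift_add y y' x := Prod.ext (P.shift_add y.1 y'.1 x.1) (Q.shift_add y.2 y'.2 x.2)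
  source := P.source ×ˢ Q.source
  isOpen_source := P.isOpen_source.prod Q.isOpen_source
  coord := Prod.map P.coord Q.coord
  coordSymm := Prod.map P.coordSymm Q.coordSymm
  contMDiffOn_coord := (P.contMDiffOn_coord.comp contMDiffOn_fst fun _ hx => hx.1).prodMk_space
    (Q.contMDiffOn_coord.comp contMDiffOn_snd fun _ hx => hx.2)
  contMDiff_coordSymm :=
    (P.contMDiff_coordSymm.comp (ContinuousLinearMap.fst ℝ V W).contMDiff).prodMk
      (Q.contMDiff_coordSymm.comp (ContinuousLinearMap.snd ℝ V W).contMDiff)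
  coordSymm_mem v := ⟨P.coordSymm_mem v.1, Q.coordSymm_mem v.2⟩
  coordSymm_coord x hx := Prod.ext (P.coordSymm_coord x.1 hx.1) (Q.coordSymm_coord x.2 hx.2)
  coord_coordSymm v := Prod.ext (P.coord_coordSymm v.1) (Q.coord_coordSymm v.2)
  shift_mem y x hx := ⟨P.shift_mem y.1 x.1 hx.1, Q.shift_mem y.2 x.2 hx.2⟩
  coord_shift y x hx := Prod.ext (P.coord_shift y.1 x.1 hx.1) (Q.coord_shift y.2 x.2 hx.2)

/-- A translation patch in other linear coordinates. -/
def TranslationPatch.reindex (P : TranslationPatch I M V) (e : W ≃L[ℝ] V) :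
    TranslationPatch I M W where
  shift y := P.shift (e y)
  smooth := P.smooth.comp
    ((e.toContinuousLinearMap.contMDiff.comp contMDiff_fst).prodMk contMDiff_snd)
  shift_zero x := by rw [map_zero, P.shift_zero]
  shift_add y y' x := by rw [map_add, P.shift_add]
  source := P.source
  isOpen_source := P.isOpen_source
  coord x := e.symm (P.coord x)
  coordSymm v := P.coordSymm (e v)
  contMDiffOn_coord := e.symm.toContinuousLinearMap.contMDiff.comp_contMDiffOn P.contMDiffOn_coord
  contMDiff_coordSymm := P.contMDiff_coordSymm.comp e.toContinuousLinearMap.contMDiff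
  coordSymm_mem v := P.coordSymm_mem (e v)
  coordSymm_coord x hx := by rw [e.apply_symm_apply, P.coordSymm_coord x hx]
  coord_coordSymm v := by rw [P.coord_coordSymm, e.symm_apply_apply]
  shift_mem y x hx := P.shift_mem (e y) x hx
  coord_shift y x hx := by rw [P.coord_shift (e y) x hx, map_add, e.symm_apply_apply]

end PatchConstructions

section DeRhamPatch

variable {E : Type*} [NormedAddCommGroup E] [NormedSpace ℝ E] [NormedSpace ℂ E]
  [IsScalarTower ℝ ℂ E] [FiniteDimensional ℝ E] [FiniteDimensional ℂ E]
  {H : Type*} [TopologicalSpace H] {I : ModelWithCorners ℝ E H} [I.Boundaryless]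
  {M : Type*} [TopologicalSpace M] [ChartedSpace H M] [IsManifold I ∞ M]
  (P : DeRhamPatch I M)

namespace DeRhamPatch

theorem shift_of_mem {x : M} (hx : x ∈ P.ball) (y : Coord E) :
    P.shift y x = P.h.symm (P.κ.symm (P.κ (P.h x) + y)) := if_pos hx

theorem shift_of_notMem {x : M} (hx : x ∉ P.ball) (y : Coord E) : P.shift y x = x := if_neg hx

theorem κ_symm_mem (v : Coord E) : P.κ.symm v ∈ Metric.ball (0 : Coord E) 1 := by
  rw [← P.κ_source]
  exact P.κ.map_target (by rw [P.κ_target]; exact mem_univ v)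

theorem h_h_symm (v : Coord E) : P.h (P.h.symm v) = v :=
  P.h.right_inv (by rw [P.h_target]; exact mem_univ v)

theorem κ_κ_symm (v : Coord E) : P.κ (P.κ.symm v) = v :=
  P.κ.right_inv (by rw [P.κ_target]; exact mem_univ v)

theorem symm_mem_ball (v : Coord E) : P.h.symm (P.κ.symm v) ∈ P.ball :=
  ⟨P.h.map_target (by rw [P.h_target]; exact mem_univ _), by rw [h_h_symm]; exact P.κ_symm_mem v⟩

theorem symm_coord {x : M} (hx : x ∈ P.ball) : P.h.symm (P.κ.symm (P.κ (P.h x))) = x := by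
  rw [P.κ.left_inv (by rw [P.κ_source]; exact hx.2), P.h.left_inv hx.1]

theorem coord_symm (v : Coord E) : P.κ (P.h (P.h.symm (P.κ.symm v))) = v := by
  rw [h_h_symm, κ_κ_symm]

theorem isOpen_ball : IsOpen P.ball :=
  P.h.continuousOn.isOpen_inter_preimage P.h.open_source Metric.isOpen_ball

theorem shift_zero (x : M) : P.shift 0 x = x := by
  by_cases hx : x ∈ P.ball
  · rw [P.shift_of_mem hx, add_zero, P.symm_coord hx]
  · exact P.shift_of_notMem hx 0

/-- The translations of a piece of de Rham data. -/
def translationPatch : TranslationPatch I M (Coord E) where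
  shift := P.shift
  smooth := P.shift_smooth
  shift_zero := P.shift_zero
  shift_add y y' x := by
    by_cases hx : x ∈ P.ball
    · rw [P.shift_of_mem hx, P.shift_of_mem hx, P.shift_of_mem (P.symm_mem_ball _), P.coord_symm,
        add_assoc, add_comm y y']
    · rw [P.shift_of_notMem hx, P.shift_of_notMem hx, P.shift_of_notMem hx]
  source := P.ball
  isOpen_source := P.isOpen_ball
  coord x := P.κ (P.h x)
  coordSymm v := P.h.symm (P.κ.symm v)
  contMDiffOn_coord := P.κ_smooth.contMDiffOn.comp (P.h_smooth.mono fun _ hx => hx.1)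
    fun _ hx => hx.2
  contMDiff_coordSymm := P.h_symm_smooth.comp P.κ_symm_smooth.contMDiff
  coordSymm_mem := P.symm_mem_ball
  coordSymm_coord _ hx := P.symm_coord hx
  coord_coordSymm := P.coord_symm
  shift_mem y x hx := by rw [P.shift_of_mem hx]; exact P.symm_mem_ball _
  coord_shift y x hx := by rw [P.shift_of_mem hx, P.coord_symm]

theorem scaledBump_eq_zero {ε : ℝ} (hε : 0 < ε) {y : Coord E} (hy : ε ≤ ‖y‖) :
    P.scaledBump ε y = 0 := by
  have h : P.bump (ε⁻¹ • y) = 0 := by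
    by_contra h
    have h1 := P.bump_support h
    rw [mem_ball_zero_iff, norm_smul, norm_inv, Real.norm_of_nonneg hε.le, inv_mul_lt_iff₀ hε] at h1
    linarith
  rw [scaledBump, h, mul_zero]

end DeRhamPatch

variable [T2Space M] [CompactSpace M]

theorem DeRhamData.nonempty_regularizer (hor : OrientedCharts I M) (D : DeRhamData I M) :
    Nonempty (Regularizer I M univ) := by
  have e : (Fin (realDim E) → ℝ) ≃L[ℝ] Coord E := (EuclideanSpace.equiv _ ℝ).symm
  exact exists_regularizer hor (fun i => (D.patch i).translationPatch.reindex e) D.cover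

variable {E' : Type*} [NormedAddCommGroup E'] [NormedSpace ℝ E'] [NormedSpace ℂ E']
  [IsScalarTower ℝ ℂ E'] [FiniteDimensional ℝ E'] [FiniteDimensional ℂ E']
  {H' : Type*} [TopologicalSpace H'] {J : ModelWithCorners ℝ E' H'} [J.Boundaryless]
  {N : Type*} [TopologicalSpace N] [ChartedSpace H' N] [IsManifold J ∞ N]
  [T2Space N] [CompactSpace N]

theorem ProductDeRhamData.nonempty_regularizer (hI : OrientedCharts I M) (hJ : OrientedCharts J N)
    (D : ProductDeRhamData I M J N) : Nonempty (Regularizer (I.prod J) (M × N) univ) := by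
  obtain ⟨e⟩ : Nonempty ((Fin (realDim (E × E')) → ℝ) ≃L[ℝ] Coord E × Coord E') :=
    FiniteDimensional.nonempty_continuousLinearEquiv_of_finrank_eq (by
      simp [realDim, Module.finrank_prod, add_mul])
  refine exists_regularizer (orientedCharts_prod hI hJ)
    (fun ij : Fin D.left.card × Fin D.right.card =>
      ((D.left.patch ij.1).translationPatch.prod (D.right.patch ij.2).translationPatch).reindex e)
    (eq_univ_of_forall fun z => ?_)
  obtain ⟨i, hi⟩ := mem_iUnion.1 (D.left.cover ▸ mem_univ z.1)
  obtain ⟨j, hj⟩ := mem_iUnion.1 (D.right.cover ▸ mem_univ z.2)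
  exact mem_iUnion.2 ⟨(i, j), hi, hj⟩

end DeRhamPatch

section Support

variable {E : Type*} [NormedAddCommGroup E] [NormedSpace ℝ E] [NormedSpace ℂ E]
  [IsScalarTower ℝ ℂ E] [FiniteDimensional ℝ E] [FiniteDimensional ℂ E]
  {H : Type*} [TopologicalSpace H] {I : ModelWithCorners ℝ E H} [I.Boundaryless]
  {M : Type*} [TopologicalSpace M] [ChartedSpace H M] [IsManifold I ∞ M]

theorem exists_of_notMem_supp {T : Current I M} {x : M} (hx : x ∉ supp I T) :
    ∃ U : Set M, IsOpen U ∧ x ∈ U ∧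
      ∀ φ : Form I M, (∀ k, closure {z | (φ k).1 z ≠ 0} ⊆ U) → T φ = 0 := by
  simp only [supp, mem_ofPred_eq] at hx
  push Not at hx
  exact hx

theorem isClosed_supp (T : Current I M) : IsClosed (supp I T) := by
  rw [← isOpen_compl_iff, isOpen_iff_mem_nhds]
  intro x hx
  obtain ⟨U, hU, hxU, h⟩ := exists_of_notMem_supp hx
  refine mem_of_superset (hU.mem_nhds hxU) fun x' hx' hs => ?_
  obtain ⟨φ, hφ, hne⟩ := hs U hU hx'
  exact hne (h φ hφ)

/-- The functional `T` vanishes on the forms that vanish on `W`. -/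
def FactorsThrough (T : Form I M → ℝ) (W : Set M) : Prop :=
  ∀ φ : Form I M, (∀ k, ∀ x ∈ W, (φ k).1 x = 0) → T φ = 0

variable [T2Space M] [CompactSpace M]

theorem factorsThrough_of_supp_subset (hor : OrientedCharts I M) {T : Current I M} {W : Set M}
    (hW : IsOpen W) (h : supp I T ⊆ W) : FactorsThrough (I := I) T W := by
  intro φ hφ
  have hloc : ∀ q ∈ Wᶜ, ∃ U : Set M, IsOpen U ∧ q ∈ U ∧ ∀ θ, SupportedIn I U θ → T θ = 0 := by
    intro q hq
    obtain ⟨U, hU, hqU, h0⟩ := exists_of_notMem_supp fun hs => hq (h hs)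
    refine ⟨U, hU, hqU, fun θ => ?_⟩
    rintro ⟨C, hC, hCU, hθ⟩
    refine h0 θ fun k => (closure_minimal (fun x hx => ?_) hC).trans hCU
    by_contra hxC
    exact hx (hθ k x hxC)
  obtain ⟨W', hW', hsub, η, hη⟩ := exists_representedOn (T := T) (K := Wᶜ)
    hW.isClosed_compl.isCompact fun q hq => by
      obtain ⟨U, hU, hqU, h0⟩ := hloc q hq
      exact ⟨U, hU, hqU, 0, fun θ hθ => by
        rw [h0 θ hθ, wedge_zero_left, integral_zero_form]⟩
  have hη0 : ∀ k, ∀ x ∈ Wᶜ, (η k).1 x = 0 := by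
    intro k x hx
    obtain ⟨U, hU, hxU, h0⟩ := hloc x hx
    refine eq_zero_of_integral_wedge_eq_zero I hor (hU.inter hW') (fun θ C hC hCU hθ => ?_) k
      ⟨hxU, hsub hx⟩
    rw [← hη θ ⟨C, hC, hCU.trans inter_subset_right, hθ⟩]
    exact h0 θ ⟨C, hC, hCU.trans inter_subset_left, hθ⟩
  have hz : wedge I η φ = 0 := by
    funext r
    refine KForm.ext fun x => ?_
    rw [wedge_apply, KForm.sum_val]
    refine Finset.sum_eq_zero fun p _ => ?_
    by_cases hx : x ∈ W
    · exact (congrArg (wedgeBilin _ _) (hφ _ x hx)).trans (map_zero _)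
    · have := congrArg (wedgeBilin (Nat.add_sub_of_le (Nat.lt_succ_iff.1 p.2))) (hη0 p x hx)
      exact (congrArg (fun l => l ((φ (r - p)).1 x)) (this.trans (map_zero _))).trans rfl
  rw [hη φ ⟨Wᶜ, hW.isClosed_compl, hsub, fun k x hx => hφ k x (not_not.1 hx)⟩, hz,
    integral_zero_form]

/-- The form that represents a functional, if there is one. -/
theorem smoothForm_spec (T : Form I M → ℝ) :
    (∀ φ, T φ = integral I (wedge I (smoothForm I T) φ)) ∨ smoothForm I T = 0 := by
  unfold smoothForm
  split_ifs with h
  · exact Or.inl h.choose_spec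
  · exact Or.inr rfl

theorem integral_smoothForm_eq_zero {T : Form I M → ℝ} {φ : Form I M} (h : T φ = 0) :
    integral I (wedge I (smoothForm I T) φ) = 0 := by
  rcases smoothForm_spec T with hT | hT
  · rw [← hT, h]
  · rw [hT, wedge_zero_left, integral_zero_form]

theorem smoothForm_eq_zero (hor : OrientedCharts I M) {T : Form I M → ℝ} {W : Set M}
    (hT : FactorsThrough (I := I) T W) (k : ℕ) {x : M} (hx : x ∉ closure W) :
    (smoothForm I T k).1 x = 0 :=
  eq_zero_of_integral_wedge_eq_zero I hor isClosed_closure.isOpen_compl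
    (fun θ _ _ hCW hθ => integral_smoothForm_eq_zero (hT θ fun k x hx => hθ k x fun hxC =>
      hCW hxC (subset_closure hx))) k hx

end Support

section Smoothing

variable {E : Type*} [NormedAddCommGroup E] [NormedSpace ℝ E] [NormedSpace ℂ E]
  [IsScalarTower ℝ ℂ E] [FiniteDimensional ℝ E] [FiniteDimensional ℂ E]
  {H : Type*} [TopologicalSpace H] {I : ModelWithCorners ℝ E H} [I.Boundaryless]
  {M : Type*} [TopologicalSpace M] [ChartedSpace H M] [IsManifold I ∞ M]
  {E' : Type*} [NormedAddCommGroup E'] [NormedSpace ℝ E'] [NormedSpace ℂ E']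
  [IsScalarTower ℝ ℂ E'] [FiniteDimensional ℝ E'] [FiniteDimensional ℂ E']
  {H' : Type*} [TopologicalSpace H'] {J : ModelWithCorners ℝ E' H'} [J.Boundaryless]
  {N : Type*} [TopologicalSpace N] [ChartedSpace H' N] [IsManifold J ∞ N]
  [T2Space M] [CompactSpace M] [T2Space N] [CompactSpace N]

theorem DeRhamPatch.prodSmoothing_eq_zero (P : DeRhamPatch I M) (Q : DeRhamPatch J N) {ε : ℝ}
    (hε : 0 < ε) {T : Form (I.prod J) (M × N) → ℝ} {φ : Form (I.prod J) (M × N)}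
    (h : ∀ y y', ‖y‖ < ε → ‖y'‖ < ε → T (pullback (I.prod J) (I.prod J)
      (Prod.map (P.shift y) (Q.shift y'))
      ((P.contMDiff_shift y).prodMap (Q.contMDiff_shift y')) φ) = 0) :
    P.prodSmoothing Q ε T φ = 0 := by
  refine integral_eq_zero_of_ae (Eventually.of_forall fun y => ?_)
  change P.scaledBump ε y.1 * Q.scaledBump ε y.2 * _ = 0
  rcases lt_or_ge ‖y.1‖ ε with h1 | h1
  · rcases lt_or_ge ‖y.2‖ ε with h2 | h2
    · rw [h y.1 y.2 h1 h2, mul_zero]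
    · rw [Q.scaledBump_eq_zero hε h2, mul_zero, zero_mul]
  · rw [P.scaledBump_eq_zero hε h1, zero_mul, zero_mul]

namespace ProductDeRhamData

variable (D : ProductDeRhamData I M J N)

theorem smoothing_dForm {ε : ℝ} (hε : 0 < ε) {T : Form (I.prod J) (M × N) → ℝ}
    (hT : ∀ φ, T (dForm (I.prod J) φ) = 0) (φ : Form (I.prod J) (M × N)) :
    D.smoothing ε T (dForm (I.prod J) φ) = 0 := by
  unfold smoothing
  generalize List.ofFn (fun a => D.order a) = L
  induction L generalizing φ with
  | nil => exact hT φ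
  | cons a L ih =>
    refine DeRhamPatch.prodSmoothing_eq_zero _ _ hε fun y y' _ _ => ?_
    rw [← dForm_pullback]
    exact ih _

theorem smoothing_eq_zero_of_closed {ε : ℝ} (hε : 0 < ε) {T : Form (I.prod J) (M × N) → ℝ}
    (hT : ∀ φ, dForm (I.prod J) φ = 0 → T φ = 0) {φ : Form (I.prod J) (M × N)}
    (hφ : dForm (I.prod J) φ = 0) : D.smoothing ε T φ = 0 := by
  unfold smoothing
  generalize List.ofFn (fun a => D.order a) = L
  induction L generalizing φ with
  | nil => exact hT φ hφ
  | cons a L ih =>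
    refine DeRhamPatch.prodSmoothing_eq_zero _ _ hε fun y y' _ _ => ih ?_
    rw [dForm_pullback, hφ]
    exact (pullbackLM (I.prod J) (I.prod J) _ ((DeRhamPatch.contMDiff_shift _ y).prodMap
      (DeRhamPatch.contMDiff_shift _ y'))).map_zero

/-- Smoothing with a small parameter does not enlarge the support much. -/
theorem factorsThrough_smoothing {A : Set (M × N)} (hA : IsClosed A)
    {T : Form (I.prod J) (M × N) → ℝ}
    (hT : ∀ W, IsOpen W → A ⊆ W → FactorsThrough (I := I.prod J) T W) {W : Set (M × N)}
    (hW : IsOpen W) (hAW : A ⊆ W) :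
    ∀ᶠ ε in 𝓝[>] (0 : ℝ), FactorsThrough (I := I.prod J) (D.smoothing ε T) W := by
  unfold smoothing
  generalize List.ofFn (fun a => D.order a) = L
  induction L generalizing W with
  | nil => exact Eventually.of_forall fun ε => hT W hW hAW
  | cons a L ih =>
    obtain ⟨W', hW', hAW', hcl⟩ := normal_exists_closure_subset hA hW hAW
    set P := D.left.patch a.1
    set Q := D.right.patch a.2
    have hcont : Continuous fun z : (Coord E × Coord E') × (M × N) =>
        (P.shift z.1.1 z.2.1, Q.shift z.1.2 z.2.2) :=
      (P.shift_smooth.continuous.comp ((continuous_fst.comp continuous_fst).prodMk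
        (continuous_fst.comp continuous_snd))).prodMk
      (Q.shift_smooth.continuous.comp ((continuous_snd.comp continuous_fst).prodMk
        (continuous_snd.comp continuous_snd)))
    obtain ⟨U, U', hU, -, h0U, hcU', hUU'⟩ := generalized_tube_lemma
      (isCompact_singleton (x := (0 : Coord E × Coord E')))
      (isClosed_closure (s := W')).isCompact (hW.preimage hcont) (by
        rintro ⟨y, z⟩ ⟨hy, hz⟩
        have hy0 : y = 0 := hy
        subst hy0
        change (P.shift 0 z.1, Q.shift 0 z.2) ∈ W
        rw [P.shift_zero, Q.shift_zero]
        exact hcl hz)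
    obtain ⟨r, hr, hrU⟩ := Metric.isOpen_iff.1 hU 0 (h0U rfl)
    filter_upwards [ih hW' hAW', Ioo_mem_nhdsGT hr] with ε hε hεr φ hφ
    refine DeRhamPatch.prodSmoothing_eq_zero P Q hεr.1 fun y y' hy hy' => hε _ fun k z hz => ?_
    have hmem : (P.shift y z.1, Q.shift y' z.2) ∈ W := hUU' (mk_mem_prod (hrU (a := (y, y')) (by
      rw [mem_ball_zero_iff, Prod.norm_def]
      exact max_lt (hy.trans hεr.2) (hy'.trans hεr.2))) (hcU' (subset_closure hz)))
    change ((φ k).1 (P.shift y z.1, Q.shift y' z.2)).compContinuousLinearMap _ = 0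
    rw [hφ k _ hmem]
    rfl

end ProductDeRhamData

theorem factorsThrough_crossTop
    (hor : OrientedCharts I M) (T : Current I M) {W : Set (M × N)} (hW : IsOpen W)
    (h : supp I T ×ˢ univ ⊆ W) : FactorsThrough (I := I.prod J) (crossTop I J T) W := by
  refine fun φ hφ => crossTop_eq_zero fun y w => ?_
  refine factorsThrough_of_supp_subset (W := (fun x => (x, y)) ⁻¹' W) hor
    (hW.preimage (continuous_id.prodMk continuous_const)) (fun x hx => h ⟨hx, mem_univ y⟩) _
    fun k x hx => ContinuousAlternatingMap.ext fun v => ?_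
  change (φ (k + realDim E')).1 (x, y) _ = 0
  rw [hφ _ _ hx]
  rfl

theorem factorsThrough_topCross
    (hor : OrientedCharts J N) (T : Current J N) {W : Set (M × N)} (hW : IsOpen W)
    (h : univ ×ˢ supp J T ⊆ W) : FactorsThrough (I := I.prod J) (topCross I J T) W := by
  refine fun φ hφ => factorsThrough_crossTop (I := J) (J := I) hor T (W := Prod.swap ⁻¹' W)
    (hW.preimage continuous_swap) (fun z hz => h ⟨mem_univ _, hz.1⟩) _ fun k z hz => ?_
  change ((φ k).1 z.swap).compContinuousLinearMap _ = 0
  rw [hφ k _ hz]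
  rfl

end Smoothing

section Correspondences

variable {E : Type*} [NormedAddCommGroup E] [NormedSpace ℝ E] [NormedSpace ℂ E]
  [IsScalarTower ℝ ℂ E] [FiniteDimensional ℝ E] [FiniteDimensional ℂ E]
  {H : Type*} [TopologicalSpace H] {I : ModelWithCorners ℝ E H} [I.Boundaryless]
  {M : Type*} [TopologicalSpace M] [ChartedSpace H M] [IsManifold I ∞ M]
  {E' : Type*} [NormedAddCommGroup E'] [NormedSpace ℝ E'] [NormedSpace ℂ E']
  [IsScalarTower ℝ ℂ E'] [FiniteDimensional ℝ E'] [FiniteDimensional ℂ E']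
  {H' : Type*} [TopologicalSpace H'] {J : ModelWithCorners ℝ E' H'} [J.Boundaryless]
  {N : Type*} [TopologicalSpace N] [ChartedSpace H' N] [IsManifold J ∞ N]
  [T2Space M] [CompactSpace M] [T2Space N] [CompactSpace N]
  {E'' : Type*} [NormedAddCommGroup E''] [NormedSpace ℝ E''] [NormedSpace ℂ E'']
  [IsScalarTower ℝ ℂ E''] [FiniteDimensional ℝ E''] [FiniteDimensional ℂ E'']
  {H'' : Type*} [TopologicalSpace H''] {K : ModelWithCorners ℝ E'' H''} [K.Boundaryless]
  {Q : Type*} [TopologicalSpace Q] [ChartedSpace H'' Q] [IsManifold K ∞ Q]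
  [T2Space Q] [CompactSpace Q]
  {D : ProductDeRhamData I M J N} {F S : Current (I.prod J) (M × N)}
  {T : Form (I.prod J) (M × N) → ℝ} {f : M × N → Q} {hf : ContMDiff (I.prod J) K ∞ f}
  {G : Current K Q}

theorem IsIntersection.apply_eq_zero (hS : IsIntersection D F T S) {φ : Form (I.prod J) (M × N)}
    (h : ∀ᶠ ε in 𝓝[>] (0 : ℝ),
      F (wedge (I.prod J) (smoothForm (I.prod J) (D.smoothing ε T)) φ) = 0) : S φ = 0 :=
  tendsto_nhds_unique (hS φ) (tendsto_const_nhds.congr' (h.mono fun _ hε => hε.symm))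

theorem supp_image_subset (hor : OrientedCharts (I.prod J) (M × N))
    (hS : IsIntersection D F T S) (hG : ∀ φ, G φ = S (pullback (I.prod J) K f hf φ))
    {A : Set (M × N)} (hA : IsClosed A)
    (hT : ∀ W, IsOpen W → A ⊆ W → FactorsThrough (I := I.prod J) T W) :
    supp K G ⊆ f '' (supp (I.prod J) F ∩ A) := by
  intro y hy
  by_contra hyA
  have hcl : IsClosed (f '' (supp (I.prod J) F ∩ A)) :=
    (((isClosed_supp F).inter hA).isCompact.image hf.continuous).isClosed
  obtain ⟨V, hV, hyV, hVcl⟩ := normal_exists_closure_subset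
    (isClosed_singleton (x := y)) hcl.isOpen_compl (singleton_subset_iff.2 hyA)
  obtain ⟨φ, hφ, hne⟩ := hy V hV (hyV rfl)
  refine hne ((hG φ).trans (hS.apply_eq_zero ?_))
  have hZ : IsClosed (supp (I.prod J) F ∩ f ⁻¹' closure V) :=
    (isClosed_supp F).inter (isClosed_closure.preimage hf.continuous)
  obtain ⟨W, hW, hAW, hWcl⟩ := normal_exists_closure_subset hA hZ.isOpen_compl fun z hzA hz =>
    hVcl hz.2 ⟨z, ⟨hz.1, hzA⟩, rfl⟩
  filter_upwards [D.factorsThrough_smoothing hA hT hW hAW] with ε hε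
  refine factorsThrough_of_supp_subset (W := (closure W ∩ f ⁻¹' closure V)ᶜ) hor
    (isClosed_closure.inter (isClosed_closure.preimage hf.continuous)).isOpen_compl
    (fun z hz hz' => hWcl hz'.1 ⟨hz, hz'.2⟩) _ fun r z hz => ?_
  rw [wedge_apply, KForm.sum_val]
  refine Finset.sum_eq_zero fun p _ => ?_
  by_cases hzW : z ∈ closure W
  · have h0 : (φ (r - p)).1 (f z) = 0 := by
      by_contra hne
      exact hz ⟨hzW, subset_closure (hφ _ (subset_closure hne))⟩
    have h1 : (pullback (I.prod J) K f hf φ (r - p)).1 z = 0 := by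
      change ((φ (r - p)).1 (f z)).compContinuousLinearMap _ = 0
      rw [h0]; rfl
    exact (congrArg (wedgeBilin _ _) h1).trans (map_zero _)
  · have h1 := congrArg (wedgeBilin (Nat.add_sub_of_le (Nat.lt_succ_iff.1 p.2)))
      (smoothForm_eq_zero hor hε p hzW)
    exact (congrArg (fun l => l ((pullback (I.prod J) K f hf φ (r - p)).1 z))
      (h1.trans (map_zero _))).trans rfl

theorem isClosedCurrent_image (hor : OrientedCharts (I.prod J) (M × N))
    (hF : IsClosedCurrent (I.prod J) F) (hS : IsIntersection D F T S)
    (hG : ∀ φ, G φ = S (pullback (I.prod J) K f hf φ))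
    (hT : ∀ φ, T (dForm (I.prod J) φ) = 0) : IsClosedCurrent K G := by
  intro φ
  refine (hG _).trans (hS.apply_eq_zero ?_)
  filter_upwards [self_mem_nhdsWithin] with ε hε
  rw [← dForm_pullback]
  exact map_wedge_dForm_eq_zero (I.prod J) F.toLinearMap hF
    (dForm_eq_zero_of_integral_wedge (I.prod J) hor fun θ =>
      integral_smoothForm_eq_zero (D.smoothing_dForm hε hT θ)) _

theorem isNullHomologous_image (hor : OrientedCharts (I.prod J) (M × N))
    (R : Regularizer (I.prod J) (M × N) univ) (R' : Regularizer K Q univ)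
    (hF : IsClosedCurrent (I.prod J) F) (hS : IsIntersection D F T S)
    (hG : ∀ φ, G φ = S (pullback (I.prod J) K f hf φ))
    (hT : ∀ φ, dForm (I.prod J) φ = 0 → T φ = 0) : IsNullHomologous K G := by
  refine exists_potential R' fun φ hφ => (hG φ).trans (hS.apply_eq_zero ?_)
  filter_upwards [self_mem_nhdsWithin] with ε hε
  have hcl : dForm (I.prod J) (pullback (I.prod J) K f hf φ) = 0 := by
    rw [dForm_pullback, hφ]
    exact (pullbackLM (I.prod J) K f hf).map_zero
  exact apply_eq_zero_of_integral_wedge hor R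
    (T := F.comp (wedgeRightCLM (I.prod J) (pullback (I.prod J) K f hf φ)))
    (fun ψ => map_dForm_wedge_eq_zero (I.prod J) F.toLinearMap hF ψ hcl)
    fun θ hθ => integral_smoothForm_eq_zero (D.smoothing_eq_zero_of_closed hε hT hθ)

theorem crossTop_dForm_eq_zero (hor : OrientedCharts J N) {T : Current I M}
    (hT : IsClosedCurrent I T) (φ : Form (I.prod J) (M × N)) :
    crossTop I J T (dForm (I.prod J) φ) = 0 :=
  (crossTop_dForm (T := (0 : Current I M)) hor (fun φ => (hT φ).symm) φ).trans
    (crossTop_eq_zero fun _ _ => rfl)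

theorem topCross_dForm_eq_zero (hor : OrientedCharts I M) {T : Current J N}
    (hT : IsClosedCurrent J T) (φ : Form (I.prod J) (M × N)) :
    topCross I J T (dForm (I.prod J) φ) = 0 :=
  (topCross_dForm (T := (0 : Current J N)) hor (fun φ => (hT φ).symm) φ).trans
    (crossTop_eq_zero fun _ _ => rfl)

theorem crossTop_eq_zero_of_closed (hor : OrientedCharts J N) {T : Current I M}
    (hT : IsNullHomologous I T) {φ : Form (I.prod J) (M × N)} (hφ : dForm (I.prod J) φ = 0) :
    crossTop I J T φ = 0 := by
  obtain ⟨S, hS⟩ := hT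
  rw [← crossTop_dForm hor hS, hφ]
  exact crossTop_eq_zero fun y w => (congrArg S (map_zero (sliceFormLM I J _ y w))).trans (map_zero S)

theorem topCross_eq_zero_of_closed (hor : OrientedCharts I M) {T : Current J N}
    (hT : IsNullHomologous J T) {φ : Form (I.prod J) (M × N)} (hφ : dForm (I.prod J) φ = 0) :
    topCross I J T φ = 0 := by
  refine crossTop_eq_zero_of_closed hor hT ?_
  rw [dForm_pullback, hφ]
  exact (pullbackLM (J.prod I) (I.prod J) _ (contMDiff_snd.prodMk contMDiff_fst)).map_zero

end Correspondences

end LebesgueCurrents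

end

theorem proposition4p5
    {E E' : Type*} [NormedAddCommGroup E] [NormedSpace ℂ E] [FiniteDimensional ℂ E]
    [NormedAddCommGroup E'] [NormedSpace ℂ E'] [FiniteDimensional ℂ E']
    {X : Type*} [TopologicalSpace X] [ChartedSpace E X] [IsManifold 𝓘(ℂ, E) ω X]
    [T2Space X] [CompactSpace X]
    {Y : Type*} [TopologicalSpace Y] [ChartedSpace E' Y] [IsManifold 𝓘(ℂ, E') ω Y]
    [T2Space Y] [CompactSpace Y]
    (D : ProductDeRhamData 𝓘(ℝ, E) X 𝓘(ℝ, E') Y)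
    (F : Current (𝓘(ℝ, E).prod 𝓘(ℝ, E')) (X × Y))
    (hF_hom : IsHomogeneous (𝓘(ℝ, E).prod 𝓘(ℝ, E')) F)
    (hF_closed : IsClosedCurrent (𝓘(ℝ, E).prod 𝓘(ℝ, E')) F)
    (hF_lebesgue : IsLebesgue (𝓘(ℝ, E).prod 𝓘(ℝ, E')) F) :
    (∀ (T : Current 𝓘(ℝ, E) X) (G : Current 𝓘(ℝ, E') Y),
      IsLebesgue 𝓘(ℝ, E) T → IsPushforward D F T G →
        supp 𝓘(ℝ, E') G ⊆
            Prod.snd '' (supp (𝓘(ℝ, E).prod 𝓘(ℝ, E')) F ∩ supp 𝓘(ℝ, E) T ×ˢ Set.univ) ∧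
          (IsClosedCurrent 𝓘(ℝ, E) T → IsClosedCurrent 𝓘(ℝ, E') G) ∧
          (IsNullHomologous 𝓘(ℝ, E) T → IsNullHomologous 𝓘(ℝ, E') G)) ∧
    (∀ (T : Current 𝓘(ℝ, E') Y) (G : Current 𝓘(ℝ, E) X),
      IsLebesgue 𝓘(ℝ, E') T → IsPullback D F T G →
        supp 𝓘(ℝ, E) G ⊆
            Prod.fst '' (supp (𝓘(ℝ, E).prod 𝓘(ℝ, E')) F ∩ Set.univ ×ˢ supp 𝓘(ℝ, E') T) ∧
          (IsClosedCurrent 𝓘(ℝ, E') T → IsClosedCurrent 𝓘(ℝ, E) G) ∧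
          (IsNullHomologous 𝓘(ℝ, E') T → IsNullHomologous 𝓘(ℝ, E) G)) := by
  have hX : OrientedCharts 𝓘(ℝ, E) X := orientedCharts_of_isManifold
  have hY : OrientedCharts 𝓘(ℝ, E') Y := orientedCharts_of_isManifold
  have hXY := orientedCharts_prod hX hY
  obtain ⟨R⟩ := D.nonempty_regularizer hX hY
  obtain ⟨RX⟩ := D.left.nonempty_regularizer hX
  obtain ⟨RY⟩ := D.right.nonempty_regularizer hY
  refine ⟨?_, ?_⟩
  · rintro T G - ⟨S, hS, hG⟩
    refine ⟨supp_image_subset hXY hS hG ((isClosed_supp T).prod isClosed_univ)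
      fun W hW h => factorsThrough_crossTop hX T hW h, fun hT => ?_, fun hT => ?_⟩
    · exact isClosedCurrent_image hXY hF_closed hS hG (crossTop_dForm_eq_zero hY hT)
    · exact isNullHomologous_image hXY R RY hF_closed hS hG
        fun φ hφ => crossTop_eq_zero_of_closed hY hT hφ
  · rintro T G - ⟨S, hS, hG⟩
    refine ⟨supp_image_subset hXY hS hG (isClosed_univ.prod (isClosed_supp T))
      fun W hW h => factorsThrough_topCross hY T hW h, fun hT => ?_, fun hT => ?_⟩
    · exact isClosedCurrent_image hXY hF_closed hS hG (topCross_dForm_eq_zero hX hT)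
    · exact isNullHomologous_image hXY R RX hF_closed hS hG
        fun φ hφ => topCross_eq_zero_of_closed hX hT hφ
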